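/- \textbf{Theorem (Non-archimedean spectral decomposition).} Let $\Bbbk$ be a field of characteristic $0$, complete for a nontrivial non-archimedean absolute value whose restriction to $\mathbb Q$ is trivial. For an admissible open subset $B$ of a (rigid) $\Bbbk$-analytic affine space with coordinates $t_1,\dots,t_n$, an \emph{F-bundle} $(\mathcal H,\nabla)$ over $B$ is a vector bundle $\mathcal H$ over $B\times\mathbb D_u$, where $\mathbb D_u$ is the germ at $0$ of the closed unit disk with coordinate $u$, with a meromorphic flat connection $\nabla$ with poles along $u=0$ such that $\nabla_{u^2\partial_u}$ and $\nabla_{u\xi}$ are regular for every tangent vector field $\xi$ on $B$. For a closed point $b\in B$, write $\mu_b(\xi)=\nabla_{u\xi}|_{\mathcal H_{b,0}}$ for $\xi\in T_bB$, and $K_b=\nabla_{u^2\partial_u}|_{\mathcal H_{b,0}}$. The F-bundle is \emph{maximal at $b$} if there is $h\in\mathcal H_{b,0}$ such that $T_bB\to\mathcal H_{b,0}$, $\xi\mapsto\mu_b(\xi)(h)$, is an isomorphism, and \emph{maximal} if it is maximal at every closed point of $B$. Let $B$ be an admissible open neighborhood of $b=0$ in a $\Bbbk$-analytic affine space, and $(\mathcal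 H,\nabla)$ an F-bundle over $B$ which is maximal at $b$. Let $\mathcal H_{b,0}=\bigoplus_{i\in I}H_i$ be a finite decomposition into $\Bbbk$-subspaces stable under $K_b$, such that for all $i\neq j$ in $I$ the spectra of $K_b|_{H_i}$ and $K_b|_{H_j}$ (their sets of eigenvalues in an algebraic closure of $\Bbbk$) are disjoint. Then there exists an admissible open neighborhood $U\subset B$ of $b$ such that $(\mathcal H|_U,\nabla|_U)/U$ decomposes into a product of maximal F-bundles $(\mathcal H_i,\nabla_i)/U_i$ extending the decomposition of $\mathcal H_{b,0}$. That is, there are admissible open neighborhoods $U_i$ of $0$ in $\Bbbk$-analytic affine spaces, maximal F-bundles $(\mathcal H_i,\nabla_i)$ over $U_i$, an isomorphism of $\Bbbk$-analytic spaces $(p_i)_{i\in I}\colon U\to\prod_{i\in I}U_i$ with $p_i(b)=0$, and an isomorphism of F-bundles over $U$ \[ \bigoplus_{i\in I}p_i^*(\mathcal H_i,\nabla_i)\;\simeq\;(\mathcal H|_U,\nabla|_U) \] which at $(b,0)$ maps the fiber $(\mathcal H_i)_{0,0}$ onto $H_i$ for every $i\in I$. -/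

import Mathlib

/-!  Rigid analytic geometry inside affine spaces, in terms of geometric points.

`k` is a complete non-archimedean field and `K` an algebraic closure of `k`, normed by the
extension of the norm of `k`.  The points of the `k`-analytic affine space of dimension `|σ|` are
the `Gal(K/k)`-orbits in `σ → K`; a subset of it is handled as a subset of `σ → K`, and, all spaces
in question being reduced, an analytic function over `k` is handled as a `K`-valued function of the
points in `σ → K`. -/

namespace RigidF

noncomputable section

universe u v w

section Rigid

variable (k : Type u) {K : Type v} [NontriviallyNormedField k] [NontriviallyNormedField K]
  [NormedAlgebra k K]

/-- `f` is (the function on the closed unit polydisc defined by) an element of the Tate algebra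
`k⟨x₁, …, xₘ⟩`, the completion of the polynomial ring for the supremum norm on the closed unit
polydisc (which is the Gauss norm). -/
def IsTate {m : ℕ} (f : (Fin m → K) → K) : Prop :=
  ∀ ε : ℝ, 0 < ε → ∃ P : MvPolynomial (Fin m) k,
    ∀ x : Fin m → K, (∀ i, ‖x i‖ ≤ 1) → ‖f x - MvPolynomial.aeval x P‖ ≤ ε

/-- `Z` is the set of points of an affinoid space `Sp (k⟨x₁, …, xₘ⟩ / 𝔞)`. -/
def IsAffinoid {m : ℕ} (Z : Set (Fin m → K)) : Prop :=
  ∃ S : Set ((Fin m → K) → K), (∀ f ∈ S, IsTate k f) ∧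
    Z = {x | (∀ i, ‖x i‖ ≤ 1) ∧ ∀ f ∈ S, f x = 0}

/-- `Y` is a rational subdomain `{|f₁| ≤ |g|, …, |fₛ| ≤ |g|}` of the affinoid space `Z`, where
`f₁, …, fₛ, g` have no common zero on `Z`. -/
def IsRationalSubdomain {m : ℕ} (Z Y : Set (Fin m → K)) : Prop :=
  ∃ (s : ℕ) (f : Fin s → (Fin m → K) → K) (g : (Fin m → K) → K),
    (∀ j, IsTate k (f j)) ∧ IsTate k g ∧
    (∀ x ∈ Z, ¬ (g x = 0 ∧ ∀ j, f j x = 0)) ∧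
    Y = {x | x ∈ Z ∧ ∀ j, ‖f j x‖ ≤ ‖g x‖}

variable {σ : Type*}

/-- `V` is a rational subdomain of some closed polydisc `{|xᵢ| ≤ |c|}` of affine space. (By
density of polynomials, rational subdomains of polydiscs can be defined by polynomials.) -/
def IsRationalDomain (V : Set (σ → K)) : Prop :=
  ∃ (c : k) (s : ℕ) (f : Fin s → MvPolynomial σ k) (g : MvPolynomial σ k), c ≠ 0 ∧
    (∀ x : σ → K, (∀ i, ‖x i‖ ≤ ‖c‖) →
      ¬ (MvPolynomial.aeval x g = 0 ∧ ∀ j, MvPolynomial.aeval x (f j) = 0)) ∧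
    V = {x | (∀ i, ‖x i‖ ≤ ‖c‖) ∧
      ∀ j, ‖MvPolynomial.aeval x (f j)‖ ≤ ‖MvPolynomial.aeval x g‖}

/-- The admissibility condition on a covering `𝒱` of `U`: for every morphism `φ` from an affinoid
space `Z` to affine space with image in `U`, the pulled back covering of `Z` is refined by a
finite covering of `Z` by rational subdomains. -/
def IsAdmissibleCover (U : Set (σ → K)) (𝒱 : Set (Set (σ → K))) : Prop :=
  U = ⋃₀ 𝒱 ∧
  ∀ (m : ℕ) (Z : Set (Fin m → K)) (φ : (Fin m → K) → σ → K), IsAffinoid k Z →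
    (∀ i, IsTate k (fun z => φ z i)) → (∀ z ∈ Z, φ z ∈ U) →
    ∃ (N : ℕ) (Y : Fin N → Set (Fin m → K)), (∀ p, IsRationalSubdomain k Z (Y p)) ∧
      Z = (⋃ p, Y p) ∧ ∀ p, ∃ V ∈ 𝒱, ∀ z ∈ Y p, φ z ∈ V

/-- Admissible open subsets of affine space (for the strong Grothendieck topology). -/
def IsAdmissibleOpen (U : Set (σ → K)) : Prop :=
  ∃ 𝒱 : Set (Set (σ → K)), (∀ V ∈ 𝒱, IsRationalDomain k V) ∧ IsAdmissibleCover k U 𝒱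

/-- `f` is a uniform limit on `V` of rational functions over `k` without poles on `V`. If `V` is
a rational domain, these are the elements of the affinoid algebra of `V`. -/
def IsUniformLimit (f : (σ → K) → K) (V : Set (σ → K)) : Prop :=
  ∀ ε : ℝ, 0 < ε → ∃ P Q : MvPolynomial σ k, ∀ x ∈ V, MvPolynomial.aeval x Q ≠ 0 ∧
    ‖f x - MvPolynomial.aeval x P / MvPolynomial.aeval x Q‖ ≤ ε

/-- `f` is a section over `U` of the structure sheaf of the rigid analytic affine space. In
particular `U` is admissible open. -/
def IsAnalyticOn (f : (σ → K) → K) (U : Set (σ → K)) : Prop :=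
  ∃ 𝒱 : Set (Set (σ → K)), (∀ V ∈ 𝒱, IsRationalDomain k V ∧ IsUniformLimit k f V) ∧
    IsAdmissibleCover k U 𝒱

/-- Matrices of analytic functions. -/
def IsAnalyticMatrixOn {r s : Type*} (M : (σ → K) → Matrix r s K) (U : Set (σ → K)) : Prop :=
  ∀ p q, IsAnalyticOn k (fun x => M x p q) U

/-- The element of `k` that defines a `k`-rational element of `K`. -/
def ratVal (z : K) : k := Function.invFun (algebraMap k K) z

variable {k}

/-- An analytic function over `k` takes values in `k` at `k`-rational points. -/
theorem IsAnalyticOn.algebraMap_ratVal [CompleteSpace k] {f : (σ → K) → K} {U : Set (σ → K)}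
    (hf : IsAnalyticOn k f U) (x : σ → k) (hx : (fun i => algebraMap k K (x i)) ∈ U) :
    algebraMap k K (ratVal k (f fun i => algebraMap k K (x i))) =
      f fun i => algebraMap k K (x i) := by
  obtain ⟨𝒱, h𝒱, hU, -⟩ := hf
  rw [hU] at hx
  obtain ⟨V, hV, hxV⟩ := hx
  have hlim := (h𝒱 V hV).2
  have hev : ∀ P : MvPolynomial σ k, MvPolynomial.aeval (fun i => algebraMap k K (x i)) P =
      algebraMap k K (MvPolynomial.eval x P) := by
    intro P
    have := MvPolynomial.aeval_algebraMap_apply K x P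
    simpa [Function.comp_def] using this
  have hclosed : IsClosed (Set.range (algebraMap k K)) :=
    ((algebraMap_isometry k K).isClosedEmbedding).isClosed_range
  have hmem : (f fun i => algebraMap k K (x i)) ∈ closure (Set.range (algebraMap k K)) := by
    rw [Metric.mem_closure_iff]
    intro ε hε
    obtain ⟨P, Q, h⟩ := hlim (ε / 2) (half_pos hε)
    refine ⟨_, ⟨MvPolynomial.eval x P / MvPolynomial.eval x Q, rfl⟩, ?_⟩
    have h2 := (h _ hxV).2
    rw [hev, hev, ← map_div₀] at h2
    rw [dist_eq_norm]
    exact lt_of_le_of_lt h2 (half_lt_self hε)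
  rw [hclosed.closure_eq] at hmem
  exact Function.invFun_eq hmem

end Rigid

section Connections

variable {K : Type v} [NontriviallyNormedField K] {ι κ : Type*}

/-- The point `(x, t)` of `B × 𝔸¹`; the coordinate `u` of `𝔸¹` has index `none`. -/
def pt (x : ι → K) (t : K) : Option ι → K := fun o => o.elim t x

/-- The projection `B × 𝔸¹ → B`. -/
def base (y : Option ι → K) : ι → K := fun i => y (some i)

/-- The map `p × id` on `B × 𝔸¹`. -/
def timesId (p : (ι → K) → κ → K) (y : Option ι → K) : Option κ → K := pt (p (base y)) (y none)

/-- Partial derivative with respect to the coordinate of index `i`. -/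
def pd {σ : Type*} [DecidableEq σ] (i : σ) (f : (σ → K) → K) (x : σ → K) : K :=
  lineDeriv K f x (Pi.single i 1)

/-- Entrywise partial derivative of a matrix of functions. -/
def pdM {σ r s : Type*} [DecidableEq σ] (i : σ) (M : (σ → K) → Matrix r s K) (x : σ → K) :
    Matrix r s K :=
  Matrix.of fun p q => pd i (fun y => M y p q) x

/-- The connection `d + u⁻¹ ∑ᵢ Tᵢ dtᵢ + u⁻² A du` on a trivial bundle: the operators
`∇_{u ∂ᵢ} = u ∂ᵢ + Tᵢ` and `∇_{u² ∂ᵤ} = u² ∂ᵤ + A`. -/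
structure ConnForm (K : Type v) (ι r : Type*) where
  T : ι → (Option ι → K) → Matrix r r K
  A : (Option ι → K) → Matrix r r K

/-- Direct sum of connections. -/
def ConnForm.directSum {I : Type*} [DecidableEq I] {r : I → Type*}
    (C : ∀ i, ConnForm K ι (r i)) : ConnForm K ι (Σ i, r i) where
  T j y := Matrix.blockDiagonal' fun i => (C i).T j y
  A y := Matrix.blockDiagonal' fun i => (C i).A y

variable [DecidableEq ι]

/-- Flatness on `V`: `[∇_{u∂ᵢ}, ∇_{u∂ⱼ}] = 0` and `[∇_{u²∂ᵤ}, ∇_{u∂ᵢ}] = u ∇_{u∂ᵢ}`, the latter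
because `[u²∂ᵤ, u∂ᵢ] = u · u∂ᵢ`. -/
structure ConnForm.IsFlatOn {r : Type*} [Fintype r] (C : ConnForm K ι r)
    (V : Set (Option ι → K)) : Prop where
  base : ∀ y ∈ V, ∀ i j, y none • (pdM (some i) (C.T j) y - pdM (some j) (C.T i) y) +
    (C.T i y * C.T j y - C.T j y * C.T i y) = 0
  u : ∀ y ∈ V, ∀ i, y none ^ 2 • pdM none (C.T i) y - y none • pdM (some i) C.A y +
    (C.A y * C.T i y - C.T i y * C.A y) = y none • C.T i y

/-- The matrix `Φ` intertwines the connections on `V`: `∇ ∘ Φ = Φ ∘ ∇'`. -/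
structure ConnForm.Intertwines {r s : Type*} [Fintype r] [Fintype s] (C : ConnForm K ι r)
    (C' : ConnForm K ι s) (Φ : (Option ι → K) → Matrix r s K) (V : Set (Option ι → K)) :
    Prop where
  base : ∀ y ∈ V, ∀ i, y none • pdM (some i) Φ y + C.T i y * Φ y = Φ y * C'.T i y
  u : ∀ y ∈ V, y none ^ 2 • pdM none Φ y + C.A y * Φ y = Φ y * C'.A y

/-- Pullback along `p × id`. -/
def ConnForm.pullback [Fintype κ] {r : Type*} (p : (ι → K) → κ → K) (C : ConnForm K κ r) :
    ConnForm K ι r where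
  T i y := ∑ l, pd i (fun x => p x l) (RigidF.base y) • C.T l (timesId p y)
  A y := C.A (timesId p y)

end Connections

section FBundles

variable (k : Type u) {K : Type v} [NontriviallyNormedField k] [NontriviallyNormedField K]
  [NormedAlgebra k K]

/-- An F-bundle over an admissible open subset `B` of affine space: a vector bundle over
`B × 𝔻ᵤ`, i.e. over some admissible open neighbourhood `W` of `B × {0}` in `B × 𝔸¹`, given by an
admissible trivializing covering with transition matrices, together with a flat connection such
that `∇_{u∂ᵢ}` and `∇_{u²∂ᵤ}` are regular.  A section with coordinates `s_b` in the chart `b` has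
coordinates `s_a = g a b * s_b` in the chart `a`. -/
structure FBundle {ι : Type*} [DecidableEq ι] (B : Set (ι → K)) where
  W : Set (Option ι → K)
  isAdmissibleOpen_W : IsAdmissibleOpen k W
  zero_section : ∀ x ∈ B, pt x 0 ∈ W
  base_mem : ∀ y ∈ W, base y ∈ B
  J : Type w
  chart : J → Set (Option ι → K)
  isAdmissibleOpen_chart : ∀ a, IsAdmissibleOpen k (chart a)
  cover : IsAdmissibleCover k W (Set.range chart)
  rank : J → ℕ
  g : ∀ a b : J, (Option ι → K) → Matrix (Fin (rank a)) (Fin (rank b)) K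
  analytic_g : ∀ a b, IsAnalyticMatrixOn k (g a b) (chart a ∩ chart b)
  g_self : ∀ a, ∀ y ∈ chart a, g a a y = 1
  g_mul : ∀ a b c, ∀ y ∈ chart a ∩ chart b ∩ chart c, g a b y * g b c y = g a c y
  conn : ∀ a, ConnForm K ι (Fin (rank a))
  analytic_T : ∀ a i, IsAnalyticMatrixOn k ((conn a).T i) (chart a)
  analytic_A : ∀ a, IsAnalyticMatrixOn k (conn a).A (chart a)
  flat : ∀ a, (conn a).IsFlatOn (chart a)
  compat : ∀ a b, (conn a).Intertwines (conn b) (g a b) (chart a ∩ chart b)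

variable {k} {ι : Type*} [DecidableEq ι] {B : Set (ι → K)}

/-- Maximality at a closed point `x` of `B`, with residue field `κ(x) = k(x₁, …, xₙ)`: there is
a cyclic vector `h` in the fibre `κ(x)^r` at `(x, 0)`, i.e. the map `v ↦ μ_x(v)(h)`, where
`μ_x(∂ᵢ) = ∇_{u∂ᵢ}|_{(x,0)}`, is an isomorphism. (The condition does not depend on the chart.) -/
def FBundle.MaximalAt [Fintype ι] (E : FBundle k B) (x : ι → K) : Prop :=
  ∀ a, pt x 0 ∈ E.chart a → ∃ h : Fin (E.rank a) → K,
    (∀ q, h q ∈ IntermediateField.adjoin k (Set.range x)) ∧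
    Function.Bijective fun v : ι → K => ∑ i, v i • ((E.conn a).T i (pt x 0)).mulVec h

/-- The endomorphism `K_b = ∇_{u²∂ᵤ}|_{(b,0)}` at the origin `b = 0`, on the fibre `k^r` in the
chart `a`. -/
def FBundle.fibreK (E : FBundle k B) (a : E.J) : Module.End k (Fin (E.rank a) → k) :=
  Matrix.toLin' (((E.conn a).A (pt 0 0)).map (ratVal k))

theorem FBundle.algebraMap_fibreK [CompleteSpace k] (E : FBundle k B) (a : E.J)
    (ha : pt 0 0 ∈ E.chart a) :
    ((LinearMap.toMatrix' (E.fibreK a)).map (algebraMap k K)) = (E.conn a).A (pt 0 0) := by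
  have h0 : (fun i : Option ι => algebraMap k K ((0 : Option ι → k) i)) = pt 0 0 := by
    funext o
    cases o <;> simp [pt]
  ext p q
  have h := (E.analytic_A a p q).algebraMap_ratVal (0 : Option ι → k) (by rw [h0]; exact ha)
  rw [h0] at h
  simpa [FBundle.fibreK] using h

variable {I : Type*} {κ : I → Type*}

/-- The maps `p i : U → U' i` are the components of an isomorphism `U ≅ ∏ᵢ U' i` of analytic
spaces. -/
structure IsProductIso (k : Type u) [NontriviallyNormedField k] [NormedAlgebra k K]
    (U : Set (ι → K)) (U' : ∀ i, Set (κ i → K)) (p : ∀ i, (ι → K) → κ i → K) : Prop where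
  analytic : ∀ i l, IsAnalyticOn k (fun x => p i x l) U
  mapsTo : ∀ i, Set.MapsTo (p i) U (U' i)
  inverse : ∃ q : ((Σ i, κ i) → K) → ι → K,
    (∀ j, IsAnalyticOn k (fun z => q z j) {z | ∀ i, (fun l => z ⟨i, l⟩) ∈ U' i}) ∧
    (∀ z, (∀ i, (fun l => z ⟨i, l⟩) ∈ U' i) →
      q z ∈ U ∧ ∀ i, p i (q z) = fun l => z ⟨i, l⟩) ∧
    ∀ x ∈ U, q (fun s => p s.1 x s.2) = x

/-- An isomorphism of F-bundles `E|_U ≅ ⨁ᵢ (p i)^* (F i)` over `U ⊆ B`: over the members `V β` of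
an admissible covering of a neighbourhood `W'` of `U × {0}`, chosen fine enough to be mapped into
the charts `a β` of `E` and `c β i` of `F i`, it is given by invertible matrices `Φ β` which are
compatible with the transition matrices and with the connections. -/
structure DirectSumIso [∀ i, DecidableEq (κ i)] [∀ i, Fintype (κ i)] [Fintype I] [DecidableEq I]
    (E : FBundle.{u, v, w} k B) (U : Set (ι → K)) {U' : ∀ i, Set (κ i → K)}
    (F : ∀ i, FBundle.{u, v, w} k (U' i)) (p : ∀ i, (ι → K) → κ i → K) where
  W' : Set (Option ι → K)
  isAdmissibleOpen_W' : IsAdmissibleOpen k W'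
  subset_W : W' ⊆ E.W
  zero_section : ∀ x ∈ U, pt x 0 ∈ W'
  base_mem : ∀ y ∈ W', base y ∈ U
  L : Type
  V : L → Set (Option ι → K)
  isAdmissibleOpen_V : ∀ β, IsAdmissibleOpen k (V β)
  cover : IsAdmissibleCover k W' (Set.range V)
  a : L → E.J
  c : L → ∀ i, (F i).J
  mem_chart : ∀ β, ∀ y ∈ V β, y ∈ E.chart (a β)
  mem_chart' : ∀ β i, ∀ y ∈ V β, timesId (p i) y ∈ (F i).chart (c β i)
  Φ : ∀ β, (Option ι → K) →
    Matrix (Fin (E.rank (a β))) (Σ i, Fin ((F i).rank (c β i))) K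
  Ψ : ∀ β, (Option ι → K) →
    Matrix (Σ i, Fin ((F i).rank (c β i))) (Fin (E.rank (a β))) K
  analytic_Φ : ∀ β, IsAnalyticMatrixOn k (Φ β) (V β)
  analytic_Ψ : ∀ β, IsAnalyticMatrixOn k (Ψ β) (V β)
  Φ_mul_Ψ : ∀ β, ∀ y ∈ V β, Φ β y * Ψ β y = 1
  Ψ_mul_Φ : ∀ β, ∀ y ∈ V β, Ψ β y * Φ β y = 1
  glue : ∀ β γ, ∀ y ∈ V β ∩ V γ, E.g (a β) (a γ) y * Φ γ y =
    Φ β y * Matrix.blockDiagonal' fun i => (F i).g (c β i) (c γ i) (timesId (p i) y)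
  intertwines : ∀ β, (E.conn (a β)).Intertwines
    (ConnForm.directSum fun i => ((F i).conn (c β i)).pullback (p i)) (Φ β) (V β)

/-- The isomorphism restricts at `(0, 0)` to the decomposition `H` of the fibre of `E`, given in
the chart `a₀`: the fibre of `F i` at the image of the origin is mapped onto `H i`. -/
def DirectSumIso.Extends [∀ i, DecidableEq (κ i)] [∀ i, Fintype (κ i)] [Fintype I]
    [DecidableEq I] {E : FBundle.{u, v, w} k B} {U : Set (ι → K)} {U' : ∀ i, Set (κ i → K)}
    {F : ∀ i, FBundle.{u, v, w} k (U' i)} {p : ∀ i, (ι → K) → κ i → K}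
    (D : DirectSumIso E U F p) (a₀ : E.J) (H : I → Submodule k (Fin (E.rank a₀) → k)) : Prop :=
  ∀ β, pt 0 0 ∈ D.V β → ∀ (i : I) (h : Fin (E.rank a₀) → k),
    h ∈ H i ↔ ∃ v : Fin ((F i).rank (D.c β i)) → k,
      (fun q => algebraMap k K (h q)) =
        (E.g a₀ (D.a β) (pt 0 0) * D.Φ β (pt 0 0)).mulVec
          (fun s => algebraMap k K
            ((Pi.single i v : ∀ j, Fin ((F j).rank (D.c β j)) → k) s.1 s.2))

end FBundles

end

end RigidF

/-!
# Spectral decomposition of non-archimedean F-bundles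

Let `r` be the rank of the F-bundle. Near the origin of the base, and of the `u`-line, the
connection is given by matrices of power series `T_i` (for `∇_{u∂_i}`) and `A` (for `∇_{u²∂_u}`).
The decomposition is constructed formally, by solving differential equations for power series; it
converges because of two features of the field. Every nonzero integer has norm one, so that
integration causes no denominators, and, in coordinates scaled by a small `q`, all nonconstant
coefficients of the connection are small. Hence every power series that is constructed has bounded,
mostly even integral, coefficients, and so defines an analytic function on the open unit polydisc
of the scaled coordinates. This is where the non-archimedean case differs from the complex one, in
which a decomposition of this kind exists only formally in `u`.

*The formal decomposition* (`exists_formal_decomposition`). In a basis adapted to the splitting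
of the fibre, `A₀ = A(0, 0)` is block diagonal, and the blocks have coprime characteristic
polynomials, so that `ad A₀` is invertible on the matrices with zero diagonal blocks
(`exists_isSylvesterInverse`). Therefore a gauge transformation, found as the fixed point of a
contraction, makes `A` block diagonal (`exists_blockDiagonal_gauge`); flatness forces the `T_i` to
be block diagonal as well (`IsFlat.isBD`). Each block is now a flat connection of rank `d_j` over
the whole base, and it remains to see that it is pulled back from a space of dimension `d_j`. By
maximality there is a vector `h` whose images under the `T_i` form a basis of the fibre at the
origin; linear coordinates on the base are chosen accordingly. At `u = 0` the `T_i` commute, by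
flatness. So if a vector field `Y` on the base satisfies `T_Y h = 0` at `u = 0` for the `j`-th
block, then `T_Y = 0` at `u = 0` there, which means that `∇_Y`, without the factor `u`, is regular
on this block. These vector fields form an involutive distribution of corank `d_j`
(`exists_sliceStructure`). It has first integrals `p_{j,c}` which extend the coordinates of a slice
(`exists_firstIntegrals`), and the block has a frame which is flat along the distribution and is
the given one on the slice; this frame identifies the block with the pullback of its restriction to
the slice (`exists_pullback_frame`). Both are solutions of linear differential equations along the
distribution, with prescribed values on the slice (`exists_flat_extension`).

*From power series to analytic functions.* The expansion of an analytic function as a bounded power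
series (`IsAnalyticOn.eventually_eq_ev`) rests on the Cauchy estimate: the maximum of the norms of
the coefficients of a polynomial is attained as its norm at an integral point, since the residue
field is infinite (`exists_norm_coeff_le_norm_eval`). With it, a flat analytic connection becomes a
flat formal connection with small nonconstant coefficients
(`ConnForm.IsFlatOn.eventually_exists_series`), to which the formal decomposition applies
(`ConnForm.IsFlatOn.nonempty_splitting`). Conversely, the values of bounded power series
(`RigidF.ev`) are compatible with products, derivatives and composition. The first integrals of all
the blocks together are tangent to the identity, hence an isomorphism from a small polydisc to a
product of polydiscs (`isProductIso_ev`); the restrictions of the blocks to the slices are maximal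
F-bundles (`sliceBundle`, `sliceBundle_maximalAt`), and the gauge transformations are the
isomorphism of F-bundles (`intertwines_of_formal`, `Splitting.directSumIso`).
-/

open MvPowerSeries

namespace RigidF

noncomputable section

/-! ### Power series with bounded coefficients -/

section Bounded

variable {k : Type*} [NormedField k] {σ : Type*}

/-- All coefficients of the power series `F` have norm at most `C`. -/
def Bd (C : ℝ) (F : MvPowerSeries σ k) : Prop := ∀ m, ‖coeff m F‖ ≤ C

theorem Bd.mono {C D : ℝ} {F : MvPowerSeries σ k} (h : Bd C F) (hCD : C ≤ D) : Bd D F :=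
  fun m => (h m).trans hCD

theorem Bd.zero {C : ℝ} (hC : 0 ≤ C) : Bd C (0 : MvPowerSeries σ k) := fun m => by simpa using hC

theorem Bd.monomial {C : ℝ} (hC : 0 ≤ C) {a : k} (ha : ‖a‖ ≤ C) (n : σ →₀ ℕ) :
    Bd C (monomial n a : MvPowerSeries σ k) := fun m => by
  classical
  rw [coeff_monomial]
  split_ifs
  · exact ha
  · simpa using hC

theorem Bd.C {C : ℝ} {a : k} (ha : ‖a‖ ≤ C) :
    Bd C (MvPowerSeries.C a : MvPowerSeries σ k) :=
  Bd.monomial ((norm_nonneg a).trans ha) ha 0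

theorem Bd.one : Bd 1 (1 : MvPowerSeries σ k) := by
  have := Bd.C (σ := σ) (a := (1 : k)) (C := 1) (by simp)
  simpa using this

theorem Bd.X (s : σ) : Bd 1 (MvPowerSeries.X s : MvPowerSeries σ k) :=
  Bd.monomial zero_le_one (by simp) _

theorem Bd.neg {C : ℝ} {F : MvPowerSeries σ k} (h : Bd C F) : Bd C (-F) := fun m => by
  simpa using h m

theorem Bd.smul {C D : ℝ} {a : k} (ha : ‖a‖ ≤ D) {F : MvPowerSeries σ k} (h : Bd C F) :
    Bd (D * C) (a • F) := fun m => by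
  rw [coeff_smul, norm_mul]
  exact mul_le_mul ha (h m) (norm_nonneg _) ((norm_nonneg _).trans ha)

theorem Bd.nonneg {C : ℝ} {F : MvPowerSeries σ k} (h : Bd C F) : 0 ≤ C :=
  (norm_nonneg _).trans (h 0)

theorem Bd.rescale {C : ℝ} {F : MvPowerSeries σ k} (h : Bd C F) {a : σ → k}
    (ha : ∀ i, ‖a i‖ ≤ 1) : Bd C (rescale a F) := fun m => by
  rw [coeff_rescale, norm_mul]
  refine (mul_le_mul ?_ (h m) (norm_nonneg _) zero_le_one).trans (one_mul C).le
  rw [Finsupp.prod, norm_prod]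
  exact Finset.prod_le_one (fun _ _ => norm_nonneg _) fun i _ => by
    rw [norm_pow]; exact pow_le_one₀ (norm_nonneg _) (ha i)

variable [IsUltrametricDist k]

theorem Bd.add {C : ℝ} {F G : MvPowerSeries σ k} (hF : Bd C F) (hG : Bd C G) : Bd C (F + G) :=
  fun m => by
    rw [map_add]
    exact (IsUltrametricDist.norm_add_le_max _ _).trans (max_le (hF m) (hG m))

theorem Bd.sub {C : ℝ} {F G : MvPowerSeries σ k} (hF : Bd C F) (hG : Bd C G) : Bd C (F - G) := by
  rw [sub_eq_add_neg]
  exact hF.add hG.neg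

theorem Bd.sum {C : ℝ} (hC : 0 ≤ C) {ι : Type*} (s : Finset ι) {F : ι → MvPowerSeries σ k}
    (h : ∀ i ∈ s, Bd C (F i)) : Bd C (∑ i ∈ s, F i) := fun m => by
  rw [map_sum]
  exact IsUltrametricDist.norm_sum_le_of_forall_le_of_nonneg hC fun i hi => h i hi m

theorem Bd.mul {C D : ℝ} {F G : MvPowerSeries σ k} (hF : Bd C F) (hG : Bd D G) :
    Bd (C * D) (F * G) := fun m => by
  classical
  rw [coeff_mul]
  refine IsUltrametricDist.norm_sum_le_of_forall_le_of_nonneg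
    (mul_nonneg hF.nonneg hG.nonneg) fun p _ => ?_
  rw [norm_mul]
  exact mul_le_mul (hF _) (hG _) (norm_nonneg _) hF.nonneg

theorem Bd.mul_one {C : ℝ} {F G : MvPowerSeries σ k} (hF : Bd C F) (hG : Bd 1 G) :
    Bd C (F * G) := by
  simpa using hF.mul hG

theorem Bd.one_mul {C : ℝ} {F G : MvPowerSeries σ k} (hF : Bd 1 F) (hG : Bd C G) :
    Bd C (F * G) := by
  simpa using hF.mul hG

theorem Bd.pow {F : MvPowerSeries σ k} {C : ℝ} (hF : Bd C F) (n : ℕ) : Bd (C ^ n) (F ^ n) := by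
  induction n with
  | zero => simpa using Bd.one
  | succ n ih => rw [pow_succ, pow_succ]; exact ih.mul hF

theorem Bd.prod {ι : Type*} (s : Finset ι) {F : ι → MvPowerSeries σ k} {C : ι → ℝ}
    (h : ∀ i ∈ s, Bd (C i) (F i)) : Bd (∏ i ∈ s, C i) (∏ i ∈ s, F i) := by
  classical
  induction s using Finset.induction_on with
  | empty => simpa using Bd.one
  | insert a s ha ih =>
    rw [Finset.prod_insert ha, Finset.prod_insert ha]
    exact (h a (by simp)).mul (ih fun i hi => h i (by simp [hi]))

theorem Bd.pderiv {C : ℝ} {F : MvPowerSeries σ k} (hF : Bd C F) (i : σ) :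
    Bd C (pderiv k i F) := fun m => by
  rw [coeff_pderiv, norm_mul]
  have h1 : ‖((m i : k) + 1)‖ ≤ 1 := by
    exact_mod_cast IsUltrametricDist.norm_natCast_le_one k (m i + 1)
  exact (mul_le_mul (hF _) h1 (norm_nonneg _) hF.nonneg).trans (_root_.mul_one C).le

end Bounded

/-! ### Order of vanishing with respect to weights -/

section Vanishing

variable {k : Type*} [Field k] {σ : Type*}

/-- The ideal of power series whose coefficients vanish in weight less than `n`. -/
def vanIdeal (k : Type*) [Field k] {σ : Type*} (w : σ → ℕ) (n : ℕ) : Ideal (MvPowerSeries σ k) where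
  carrier := {F | ∀ m, Finsupp.weight w m < n → coeff m F = 0}
  add_mem' := fun ha hb m hm => by rw [map_add, ha m hm, hb m hm, add_zero]
  zero_mem' := fun m _ => by simp
  smul_mem' := fun c F hF m hm => by
    classical
    rw [smul_eq_mul, coeff_mul]
    refine Finset.sum_eq_zero fun p hp => ?_
    rw [Finset.HasAntidiagonal.mem_antidiagonal] at hp
    rw [hF p.2, mul_zero]
    refine lt_of_le_of_lt ?_ hm
    rw [← hp, map_add]
    exact Nat.le_add_left _ _

variable {w : σ → ℕ} {n : ℕ} {F G : MvPowerSeries σ k}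

theorem vanIdeal_zero : F ∈ vanIdeal k w 0 := fun _ h => absurd h (Nat.not_lt_zero _)

theorem vanIdeal_anti {n' : ℕ} (h : n ≤ n') (hF : F ∈ vanIdeal k w n') : F ∈ vanIdeal k w n :=
  fun m hm => hF m (hm.trans_le h)

theorem mul_mem_vanIdeal {a b : ℕ} (hF : F ∈ vanIdeal k w a) (hG : G ∈ vanIdeal k w b) :
    F * G ∈ vanIdeal k w (a + b) := fun m hm => by
  classical
  rw [coeff_mul]
  refine Finset.sum_eq_zero fun p hp => ?_
  rw [Finset.HasAntidiagonal.mem_antidiagonal] at hp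
  rw [← hp, map_add] at hm
  by_cases h : Finsupp.weight w p.1 < a
  · rw [hF _ h, zero_mul]
  · rw [hG p.2 (by omega), mul_zero]

theorem X_mem_vanIdeal (i : σ) : (X i : MvPowerSeries σ k) ∈ vanIdeal k w (w i) := fun m hm => by
  classical
  rw [coeff_X, if_neg]
  rintro rfl
  simp [Finsupp.weight_single] at hm

/-- Differentiation lowers the weight by the weight of the variable. -/
theorem pderiv_mem_vanIdeal {a : ℕ} (i : σ) (hF : F ∈ vanIdeal k w a) (ha : n + w i ≤ a) :
    pderiv k i F ∈ vanIdeal k w n := fun m hm => by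
  rw [coeff_pderiv, hF, zero_mul]
  rw [map_add, Finsupp.weight_single]
  simp only [one_smul]
  omega

theorem eq_zero_of_forall_mem_vanIdeal (h : ∀ n, F ∈ vanIdeal k w n) : F = 0 := by
  ext m
  exact h (Finsupp.weight w m + 1) m (Nat.lt_succ_self _)

theorem mem_vanIdeal_one_iff [Fintype σ] :
    F ∈ vanIdeal k (fun _ : σ => 1) 1 ↔ constantCoeff F = 0 := by
  rw [← coeff_zero_eq_constantCoeff_apply]
  refine ⟨fun h => h 0 (by simp), fun h m hm => ?_⟩
  have : m = 0 := by
    have h1 : Finsupp.weight (fun _ : σ => 1) m = 0 := by omega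
    ext i
    have := Finsupp.le_weight (fun _ : σ => 1) (s := i) (by simp) m
    simp only [h1] at this
    simpa using this
  rwa [this]

end Vanishing

/-! ### Fixed points and inverses of matrices of power series -/

section FixedPoint

variable {k : Type*} [NormedField k] {σ r s : Type*}

/-- A map of matrices of power series that increases the order of contact has a fixed point. If
it preserves matrices with coefficients bounded by `η`, the fixed point is one of them. -/
theorem exists_fixedPoint (w : σ → ℕ)
    (G : Matrix r s (MvPowerSeries σ k) → Matrix r s (MvPowerSeries σ k))
    (hG : ∀ n X Y, (∀ i j, X i j - Y i j ∈ vanIdeal k w n) →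
      ∀ i j, G X i j - G Y i j ∈ vanIdeal k w (n + 1))
    (η : ℝ) (hη : 0 ≤ η)
    (hB : ∀ X, (∀ i j, Bd η (X i j)) → ∀ i j, Bd η (G X i j)) :
    ∃ X, G X = X ∧ ∀ i j, Bd η (X i j) := by
  -- the iterates stabilize in each weight
  set x : ℕ → Matrix r s (MvPowerSeries σ k) := fun n => G^[n] 0 with hx
  have hxs : ∀ n, x (n + 1) = G (x n) := fun n => Function.iterate_succ_apply' G n 0
  have hbd : ∀ n i j, Bd η (x n i j) := by
    intro n
    induction n with
    | zero => intro i j; exact Bd.zero hη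
    | succ n ih => rw [hxs]; exact hB _ ih
  have hstep : ∀ n i j, x (n + 1) i j - x n i j ∈ vanIdeal k w n := by
    intro n
    induction n with
    | zero => intro i j; exact vanIdeal_zero
    | succ n ih => rw [hxs (n + 1), hxs n]; exact hG n _ _ (by rw [← hxs]; exact ih)
  have hst : ∀ n l i j, x (n + l) i j - x n i j ∈ vanIdeal k w n := by
    intro n l
    induction l with
    | zero => intro i j; simp
    | succ l ih =>
      intro i j
      have h1 := vanIdeal_anti (Nat.le_add_right n l) (hstep (n + l) i j)
      have := (vanIdeal k w n).add_mem h1 (ih i j)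
      simpa [add_assoc] using this
  let X : Matrix r s (MvPowerSeries σ k) :=
    fun i j m => coeff m (x (Finsupp.weight w m + 1) i j)
  have hX : ∀ n i j, X i j - x n i j ∈ vanIdeal k w n := by
    intro n i j m hm
    have h1 : coeff m (X i j) = coeff m (x (Finsupp.weight w m + 1) i j) := rfl
    obtain ⟨l, hl⟩ := Nat.exists_eq_add_of_le (Nat.succ_le_of_lt hm)
    have h2 := hst (Finsupp.weight w m + 1) l i j m (Nat.lt_succ_self _)
    rw [← Nat.succ_eq_add_one, ← hl, map_sub, sub_eq_zero] at h2
    rw [map_sub, h1, ← h2, sub_self]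
  refine ⟨X, ?_, fun i j m => hbd _ i j m⟩
  ext1 i j
  rw [← sub_eq_zero]
  refine eq_zero_of_forall_mem_vanIdeal (w := w) fun n => ?_
  have h1 := hG n X (x n) (hX n) i j
  rw [← hxs] at h1
  have h2 := (vanIdeal k w n).sub_mem (vanIdeal_anti n.le_succ h1)
    (vanIdeal_anti n.le_succ (hX (n + 1) i j))
  simpa using h2

end FixedPoint

section Matrices

variable {k : Type*} [NormedField k] {σ r s t : Type*}

theorem Bd.matrix_one [DecidableEq r] (i j : r) :
    Bd 1 ((1 : Matrix r r (MvPowerSeries σ k)) i j) := by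
  rw [Matrix.one_apply]
  split_ifs
  · exact Bd.one
  · exact Bd.zero zero_le_one

theorem mem_vanIdeal_matrix_mul [Fintype s] {w : σ → ℕ} {a b : ℕ}
    {M : Matrix r s (MvPowerSeries σ k)}
    {N : Matrix s t (MvPowerSeries σ k)} (hM : ∀ i j, M i j ∈ vanIdeal k w a)
    (hN : ∀ i j, N i j ∈ vanIdeal k w b) (i : r) (j : t) :
    (M * N) i j ∈ vanIdeal k w (a + b) := by
  rw [Matrix.mul_apply]
  exact Ideal.sum_mem _ fun l _ => mul_mem_vanIdeal (hM i l) (hN l j)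

variable [IsUltrametricDist k]

theorem Bd.matrix_mul [Fintype s] {C D : ℝ} {M : Matrix r s (MvPowerSeries σ k)}
    {N : Matrix s t (MvPowerSeries σ k)} (hC : 0 ≤ C) (hD : 0 ≤ D) (hM : ∀ i j, Bd C (M i j))
    (hN : ∀ i j, Bd D (N i j)) (i : r) (j : t) : Bd (C * D) ((M * N) i j) := by
  rw [Matrix.mul_apply]
  exact Bd.sum (mul_nonneg hC hD) _ fun l _ => (hM i l).mul (hN l j)

/-- A matrix of integral power series with constant term `1` has an inverse of the same kind. -/
theorem exists_inverse [Fintype σ] [Fintype r] [DecidableEq r]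
    (M : Matrix r r (MvPowerSeries σ k))
    (hM : ∀ i j, Bd 1 (M i j)) (h0 : M.map constantCoeff = 1) :
    ∃ N : Matrix r r (MvPowerSeries σ k), M * N = 1 ∧ N * M = 1 ∧ (∀ i j, Bd 1 (N i j)) ∧
      N.map constantCoeff = 1 := by
  have hE : ∀ i j, (1 - M) i j ∈ vanIdeal k (fun _ : σ => 1) 1 := by
    intro i j
    rw [mem_vanIdeal_one_iff]
    have := congrFun (congrFun h0 i) j
    rw [Matrix.map_apply] at this
    rw [Matrix.sub_apply, map_sub, this, Matrix.one_apply, Matrix.one_apply]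
    split_ifs <;> simp
  obtain ⟨N, hN, hNb⟩ := exists_fixedPoint (fun _ : σ => 1) (fun X => 1 + (1 - M) * X)
    (by
      intro n X Y h i j
      have : (1 + (1 - M) * X) i j - (1 + (1 - M) * Y) i j = ((1 - M) * (X - Y)) i j := by
        rw [Matrix.mul_sub]; simp
      rw [this, add_comm n 1]
      exact mem_vanIdeal_matrix_mul hE h i j) 1 zero_le_one
    (by
      intro X hX i j
      refine (Bd.matrix_one i j).add ?_
      have := Bd.matrix_mul zero_le_one zero_le_one
        (M := 1 - M) (fun i j => (Bd.matrix_one i j).sub (hM i j)) hX i j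
      rwa [_root_.mul_one] at this)
  have h1 : M * N = 1 := by
    have : 1 + (1 - M) * N = N := hN
    rw [sub_mul, one_mul] at this
    have h2 : M * N = 1 + (N - M * N) - N + M * N - (1 + (N - M * N) - N) := by abel
    rw [h2, this]
    have h3 : M * N = 1 + N - (1 + (N - M * N)) := by abel
    rw [this] at h3
    simpa using h3
  refine ⟨N, h1, mul_eq_one_comm.mp h1, hNb, ?_⟩
  have h2 := congrArg (fun X : Matrix r r _ => X.map (constantCoeff (σ := σ) (R := k))) h1
  rw [Matrix.map_mul, h0, one_mul] at h2
  rw [h2]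
  exact Matrix.map_one _ (map_zero _) (map_one _)

end Matrices

/-! ### Derivations of matrices and gauge transformations -/

section MatrixDerivation

variable {k R : Type*} [CommRing k] [CommRing R] [Algebra k R] {r s t : Type*}

/-- Entrywise application of a derivation to a matrix. -/
def matD (D : Derivation k R R) : Matrix r s R →ₗ[k] Matrix r s R := D.toLinearMap.mapMatrix

@[simp] theorem matD_apply (D : Derivation k R R) (M : Matrix r s R) (i : r) (j : s) :
    matD D M i j = D (M i j) := rfl

theorem matD_mul [Fintype s] (D : Derivation k R R) (M : Matrix r s R) (N : Matrix s t R) :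
    matD D (M * N) = matD D M * N + M * matD D N := by
  ext i j
  simp only [matD_apply, Matrix.mul_apply, Matrix.add_apply, map_sum, Derivation.leibniz,
    smul_eq_mul, Finset.sum_add_distrib]
  rw [add_comm]
  congr 1
  exact Finset.sum_congr rfl fun l _ => mul_comm _ _

theorem matD_one [DecidableEq r] (D : Derivation k R R) : matD D (1 : Matrix r r R) = 0 := by
  ext i j
  rw [matD_apply, Matrix.one_apply]
  split_ifs <;> simp

theorem matD_smul (D : Derivation k R R) (a : R) (M : Matrix r s R) :
    matD D (a • M) = D a • M + a • matD D M := by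
  ext i j
  simp [mul_comm (D a), add_comm]

/-- A gauge transformation preserves the curvature equation of a pair of connection operators
`D₁ + M₁`, `D₂ + M₂` with commutator `D₃ + M₃`. -/
theorem gauge_curvature [Fintype r] [Fintype s] [DecidableEq s] {D₁ D₂ D₃ : Derivation k R R}
    (hD : ∀ x, D₁ (D₂ x) - D₂ (D₁ x) = D₃ x) {M₁ M₂ M₃ : Matrix r r R}
    {N₁ N₂ N₃ : Matrix s s R} {Φ : Matrix r s R} {Ψ : Matrix s r R}
    (hΦ : Ψ * Φ = 1)
    (h₁ : matD D₁ Φ + M₁ * Φ = Φ * N₁) (h₂ : matD D₂ Φ + M₂ * Φ = Φ * N₂)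
    (h₃ : matD D₃ Φ + M₃ * Φ = Φ * N₃)
    (hM : matD D₁ M₂ - matD D₂ M₁ + (M₁ * M₂ - M₂ * M₁) = M₃) :
    matD D₁ N₂ - matD D₂ N₁ + (N₁ * N₂ - N₂ * N₁) = N₃ := by
  have hDM : matD D₁ (matD D₂ Φ) - matD D₂ (matD D₁ Φ) = matD D₃ Φ := by
    ext i j
    exact hD _
  have e1 : Φ * matD D₁ N₂ = matD D₁ (matD D₂ Φ) + matD D₁ M₂ * Φ + M₂ * matD D₁ Φ
      - matD D₁ Φ * N₂ := by
    have := congrArg (matD D₁) h₂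
    rw [map_add, matD_mul, matD_mul] at this
    rw [← add_assoc] at this
    rw [this]; abel
  have e2 : Φ * matD D₂ N₁ = matD D₂ (matD D₁ Φ) + matD D₂ M₁ * Φ + M₁ * matD D₂ Φ
      - matD D₂ Φ * N₁ := by
    have := congrArg (matD D₂) h₁
    rw [map_add, matD_mul, matD_mul] at this
    rw [← add_assoc] at this
    rw [this]; abel
  have e3 : matD D₁ Φ = Φ * N₁ - M₁ * Φ := by rw [← h₁]; abel
  have e4 : matD D₂ Φ = Φ * N₂ - M₂ * Φ := by rw [← h₂]; abel
  have key : Φ * (matD D₁ N₂ - matD D₂ N₁ + (N₁ * N₂ - N₂ * N₁)) = Φ * N₃ := by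
    rw [← h₃, ← hM, ← hDM, Matrix.mul_add, Matrix.mul_sub, e1, e2, e3, e4]
    simp only [Matrix.add_mul, Matrix.sub_mul, Matrix.mul_sub, Matrix.mul_assoc]
    abel
  have := congrArg (fun Z => Ψ * Z) key
  simpa [← Matrix.mul_assoc, hΦ] using this

end MatrixDerivation

/-! ### Block diagonal matrices -/

section Blocks

variable {R : Type*} [Ring R] {r I : Type*} (β : r → I)

/-- Block diagonal matrices with respect to the partition of the index set into the fibres
of `β`. -/
def IsBD (M : Matrix r r R) : Prop := ∀ p q, β p ≠ β q → M p q = 0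

/-- Matrices with vanishing diagonal blocks. -/
def IsOff (M : Matrix r r R) : Prop := ∀ p q, β p = β q → M p q = 0

/-- The block diagonal part of a matrix. -/
def diagPart [DecidableEq I] (M : Matrix r r R) : Matrix r r R :=
  Matrix.of fun p q => if β p = β q then M p q else 0

variable {β} {M N : Matrix r r R}

theorem isBD_diagPart [DecidableEq I] : IsBD β (diagPart β M) := fun p q h => by
  simp [diagPart, h]

theorem isOff_sub_diagPart [DecidableEq I] : IsOff β (M - diagPart β M) := fun p q h => by
  simp [diagPart, h]

theorem IsBD.add (hM : IsBD β M) (hN : IsBD β N) : IsBD β (M + N) := fun p q h => by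
  simp [hM p q h, hN p q h]

theorem IsBD.sub (hM : IsBD β M) (hN : IsBD β N) : IsBD β (M - N) := fun p q h => by
  simp [hM p q h, hN p q h]

theorem IsOff.add (hM : IsOff β M) (hN : IsOff β N) : IsOff β (M + N) := fun p q h => by
  simp [hM p q h, hN p q h]

theorem IsOff.sub (hM : IsOff β M) (hN : IsOff β N) : IsOff β (M - N) := fun p q h => by
  simp [hM p q h, hN p q h]

theorem IsBD.mul [Fintype r] (hM : IsBD β M) (hN : IsBD β N) : IsBD β (M * N) := fun p q h => by
  rw [Matrix.mul_apply]
  refine Finset.sum_eq_zero fun l _ => ?_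
  by_cases hl : β p = β l
  · rw [hN l q (hl ▸ h), mul_zero]
  · rw [hM p l hl, zero_mul]

theorem IsOff.mul_bd [Fintype r] (hM : IsOff β M) (hN : IsBD β N) : IsOff β (M * N) :=
  fun p q h => by
    rw [Matrix.mul_apply]
    refine Finset.sum_eq_zero fun l _ => ?_
    by_cases hl : β p = β l
    · rw [hM p l hl, zero_mul]
    · rw [hN l q (fun h' => hl (h.trans h'.symm)), mul_zero]

theorem IsBD.mul_off [Fintype r] (hM : IsBD β M) (hN : IsOff β N) : IsOff β (M * N) :=
  fun p q h => by
    rw [Matrix.mul_apply]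
    refine Finset.sum_eq_zero fun l _ => ?_
    by_cases hl : β p = β l
    · rw [hN l q (hl.symm.trans h), mul_zero]
    · rw [hM p l hl, zero_mul]

theorem IsBD.eq_zero (hM : IsBD β M) (hN : IsOff β M) : M = 0 := by
  ext p q
  by_cases h : β p = β q
  · exact hN p q h
  · exact hM p q h

end Blocks

section CoefficientwiseMaps

variable {k : Type*} [Field k] {σ r : Type*}

/-- Coefficientwise application of a linear map of matrices. -/
def liftL (L : Matrix r r k →ₗ[k] Matrix r r k) (Y : Matrix r r (MvPowerSeries σ k)) :
    Matrix r r (MvPowerSeries σ k) := fun p q m => L (Y.map (coeff m)) p q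

theorem coeff_liftL (L : Matrix r r k →ₗ[k] Matrix r r k) (Y : Matrix r r (MvPowerSeries σ k))
    (m : σ →₀ ℕ) : (liftL L Y).map (coeff m) = L (Y.map (coeff m)) := rfl

theorem liftL_sub (L : Matrix r r k →ₗ[k] Matrix r r k) (Y Z : Matrix r r (MvPowerSeries σ k)) :
    liftL L Y - liftL L Z = liftL L (Y - Z) := by
  ext p q m
  have h : (Y - Z).map (coeff m) = Y.map (coeff m) - Z.map (coeff m) :=
    Matrix.map_sub _ (map_sub _) _ _
  change L (Y.map (coeff m)) p q - L (Z.map (coeff m)) p q = L ((Y - Z).map (coeff m)) p q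
  rw [h, map_sub]
  rfl

theorem liftL_mem_vanIdeal {L : Matrix r r k →ₗ[k] Matrix r r k}
    {Y : Matrix r r (MvPowerSeries σ k)} {w : σ → ℕ} {n : ℕ}
    (hY : ∀ i j, Y i j ∈ vanIdeal k w n) (i j : r) : liftL L Y i j ∈ vanIdeal k w n :=
  fun m hm => by
    have : Y.map (coeff m) = 0 := by
      ext p q
      exact hY p q m hm
    change L (Y.map (coeff m)) i j = 0
    rw [this, map_zero]
    rfl

theorem ext_coeff {Y Z : Matrix r r (MvPowerSeries σ k)}
    (h : ∀ m, Y.map (coeff m) = Z.map (coeff m)) : Y = Z := by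
  ext p q m
  exact congrFun (congrFun (h m) p) q

theorem coeff_map_C_mul [Fintype r] (A : Matrix r r k) (Y : Matrix r r (MvPowerSeries σ k))
    (m : σ →₀ ℕ) : (A.map MvPowerSeries.C * Y).map (coeff m) = A * Y.map (coeff m) := by
  ext p q
  simp [Matrix.mul_apply, coeff_C_mul]

theorem coeff_mul_map_C [Fintype r] (A : Matrix r r k) (Y : Matrix r r (MvPowerSeries σ k))
    (m : σ →₀ ℕ) : (Y * A.map MvPowerSeries.C).map (coeff m) = Y.map (coeff m) * A := by
  ext p q
  simp [Matrix.mul_apply, coeff_mul_C]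

end CoefficientwiseMaps

/-! ### Flat formal connections -/

section Operators

variable {k : Type*} [Field k] {S : Type*}

/-- The derivation `u ∂ₐ`, where `u` is the variable of index `none`. -/
def uD (k : Type*) [Field k] {S : Type*} (a : S) :
    Derivation k (MvPowerSeries (Option S) k) (MvPowerSeries (Option S) k) :=
  (X none : MvPowerSeries (Option S) k) • pderiv k (some a)

/-- The derivation `q u² ∂ᵤ`. -/
def uuD (S : Type*) (q : k) :
    Derivation k (MvPowerSeries (Option S) k) (MvPowerSeries (Option S) k) :=
  (MvPowerSeries.C q * X none ^ 2 : MvPowerSeries (Option S) k) • pderiv k none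

theorem uD_apply (a : S) (F : MvPowerSeries (Option S) k) :
    uD k a F = X none * pderiv k (some a) F := rfl

theorem uuD_apply (q : k) (F : MvPowerSeries (Option S) k) :
    uuD S q F = MvPowerSeries.C q * X none ^ 2 * pderiv k none F := rfl

theorem pderiv_comm (i j : S) (F : MvPowerSeries S k) :
    pderiv k i (pderiv k j F) = pderiv k j (pderiv k i F) := by
  classical
  ext m
  simp only [coeff_pderiv, Finsupp.add_apply, Finsupp.single_apply, Nat.cast_add]
  by_cases h : i = j
  · subst h; ring
  · rw [if_neg h, if_neg (Ne.symm h), add_right_comm]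
    push_cast
    ring

theorem uD_comm (a b : S) (F : MvPowerSeries (Option S) k) :
    uD k a (uD k b F) - uD k b (uD k a F) = 0 := by
  simp only [uD_apply, Derivation.leibniz, smul_eq_mul]
  rw [pderiv_X_of_ne (by simp), pderiv_X_of_ne (by simp), pderiv_comm]
  ring

theorem uuD_uD_comm (q : k) (a : S) (F : MvPowerSeries (Option S) k) :
    uuD S q (uD k a F) - uD k a (uuD S q F) =
      ((MvPowerSeries.C q * X none : MvPowerSeries (Option S) k) • uD k a) F := by
  simp only [uD_apply, uuD_apply, Derivation.leibniz, smul_eq_mul, Derivation.smul_apply,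
    pow_two]
  rw [pderiv_X_of_ne (show (none : Option S) ≠ some a by simp), pderiv_X_self, pderiv_C,
    pderiv_comm (some a)]
  ring

/-- The connection with operators `u ∂ₐ + Tₐ` and `q u² ∂ᵤ + A` is flat. The factor `q` arises from
the coordinate `u` by scaling all coordinates: if `t = q t'` and `u = q u'`, then
`u ∂_t = u' ∂_{t'}` and `u² ∂ᵤ = q u'² ∂_{u'}`. -/
structure IsFlat {r : Type*} [Fintype r] (q : k)
    (T : S → Matrix r r (MvPowerSeries (Option S) k))
    (A : Matrix r r (MvPowerSeries (Option S) k)) : Prop where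
  base : ∀ a b, matD (uD k a) (T b) - matD (uD k b) (T a) + (T a * T b - T b * T a) = 0
  u : ∀ a, matD (uuD S q) (T a) - matD (uD k a) A + (A * T a - T a * A) =
    (MvPowerSeries.C q * X none : MvPowerSeries (Option S) k) • T a

/-- Flatness is invariant under gauge transformations. Only a left inverse of `Φ` is needed. -/
theorem IsFlat.gauge {r s : Type*} [Fintype r] [Fintype s] [DecidableEq s] {q : k}
    {T : S → Matrix r r (MvPowerSeries (Option S) k)} {A : Matrix r r (MvPowerSeries (Option S) k)}
    {T' : S → Matrix s s (MvPowerSeries (Option S) k)}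
    {A' : Matrix s s (MvPowerSeries (Option S) k)}
    {Φ : Matrix r s (MvPowerSeries (Option S) k)} {Ψ : Matrix s r (MvPowerSeries (Option S) k)}
    (h : IsFlat q T A) (hΦ : Ψ * Φ = 1)
    (hT : ∀ a, matD (uD k a) Φ + T a * Φ = Φ * T' a)
    (hA : matD (uuD S q) Φ + A * Φ = Φ * A') : IsFlat q T' A' where
  base a b := gauge_curvature (D₃ := 0) (N₃ := 0) (uD_comm a b) hΦ (hT a) (hT b)
    (by ext i j; simp [matD]) (h.base a b)
  u a := by
    refine gauge_curvature (uuD_uD_comm q a) hΦ hA (hT a) ?_ (h.u a)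
    rw [Matrix.mul_smul, ← hT a, smul_add, Matrix.smul_mul]
    congr 1

theorem uuD_mem_vanIdeal (q : k) {n : ℕ} {F : MvPowerSeries (Option S) k}
    (hF : F ∈ vanIdeal k (fun _ => 1) n) : uuD S q F ∈ vanIdeal k (fun _ => 1) (n + 1) := by
  rw [uuD_apply, mul_assoc]
  refine Ideal.mul_mem_left _ _ ?_
  have hX : (X none ^ 2 : MvPowerSeries (Option S) k) ∈ vanIdeal k (fun _ => 1) 2 := by
    rw [pow_two]
    exact mul_mem_vanIdeal (X_mem_vanIdeal (w := fun _ => 1) none)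
      (X_mem_vanIdeal (w := fun _ => 1) none)
  cases n with
  | zero => exact Ideal.mul_mem_right _ _ (vanIdeal_anti (by norm_num) hX)
  | succ n =>
    have := mul_mem_vanIdeal hX (pderiv_mem_vanIdeal (n := n) none hF le_rfl)
    rwa [add_comm 2 n] at this

end Operators

/-! ### Block diagonalization in the direction of `u` -/

section BlockDiagonalization

variable {k : Type*} [NormedField k] {S r I σ : Type*} (β : r → I)

section

variable [Fintype r]

/-- `L` is a section of `ad A₀` on the matrices with vanishing diagonal blocks, of operator norm
at most `M`. -/
structure IsSylvesterInverse (A₀ : Matrix r r k) (L : Matrix r r k →ₗ[k] Matrix r r k) (M : ℝ) :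
    Prop where
  off : ∀ Z, IsOff β (L Z)
  right : ∀ Z, IsOff β Z → A₀ * L Z - L Z * A₀ = Z
  left : ∀ Z, IsOff β Z → L (A₀ * Z - Z * A₀) = Z
  norm_le : ∀ Z (c : ℝ), 0 ≤ c → (∀ p q, ‖Z p q‖ ≤ c) → ∀ p q, ‖L Z p q‖ ≤ M * c

variable {β} {A₀ : Matrix r r k} {L : Matrix r r k →ₗ[k] Matrix r r k} {M : ℝ}

theorem IsSylvesterInverse.liftL_right (hL : IsSylvesterInverse β A₀ L M)
    {Z : Matrix r r (MvPowerSeries σ k)} (hZ : IsOff β Z) :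
    A₀.map C * liftL L Z - liftL L Z * A₀.map C = Z := by
  refine ext_coeff fun m => ?_
  rw [Matrix.map_sub _ (map_sub _), coeff_map_C_mul, coeff_mul_map_C, coeff_liftL]
  exact hL.right _ fun p q h => by simp [hZ p q h]

theorem IsSylvesterInverse.liftL_left (hL : IsSylvesterInverse β A₀ L M)
    {Z : Matrix r r (MvPowerSeries σ k)} (hZ : IsOff β Z) :
    liftL L (A₀.map C * Z - Z * A₀.map C) = Z := by
  refine ext_coeff fun m => ?_
  rw [coeff_liftL, Matrix.map_sub _ (map_sub _), coeff_map_C_mul, coeff_mul_map_C]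
  exact hL.left _ fun p q h => by simp [hZ p q h]

theorem IsSylvesterInverse.bd (hL : IsSylvesterInverse β A₀ L M)
    {Z : Matrix r r (MvPowerSeries σ k)} {c : ℝ} (hc : 0 ≤ c) (hZ : ∀ p q, Bd c (Z p q))
    (p q : r) : Bd (M * c) (liftL L Z p q) := fun m =>
  hL.norm_le _ c hc (fun p q => hZ p q m) p q

end

section

variable {β} [DecidableEq I]

theorem Bd.diagPart {c : ℝ} (hc : 0 ≤ c) {Z : Matrix r r (MvPowerSeries σ k)}
    (hZ : ∀ p q, Bd c (Z p q)) (p q : r) : Bd c (diagPart β Z p q) := by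
  rw [RigidF.diagPart, Matrix.of_apply]
  split_ifs
  · exact hZ p q
  · exact Bd.zero hc

theorem diagPart_mem {J : Ideal (MvPowerSeries σ k)} {Z : Matrix r r (MvPowerSeries σ k)}
    (hZ : ∀ p q, Z p q ∈ J) (p q : r) : diagPart β Z p q ∈ J := by
  rw [diagPart, Matrix.of_apply]
  split_ifs
  · exact hZ p q
  · exact J.zero_mem

theorem diagPart_sub (Y Z : Matrix r r (MvPowerSeries σ k)) :
    diagPart β (Y - Z) = diagPart β Y - diagPart β Z := by
  ext1 p q
  simp only [diagPart, Matrix.of_apply, Matrix.sub_apply]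
  split_ifs <;> simp

theorem uD_mem_vanIdeal (a : S) {F : MvPowerSeries (Option S) k} :
    RigidF.uD k a F ∈ vanIdeal k (fun _ => 1) 1 :=
  Ideal.mul_mem_right _ _ (X_mem_vanIdeal (w := fun _ => 1) none)

end

section

variable [IsUltrametricDist k]

theorem Bd.uuD {C : ℝ} {q : k} {F : MvPowerSeries (Option S) k} (hF : Bd C F) :
    Bd (‖q‖ * C) (uuD S q F) := by
  rw [uuD_apply]
  refine Bd.mul ?_ (hF.pderiv _)
  have h2 : Bd 1 ((MvPowerSeries.X none : MvPowerSeries (Option S) k) ^ 2) := by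
    simpa using (Bd.X (k := k) (none : Option S)).pow 2
  exact (Bd.C le_rfl).mul_one h2

theorem Bd.uD {C : ℝ} {F : MvPowerSeries (Option S) k} (hF : Bd C F) (a : S) :
    Bd C (uD k a F) := by
  rw [uD_apply]
  exact (Bd.X _).one_mul (hF.pderiv _)

end

variable [Fintype r] [DecidableEq r] [DecidableEq I] {β} {A₀ : Matrix r r k}
  {L : Matrix r r k →ₗ[k] Matrix r r k} {M : ℝ}

/-- The connection operator `q u² ∂ᵤ + A` is brought to block diagonal form by a gauge
transformation `1 + X` with `X` off-diagonal: since `ad A₀` is invertible on the off-diagonal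
matrices, `X` is the fixed point of a contraction, and no denominators arise. -/
theorem exists_blockDiagonal_gauge [IsUltrametricDist k] (hL : IsSylvesterInverse β A₀ L M)
    {q : k} {η b : ℝ} (hη : 0 ≤ η) (hη1 : η ≤ 1) (hb : 0 ≤ b) (hM : 0 ≤ M) (hMb : M * b ≤ η)
    (hMq : M * ‖q‖ ≤ 1) {B : Matrix r r (MvPowerSeries (Option S) k)}
    (hB : ∀ i j, Bd b (B i j)) (hB0 : ∀ i j, B i j ∈ vanIdeal k (fun _ => 1) 1) :
    ∃ X B' : Matrix r r (MvPowerSeries (Option S) k), (∀ i j, Bd η (X i j)) ∧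
      (∀ i j, X i j ∈ vanIdeal k (fun _ => 1) 1) ∧ IsBD β B' ∧
      (∀ i j, Bd b (B' i j)) ∧ (∀ i j, B' i j ∈ vanIdeal k (fun _ => 1) 1) ∧
      matD (uuD S q) (1 + X) + (A₀.map C + B) * (1 + X) = (1 + X) * (A₀.map C + B') := by
  -- the diagonal part of the gauge equation gives `B' = (B (1 + X))_diag`, and then its
  -- off-diagonal part reads `[A₀, X] = R X`
  let R : Matrix r r (MvPowerSeries (Option S) k) → Matrix r r (MvPowerSeries (Option S) k) :=
    fun X => X * diagPart β (B * (1 + X)) - (B * (1 + X) - diagPart β (B * (1 + X))) -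
      matD (uuD S q) X
  have hRdiff : ∀ X Y, R X - R Y = (X - Y) * diagPart β (B * (1 + X)) +
      Y * diagPart β (B * (X - Y)) - (B * (X - Y) - diagPart β (B * (X - Y))) -
      matD (uuD S q) (X - Y) := by
    intro X Y
    have h : B * (X - Y) = B * (1 + X) - B * (1 + Y) := by rw [← Matrix.mul_sub]; simp
    simp only [R]
    rw [h, diagPart_sub, map_sub]
    noncomm_ring
  have hb1 : ∀ X : Matrix r r (MvPowerSeries (Option S) k), (∀ i j, Bd η (X i j)) →
      ∀ i j, Bd b ((B * (1 + X)) i j) := by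
    intro X hX i j
    have := Bd.matrix_mul hb zero_le_one hB
      (N := 1 + X) (fun i j => (Bd.matrix_one i j).add ((hX i j).mono hη1)) i j
    rwa [mul_one] at this
  have hv1 : ∀ Z : Matrix r r (MvPowerSeries (Option S) k), ∀ n,
      (∀ i j, Z i j ∈ vanIdeal k (fun _ => 1) n) →
      ∀ i j, (B * Z) i j ∈ vanIdeal k (fun _ => 1) (n + 1) := by
    intro Z n hZ i j
    rw [add_comm n 1]
    exact mem_vanIdeal_matrix_mul hB0 hZ i j
  have hv2 : ∀ Z : Matrix r r (MvPowerSeries (Option S) k),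
      ∀ i j, (B * Z) i j ∈ vanIdeal k (fun _ => 1) 1 :=
    fun Z => hv1 Z 0 fun i j => vanIdeal_zero
  obtain ⟨X, hX, hXb⟩ := exists_fixedPoint (fun _ : Option S => 1) (fun X => liftL L (R X))
    (by
      intro n X Y h i j
      change (liftL L (R X) - liftL L (R Y)) i j ∈ _
      rw [liftL_sub, hRdiff]
      refine liftL_mem_vanIdeal (fun i j => ?_) i j
      refine Ideal.sub_mem _ (Ideal.sub_mem _ (Ideal.add_mem _ ?_ ?_) (Ideal.sub_mem _ ?_ ?_)) ?_
      · exact mem_vanIdeal_matrix_mul (M := X - Y) h (diagPart_mem (hv2 _)) i j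
      · have := mem_vanIdeal_matrix_mul (M := Y) (a := 0) (fun _ _ => vanIdeal_zero)
          (diagPart_mem (β := β) (hv1 (X - Y) n h)) i j
        rwa [zero_add] at this
      · exact hv1 (X - Y) n h i j
      · exact diagPart_mem (hv1 (X - Y) n h) i j
      · exact uuD_mem_vanIdeal q (h i j))
    η hη
    (by
      intro X hX i j
      have hc : 0 ≤ max b (‖q‖ * η) := le_max_of_le_left hb
      have h1 := hL.bd hc (Z := R X) (fun p q' => by
        refine Bd.sub (Bd.sub ?_ (Bd.sub ?_ ?_)) ?_
        · have := Bd.matrix_mul hη hb hX (Bd.diagPart (β := β) hb (hb1 X hX)) p q'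
          exact this.mono ((mul_le_of_le_one_left hb hη1).trans (le_max_left _ _))
        · exact (hb1 X hX p q').mono (le_max_left _ _)
        · exact (Bd.diagPart hb (hb1 X hX) p q').mono (le_max_left _ _)
        · exact (hX p q').uuD.mono (le_max_right _ _)) i j
      refine h1.mono ?_
      rw [mul_max_of_nonneg _ _ hM]
      refine max_le hMb ?_
      rw [← mul_assoc]
      exact mul_le_of_le_one_left hη hMq)
  have hXoff : IsOff β X := fun p q' h => by
    rw [← hX]
    ext m
    exact hL.off _ p q' h
  have hD : IsOff β (matD (uuD S q) X) := fun p q' h => by simp [hXoff p q' h]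
  have hRoff : IsOff β (R X) :=
    ((hXoff.mul_bd isBD_diagPart).sub isOff_sub_diagPart).sub hD
  have heq := hL.liftL_right hRoff
  rw [hX] at heq
  refine ⟨X, diagPart β (B * (1 + X)), hXb, ?_, isBD_diagPart, Bd.diagPart hb (hb1 X hXb),
    diagPart_mem (hv2 _), ?_⟩
  · rw [← hX]
    refine fun i j => liftL_mem_vanIdeal (fun i j => ?_) i j
    refine Ideal.sub_mem _ (Ideal.sub_mem _ ?_ (Ideal.sub_mem _ (hv2 _ _ _) ?_)) ?_
    · have := mem_vanIdeal_matrix_mul (M := X) (a := 0) (fun _ _ => vanIdeal_zero)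
          (diagPart_mem (β := β) (hv2 (1 + X))) i j
      rwa [zero_add] at this
    · exact diagPart_mem (hv2 _) _ _
    · exact uuD_mem_vanIdeal q vanIdeal_zero
  · rw [map_add, matD_one, zero_add]
    have e : ∀ (D Z a B P : Matrix r r (MvPowerSeries (Option S) k)),
        a * Z - Z * a = Z * P - (B * (1 + Z) - P) - D →
        D + (a + B) * (1 + Z) = (1 + Z) * (a + P) := by
      intro D Z a B P h
      have h1 : D + (a + B) * (1 + Z) - (1 + Z) * (a + P) =
          (a * Z - Z * a) - (Z * P - (B * (1 + Z) - P) - D) := by noncomm_ring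
      rw [← sub_eq_zero, h1, h, sub_self]
    exact e _ _ _ _ _ heq

/-- If `q u² ∂ᵤ + A` is block diagonal, so are the other operators of a flat connection: by
flatness, the off-diagonal part `Y` of `T a` satisfies `[A₀, Y] = q u Y - q u² ∂ᵤ Y - [B, Y]`. The
operator `ad A₀` is invertible on off-diagonal matrices, and the right-hand side vanishes to a higher
order than `Y`, so that `Y = 0`. -/
theorem IsFlat.isBD {T : S → Matrix r r (MvPowerSeries (Option S) k)} {q : k}
    {B : Matrix r r (MvPowerSeries (Option S) k)} (h : IsFlat q T (A₀.map C + B))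
    (hL : IsSylvesterInverse β A₀ L M) (hA₀ : IsBD β A₀) (hB : IsBD β B)
    (hB0 : ∀ i j, B i j ∈ vanIdeal k (fun _ => 1) 1) (a : S) : IsBD β (T a) := by
  set Y := T a - diagPart β (T a) with hY
  have hYoff : IsOff β Y := isOff_sub_diagPart
  have hA₀' : IsBD β (A₀.map (C (σ := Option S))) := fun p q h => by simp [hA₀ p q h]
  have hA : IsBD β (A₀.map C + B) := hA₀'.add hB
  have hT : T a = Y + diagPart β (T a) := by rw [hY]; abel
  have key : A₀.map C * Y - Y * A₀.map C = (C q * X none : MvPowerSeries (Option S) k) • Y -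
      matD (uuD S q) Y - (B * Y - Y * B) := by
    have hu := h.u a
    rw [← sub_eq_zero]
    have hoff : IsOff β (A₀.map C * Y - Y * A₀.map C -
        ((C q * X none : MvPowerSeries (Option S) k) • Y -
      matD (uuD S q) Y - (B * Y - Y * B))) := by
      refine ((hA₀'.mul_off hYoff).sub (hYoff.mul_bd hA₀')).sub (IsOff.sub (IsOff.sub ?_ ?_)
        ((hB.mul_off hYoff).sub (hYoff.mul_bd hB)))
      · intro p q' h; simp [hYoff p q' h]
      · intro p q' h; simp [hYoff p q' h]
    refine IsBD.eq_zero (β := β) ?_ hoff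
    set P := diagPart β (T a) with hP
    have hPb : IsBD β P := isBD_diagPart
    have e : A₀.map C * Y - Y * A₀.map C - ((C q * X none : MvPowerSeries (Option S) k) • Y -
      matD (uuD S q) Y - (B * Y - Y * B)) =
      (C q * X none : MvPowerSeries (Option S) k) • P - matD (uuD S q) P -
        ((A₀.map C + B) * P - P * (A₀.map C + B)) + matD (uD k a) (A₀.map C + B) := by
      rw [hT, map_add, smul_add] at hu
      rw [← sub_eq_zero] at hu ⊢
      rw [← hu]
      noncomm_ring
    rw [e]
    refine IsBD.add (IsBD.sub (IsBD.sub ?_ ?_) ((hA.mul hPb).sub (hPb.mul hA))) ?_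
    · intro p q' h; simp [hPb p q' h]
    · intro p q' h; simp [hPb p q' h]
    · intro p q' h; rw [matD_apply, hA p q' h, map_zero]
  have hv : ∀ n, ∀ i j, Y i j ∈ vanIdeal k (fun _ => 1) n := by
    intro n
    induction n with
    | zero => exact fun i j => vanIdeal_zero
    | succ n ih =>
      rw [← hL.liftL_left hYoff, key]
      refine fun i j => liftL_mem_vanIdeal (fun i j => ?_) i j
      refine Ideal.sub_mem _ (Ideal.sub_mem _ ?_ ?_) (Ideal.sub_mem _ ?_ ?_)
      · rw [Matrix.smul_apply, smul_eq_mul, mul_assoc, add_comm n 1]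
        exact Ideal.mul_mem_left _ _
          (mul_mem_vanIdeal (X_mem_vanIdeal (w := fun _ => 1) none) (ih i j))
      · exact uuD_mem_vanIdeal q (ih i j)
      · rw [add_comm n 1]
        exact mem_vanIdeal_matrix_mul hB0 ih i j
      · exact mem_vanIdeal_matrix_mul ih hB0 i j
  have hY0 : Y = 0 := by
    ext1 i j
    exact eq_zero_of_forall_mem_vanIdeal fun n => hv n i j
  rw [hT, hY0, zero_add]
  exact isBD_diagPart

end BlockDiagonalization

/-! ### Flat extension of power series -/

section FlatExtension

variable {k : Type*} [NormedField k] {σ r s : Type*}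

theorem charZero_of_norm_natCast (hk : ∀ n : ℕ, n ≠ 0 → ‖(n : k)‖ = 1) : CharZero k :=
  charZero_of_inj_zero fun n h => by_contra fun hn => by
    have := hk n hn
    rw [h, norm_zero] at this
    exact zero_ne_one this

theorem coeff_X_mul_pderiv (b : σ) (F : MvPowerSeries σ k) (m : σ →₀ ℕ) :
    coeff m (X b * pderiv k b F) = m b * coeff m F := by
  classical
  rw [X, coeff_monomial_mul]
  split_ifs with h
  · rw [coeff_pderiv, one_mul, tsub_add_cancel_of_le h, mul_comm]
    congr 1
    have := h b
    simp only [Finsupp.single_eq_same] at this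
    rw [Finsupp.tsub_apply, Finsupp.single_eq_same]
    rw [← Nat.cast_add_one, Nat.sub_add_cancel this]
  · have : m b = 0 := by
      by_contra h0
      refine h fun i => ?_
      rw [Finsupp.single_apply]
      split_ifs with hi
      · subst hi; omega
      · exact Nat.zero_le _
    simp [this]

/-- Uniqueness for differential equations in the variables `x_b` with `w b = 1`: a family of power
series vanishes if it vanishes on the locus where these variables are zero, and if its derivatives
with respect to them vanish there to any order to which the family itself does. -/
theorem eq_zero_of_pderiv_mem [CharZero k] {ι : Type*} {w : σ → ℕ} (hw : ∀ b, w b ≤ 1)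
    (x : ι → MvPowerSeries σ k)
    (h1 : ∀ i, x i ∈ vanIdeal k w 1)
    (h : ∀ n, (∀ i, x i ∈ vanIdeal k w n) → ∀ b, w b = 1 → ∀ i,
      pderiv k b (x i) ∈ vanIdeal k w n) (i : ι) : x i = 0 := by
  have hv : ∀ n i, x i ∈ vanIdeal k w (n + 1) := by
    intro n
    induction n with
    | zero => exact h1
    | succ n ih =>
      intro i m hm
      rcases Nat.lt_or_ge (Finsupp.weight w m) (n + 1) with hlt | hge
      · exact ih i m hlt
      have hex : ∃ b, m b * w b ≠ 0 := by
        by_contra! hcon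
        have : Finsupp.weight w m = 0 := by
          rw [Finsupp.weight_apply, Finsupp.sum]
          exact Finset.sum_eq_zero fun b _ => by simpa using hcon b
        omega
      obtain ⟨b, hb⟩ := hex
      have hmb : m b ≠ 0 := left_ne_zero_of_mul hb
      have hwb : w b = 1 := by have := hw b; have := right_ne_zero_of_mul hb; omega
      have h2 : Finsupp.single b 1 ≤ m := by
        rw [Finsupp.single_le_iff]; omega
      have h3 := h (n + 1) ih b hwb i (m - Finsupp.single b 1) (by
        have := congrArg (Finsupp.weight w) (tsub_add_cancel_of_le h2)
        rw [map_add, Finsupp.weight_single, hwb] at this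
        simp only [smul_eq_mul, mul_one] at this
        omega)
      rw [coeff_pderiv, tsub_add_cancel_of_le h2] at h3
      refine (mul_eq_zero.mp h3).resolve_right ?_
      exact Nat.cast_add_one_ne_zero _
  exact eq_zero_of_forall_mem_vanIdeal fun n => vanIdeal_anti n.le_succ (hv n i)

/-- Division of the coefficients by their weights, an inverse of the Euler operator. -/
def intW (w : σ → ℕ) (F : MvPowerSeries σ k) : MvPowerSeries σ k :=
  fun m => coeff m F / (Finsupp.weight w m : k)

theorem coeff_intW (w : σ → ℕ) (F : MvPowerSeries σ k) (m : σ →₀ ℕ) :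
    coeff m (intW w F) = coeff m F / (Finsupp.weight w m : k) := rfl

variable [Fintype σ]

/-- The Euler operator in the variables of weight one multiplies the coefficients by their
weights. -/
theorem coeff_euler {w : σ → ℕ} (hw : ∀ b, w b ≤ 1) (F : MvPowerSeries σ k) (m : σ →₀ ℕ) :
    coeff m (∑ b with w b = 1, X b * pderiv k b F) = (Finsupp.weight w m : k) * coeff m F := by
  rw [map_sum]
  simp only [coeff_X_mul_pderiv]
  rw [← Finset.sum_mul, Finsupp.weight_apply, Finsupp.sum_fintype _ _ (by simp)]
  congr 1
  rw [Finset.sum_filter]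
  push_cast
  refine Finset.sum_congr rfl fun b _ => ?_
  have := hw b
  split_ifs with h
  · simp [h]
  · have : w b = 0 := by omega
    simp [this]

variable [IsUltrametricDist k]

/-- Flat extension: let `∇_b = ∂_b + E_b`, for the variables `x_b` with `w b = 1`, be commuting
operators, where `E_b` does not involve derivatives in these directions. Then every `X₀` that is
independent of these variables extends from the locus where they vanish to a solution of
`∇_b X = 0`. The solution is that of the single radial equation `∑ x_b ∇_b X = 0`, which is found
degree by degree. The only denominators are natural numbers, so that integrality is preserved if
these have norm `1`. -/
theorem exists_flat_extension (hk : ∀ n : ℕ, n ≠ 0 → ‖(n : k)‖ = 1) {w : σ → ℕ}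
    (hw : ∀ b, w b ≤ 1)
    (E : σ → Matrix r s (MvPowerSeries σ k) →+ Matrix r s (MvPowerSeries σ k))
    (hEv : ∀ b n X, (∀ i j, X i j ∈ vanIdeal k w n) → ∀ i j, E b X i j ∈ vanIdeal k w n)
    (hEb : ∀ b X, (∀ i j, Bd 1 (X i j)) → ∀ i j, Bd 1 (E b X i j))
    (hEX : ∀ a b, w a = 1 → ∀ Z, E b ((X a : MvPowerSeries σ k) • Z) =
      (X a : MvPowerSeries σ k) • E b Z)
    (hcomm : ∀ a b, w a = 1 → w b = 1 → ∀ Z,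
      matD (pderiv k a) (matD (pderiv k b) Z + E b Z) + E a (matD (pderiv k b) Z + E b Z) =
      matD (pderiv k b) (matD (pderiv k a) Z + E a Z) + E b (matD (pderiv k a) Z + E a Z))
    (X₀ : Matrix r s (MvPowerSeries σ k)) (hX₀ : ∀ i j, Bd 1 (X₀ i j))
    (hX₀' : ∀ b, w b = 1 → matD (pderiv k b) X₀ = 0) :
    ∃ X : Matrix r s (MvPowerSeries σ k), (∀ i j, Bd 1 (X i j)) ∧
      (∀ b, w b = 1 → matD (pderiv k b) X + E b X = 0) ∧
      ∀ i j, X i j - X₀ i j ∈ vanIdeal k w 1 := by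
  have := charZero_of_norm_natCast hk
  have hk0 : ∀ n : ℕ, n ≠ 0 → (n : k) ≠ 0 := fun n hn => Nat.cast_ne_zero.mpr hn
  -- the radial equation is `(Euler operator) X + G X = 0`
  let G : Matrix r s (MvPowerSeries σ k) → Matrix r s (MvPowerSeries σ k) := fun X =>
    ∑ b with w b = 1, (MvPowerSeries.X b : MvPowerSeries σ k) • E b X
  have hGsub : ∀ X Y, G X - G Y = G (X - Y) := fun X Y => by
    simp only [G]
    rw [← Finset.sum_sub_distrib]
    exact Finset.sum_congr rfl fun b _ => by rw [map_sub, smul_sub]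
  have hGv : ∀ n X, (∀ i j, X i j ∈ vanIdeal k w n) →
      ∀ i j, G X i j ∈ vanIdeal k w (n + 1) := by
    intro n X hX i j
    simp only [G, Matrix.sum_apply]
    refine Ideal.sum_mem _ fun b hb => ?_
    rw [Finset.mem_filter] at hb
    rw [Matrix.smul_apply, smul_eq_mul, add_comm n 1]
    refine mul_mem_vanIdeal ?_ (hEv b n X hX i j)
    have := X_mem_vanIdeal (k := k) (w := w) b
    rwa [hb.2] at this
  have hGb : ∀ X, (∀ i j, Bd 1 (X i j)) → ∀ i j, Bd 1 (G X i j) := by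
    intro X hX i j
    simp only [G, Matrix.sum_apply]
    refine Bd.sum zero_le_one _ fun b _ => ?_
    rw [Matrix.smul_apply, smul_eq_mul]
    exact (Bd.X b).one_mul (hEb b X hX i j)
  have hint : ∀ {n} {F : MvPowerSeries σ k}, F ∈ vanIdeal k w n → intW w F ∈ vanIdeal k w n :=
    fun hF m hm => by rw [coeff_intW, hF m hm, zero_div]
  obtain ⟨X, hX, hXb⟩ := exists_fixedPoint w (fun X => X₀ - (G X).map (intW w))
    (by
      intro n X Y h i j
      have h1 : (X₀ - (G X).map (intW w)) i j - (X₀ - (G Y).map (intW w)) i j =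
          - intW w ((G (X - Y)) i j) := by
        rw [← hGsub]
        ext m
        simp only [Matrix.sub_apply, Matrix.map_apply, map_sub, map_neg, coeff_intW]
        ring
      rw [h1]
      exact neg_mem (hint (hGv n (X - Y) h i j))) 1 zero_le_one
    (by
      intro X hX i j
      refine (hX₀ i j).sub fun m => ?_
      rw [Matrix.map_apply, coeff_intW, norm_div]
      by_cases h0 : Finsupp.weight w m = 0
      · simp [h0]
      · rw [hk _ h0, div_one]
        exact hGb X hX i j m)
  have hrad : ∑ b with w b = 1, (MvPowerSeries.X b : MvPowerSeries σ k) •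
      (matD (pderiv k b) X + E b X) = 0 := by
    simp only [smul_add, Finset.sum_add_distrib]
    change _ + G X = 0
    ext i j m
    rw [Matrix.add_apply, map_add, Matrix.sum_apply]
    simp only [Matrix.smul_apply, smul_eq_mul, matD_apply]
    rw [coeff_euler hw]
    have h1 : coeff m (X i j) =
        coeff m (X₀ i j) - coeff m (G X i j) / (Finsupp.weight w m : k) := by
      conv_lhs => rw [← hX]
      rw [Matrix.sub_apply, map_sub, Matrix.map_apply, coeff_intW]
    have h2 : (Finsupp.weight w m : k) * coeff m (X₀ i j) = 0 := by
      rw [← coeff_euler hw, Finset.sum_eq_zero, map_zero]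
      intro b hb
      have := congrFun (congrFun (hX₀' b (Finset.mem_filter.mp hb).2) i) j
      rw [matD_apply] at this
      rw [this, Matrix.zero_apply, mul_zero]
    rw [h1, mul_sub, h2]
    by_cases h0 : Finsupp.weight w m = 0
    · have := hGv 0 X (fun _ _ => vanIdeal_zero) i j m (by omega)
      simp [h0, this]
    · rw [mul_div_cancel₀ _ (hk0 _ h0)]
      simp
  refine ⟨X, hXb, fun a ha => ?_, fun i j => ?_⟩
  -- `W = ∇ₐ X` satisfies `W + ∑ x_b ∇_b W = 0`, as the `∇_b` commute; since `1 + weight` is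
  -- invertible, this forces `W = 0` degree by degree
  · set W := matD (pderiv k a) X + E a X with hW
    have h1 : W + ∑ b with w b = 1, (MvPowerSeries.X b : MvPowerSeries σ k) •
        (matD (pderiv k b) W + E b W) = 0 := by
      have h2 := congrArg (fun Z => matD (pderiv k a) Z + E a Z) hrad
      simp only [map_sum, map_zero, add_zero] at h2
      rw [← h2, ← Finset.sum_add_distrib]
      have h3 : ∀ b ∈ Finset.univ.filter (fun b => w b = 1),
          matD (pderiv k a) ((MvPowerSeries.X b : MvPowerSeries σ k) •
            (matD (pderiv k b) X + E b X)) +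
          E a ((MvPowerSeries.X b : MvPowerSeries σ k) • (matD (pderiv k b) X + E b X)) =
          (pderiv k a (MvPowerSeries.X b : MvPowerSeries σ k)) • (matD (pderiv k b) X + E b X) +
          (MvPowerSeries.X b : MvPowerSeries σ k) • (matD (pderiv k b) W + E b W) := by
        intro b hb
        have hb := (Finset.mem_filter.mp hb).2
        rw [matD_smul, hEX b a hb, add_assoc, ← smul_add, hcomm a b ha hb]
      rw [Finset.sum_congr rfl h3, Finset.sum_add_distrib]
      congr 1
      rw [Finset.sum_eq_single a]
      · rw [pderiv_X_self, one_smul]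
      · intro b _ hb
        rw [pderiv_X_of_ne hb, zero_smul]
      · intro h
        exact absurd (Finset.mem_filter.mpr ⟨Finset.mem_univ a, ha⟩) h
    have h4 : ∀ i j m, (1 + (Finsupp.weight w m : k)) * coeff m (W i j) =
        - coeff m (G W i j) := by
      intro i j m
      have h5 := congrArg (coeff m) (congrFun (congrFun h1 i) j)
      simp only [smul_add, Finset.sum_add_distrib] at h5
      rw [Matrix.add_apply, map_add, Matrix.add_apply, map_add] at h5
      rw [Matrix.sum_apply] at h5
      simp only [Matrix.smul_apply, smul_eq_mul, matD_apply] at h5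
      rw [coeff_euler hw] at h5
      change _ + (_ + coeff m (G W i j)) = _ at h5
      rw [Matrix.zero_apply, map_zero] at h5
      linear_combination h5
    have hv : ∀ n, ∀ i j, W i j ∈ vanIdeal k w n := by
      intro n
      induction n with
      | zero => exact fun i j => vanIdeal_zero
      | succ n ih =>
        intro i j m hm
        have h5 := h4 i j m
        rw [hGv n W ih i j m hm, neg_zero] at h5
        refine (mul_eq_zero.mp h5).resolve_left ?_
        have := hk0 (1 + Finsupp.weight w m) (by omega)
        exact_mod_cast this
    ext1 i j
    exact eq_zero_of_forall_mem_vanIdeal fun n => hv n i j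
  · have : X i j - X₀ i j = - intW w (G X i j) := by
      conv_lhs => rw [← hX]
      simp
    rw [this]
    exact neg_mem (hint (hGv 0 X (fun _ _ => vanIdeal_zero) i j))

end FlatExtension

/-! ### Substitution of power series -/

section Substitution

variable {k : Type*} [NormedField k] {σ τ : Type*}

theorem weight_eq_degree (d : τ →₀ ℕ) : Finsupp.weight (fun _ : τ => 1) d = d.degree :=
  (DFunLike.congr_fun Finsupp.degree_eq_weight_one d).symm

theorem prod_pow_mem_vanIdeal {w : σ → ℕ} {P : τ → MvPowerSeries σ k}
    (hP : ∀ i, P i ∈ vanIdeal k w 1) (d : τ →₀ ℕ) :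
    (d.prod fun i n => P i ^ n) ∈ vanIdeal k w d.degree := by
  classical
  have hpow : ∀ i n, P i ^ n ∈ vanIdeal k w n := fun i n => by
    induction n with
    | zero => exact vanIdeal_zero
    | succ n ih => rw [pow_succ]; exact mul_mem_vanIdeal ih (hP i)
  have : ∀ s : Finset τ, (∏ i ∈ s, P i ^ d i) ∈ vanIdeal k w (∑ i ∈ s, d i) := fun s => by
    induction s using Finset.induction_on with
    | empty => exact vanIdeal_zero
    | insert a s ha ih =>
      rw [Finset.prod_insert ha, Finset.sum_insert ha]
      exact mul_mem_vanIdeal (hpow a _) ih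
  exact this d.support

theorem subst_mem_vanIdeal [Finite τ] {w : σ → ℕ} {P : τ → MvPowerSeries σ k}
    (hP : ∀ i, P i ∈ vanIdeal k w 1) (hP0 : ∀ i, constantCoeff (P i) = 0) {n : ℕ}
    {F : MvPowerSeries τ k} (hF : F ∈ vanIdeal k (fun _ => 1) n) :
    subst P F ∈ vanIdeal k w n := fun m hm => by
  rw [coeff_subst (hasSubst_of_constantCoeff_zero hP0), finsum_eq_zero_of_forall_eq_zero]
  intro d
  by_cases hd : d.degree < n
  · have h1 : coeff d F = 0 := hF d ((weight_eq_degree d).trans_lt hd)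
    rw [h1, zero_smul]
  · rw [prod_pow_mem_vanIdeal hP d m (by omega), smul_zero]

theorem bd_subst [IsUltrametricDist k] [Finite τ] {P : τ → MvPowerSeries σ k} {δ C : ℝ}
    (hC : 0 ≤ C)
    (hP : ∀ i, Bd δ (P i)) (hP0 : ∀ i, constantCoeff (P i) = 0)
    {F : MvPowerSeries τ k} (hF : ∀ d, ‖coeff d F‖ * δ ^ d.degree ≤ C) : Bd C (subst P F) := by
  intro m
  have hS := hasSubst_of_constantCoeff_zero hP0
  rw [coeff_subst hS, finsum_eq_sum _ (coeff_subst_finite hS F m)]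
  refine IsUltrametricDist.norm_sum_le_of_forall_le_of_nonneg hC fun d _ => ?_
  rw [smul_eq_mul, norm_mul]
  refine (mul_le_mul_of_nonneg_left ?_ (norm_nonneg _)).trans (hF d)
  have h1 := Bd.prod d.support (F := fun i => P i ^ d i) fun i _ => (hP i).pow (d i)
  rw [Finset.prod_pow_eq_pow_sum] at h1
  exact h1 m

theorem Bd.subst [IsUltrametricDist k] [Finite τ] {P : τ → MvPowerSeries σ k} {C : ℝ}
    (hP : ∀ i, Bd 1 (P i)) (hP0 : ∀ i, constantCoeff (P i) = 0)
    {F : MvPowerSeries τ k} (hF : Bd C F) : Bd C (subst P F) :=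
  bd_subst hF.nonneg hP hP0 fun d => by simpa using hF d

theorem rescale_subst [Finite τ] [Finite σ] {P : τ → MvPowerSeries σ k}
    (hP0 : ∀ i, constantCoeff (P i) = 0) (a : σ → k) (F : MvPowerSeries τ k) :
    rescale a (subst P F) = subst (fun i => rescale a (P i)) F := by
  simp only [rescale_eq_subst]
  exact subst_comp_subst_apply (hasSubst_of_constantCoeff_zero hP0) (HasSubst.smul_X a) F

theorem sub_truncTotal_mem [Finite τ] (F : MvPowerSeries τ k) (n : ℕ) :
    F - (truncTotal n F : MvPowerSeries τ k) ∈ vanIdeal k (fun _ => 1) n := fun m hm => by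
  rw [map_sub, MvPolynomial.coeff_coe, coeff_truncTotal, sub_self]
  exact (weight_eq_degree m).symm.trans_lt hm

/-- The chain rule. -/
theorem pderiv_subst [Fintype τ] [Finite σ] {P : τ → MvPowerSeries σ k}
    (hP0 : ∀ i, constantCoeff (P i) = 0) (i : σ) (F : MvPowerSeries τ k) :
    pderiv k i (subst P F) = ∑ l, subst P (pderiv k l F) * pderiv k i (P l) := by
  classical
  have := Fintype.ofFinite σ
  have hS := hasSubst_of_constantCoeff_zero hP0
  have hPv : ∀ i, P i ∈ vanIdeal k (fun _ => 1) 1 := fun i => mem_vanIdeal_one_iff.mpr (hP0 i)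
  have hpoly : ∀ Q : MvPolynomial τ k, pderiv k i (subst P (Q : MvPowerSeries τ k)) =
      ∑ l, subst P (pderiv k l (Q : MvPowerSeries τ k)) * pderiv k i (P l) := by
    intro Q
    induction Q using MvPolynomial.induction_on with
    | C a =>
      rw [MvPolynomial.coe_C, subst_C, pderiv_C, Finset.sum_eq_zero]
      intro l _
      rw [pderiv_C, ← coe_substAlgHom hS, map_zero, zero_mul]
    | add p q hp hq =>
      rw [MvPolynomial.coe_add, subst_add hS, map_add, hp, hq, ← Finset.sum_add_distrib]
      refine Finset.sum_congr rfl fun l _ => ?_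
      rw [map_add, subst_add hS, add_mul]
    | mul_X p j hp =>
      rw [MvPolynomial.coe_mul, MvPolynomial.coe_X, subst_mul hS, subst_X hS, Derivation.leibniz,
        hp, smul_eq_mul, smul_eq_mul, Finset.mul_sum]
      have h1 : ∀ l, subst P (pderiv k l ((p : MvPowerSeries τ k) * X j)) * pderiv k i (P l) =
          P j * (subst P (pderiv k l (p : MvPowerSeries τ k)) * pderiv k i (P l)) +
          (if j = l then subst P (p : MvPowerSeries τ k) * pderiv k i (P l) else 0) := by
        intro l
        rw [Derivation.leibniz, smul_eq_mul, smul_eq_mul, subst_add hS, subst_mul hS,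
          subst_mul hS, subst_X hS]
        by_cases h : j = l
        · subst h
          rw [pderiv_X_self, if_pos rfl, ← coe_substAlgHom hS, map_one]
          ring
        · rw [pderiv_X_of_ne h, if_neg h, ← coe_substAlgHom hS, map_zero]
          ring
      simp only [h1, Finset.sum_add_distrib, Finset.sum_ite_eq, Finset.mem_univ, if_true]
      rw [add_comm]
  rw [← sub_eq_zero]
  refine eq_zero_of_forall_mem_vanIdeal (w := fun _ => 1) fun n => ?_
  obtain ⟨R, hR, hF⟩ : ∃ R ∈ vanIdeal k (fun _ : τ => 1) (n + 1),
      F = (truncTotal (n + 1) F : MvPowerSeries τ k) + R :=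
    ⟨_, sub_truncTotal_mem F (n + 1), by abel⟩
  have h2 : pderiv k i (subst P F) - ∑ l, subst P (pderiv k l F) * pderiv k i (P l) =
      pderiv k i (subst P R) - ∑ l, subst P (pderiv k l R) * pderiv k i (P l) := by
    rw [hF, subst_add hS, map_add, hpoly]
    simp only [map_add, subst_add hS, add_mul, Finset.sum_add_distrib]
    abel
  rw [h2]
  refine Ideal.sub_mem _ (pderiv_mem_vanIdeal i (subst_mem_vanIdeal hPv hP0 hR) le_rfl)
    (Ideal.sum_mem _ fun l _ => Ideal.mul_mem_right _ _
      (subst_mem_vanIdeal hPv hP0 (pderiv_mem_vanIdeal l hR le_rfl)))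

end Substitution

/-! ### Curvature in the directions of vector fields -/

section ContractedCurvature

variable {k : Type*} [Field k] {S r s : Type*}

theorem matD_uD (a : S)
    (M : Matrix r s (MvPowerSeries (Option S) k)) :
    matD (uD k a) M = (X none : MvPowerSeries (Option S) k) • matD (pderiv k (some a)) M := rfl

variable [Fintype S]

/-- The vector field `∑ₐ φₐ ∂ₐ` on the base. -/
def vf (φ : S → MvPowerSeries (Option S) k) :
    Derivation k (MvPowerSeries (Option S) k) (MvPowerSeries (Option S) k) :=
  ∑ a, φ a • pderiv k (some a)

theorem vf_apply (φ : S → MvPowerSeries (Option S) k) (F : MvPowerSeries (Option S) k) :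
    vf φ F = ∑ a, φ a * pderiv k (some a) F := by
  have := map_sum (Derivation.coeFnAddMonoidHom (R := k) (A := MvPowerSeries (Option S) k)
    (M := MvPowerSeries (Option S) k)) (fun a => φ a • pderiv k (some a)) Finset.univ
  have := congrFun this F
  rw [Finset.sum_apply] at this
  exact this

theorem matD_vf (φ : S → MvPowerSeries (Option S) k)
    (M : Matrix r s (MvPowerSeries (Option S) k)) :
    matD (vf φ) M = ∑ a, φ a • matD (pderiv k (some a)) M := by
  ext1 i j
  rw [matD_apply, vf_apply, Matrix.sum_apply]
  rfl

variable {q : k} {T : S → Matrix r r (MvPowerSeries (Option S) k)}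
  {A : Matrix r r (MvPowerSeries (Option S) k)}

theorem matD_sum_smul (D : Derivation k (MvPowerSeries (Option S) k) (MvPowerSeries (Option S) k))
    (φ : S → MvPowerSeries (Option S) k) :
    matD D (∑ a, φ a • T a) = (∑ a, D (φ a) • T a) + ∑ a, φ a • matD D (T a) := by
  rw [map_sum, ← Finset.sum_add_distrib]
  exact Finset.sum_congr rfl fun a _ => matD_smul _ _ _

variable [Fintype r]

/-- The curvature of a flat connection in the directions of a vector field and of a coordinate field
on the base. -/
theorem IsFlat.contract_left (h : IsFlat q T A) (φ : S → MvPowerSeries (Option S) k) (c : S) :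
    (X none : MvPowerSeries (Option S) k) •
      (matD (vf φ) (T c) - matD (pderiv k (some c)) (∑ a, φ a • T a)) +
      ((∑ a, φ a • T a) * T c - T c * ∑ a, φ a • T a) =
    - (X none : MvPowerSeries (Option S) k) • ∑ a, pderiv k (some c) (φ a) • T a := by
  have h1 : ∑ a, φ a • (matD (uD k a) (T c) - matD (uD k c) (T a) + (T a * T c - T c * T a)) =
      0 := Finset.sum_eq_zero fun a _ => by rw [h.base a c, smul_zero]
  rw [matD_sum_smul, matD_vf, Finset.sum_mul, Finset.mul_sum]
  simp only [smul_add, smul_sub, Finset.sum_add_distrib, Finset.sum_sub_distrib, matD_uD] at h1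
  simp only [smul_sub, smul_add, Finset.smul_sum, Matrix.smul_mul, Matrix.mul_smul]
  simp only [smul_comm (φ _) (X none : MvPowerSeries (Option S) k)] at h1
  rw [← sub_eq_zero]
  rw [← h1]
  simp only [neg_smul, Finset.sum_neg_distrib]
  abel

/-- The curvature of a flat connection in the directions of two vector fields on the base. -/
theorem IsFlat.contract (h : IsFlat q T A) (φ ψ : S → MvPowerSeries (Option S) k) :
    (X none : MvPowerSeries (Option S) k) •
      (matD (vf φ) (∑ a, ψ a • T a) - matD (vf ψ) (∑ a, φ a • T a)) +
      ((∑ a, φ a • T a) * (∑ a, ψ a • T a) - (∑ a, ψ a • T a) * ∑ a, φ a • T a) =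
    (X none : MvPowerSeries (Option S) k) • ∑ a, (vf φ (ψ a) - vf ψ (φ a)) • T a := by
  set V := (X none : MvPowerSeries (Option S) k)
  set P := ∑ a, φ a • T a with hP
  have h1 : ∑ c, ψ c • (V • (matD (vf φ) (T c) - matD (pderiv k (some c)) P) +
      (P * T c - T c * P)) = ∑ c, ψ c • (- V • ∑ a, pderiv k (some c) (φ a) • T a) :=
    Finset.sum_congr rfl fun c _ => by rw [h.contract_left φ c]
  have h2 : ∑ c, ψ c • (- V • ∑ a, pderiv k (some c) (φ a) • T a) =
      - V • ∑ a, vf ψ (φ a) • T a := by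
    simp only [vf_apply, Finset.sum_smul, Finset.smul_sum, smul_smul]
    rw [Finset.sum_comm]
    refine Finset.sum_congr rfl fun a _ => Finset.sum_congr rfl fun c _ => ?_
    congr 1; ring
  rw [h2] at h1
  simp only [smul_add, smul_sub, Finset.sum_add_distrib, Finset.sum_sub_distrib] at h1
  simp only [smul_comm (ψ _) V, ← Finset.smul_sum, ← Matrix.mul_smul] at h1
  rw [← Finset.mul_sum, ← matD_vf] at h1
  have h3 : ∑ x, T x * ψ x • P = (∑ a, ψ a • T a) * P := by
    rw [Finset.sum_mul]
    exact Finset.sum_congr rfl fun a _ => by rw [Matrix.mul_smul, Matrix.smul_mul]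
  rw [h3] at h1
  rw [matD_sum_smul]
  simp only [sub_smul, Finset.sum_sub_distrib, smul_sub, smul_add]
  rw [neg_smul] at h1
  rw [sub_eq_add_neg (V • ∑ a, vf φ (ψ a) • T a), ← h1]
  abel

/-- The curvature of a flat connection in the directions of `u` and of a vector field on the base
that does not depend on `u`. -/
theorem IsFlat.contract_u (h : IsFlat q T A) {φ : S → MvPowerSeries (Option S) k}
    (hφ : ∀ a, pderiv k none (φ a) = 0) :
    matD (uuD S q) (∑ a, φ a • T a) - (X none : MvPowerSeries (Option S) k) • matD (vf φ) A +
      (A * (∑ a, φ a • T a) - (∑ a, φ a • T a) * A) =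
    (C q * X none : MvPowerSeries (Option S) k) • ∑ a, φ a • T a := by
  have h1 : ∑ a, φ a • (matD (uuD S q) (T a) - matD (uD k a) A + (A * T a - T a * A)) =
      ∑ a, φ a • ((C q * X none : MvPowerSeries (Option S) k) • T a) :=
    Finset.sum_congr rfl fun a _ => by rw [h.u a]
  have h0 : ∀ a, uuD S q (φ a) = 0 := fun a => by rw [uuD_apply, hφ, mul_zero]
  rw [matD_sum_smul, matD_vf]
  simp only [h0, zero_smul, Finset.sum_const_zero, zero_add]
  simp only [smul_add, smul_sub, Finset.sum_add_distrib, Finset.sum_sub_distrib, matD_uD,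
    smul_comm (φ _) (X none : MvPowerSeries (Option S) k),
    smul_comm (φ _) (C q * X none : MvPowerSeries (Option S) k),
    ← Finset.smul_sum] at h1
  rw [← h1, Finset.mul_sum, Finset.sum_mul]
  simp only [Matrix.mul_smul, Matrix.smul_mul]

end ContractedCurvature

/-! ### Restriction to coordinate subspaces and division by `u` -/

section Restriction

variable {k : Type*} [NormedField k] {σ : Type*}

/-- Restriction to the linear subspace where the variables of nonzero weight vanish. -/
def restr (w : σ → ℕ) : MvPowerSeries σ k →+* MvPowerSeries σ k :=
  rescale fun i => if w i = 0 then 1 else 0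

theorem coeff_restr (w : σ → ℕ) (F : MvPowerSeries σ k) (m : σ →₀ ℕ) :
    coeff m (restr w F) = if Finsupp.weight w m = 0 then coeff m F else 0 := by
  rw [restr, coeff_rescale, Finsupp.prod]
  split_ifs with h
  · rw [Finset.prod_eq_one, one_mul]
    intro i hi
    rw [if_pos, one_pow]
    by_contra hw
    have := Finsupp.le_weight w hw m
    rw [h] at this
    rw [Finsupp.mem_support_iff] at hi
    omega
  · obtain ⟨i, hi⟩ : ∃ i, m i * w i ≠ 0 := by
      by_contra! hcon
      refine h ?_
      rw [Finsupp.weight_apply, Finsupp.sum]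
      exact Finset.sum_eq_zero fun b _ => by simpa using hcon b
    rw [Finset.prod_eq_zero (i := i), zero_mul]
    · exact Finsupp.mem_support_iff.mpr (left_ne_zero_of_mul hi)
    · rw [if_neg (right_ne_zero_of_mul hi), zero_pow (left_ne_zero_of_mul hi)]

theorem restr_eq_zero_iff {w : σ → ℕ} {F : MvPowerSeries σ k} :
    restr w F = 0 ↔ F ∈ vanIdeal k w 1 := by
  refine ⟨fun h m hm => ?_, fun h => ?_⟩
  · have := congrArg (coeff m) h
    rwa [coeff_restr, if_pos (by omega), map_zero] at this
  · ext m
    rw [coeff_restr, map_zero]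
    split_ifs with h0
    · exact h m (by omega)
    · rfl

theorem restr_restr (w : σ → ℕ) (F : MvPowerSeries σ k) : restr w (restr w F) = restr w F := by
  ext m
  rw [coeff_restr, coeff_restr]
  split_ifs <;> rfl

theorem restr_C (w : σ → ℕ) (a : k) : restr w (C a : MvPowerSeries σ k) = C a := by
  classical
  ext m
  rw [coeff_restr, coeff_C]
  split_ifs with h1 h2 <;> simp_all

theorem restr_X (w : σ → ℕ) (i : σ) :
    restr w (X i : MvPowerSeries σ k) = if w i = 0 then X i else 0 := by
  classical
  ext m
  rw [coeff_restr, coeff_X]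
  by_cases hm : m = Finsupp.single i 1
  · subst hm
    rw [Finsupp.weight_single, one_smul]
    by_cases h : w i = 0
    · rw [if_pos h, if_pos h, coeff_index_single_self_X, if_pos rfl]
    · rw [if_neg h, if_neg h, map_zero]
  · split_ifs <;> simp [coeff_X, hm]

theorem constantCoeff_restr (w : σ → ℕ) (F : MvPowerSeries σ k) :
    constantCoeff (restr w F) = constantCoeff F := by
  rw [← coeff_zero_eq_constantCoeff_apply, coeff_restr, map_zero, if_pos rfl,
    coeff_zero_eq_constantCoeff_apply]

theorem pderiv_restr {w : σ → ℕ} {i : σ} (hi : w i = 0) (F : MvPowerSeries σ k) :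
    pderiv k i (restr w F) = restr w (pderiv k i F) := by
  ext m
  rw [coeff_pderiv, coeff_restr, coeff_restr, map_add, Finsupp.weight_single, hi, smul_zero,
    add_zero, coeff_pderiv]
  split_ifs <;> simp

theorem pderiv_restr_of_ne {w : σ → ℕ} {i : σ} (hi : w i ≠ 0) (F : MvPowerSeries σ k) :
    pderiv k i (restr w F) = 0 := by
  ext m
  rw [coeff_pderiv, coeff_restr, if_neg, zero_mul, map_zero]
  rw [map_add, Finsupp.weight_single, one_smul]
  omega

theorem Bd.restr {C : ℝ} {F : MvPowerSeries σ k} (hF : Bd C F) (w : σ → ℕ) :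
    Bd C (restr w F) := fun m => by
  rw [coeff_restr]
  split_ifs
  · exact hF m
  · simpa using hF.nonneg

end Restriction

section DivisionByU

variable {k : Type*} [NormedField k] {S : Type*}

/-- The weight of the variable `u`. -/
def wtU (S : Type*) : Option S → ℕ := fun o => o.elim 1 fun _ => 0

/-- The quotient of `F - F(u = 0)` by `u`. -/
def divU (F : MvPowerSeries (Option S) k) : MvPowerSeries (Option S) k :=
  fun m => coeff (m + Finsupp.single none 1) F

/-- A power series that vanishes for `u = 0` is divisible by `u`. -/
theorem X_mul_divU {F : MvPowerSeries (Option S) k} (hF : restr (wtU S) F = 0) :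
    X none * divU F = F := by
  classical
  ext m
  rw [X, coeff_monomial_mul]
  split_ifs with h
  · rw [one_mul]
    change coeff (m - Finsupp.single none 1 + Finsupp.single none 1) F = _
    rw [tsub_add_cancel_of_le h]
  · have := restr_eq_zero_iff.mp hF m ?_
    · exact this.symm
    rw [Finsupp.single_le_iff] at h
    rw [Finsupp.weight_apply, Finsupp.sum, Finset.sum_eq_zero]
    · exact one_pos
    · intro o _
      cases o with
      | none => simp; left; omega
      | some a => simp [wtU]

theorem X_none_smul_injective {r s : Type*} {M N : Matrix r s (MvPowerSeries (Option S) k)}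
    (h : (X none : MvPowerSeries (Option S) k) • M = (X none : MvPowerSeries (Option S) k) • N) :
    M = N := by
  ext1 i j
  have := congrFun (congrFun h i) j
  exact mul_left_cancel₀ (fun h0 => by
    have := congrArg (coeff (Finsupp.single none 1)) h0
    rw [coeff_index_single_self_X, map_zero] at this
    exact one_ne_zero this) this

end DivisionByU

/-! ### Flat frames along a distribution transversal to a slice -/

section SliceFrames

variable {k : Type*} [NormedField k] {S J : Type*} (e : J → S)

open Classical in
/-- The weight that counts the variables of the base outside of the image of `e`. -/
def wtO : Option S → ℕ := fun o => o.elim 0 fun b => if b ∈ Set.range e then 0 else 1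

theorem wtO_le (o : Option S) : wtO e o ≤ 1 := by
  cases o with
  | none => exact zero_le_one
  | some b => simp only [wtO, Option.elim]; split_ifs <;> omega

@[simp] theorem wtO_none : wtO e none = 0 := rfl

@[simp] theorem wtO_some (c : J) : wtO e (some (e c)) = 0 := by simp [wtO]

theorem wtO_eq_one_iff {o : Option S} : wtO e o = 1 ↔ ∃ b, b ∉ Set.range e ∧ o = some b := by
  cases o with
  | none => simp
  | some b => simp [wtO]

variable {e} [Fintype S] [DecidableEq S] [Fintype J]

/-- The coefficients of the vector field `∂_b + ∑_c f_{bc} ∂_{e c}`. -/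
def sliceField (e : J → S) (f : S → J → MvPowerSeries (Option S) k) (b a : S) :
    MvPowerSeries (Option S) k :=
  (if b = a then 1 else 0) + ∑ c, if e c = a then f b c else 0

theorem sum_sliceField {M : Type*} [AddCommGroup M] [Module (MvPowerSeries (Option S) k) M]
    (f : S → J → MvPowerSeries (Option S) k) (b : S) (g : S → M) :
    ∑ a, sliceField e f b a • g a = g b + ∑ c, f b c • g (e c) := by
  simp only [sliceField, add_smul, Finset.sum_add_distrib, Finset.sum_smul, ite_smul, one_smul,
    zero_smul]
  congr 1
  · simp
  · rw [Finset.sum_comm]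
    simp

theorem vf_sliceField (f : S → J → MvPowerSeries (Option S) k) (b : S)
    (F : MvPowerSeries (Option S) k) :
    vf (sliceField e f b) F = pderiv k (some b) F + ∑ c, f b c * pderiv k (some (e c)) F := by
  rw [vf_apply]
  exact sum_sliceField f b fun a => pderiv k (some a) F

theorem matD_vf_sliceField {r s : Type*} (f : S → J → MvPowerSeries (Option S) k) (b : S)
    (M : Matrix r s (MvPowerSeries (Option S) k)) :
    matD (vf (sliceField e f b)) M =
      matD (pderiv k (some b)) M + ∑ c, f b c • matD (pderiv k (some (e c))) M := by
  rw [matD_vf, sum_sliceField f b fun a => matD (pderiv k (some a)) M]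

variable [IsUltrametricDist k]

/-- Flat frames along the vector fields `∂_b + ∑_c f_{bc} ∂_{e c}`, for a flat connection in
these directions, with prescribed restriction `X₀` to the slice. -/
theorem exists_flat_frame (hk : ∀ n : ℕ, n ≠ 0 → ‖(n : k)‖ = 1) {r s : Type*} [Fintype r]
    {f : S → J → MvPowerSeries (Option S) k} (hf : ∀ b c, Bd 1 (f b c))
    (hcomm : ∀ a b F, vf (sliceField e f a) (vf (sliceField e f b) F) =
      vf (sliceField e f b) (vf (sliceField e f a) F))
    {Sm : S → Matrix r r (MvPowerSeries (Option S) k)} (hSm : ∀ b i j, Bd 1 (Sm b i j))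
    (hcurv : ∀ a b, matD (vf (sliceField e f a)) (Sm b) - matD (vf (sliceField e f b)) (Sm a) +
      (Sm a * Sm b - Sm b * Sm a) = 0)
    (X₀ : Matrix r s (MvPowerSeries (Option S) k)) (hX₀ : ∀ i j, Bd 1 (X₀ i j))
    (hX₀' : ∀ b ∉ Set.range e, matD (pderiv k (some b)) X₀ = 0) :
    ∃ X : Matrix r s (MvPowerSeries (Option S) k), (∀ i j, Bd 1 (X i j)) ∧
      (∀ b ∉ Set.range e, matD (vf (sliceField e f b)) X + Sm b * X = 0) ∧
      ∀ i j, X i j - X₀ i j ∈ vanIdeal k (wtO e) 1 := by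
  let E : Option S → Matrix r s (MvPowerSeries (Option S) k) →+
      Matrix r s (MvPowerSeries (Option S) k) := fun o => o.elim 0 fun b =>
    { toFun := fun Z => ∑ c, f b c • matD (pderiv k (some (e c))) Z + Sm b * Z
      map_zero' := by simp
      map_add' := fun Y Z => by
        simp only [map_add, smul_add, Finset.sum_add_distrib, Matrix.mul_add]
        abel }
  have hE : ∀ b Z, matD (pderiv k (some b)) Z + E (some b) Z =
      matD (vf (sliceField e f b)) Z + Sm b * Z := fun b Z => by
    rw [matD_vf_sliceField, add_assoc]
    rfl
  have hE' : ∀ b Z, E (some b) Z = ∑ c, f b c • matD (pderiv k (some (e c))) Z + Sm b * Z :=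
    fun b Z => rfl
  obtain ⟨X, hX1, hX2, hX3⟩ := exists_flat_extension hk (wtO_le e) E
    (by
      intro o n X hX i j
      cases o with
      | none => exact Ideal.zero_mem _
      | some b =>
        rw [hE', Matrix.add_apply, Matrix.sum_apply]
        refine Ideal.add_mem _ (Ideal.sum_mem _ fun c _ => ?_) ?_
        · exact Ideal.mul_mem_left _ _ (pderiv_mem_vanIdeal _ (hX i j) (by simp))
        · rw [Matrix.mul_apply]
          exact Ideal.sum_mem _ fun l _ => Ideal.mul_mem_left _ _ (hX l j))
    (by
      intro o X hX i j
      cases o with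
      | none => exact Bd.zero zero_le_one
      | some b =>
        rw [hE', Matrix.add_apply, Matrix.sum_apply]
        refine (Bd.sum zero_le_one _ fun c _ => ?_).add ?_
        · exact (hf b c).one_mul ((hX i j).pderiv _)
        · rw [Matrix.mul_apply]
          exact Bd.sum zero_le_one _ fun l _ => (hSm b i l).one_mul (hX l j))
    (by
      intro a o ha Z
      obtain ⟨a, ha', rfl⟩ := (wtO_eq_one_iff e).mp ha
      cases o with
      | none => exact (smul_zero _).symm
      | some b =>
        rw [hE', hE', smul_add, Matrix.mul_smul, Finset.smul_sum]
        congr 1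
        refine Finset.sum_congr rfl fun c _ => ?_
        rw [matD_smul, pderiv_X_of_ne, zero_smul, zero_add, smul_comm]
        rintro h
        exact ha' ⟨c, (Option.some_injective _ h).symm⟩)
    (by
      intro o o' ha hb Z
      obtain ⟨a, -, rfl⟩ := (wtO_eq_one_iff e).mp ha
      obtain ⟨b, -, rfl⟩ := (wtO_eq_one_iff e).mp hb
      rw [hE, hE, hE, hE, map_add, map_add, matD_mul, matD_mul]
      have h1 : matD (vf (sliceField e f a)) (matD (vf (sliceField e f b)) Z) =
          matD (vf (sliceField e f b)) (matD (vf (sliceField e f a)) Z) := by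
        ext1 i j
        exact hcomm a b _
      have h2 := congrArg (fun Y => Y * Z) (hcurv a b)
      simp only [Matrix.add_mul, Matrix.sub_mul, Matrix.zero_mul] at h2
      rw [h1, ← sub_eq_zero, ← h2]
      simp only [Matrix.mul_add, Matrix.mul_assoc]
      abel) X₀ hX₀
    (by
      intro o ho
      obtain ⟨b, hb, rfl⟩ := (wtO_eq_one_iff e).mp ho
      exact hX₀' b hb)
  refine ⟨X, hX1, fun b hb => ?_, hX3⟩
  rw [← hE]
  exact hX2 _ ((wtO_eq_one_iff e).mpr ⟨b, hb, rfl⟩)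

end SliceFrames

section VectorFields

variable {k : Type*} [Field k] {S : Type*} [Fintype S]

theorem vf_X_none (φ : S → MvPowerSeries (Option S) k) :
    vf φ (X none : MvPowerSeries (Option S) k) = 0 := by
  rw [vf_apply]
  exact Finset.sum_eq_zero fun a _ => by rw [pderiv_X_of_ne (by simp), mul_zero]

/-- The commutator of two vector fields on the base. -/
theorem vf_vf_sub (φ ψ : S → MvPowerSeries (Option S) k) (F : MvPowerSeries (Option S) k) :
    vf φ (vf ψ F) - vf ψ (vf φ F) =
      ∑ s, (vf φ (ψ s) - vf ψ (φ s)) * pderiv k (some s) F := by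
  have h : ∀ φ ψ : S → MvPowerSeries (Option S) k, vf φ (vf ψ F) =
      (∑ s, vf φ (ψ s) * pderiv k (some s) F) +
        ∑ s, ∑ a, ψ s * φ a * pderiv k (some a) (pderiv k (some s) F) := by
    intro φ ψ
    rw [vf_apply ψ, map_sum, ← Finset.sum_add_distrib]
    refine Finset.sum_congr rfl fun s _ => ?_
    rw [Derivation.leibniz, smul_eq_mul, smul_eq_mul, vf_apply φ (pderiv k (some s) F),
      Finset.mul_sum, add_comm]
    congr 1
    · ring
    · exact Finset.sum_congr rfl fun a _ => by ring
  have h2 : ∑ s, ∑ a, ψ s * φ a * pderiv k (some a) (pderiv k (some s) F) =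
      ∑ s, ∑ a, φ s * ψ a * pderiv k (some a) (pderiv k (some s) F) := by
    rw [Finset.sum_comm]
    refine Finset.sum_congr rfl fun s _ => Finset.sum_congr rfl fun a _ => ?_
    rw [pderiv_comm]
    ring
  rw [h φ ψ, h ψ φ, h2]
  simp only [sub_mul, Finset.sum_sub_distrib]
  ring

theorem vf_uuD {φ : S → MvPowerSeries (Option S) k} (hφ : ∀ a, pderiv k none (φ a) = 0) (q : k)
    (F : MvPowerSeries (Option S) k) : vf φ (uuD S q F) = uuD S q (vf φ F) := by
  rw [vf_apply, vf_apply, map_sum]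
  refine Finset.sum_congr rfl fun a _ => ?_
  simp only [uuD_apply, Derivation.leibniz, smul_eq_mul, hφ, pderiv_C, pow_two]
  rw [pderiv_X_of_ne (show (none : Option S) ≠ some a by simp), pderiv_comm]
  ring

theorem vf_pderiv (φ : S → MvPowerSeries (Option S) k) (i : Option S)
    (F : MvPowerSeries (Option S) k) :
    vf φ (pderiv k i F) =
      pderiv k i (vf φ F) - ∑ a, pderiv k i (φ a) * pderiv k (some a) F := by
  simp only [vf_apply, map_sum, Derivation.leibniz, smul_eq_mul, Finset.sum_add_distrib]
  rw [add_sub_assoc, ← Finset.sum_sub_distrib, Finset.sum_eq_zero (f := fun x => _ - _), add_zero]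
  · exact Finset.sum_congr rfl fun a _ => by rw [pderiv_comm]
  · intro a _
    ring

end VectorFields

/-! ### The distribution defined by a cyclic vector -/

section SliceStructure

variable {k : Type*} [NormedField k] {S J : Type*} [DecidableEq S] [Fintype J]

theorem pderiv_sliceField {e : J → S} {f : S → J → MvPowerSeries (Option S) k} (b : S)
    (D : Derivation k (MvPowerSeries (Option S) k) (MvPowerSeries (Option S) k)) (a : S) :
    D (sliceField e f b a) = ∑ c, if e c = a then D (f b c) else 0 := by
  rw [sliceField, map_add, map_sum]
  have h1 : D (if b = a then (1 : MvPowerSeries (Option S) k) else 0) = 0 := by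
    split_ifs <;> simp
  rw [h1, zero_add]
  exact Finset.sum_congr rfl fun c _ => by split_ifs <;> simp

variable [Fintype S]

/-- Vector fields `Y_b = ∂_b + ∑_c f_{bc} ∂_{e c}` on the base, along which the operators of the
connection, divided by `u`, form a regular flat connection with matrices `Sm b`. -/
structure IsSliceStructure (e : J → S) {r : Type*} [Fintype r]
    (T : S → Matrix r r (MvPowerSeries (Option S) k))
    (f : S → J → MvPowerSeries (Option S) k)
    (Sm : S → Matrix r r (MvPowerSeries (Option S) k)) : Prop where
  bd_f : ∀ b c, Bd 1 (f b c)
  bd_Sm : ∀ b i j, Bd 1 (Sm b i j)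
  const_f : ∀ b ∉ Set.range e, ∀ c, constantCoeff (f b c) = 0
  pderiv_f : ∀ b c, pderiv k none (f b c) = 0
  contr : ∀ b, ∑ a, sliceField e f b a • T a = (X none : MvPowerSeries (Option S) k) • Sm b
  comm : ∀ a b F, vf (sliceField e f a) (vf (sliceField e f b) F) =
    vf (sliceField e f b) (vf (sliceField e f a) F)
  curv : ∀ a b, matD (vf (sliceField e f a)) (Sm b) - matD (vf (sliceField e f b)) (Sm a) +
    (Sm a * Sm b - Sm b * Sm a) = 0

theorem sum_pderiv_sliceField {e : J → S} {f : S → J → MvPowerSeries (Option S) k} (b : S)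
    (D : Derivation k (MvPowerSeries (Option S) k) (MvPowerSeries (Option S) k))
    {M : Type*} [AddCommGroup M] [Module (MvPowerSeries (Option S) k) M] (g : S → M) :
    ∑ a, D (sliceField e f b a) • g a = ∑ c, D (f b c) • g (e c) := by
  simp only [pderiv_sliceField, Finset.sum_smul, ite_smul, zero_smul]
  rw [Finset.sum_comm]
  simp

variable [DecidableEq J] [IsUltrametricDist k]

/-- The columns of `N` are the values of `T_{e c}` on the cyclic vector `h`. At `u = 0` the
matrices `T_a` commute, so that a vector field `Y` with `T_Y h = 0` at `u = 0` has `T_Y = 0` at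
`u = 0`. These vector fields form an involutive distribution. -/
theorem exists_sliceStructure {e : J → S} {q : k}
    {T : S → Matrix J J (MvPowerSeries (Option S) k)}
    {A : Matrix J J (MvPowerSeries (Option S) k)} (hflat : IsFlat q T A) (h : J → k)
    {N : Matrix J J (MvPowerSeries (Option S) k)}
    (hN : ∀ i c, N i c = (T (e c)).mulVec (fun j => C (h j)) i) (hNb : ∀ i c, Bd 1 (N i c))
    (hN0 : N.map constantCoeff = 1) {ε Ct : ℝ} (hε1 : ε ≤ 1) (hεC : ε * Ct ≤ 1)
    (hO : ∀ b ∉ Set.range e, ∀ i, Bd ε ((T b).mulVec (fun j => C (h j)) i) ∧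
      constantCoeff ((T b).mulVec (fun j => C (h j)) i) = 0)
    (hT : ∀ b i j, Bd Ct (T b i j)) (hT1 : ∀ b i j m, m ≠ 0 → ‖coeff m (T b i j)‖ ≤ 1) :
    ∃ f Sm, IsSliceStructure e T f Sm := by
  classical
  set ρ := restr (k := k) (wtU S) with hρ
  obtain ⟨N', hNN', hN'N, hN'b, -⟩ := exists_inverse N hNb hN0
  set t : S → J → MvPowerSeries (Option S) k := fun b => (T b).mulVec (fun j => C (h j)) with ht
  have htb : ∀ b i, Bd 1 (t b i) := by
    intro b i
    by_cases hb : b ∈ Set.range e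
    · obtain ⟨c, rfl⟩ := hb
      have := hNb i c
      rwa [hN] at this
    · exact (hO b hb i).1.mono hε1
  -- the `f b` are determined by the condition that `T_b + ∑ f_{bc} T_{e c}` kills `h` at `u = 0`
  set f : S → J → MvPowerSeries (Option S) k := fun b c => ρ (-(N'.mulVec (t b)) c) with hf
  have hN'tb : ∀ b c (D : ℝ), 0 ≤ D → (∀ i, Bd D (t b i)) → Bd D (f b c) := by
    intro b c D hD0 hD
    refine Bd.restr (Bd.neg ?_) _
    rw [Matrix.mulVec, dotProduct]
    exact Bd.sum hD0 _ fun l _ => (hN'b c l).one_mul (hD l)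
  have hfJ : ∀ c₀ c, f (e c₀) c = if c₀ = c then -1 else 0 := by
    intro c₀ c
    have h1 : N'.mulVec (t (e c₀)) c = (N' * N) c c₀ := by
      rw [Matrix.mulVec, dotProduct, Matrix.mul_apply]
      exact Finset.sum_congr rfl fun l _ => by rw [hN]
    simp only [hf]
    rw [h1, hN'N, Matrix.one_apply]
    split_ifs with h2 h3 h3
    · simp
    · exact absurd h2.symm h3
    · exact absurd h3.symm h2
    · simp
  have hρf : ∀ b c, ρ (f b c) = f b c := fun b c => restr_restr _ _
  set P : S → Matrix J J (MvPowerSeries (Option S) k) := fun b =>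
    ∑ a, sliceField e f b a • T a with hP
  have hPe : ∀ b, P b = T b + ∑ c, f b c • T (e c) := fun b => sum_sliceField f b T
  -- the connection matrices at `u = 0` commute
  set T0 : S → Matrix J J (MvPowerSeries (Option S) k) := fun a => (T a).map ρ with hT0
  have hρX : ρ (X none : MvPowerSeries (Option S) k) = 0 := by
    rw [hρ, restr_X, if_neg (by simp [wtU])]
  have hT0comm : ∀ a b, T0 a * T0 b = T0 b * T0 a := by
    intro a b
    have h1 := congrArg (fun M : Matrix J J (MvPowerSeries (Option S) k) => M.map ρ)
      (hflat.base a b)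
    rw [Matrix.map_add _ (map_add ρ), Matrix.map_sub _ (map_sub ρ), Matrix.map_sub _ (map_sub ρ),
      Matrix.map_mul, Matrix.map_mul] at h1
    have h2 : ∀ a b, (matD (uD k a) (T b)).map ρ = 0 := by
      intro a b
      ext1 i j
      rw [Matrix.map_apply, matD_apply, uD_apply, map_mul, hρX, zero_mul]
      rfl
    rw [h2, h2, sub_zero, zero_add, Matrix.map_zero _ (map_zero ρ)] at h1
    exact sub_eq_zero.mp h1
  set N0 := N.map ρ with hN0'
  have hN0inv : N0 * N'.map ρ = 1 := by
    rw [← Matrix.map_mul, hNN', Matrix.map_one _ (map_zero ρ) (map_one ρ)]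
  have hN'0inv : N'.map ρ * N0 = 1 := mul_eq_one_comm.mp hN0inv
  have hρt : ∀ a i, ρ (t a i) = (T0 a).mulVec (fun j => C (h j)) i := by
    intro a i
    simp only [ht, Matrix.mulVec, dotProduct, map_sum, map_mul, hρ, restr_C]
    rfl
  have hN0col : ∀ i c, N0 i c = (T0 (e c)).mulVec (fun j => C (h j)) i := by
    intro i c
    rw [← hρt, hN0', Matrix.map_apply, hN]
  have hP0e : ∀ b, (P b).map ρ = T0 b + ∑ c, f b c • T0 (e c) := by
    intro b
    ext1 i j
    rw [hPe, Matrix.map_apply, Matrix.add_apply, map_add, Matrix.add_apply, Matrix.sum_apply,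
      Matrix.sum_apply, map_sum]
    simp only [Matrix.smul_apply, smul_eq_mul, map_mul, hρf]
    rfl
  have hP0h : ∀ b, ((P b).map ρ).mulVec (fun j => C (h j)) = 0 := by
    intro b
    ext1 i
    rw [hP0e, Matrix.add_mulVec, Pi.add_apply, ← hρt, Matrix.sum_mulVec, Finset.sum_apply]
    simp only [Matrix.smul_mulVec, Pi.smul_apply, smul_eq_mul, ← hN0col]
    have h1 : f b = -((N'.map ρ).mulVec fun l => ρ (t b l)) := by
      ext1 c
      simp only [hf, Pi.neg_apply, Matrix.mulVec, dotProduct, map_neg, map_sum, map_mul]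
      rfl
    have h2 : ∑ c, f b c * N0 i c = N0.mulVec (f b) i := by
      rw [Matrix.mulVec, dotProduct]
      exact Finset.sum_congr rfl fun c _ => mul_comm _ _
    rw [h2, h1, Matrix.mulVec_neg, Matrix.mulVec_mulVec, hN0inv, Matrix.one_mulVec]
    simp
  -- `P b` commutes at `u = 0` with the `T_{e c}`, hence kills the vectors `T_{e c} h`, a basis
  have hP0 : ∀ b, (P b).map ρ = 0 := by
    intro b
    have hc : ∀ c, (P b).map ρ * T0 (e c) = T0 (e c) * (P b).map ρ := by
      intro c
      rw [hP0e, add_mul, mul_add, Finset.sum_mul, Finset.mul_sum, hT0comm]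
      congr 1
      exact Finset.sum_congr rfl fun d _ => by
        rw [Matrix.smul_mul, Matrix.mul_smul, hT0comm]
    have h1 : (P b).map ρ * N0 = 0 := by
      ext1 i c
      have h2 : ((P b).map ρ * N0) i c =
          ((P b).map ρ).mulVec ((T0 (e c)).mulVec (fun j => C (h j))) i := by
        rw [Matrix.mul_apply, Matrix.mulVec, dotProduct]
        exact Finset.sum_congr rfl fun l _ => by rw [hN0col]
      rw [h2, Matrix.mulVec_mulVec, hc, ← Matrix.mulVec_mulVec, hP0h, Matrix.mulVec_zero]
      rfl
    rw [← Matrix.mul_one ((P b).map ρ), ← hN0inv, ← Matrix.mul_assoc, h1, Matrix.zero_mul]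
  set Sm : S → Matrix J J (MvPowerSeries (Option S) k) := fun b => (P b).map divU with hSm
  have hPS : ∀ b, P b = (X none : MvPowerSeries (Option S) k) • Sm b := by
    intro b
    ext1 i j
    exact (X_mul_divU (congrFun (congrFun (hP0 b) i) j)).symm
  have hcontract := fun a b => hflat.contract (sliceField e f a) (sliceField e f b)
  set D : S → Derivation k (MvPowerSeries (Option S) k) (MvPowerSeries (Option S) k) :=
    fun a => vf (sliceField e f a) with hD
  have hsum : ∀ a b, (X none : MvPowerSeries (Option S) k) •
      (matD (D a) (Sm b) - matD (D b) (Sm a) + (Sm a * Sm b - Sm b * Sm a)) =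
      ∑ c, (D a (f b c) - D b (f a c)) • T (e c) := by
    intro a b
    apply X_none_smul_injective
    have h1 := hcontract a b
    have h2 : ∀ a b, matD (D a) (P b) = (X none : MvPowerSeries (Option S) k) •
        matD (D a) (Sm b) := fun a b => by
      rw [hPS, matD_smul, hD, vf_X_none, zero_smul, zero_add]
    change (X none : MvPowerSeries (Option S) k) • (matD (D a) (P b) - matD (D b) (P a)) +
      (P a * P b - P b * P a) = _ at h1
    have h3 : ∑ s, (D a (sliceField e f b s) - D b (sliceField e f a s)) • T s =
        ∑ c, (D a (f b c) - D b (f a c)) • T (e c) := by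
      simp only [sub_smul, Finset.sum_sub_distrib]
      rw [sum_pderiv_sliceField, sum_pderiv_sliceField]
    rw [← h3, ← h1, h2, h2, hPS a, hPS b]
    simp only [smul_add, smul_sub, Matrix.smul_mul, Matrix.mul_smul]
  -- the commutator of two of the vector fields is a combination of the `∂_{e c}`; at `u = 0` the
  -- same combination of the `T_{e c}` kills `h`, so that its coefficients vanish
  have hg0 : ∀ a b c, D a (f b c) - D b (f a c) = 0 := by
    intro a b
    set g : J → MvPowerSeries (Option S) k := fun c => D a (f b c) - D b (f a c) with hg
    have hρD : ∀ a b c, ρ (D a (f b c)) = D a (f b c) := by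
      intro a b c
      rw [hD]
      simp only
      rw [vf_sliceField, map_add, map_sum, ← pderiv_restr (by simp [wtU]), hρf]
      congr 1
      refine Finset.sum_congr rfl fun d _ => ?_
      rw [map_mul, ← pderiv_restr (by simp [wtU]), hρf, hρf]
    have h1 : N0.mulVec g = 0 := by
      ext1 i
      have h2 := congrArg (fun M : Matrix J J (MvPowerSeries (Option S) k) =>
        (M.map ρ).mulVec (fun j => C (h j)) i) (hsum a b)
      have h3 : ((X none : MvPowerSeries (Option S) k) • (matD (D a) (Sm b) - matD (D b) (Sm a) +
          (Sm a * Sm b - Sm b * Sm a))).map ρ = 0 := by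
        ext1 i j
        rw [Matrix.map_apply, Matrix.smul_apply, smul_eq_mul, map_mul, hρX, zero_mul]
        rfl
      have h4 : (∑ c, g c • T (e c)).map ρ = ∑ c, g c • T0 (e c) := by
        ext1 i j
        rw [Matrix.map_apply, Matrix.sum_apply, Matrix.sum_apply, map_sum]
        refine Finset.sum_congr rfl fun c _ => ?_
        rw [Matrix.smul_apply, smul_eq_mul, map_mul]
        simp only [hg, map_sub, hρD]
        rfl
      rw [h3, h4, Matrix.zero_mulVec, Matrix.sum_mulVec, Finset.sum_apply] at h2
      rw [h2, Matrix.mulVec, dotProduct]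
      refine Finset.sum_congr rfl fun c _ => ?_
      rw [Matrix.smul_mulVec, Pi.smul_apply, smul_eq_mul, hN0col, mul_comm]
    have h5 : g = 0 := by
      rw [← Matrix.one_mulVec g, ← hN'0inv, ← Matrix.mulVec_mulVec, h1, Matrix.mulVec_zero]
    exact fun c => congrFun h5 c
  refine ⟨f, Sm, ⟨fun b c => hN'tb b c 1 zero_le_one (htb b), ?_, ?_, ?_, hPS, ?_, ?_⟩⟩
  · intro b i j m
    change ‖coeff (m + Finsupp.single none 1) (P b i j)‖ ≤ 1
    by_cases hb : b ∈ Set.range e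
    · obtain ⟨c₀, rfl⟩ := hb
      have : P (e c₀) = 0 := by
        rw [hPe]
        simp [hfJ]
      rw [this]
      simp
    · have hm : m + Finsupp.single none 1 ≠ 0 := fun h0 => by
        have := DFunLike.congr_fun h0 none
        simp at this
      rw [hPe, Matrix.add_apply, map_add, Matrix.sum_apply]
      refine (IsUltrametricDist.norm_add_le_max _ _).trans (max_le (hT1 _ _ _ _ hm) ?_)
      refine Bd.sum zero_le_one _ (fun c _ => ?_) _
      have hε : 0 ≤ ε := (hO b hb i).1.nonneg
      exact ((hN'tb b c ε hε fun i => (hO b hb i).1).mul (hT (e c) i j)).mono hεC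
  · intro b hb c
    simp only [hf]
    rw [hρ, constantCoeff_restr, map_neg, Matrix.mulVec, dotProduct, map_sum,
      Finset.sum_eq_zero, neg_zero]
    intro l _
    rw [map_mul, (hO b hb l).2, mul_zero]
  · intro b c
    exact pderiv_restr_of_ne (by simp [wtU]) _
  · intro a b F
    rw [← sub_eq_zero, vf_vf_sub]
    have := sum_pderiv_sliceField (e := e) (f := f) b (D a) fun s => pderiv k (some s) F
    have h2 := sum_pderiv_sliceField (e := e) (f := f) a (D b) fun s => pderiv k (some s) F
    simp only [smul_eq_mul] at this h2
    simp only [sub_mul, Finset.sum_sub_distrib]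
    rw [this, h2, ← Finset.sum_sub_distrib]
    exact Finset.sum_eq_zero fun c _ => by rw [← sub_mul, hg0, zero_mul]
  · intro a b
    apply X_none_smul_injective
    rw [hsum, smul_zero]
    exact Finset.sum_eq_zero fun c _ => by rw [hg0, zero_smul]

end SliceStructure

/-! ### Connections pulled back from a slice -/

section SlicePullback

variable {k : Type*} [NormedField k] {S J : Type*}

/-- The map of formal spaces with components `p c` in the directions of the slice. -/
def sliceMap (e : J → S) (p : J → MvPowerSeries (Option S) k) (o : Option S) :
    MvPowerSeries (Option S) k :=
  o.elim (X none) (Function.extend e p 0)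

variable {e : J → S} {p : J → MvPowerSeries (Option S) k}

theorem sliceMap_none : sliceMap e p none = X none := rfl

theorem sliceMap_some (he : Function.Injective e) (c : J) :
    sliceMap e p (some (e c)) = p c := he.extend_apply p 0 c

theorem sliceMap_of_not_mem {b : S} (hb : b ∉ Set.range e) : sliceMap e p (some b) = 0 :=
  Function.extend_apply' p (0 : S → MvPowerSeries (Option S) k) b fun ⟨c, hc⟩ => hb ⟨c, hc⟩

/-- Case distinction for the components of `sliceMap`. -/
theorem sliceMap_cases (he : Function.Injective e)
    {Q : Option S → MvPowerSeries (Option S) k → Prop}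
    (h1 : Q none (X none)) (h2 : ∀ c, Q (some (e c)) (p c))
    (h3 : ∀ b ∉ Set.range e, Q (some b) 0) (o : Option S) : Q o (sliceMap e p o) := by
  cases o with
  | none => exact h1
  | some b =>
    by_cases hb : b ∈ Set.range e
    · obtain ⟨c, rfl⟩ := hb
      rw [sliceMap_some he]
      exact h2 c
    · rw [sliceMap_of_not_mem hb]
      exact h3 b hb

variable [Fintype S] [DecidableEq S] [Fintype J] [IsUltrametricDist k]

theorem degree_lt_two {σ : Type*} [Fintype σ] {m : σ →₀ ℕ} (hm : m.degree < 2) :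
    m = 0 ∨ ∃ i, m = Finsupp.single i 1 := by
  by_cases h0 : m = 0
  · exact Or.inl h0
  right
  obtain ⟨i, hi⟩ := Finsupp.ne_iff.mp h0
  have h1 : Finsupp.single i 1 ≤ m := by
    rw [Finsupp.single_le_iff]
    simp only [Finsupp.coe_zero, Pi.zero_apply] at hi
    omega
  have h2 := congrArg Finsupp.degree (tsub_add_cancel_of_le h1)
  rw [map_add, Finsupp.degree_single] at h2
  have h3 : (m - Finsupp.single i 1).degree = 0 := by omega
  rw [Finsupp.degree_eq_zero_iff] at h3
  refine ⟨i, ?_⟩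
  have := tsub_add_cancel_of_le h1
  rw [h3, zero_add] at this
  exact this.symm

/-- First integrals of the distribution `⟨Y_b⟩` which restrict to the coordinates of the slice. -/
theorem exists_firstIntegrals (hk : ∀ n : ℕ, n ≠ 0 → ‖(n : k)‖ = 1)
    {T : S → Matrix J J (MvPowerSeries (Option S) k)}
    {f : S → J → MvPowerSeries (Option S) k} {Sm : S → Matrix J J (MvPowerSeries (Option S) k)}
    (H : IsSliceStructure e T f Sm) :
    ∃ p : J → MvPowerSeries (Option S) k, (∀ c, Bd 1 (p c)) ∧
      (∀ b ∉ Set.range e, ∀ c, vf (sliceField e f b) (p c) = 0) ∧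
      (∀ c, p c - X (some (e c)) ∈ vanIdeal k (wtO e) 1) ∧
      (∀ c, pderiv k none (p c) = 0) ∧
      (∀ c, p c - X (some (e c)) ∈ vanIdeal k (fun _ => 1) 2) := by
  have := charZero_of_norm_natCast hk
  obtain ⟨X₁, hb, hflat, hX⟩ := exists_flat_frame hk (r := Unit) H.bd_f H.comm (Sm := 0)
    (fun _ _ _ => Bd.zero zero_le_one) (fun a b => by simp)
    (Matrix.of fun _ c => X (some (e c))) (fun _ _ => Bd.X _)
    (fun b hb => by
      ext1 i c
      rw [matD_apply, Matrix.of_apply, pderiv_X_of_ne, Matrix.zero_apply]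
      intro h
      exact hb ⟨c, Option.some_injective _ h⟩)
  set p : J → MvPowerSeries (Option S) k := fun c => X₁ () c with hp
  have hpY : ∀ b ∉ Set.range e, ∀ c, vf (sliceField e f b) (p c) = 0 := by
    intro b hb c
    have := congrFun (congrFun (hflat b hb) ()) c
    simpa using this
  have hpX : ∀ c, p c - X (some (e c)) ∈ vanIdeal k (wtO e) 1 := fun c => hX () c
  refine ⟨p, fun c => hb () c, hpY, hpX, ?_, ?_⟩
  · refine eq_zero_of_pderiv_mem (wtO_le e) (fun c => pderiv k none (p c)) ?_ ?_
    · intro c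
      have := pderiv_mem_vanIdeal (n := 1) none (hpX c) (by simp)
      rwa [map_sub, pderiv_X_of_ne (by simp), sub_zero] at this
    · intro n hn o ho c
      obtain ⟨b, hb, rfl⟩ := (wtO_eq_one_iff e).mp ho
      have h1 := congrArg (pderiv k none) (hpY b hb c)
      rw [vf_sliceField, map_add, map_sum, map_zero, pderiv_comm] at h1
      rw [eq_neg_of_add_eq_zero_left h1]
      refine neg_mem (Ideal.sum_mem _ fun d _ => ?_)
      rw [Derivation.leibniz, H.pderiv_f, smul_zero, add_zero, pderiv_comm, smul_eq_mul]
      exact Ideal.mul_mem_left _ _ (pderiv_mem_vanIdeal _ (hn c) (by simp))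
  · intro c m hm
    rw [show Finsupp.weight (fun _ : Option S => 1) m = m.degree from weight_eq_degree m] at hm
    rcases degree_lt_two hm with rfl | ⟨o, rfl⟩
    · exact hpX c 0 (by simp)
    · rcases Nat.lt_or_ge (wtO e o) 1 with ho | ho
      · exact hpX c _ (by rwa [Finsupp.weight_single, one_smul])
      · obtain ⟨b, hb, rfl⟩ := (wtO_eq_one_iff e).mp (le_antisymm (wtO_le e o) ho)
        have h1 := congrArg constantCoeff (hpY b hb c)
        rw [vf_sliceField, map_add, map_sum, map_zero, Finset.sum_eq_zero, add_zero] at h1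
        · rw [← coeff_zero_eq_constantCoeff_apply, coeff_pderiv] at h1
          simp only [zero_add, Finsupp.coe_zero, Pi.zero_apply, Nat.cast_zero, mul_one] at h1
          rw [map_sub, h1, coeff_X, if_neg, sub_zero]
          intro h2
          have := (Finsupp.single_left_inj one_ne_zero).mp h2
          exact hb ⟨c, (Option.some_injective _ this).symm⟩
        · intro d _
          rw [map_mul, H.const_f b hb, zero_mul]

variable [DecidableEq J]

/-- A flat connection with a slice structure is the pullback, along the first integrals, of its
restriction to the slice: a frame that is flat along the distribution and trivial on the slice
intertwines the two connections, by uniqueness of the solutions with given restriction to the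
slice. -/
theorem exists_pullback_frame (hk : ∀ n : ℕ, n ≠ 0 → ‖(n : k)‖ = 1) (he : Function.Injective e)
    {q : k} {T : S → Matrix J J (MvPowerSeries (Option S) k)}
    {A : Matrix J J (MvPowerSeries (Option S) k)} (hflat : IsFlat q T A)
    {f : S → J → MvPowerSeries (Option S) k} {Sm : S → Matrix J J (MvPowerSeries (Option S) k)}
    (H : IsSliceStructure e T f Sm) :
    ∃ (p : J → MvPowerSeries (Option S) k) (Φ Ψ : Matrix J J (MvPowerSeries (Option S) k)),
      (∀ c, Bd 1 (p c)) ∧ (∀ c, pderiv k none (p c) = 0) ∧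
      (∀ c, p c - X (some (e c)) ∈ vanIdeal k (fun _ => 1) 2) ∧
      (∀ i j, Bd 1 (Φ i j)) ∧ (∀ i j, Bd 1 (Ψ i j)) ∧ Φ * Ψ = 1 ∧ Ψ * Φ = 1 ∧
      Φ.map constantCoeff = 1 ∧
      (∀ a, matD (uD k a) Φ + T a * Φ = Φ * ∑ c, pderiv k (some a) (p c) •
        (T (e c)).map (subst (sliceMap e p))) ∧
      matD (uuD S q) Φ + A * Φ = Φ * A.map (subst (sliceMap e p)) := by
  have := charZero_of_norm_natCast hk
  obtain ⟨p, hpb, hpY, hpX, hpu, hp2⟩ := exists_firstIntegrals hk H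
  obtain ⟨Φ, hΦb, hΦY, hΦ1⟩ := exists_flat_frame hk H.bd_f H.comm H.bd_Sm H.curv
    (1 : Matrix J J (MvPowerSeries (Option S) k)) Bd.matrix_one
    (fun b _ => matD_one (pderiv k (some b : Option S)))
  have hΦ0 : Φ.map constantCoeff = 1 := by
    ext i j
    have := hΦ1 i j 0 (by simp)
    rw [map_sub, sub_eq_zero, coeff_zero_eq_constantCoeff_apply,
      coeff_zero_eq_constantCoeff_apply] at this
    rw [Matrix.map_apply, this, Matrix.one_apply, Matrix.one_apply]
    split_ifs <;> simp
  obtain ⟨Ψ, hΦΨ, hΨΦ, hΨb, -⟩ := exists_inverse Φ hΦb hΦ0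
  set Pm := sliceMap e p with hPm
  have hp0 : ∀ c, constantCoeff (p c) = 0 := fun c => by
    have := hp2 c 0 (by simp)
    rwa [map_sub, coeff_zero_eq_constantCoeff_apply, coeff_zero_eq_constantCoeff_apply,
      constantCoeff_X, sub_zero] at this
  have hPm0 : ∀ o, constantCoeff (Pm o) = 0 :=
    sliceMap_cases he (Q := fun _ F => constantCoeff F = 0) (constantCoeff_X _) hp0
      fun _ _ => map_zero _
  have hPmY : ∀ b ∉ Set.range e, ∀ o, vf (sliceField e f b) (Pm o) = 0 := fun b hb =>
    sliceMap_cases he (Q := fun _ F => vf (sliceField e f b) F = 0) (vf_X_none _) (hpY b hb)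
      fun _ _ => map_zero _
  have hsubstY : ∀ b ∉ Set.range e, ∀ G : MvPowerSeries (Option S) k,
      vf (sliceField e f b) (subst Pm G) = 0 := by
    intro b hb G
    rw [vf_apply]
    simp only [pderiv_subst hPm0, Finset.mul_sum]
    rw [Finset.sum_comm]
    refine Finset.sum_eq_zero fun l _ => ?_
    have h1 := hPmY b hb l
    rw [vf_apply] at h1
    have h2 : ∀ a, sliceField e f b a * (subst Pm (pderiv k l G) * pderiv k (some a) (Pm l)) =
        subst Pm (pderiv k l G) * (sliceField e f b a * pderiv k (some a) (Pm l)) :=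
      fun a => by ring
    simp only [h2]
    rw [← Finset.mul_sum, h1, mul_zero]
  -- the substitution does not change the restriction to the slice
  have hsubstV : ∀ G : MvPowerSeries (Option S) k, G - subst Pm G ∈ vanIdeal k (wtO e) 1 := by
    intro G
    rw [← restr_eq_zero_iff, map_sub, sub_eq_zero]
    have h1 : ∀ o, restr (wtO e) (Pm o) = restr (wtO e) (X o : MvPowerSeries (Option S) k) := by
      refine sliceMap_cases he (Q := fun o F => restr (wtO e) F =
        restr (wtO e) (X o : MvPowerSeries (Option S) k)) rfl (fun c => ?_) (fun b hb => ?_)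
      · rw [← sub_eq_zero, ← map_sub, restr_eq_zero_iff]
        exact hpX c
      · rw [restr_X, (wtO_eq_one_iff e).mpr ⟨b, hb, rfl⟩, map_zero, if_neg one_ne_zero]
    have h2 := rescale_subst (P := (X : Option S → MvPowerSeries (Option S) k))
      (fun o => constantCoeff_X o) (fun o => if wtO e o = 0 then (1 : k) else 0) G
    have h3 := rescale_subst hPm0 (fun o => if wtO e o = 0 then (1 : k) else 0) G
    rw [show subst (X : Option S → MvPowerSeries (Option S) k) G = G from
      congrFun subst_self G] at h2
    refine h2.trans (Eq.trans ?_ h3.symm)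
    congr 1
    funext o
    exact (h1 o).symm
  have hYΦ : ∀ b ∉ Set.range e, matD (vf (sliceField e f b)) Φ = - (Sm b * Φ) := fun b hb =>
    eq_neg_of_add_eq_zero_left (hΦY b hb)
  have hmulV : ∀ (M L : Matrix J J (MvPowerSeries (Option S) k)),
      (∀ i j, (M - L) i j ∈ vanIdeal k (wtO e) 1) →
      ∀ i j, (M * Φ - Φ * L) i j ∈ vanIdeal k (wtO e) 1 := by
    intro M L hML i j
    have h1 : M * Φ - Φ * L = M * (Φ - 1) + (M - L) - (Φ - 1) * L := by noncomm_ring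
    rw [h1]
    refine Ideal.sub_mem _ (Ideal.add_mem _ ?_ (hML i j)) ?_
    · exact mem_vanIdeal_matrix_mul (a := 0) (fun _ _ => vanIdeal_zero) (N := Φ - 1) hΦ1 i j
    · exact mem_vanIdeal_matrix_mul (b := 0) (M := Φ - 1) hΦ1 (fun _ _ => vanIdeal_zero) i j
  -- the equations `∇_{Y_b} W_i = ∑ g_{i,i'} W_{i'}` determine `W` by its restriction to the slice
  have huniq : ∀ (ι : Type _) [Fintype ι] (W : ι → Matrix J J (MvPowerSeries (Option S) k))
      (g : S → ι → ι → MvPowerSeries (Option S) k),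
      (∀ i p q, W i p q ∈ vanIdeal k (wtO e) 1) →
      (∀ b ∉ Set.range e, ∀ i, matD (vf (sliceField e f b)) (W i) + Sm b * W i =
        - ∑ i', g b i i' • W i') → ∀ i, W i = 0 := by
    intro ι _ W g hW1 hW i
    have := eq_zero_of_pderiv_mem (wtO_le e) (fun x : ι × J × J => W x.1 x.2.1 x.2.2)
      (fun x => hW1 _ _ _) (by
        rintro n hn o ho ⟨i, a, a'⟩
        obtain ⟨b, hb, rfl⟩ := (wtO_eq_one_iff e).mp ho
        have h1 := congrFun (congrFun (hW b hb i) a) a'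
        rw [Matrix.add_apply, matD_apply, vf_sliceField, add_assoc] at h1
        rw [eq_sub_of_add_eq h1]
        refine Ideal.sub_mem _ ?_ (Ideal.add_mem _ ?_ ?_)
        · rw [Matrix.neg_apply, Matrix.sum_apply]
          exact neg_mem (Ideal.sum_mem _ fun i' _ => Ideal.mul_mem_left _ _ (hn ⟨i', a, a'⟩))
        · exact Ideal.sum_mem _ fun d _ => Ideal.mul_mem_left _ _
            (pderiv_mem_vanIdeal _ (hn ⟨i, a, a'⟩) (by simp))
        · rw [Matrix.mul_apply]
          exact Ideal.sum_mem _ fun l _ => Ideal.mul_mem_left _ _ (hn ⟨i, l, a'⟩))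
    ext1 a a'
    exact this ⟨i, a, a'⟩
  refine ⟨p, Φ, Ψ, hpb, hpu, hp2, hΦb, hΨb, hΦΨ, hΨΦ, hΦ0, ?_, ?_⟩
  · set T' : J → Matrix J J (MvPowerSeries (Option S) k) :=
      fun c => (T (e c)).map (subst Pm) with hT'
    set Z : S → Matrix J J (MvPowerSeries (Option S) k) :=
      fun a => ∑ c, pderiv k (some a) (p c) • T' c with hZ
    have hT'Y : ∀ b ∉ Set.range e, ∀ c, matD (vf (sliceField e f b)) (T' c) = 0 := by
      intro b hb c
      ext1 i j
      exact hsubstY b hb _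
    have hfield : ∀ b i, ∀ g : S → MvPowerSeries (Option S) k,
        ∑ a, pderiv k i (sliceField e f b a) * g a = ∑ c, pderiv k i (f b c) * g (e c) :=
      fun b i g => sum_pderiv_sliceField b (pderiv k i) g
    have hYZ : ∀ b ∉ Set.range e, ∀ c, matD (vf (sliceField e f b)) (Z (e c)) =
        - ∑ d, pderiv k (some (e c)) (f b d) • Z (e d) := by
      intro b hb c
      simp only [hZ, map_sum, matD_smul, hT'Y b hb, smul_zero, add_zero, Finset.smul_sum,
        smul_smul]
      rw [Finset.sum_comm, ← Finset.sum_neg_distrib]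
      refine Finset.sum_congr rfl fun d _ => ?_
      rw [vf_pderiv, hpY b hb, map_zero, zero_sub,
        hfield b (some (e c)) fun a => pderiv k (some a) (p d), neg_smul, Finset.sum_smul]
    -- the defects `W` of the intertwining relations in the directions of the slice solve a linear
    -- system along the distribution and vanish on the slice
    have hW : ∀ c, matD (uD k (e c)) Φ + T (e c) * Φ - Φ * Z (e c) = 0 := by
      refine huniq J _ (fun b c d => pderiv k (some (e c)) (f b d)) ?_ ?_
      · intro c i j
        rw [add_sub_assoc, Matrix.add_apply]
        refine Ideal.add_mem _ ?_ (hmulV _ _ (fun i j => ?_) i j)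
        · have h1 := pderiv_mem_vanIdeal (n := 1) (some (e c)) (hΦ1 i j) (by simp)
          have h2 : pderiv k (some (e c)) ((1 : Matrix J J (MvPowerSeries (Option S) k)) i j) = 0 :=
            congrFun (congrFun (matD_one (pderiv k (some (e c)))) i) j
          rw [map_sub, h2, sub_zero] at h1
          exact Ideal.mul_mem_left _ _ h1
        · have h1 : (T (e c) - Z (e c)) i j = (T (e c) i j - T' c i j) -
              ∑ d, pderiv k (some (e c)) (p d - X (some (e d))) * T' d i j := by
            have h2 : ∑ d, pderiv k (some (e c)) (X (some (e d)) : MvPowerSeries (Option S) k) *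
                T' d i j = T' c i j := by
              rw [Finset.sum_eq_single c]
              · rw [pderiv_X_self, one_mul]
              · intro d _ hd
                rw [pderiv_X_of_ne, zero_mul]
                intro h
                exact hd (he (Option.some_injective _ h))
              · simp
            simp only [map_sub, sub_mul, Finset.sum_sub_distrib]
            have h3 : Z (e c) i j = ∑ d, pderiv k (some (e c)) (p d) * T' d i j := by
              simp only [hZ, Matrix.sum_apply, Matrix.smul_apply, smul_eq_mul]
            rw [h2, Matrix.sub_apply, h3]
            ring
          rw [h1]
          refine Ideal.sub_mem _ (hsubstV _) (Ideal.sum_mem _ fun d _ =>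
            Ideal.mul_mem_right _ _ (pderiv_mem_vanIdeal _ (hpX d) (by simp)))
      · intro b hb c
        set Y := vf (sliceField e f b) with hY
        have h1 : matD Y (matD (uD k (e c)) Φ) = matD (uD k (e c)) (matD Y Φ) -
            ∑ d, pderiv k (some (e c)) (f b d) • matD (uD k (e d)) Φ := by
          ext1 i j
          rw [Matrix.sub_apply, Matrix.sum_apply]
          simp only [matD_apply, uD_apply, Matrix.smul_apply, smul_eq_mul, Derivation.leibniz]
          rw [hY, vf_X_none, vf_pderiv, hfield b (some (e c)) fun a => pderiv k (some a) (Φ i j),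
            mul_zero, add_zero, mul_sub, Finset.mul_sum]
          congr 1
          exact Finset.sum_congr rfl fun d _ => by ring
        -- curvature in the directions `Y_b` and `∂_{e c}`
        have h2 : matD Y (T (e c)) - matD (uD k (e c)) (Sm b) + (Sm b * T (e c) - T (e c) * Sm b) =
            - ∑ d, pderiv k (some (e c)) (f b d) • T (e d) := by
          apply X_none_smul_injective
          have h3 := hflat.contract_left (sliceField e f b) (e c)
          rw [H.contr, matD_smul, pderiv_X_of_ne (by simp), zero_smul, zero_add,
            sum_pderiv_sliceField b (pderiv k (some (e c))) T] at h3
          rw [smul_neg, ← neg_smul, ← h3, matD_uD]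
          simp only [smul_add, smul_sub, Matrix.smul_mul, Matrix.mul_smul]
          rfl
        simp only [map_add, map_sub, matD_mul, h1]
        rw [hYZ b hb c, hYΦ b hb, map_neg, matD_mul]
        have h4 := congrArg (fun M => M * Φ) h2
        simp only [add_mul, sub_mul, neg_mul, Finset.sum_mul, Matrix.smul_mul] at h4
        simp only [smul_sub, smul_add, Finset.sum_add_distrib, Finset.sum_sub_distrib,
          mul_neg, Finset.mul_sum, Matrix.mul_smul, mul_add, mul_sub]
        rw [← sub_eq_zero] at h4 ⊢
        rw [← h4]
        noncomm_ring
    have hWe : ∀ c, matD (uD k (e c)) Φ + T (e c) * Φ = Φ * Z (e c) :=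
      fun c => sub_eq_zero.mp (hW c)
    intro a
    change _ = Φ * Z a
    by_cases ha : a ∈ Set.range e
    · obtain ⟨c, rfl⟩ := ha
      exact hWe c
    -- the other directions are combinations of those of the slice and of the `Y_b`
    have h1 : matD (uD k a) Φ = (X none : MvPowerSeries (Option S) k) •
        matD (vf (sliceField e f a)) Φ - ∑ c, f a c • matD (uD k (e c)) Φ := by
      rw [matD_vf_sliceField, smul_add, Finset.smul_sum]
      simp only [matD_uD, smul_comm (f a _) (X none : MvPowerSeries (Option S) k)]
      abel
    have h2 : T a = (X none : MvPowerSeries (Option S) k) • Sm a - ∑ c, f a c • T (e c) := by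
      rw [← H.contr, sum_sliceField]
      abel
    have h3 : Z a = - ∑ c, f a c • Z (e c) := by
      simp only [hZ, Finset.smul_sum, smul_smul]
      rw [Finset.sum_comm, ← Finset.sum_neg_distrib]
      refine Finset.sum_congr rfl fun d _ => ?_
      have := hpY a ha d
      rw [vf_sliceField] at this
      rw [eq_neg_of_add_eq_zero_left this, neg_smul, Finset.sum_smul]
    rw [h1, h2, h3, hYΦ a ha, sub_mul, Matrix.smul_mul, Finset.sum_mul, mul_neg, Finset.mul_sum]
    simp only [Matrix.mul_smul, Matrix.smul_mul, ← hWe, smul_add, Finset.sum_add_distrib, smul_neg]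
    abel
  · have hW := huniq PUnit (fun _ => matD (uuD S q) Φ + A * Φ - Φ * A.map (subst Pm))
      (fun _ _ _ => 0) ?_ ?_ PUnit.unit
    · exact sub_eq_zero.mp hW
    · intro _ i j
      rw [add_sub_assoc, Matrix.add_apply]
      refine Ideal.add_mem _ ?_ (hmulV _ _ (fun i j => hsubstV _) i j)
      have h1 := pderiv_mem_vanIdeal (n := 1) none (hΦ1 i j) (by simp)
      have h2 : pderiv k none ((1 : Matrix J J (MvPowerSeries (Option S) k)) i j) = 0 :=
        congrFun (congrFun (matD_one (pderiv k none)) i) j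
      rw [map_sub, h2, sub_zero] at h1
      exact Ideal.mul_mem_left _ _ h1
    · intro b hb _
      set Y := vf (sliceField e f b) with hY
      have hu : ∀ a, pderiv k none (sliceField e f b a) = 0 := fun a => by
        rw [pderiv_sliceField]
        exact Finset.sum_eq_zero fun c _ => by rw [H.pderiv_f, ite_self]
      have h1 : matD Y (matD (uuD S q) Φ) = matD (uuD S q) (matD Y Φ) := by
        ext1 i j
        exact vf_uuD hu q _
      have h2 : matD (uuD S q) (Sm b) - matD Y A + (A * Sm b - Sm b * A) = 0 := by
        apply X_none_smul_injective
        have h3 := hflat.contract_u hu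
        rw [H.contr, matD_smul] at h3
        have h4 : uuD S q (X none : MvPowerSeries (Option S) k) = C q * X none * X none := by
          rw [uuD_apply, pderiv_X_self]; ring
        rw [h4, smul_smul, ← sub_eq_zero] at h3
        rw [smul_zero, ← h3]
        simp only [smul_add, smul_sub, Matrix.smul_mul, Matrix.mul_smul, hY]
        abel
      have h5 : matD Y (A.map (subst Pm)) = 0 := by
        ext1 i j
        exact hsubstY b hb _
      simp only [map_add, map_sub, matD_mul, h1, h5, mul_zero, add_zero, zero_smul,
        Finset.sum_const_zero, neg_zero]
      rw [hYΦ b hb, map_neg, matD_mul]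
      have h4 := congrArg (fun M => M * Φ) h2
      simp only [add_mul, sub_mul, zero_mul] at h4
      rw [← neg_eq_zero, ← h4]
      noncomm_ring

end SlicePullback

/-! ### The formal inverse function theorem -/

section FormalInverse

variable {k : Type*} [NormedField k] {τ : Type*}

theorem prod_pow_sub_mem_vanIdeal {P : τ → MvPowerSeries τ k}
    (hP : ∀ i, P i - X i ∈ vanIdeal k (fun _ => 1) 2) (d : τ →₀ ℕ) :
    (d.prod fun i n => P i ^ n) - (d.prod fun i n => (X i : MvPowerSeries τ k) ^ n) ∈
      vanIdeal k (fun _ => 1) (d.degree + 1) := by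
  classical
  have hX : ∀ i n, (X i : MvPowerSeries τ k) ^ n ∈ vanIdeal k (fun _ => 1) n := fun i n => by
    induction n with
    | zero => exact vanIdeal_zero
    | succ n ih =>
      rw [pow_succ]
      exact mul_mem_vanIdeal ih (X_mem_vanIdeal (w := fun _ => 1) i)
  have hP1 : ∀ i, P i ∈ vanIdeal k (fun _ => 1) 1 := fun i => by
    have h2 : (X i : MvPowerSeries τ k) ∈ vanIdeal k (fun _ => 1) 1 :=
      X_mem_vanIdeal (w := fun _ => 1) i
    have := Ideal.add_mem _ (vanIdeal_anti one_le_two (hP i)) h2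
    rwa [sub_add_cancel] at this
  have hpow : ∀ i n, P i ^ n ∈ vanIdeal k (fun _ => 1) n := fun i n => by
    induction n with
    | zero => exact vanIdeal_zero
    | succ n ih => rw [pow_succ]; exact mul_mem_vanIdeal ih (hP1 i)
  have hpd : ∀ i n, P i ^ n - X i ^ n ∈ vanIdeal k (fun _ => 1) (n + 1) := fun i n => by
    induction n with
    | zero => simp
    | succ n ih =>
      have : P i ^ (n + 1) - X i ^ (n + 1) = P i ^ n * (P i - X i) + (P i ^ n - X i ^ n) * X i := by
        ring
      rw [this]
      have h2 : P i ^ n * (P i - X i) ∈ vanIdeal k (fun _ => 1) (n + 2) :=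
        mul_mem_vanIdeal (hpow i n) (hP i)
      exact Ideal.add_mem _ h2
        (mul_mem_vanIdeal ih (X_mem_vanIdeal (w := fun _ => 1) i))
  have : ∀ s : Finset τ, (∏ i ∈ s, (X i : MvPowerSeries τ k) ^ d i) ∈
        vanIdeal k (fun _ => 1) (∑ i ∈ s, d i) ∧
      (∏ i ∈ s, P i ^ d i) - (∏ i ∈ s, (X i : MvPowerSeries τ k) ^ d i) ∈
        vanIdeal k (fun _ => 1) (∑ i ∈ s, d i + 1) := fun s => by
    induction s using Finset.induction_on with
    | empty => simpa using vanIdeal_zero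
    | insert a s ha ih =>
      simp only [Finset.prod_insert ha, Finset.sum_insert ha]
      refine ⟨mul_mem_vanIdeal (hX a _) ih.1, ?_⟩
      have h1 : P a ^ d a * (∏ i ∈ s, P i ^ d i) -
          X a ^ d a * (∏ i ∈ s, (X i : MvPowerSeries τ k) ^ d i) =
          P a ^ d a * ((∏ i ∈ s, P i ^ d i) - ∏ i ∈ s, (X i : MvPowerSeries τ k) ^ d i) +
          (P a ^ d a - X a ^ d a) * ∏ i ∈ s, (X i : MvPowerSeries τ k) ^ d i := by ring
      rw [h1]
      refine Ideal.add_mem _ ?_ ?_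
      · have := mul_mem_vanIdeal (hpow a (d a)) ih.2
        rwa [← add_assoc] at this
      · have := mul_mem_vanIdeal (hpd a (d a)) ih.1
        rwa [add_right_comm] at this
  exact (this d.support).2

variable [Fintype τ]

/-- Substitution of a system tangent to the identity increases the order of contact with the
identity. -/
theorem sub_subst_mem_vanIdeal {P : τ → MvPowerSeries τ k} (hP0 : ∀ i, constantCoeff (P i) = 0)
    (hP : ∀ i, P i - X i ∈ vanIdeal k (fun _ => 1) 2) {n : ℕ} {F : MvPowerSeries τ k}
    (hF : F ∈ vanIdeal k (fun _ => 1) n) :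
    F - subst P F ∈ vanIdeal k (fun _ => 1) (n + 1) := fun m hm => by
  have h1 := coeff_subst (a := (X : τ → MvPowerSeries τ k))
    (hasSubst_of_constantCoeff_zero fun i => constantCoeff_X i) F m
  rw [show subst (X : τ → MvPowerSeries τ k) F = F from congrFun subst_self F] at h1
  rw [map_sub, h1, coeff_subst (hasSubst_of_constantCoeff_zero hP0), sub_eq_zero]
  refine finsum_congr fun d => ?_
  by_cases hd : d.degree < n
  · have h2 : coeff d F = 0 := hF d ((weight_eq_degree d).trans_lt hd)
    rw [h2, zero_smul, zero_smul]
  · have h2 := prod_pow_sub_mem_vanIdeal hP d m (by omega)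
    rw [map_sub, sub_eq_zero] at h2
    rw [h2]

/-- Substitution of a system tangent to the identity is injective: it does not change the
homogeneous part of lowest degree. -/
theorem subst_injective {P : τ → MvPowerSeries τ k} (hP0 : ∀ i, constantCoeff (P i) = 0)
    (hP : ∀ i, P i - X i ∈ vanIdeal k (fun _ => 1) 2) {F G : MvPowerSeries τ k}
    (h : subst P F = subst P G) : F = G := by
  have hS := hasSubst_of_constantCoeff_zero hP0
  rw [← sub_eq_zero]
  refine eq_zero_of_forall_mem_vanIdeal (w := fun _ => 1) fun n => ?_
  induction n with
  | zero => exact vanIdeal_zero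
  | succ n ih =>
    have := sub_subst_mem_vanIdeal hP0 hP ih
    rwa [subst_sub hS, h, sub_self, sub_zero] at this

/-- The formal inverse function theorem for systems tangent to the identity; the inverse of an
integral system is integral. -/
theorem exists_formal_inverse [IsUltrametricDist k] {P : τ → MvPowerSeries τ k}
    (hPb : ∀ i, Bd 1 (P i)) (hP : ∀ i, P i - X i ∈ vanIdeal k (fun _ => 1) 2) :
    ∃ Q : τ → MvPowerSeries τ k, (∀ i, Bd 1 (Q i)) ∧ (∀ i, constantCoeff (Q i) = 0) ∧
      (∀ i, subst P (Q i) = X i) ∧ ∀ i, subst Q (P i) = X i := by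
  have hP0 : ∀ i, constantCoeff (P i) = 0 := fun i => by
    have := hP i 0 (by simp)
    rwa [map_sub, coeff_zero_eq_constantCoeff_apply, coeff_zero_eq_constantCoeff_apply,
      constantCoeff_X, sub_zero] at this
  have hS := hasSubst_of_constantCoeff_zero hP0
  obtain ⟨Q, hQ, hQb⟩ := exists_fixedPoint (r := τ) (s := Unit) (fun _ : τ => 1)
    (fun F => Matrix.of fun i j => X i + (F i j - subst P (F i j)))
    (by
      intro n F G h i j
      have := sub_subst_mem_vanIdeal hP0 hP (h i j)
      rw [subst_sub hS] at this
      simp only [Matrix.of_apply]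
      rwa [add_sub_add_left_eq_sub, sub_sub_sub_comm])
    1 zero_le_one
    (by
      intro F hF i j
      exact (Bd.X i).add ((hF i j).sub (Bd.subst hPb hP0 (hF i j))))
  have h1 : ∀ i, subst P (Q i ()) = X i := by
    intro i
    have := congrFun (congrFun hQ i) ()
    simp only [Matrix.of_apply] at this
    linear_combination -this
  have h0 : ∀ i, constantCoeff (Q i ()) = 0 := by
    intro i
    have h2 := sub_subst_mem_vanIdeal hP0 hP (n := 0) (F := Q i ()) vanIdeal_zero 0 (by simp)
    rw [h1, map_sub, coeff_zero_eq_constantCoeff_apply, coeff_zero_eq_constantCoeff_apply,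
      constantCoeff_X, sub_zero] at h2
    exact h2
  refine ⟨fun i => Q i (), fun i => hQb i (), h0, h1, fun i => ?_⟩
  apply subst_injective hP0 hP
  rw [subst_comp_subst_apply (hasSubst_of_constantCoeff_zero h0) hS, subst_X hS]
  simp only [h1]
  exact congrFun subst_self _

end FormalInverse

/-! ### The formal spectral decomposition -/

section FormalDecomposition

section Blocks

variable {I : Type*} {J : I → Type*}

/-- The diagonal block of index `j` of a matrix. -/
def blk {R : Type*} (j : I) (M : Matrix (Σ i, J i) (Σ i, J i) R) : Matrix (J j) (J j) R :=
  M.submatrix (Sigma.mk j) (Sigma.mk j)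

theorem blk_apply {R : Type*} (j : I) (M : Matrix (Σ i, J i) (Σ i, J i) R) (p q : J j) :
    blk j M p q = M ⟨j, p⟩ ⟨j, q⟩ := rfl

theorem IsBD.eq_blockDiagonal' [DecidableEq I] {R : Type*} [CommRing R]
    {M : Matrix (Σ i, J i) (Σ i, J i) R} (hM : IsBD Sigma.fst M) :
    M = Matrix.blockDiagonal' fun j => blk j M := by
  ext1 ⟨i, p⟩ ⟨j, q⟩
  rw [Matrix.blockDiagonal'_apply]
  split_ifs with h
  · dsimp only at h
    subst h
    rfl
  · exact hM _ _ h

theorem IsBD.sum_row [Fintype I] [∀ i, Fintype (J i)] {R : Type*} [CommRing R]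
    {M : Matrix (Σ i, J i) (Σ i, J i) R} (hM : IsBD Sigma.fst M) (v : (Σ i, J i) → R) (j : I)
    (p : J j) : ∑ s, M ⟨j, p⟩ s * v s = ∑ q, M ⟨j, p⟩ ⟨j, q⟩ * v ⟨j, q⟩ := by
  rw [Fintype.sum_sigma, Finset.sum_eq_single_of_mem j (Finset.mem_univ _)]
  intro i _ hi
  exact Finset.sum_eq_zero fun q _ => by rw [hM _ _ (Ne.symm hi), zero_mul]

theorem IsBD.blk_mul [Fintype I] [∀ i, Fintype (J i)] {R : Type*} [CommRing R]
    {M : Matrix (Σ i, J i) (Σ i, J i) R} (hM : IsBD Sigma.fst M)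
    (N : Matrix (Σ i, J i) (Σ i, J i) R) (j : I) : blk j (M * N) = blk j M * blk j N := by
  ext p q
  rw [blk_apply, Matrix.mul_apply, Matrix.mul_apply, hM.sum_row (fun s => N s ⟨j, q⟩)]
  rfl

theorem IsBD.blk_mulVec [Fintype I] [∀ i, Fintype (J i)] {R : Type*} [CommRing R]
    {M : Matrix (Σ i, J i) (Σ i, J i) R} (hM : IsBD Sigma.fst M) (v : (Σ i, J i) → R) (j : I)
    (p : J j) : (blk j M).mulVec (fun q => v ⟨j, q⟩) p = M.mulVec v ⟨j, p⟩ :=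
  (hM.sum_row v j p).symm

theorem matD_blockDiagonal' [DecidableEq I] {k : Type*} [NormedField k] {σ : Type*}
    (D : Derivation k (MvPowerSeries σ k) (MvPowerSeries σ k))
    (M : ∀ i, Matrix (J i) (J i) (MvPowerSeries σ k)) :
    matD D (Matrix.blockDiagonal' M) = Matrix.blockDiagonal' fun i => matD D (M i) :=
  Matrix.blockDiagonal'_map M D (map_zero D)

theorem IsFlat.blk [Fintype I] [∀ i, Fintype (J i)] {k : Type*} [NormedField k] {q : k}
    {T : (Σ i, J i) → Matrix (Σ i, J i) (Σ i, J i) (MvPowerSeries (Option (Σ i, J i)) k)}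
    {A : Matrix (Σ i, J i) (Σ i, J i) (MvPowerSeries (Option (Σ i, J i)) k)}
    (h : IsFlat q T A) (hT : ∀ a, IsBD Sigma.fst (T a)) (hA : IsBD Sigma.fst A) (j : I) :
    IsFlat q (fun a => blk j (T a)) (blk j A) where
  base a b := by
    have := congrArg (RigidF.blk j) (h.base a b)
    rw [← (hT a).blk_mul, ← (hT b).blk_mul]
    exact this
  u a := by
    have := congrArg (RigidF.blk j) (h.u a)
    rw [← (hT a).blk_mul, ← hA.blk_mul]
    exact this

end Blocks

variable {k : Type*} [NormedField k] {I : Type*} [Fintype I] [DecidableEq I] {J : I → Type*}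
  [∀ i, Fintype (J i)] [∀ i, DecidableEq (J i)]

variable [IsUltrametricDist k]

/-- The formal spectral decomposition, with integral solutions: a flat connection with
block diagonal `A₀ = A(0, 0)` is, after a gauge transformation `Φ`, the direct sum of the pullbacks
along `p` of its diagonal blocks restricted to the slices. -/
theorem exists_formal_decomposition (hk : ∀ n : ℕ, n ≠ 0 → ‖(n : k)‖ = 1) {q : k}
    {T : (Σ i, J i) → Matrix (Σ i, J i) (Σ i, J i) (MvPowerSeries (Option (Σ i, J i)) k)}
    {A : Matrix (Σ i, J i) (Σ i, J i) (MvPowerSeries (Option (Σ i, J i)) k)}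
    (hflat : IsFlat q T A) {h : (Σ i, J i) → k}
    {T₀ : (Σ i, J i) → Matrix (Σ i, J i) (Σ i, J i) k} {A₀ : Matrix (Σ i, J i) (Σ i, J i) k}
    {L : Matrix (Σ i, J i) (Σ i, J i) k →ₗ[k] Matrix (Σ i, J i) (Σ i, J i) k}
    {M η b Ct : ℝ} (hL : IsSylvesterInverse Sigma.fst A₀ L M) (hA₀ : IsBD Sigma.fst A₀)
    (hη : 0 ≤ η) (hM : 0 ≤ M) (hMb : M * b ≤ η) (hMq : M * ‖q‖ ≤ 1) (hCt : 1 ≤ Ct)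
    (hηC : η * Ct ^ 3 ≤ 1)
    (hcyc : ∀ a s, (T₀ a).mulVec h s = if s = a then 1 else 0)
    (hT₀ : ∀ a i j, ‖T₀ a i j‖ ≤ Ct) (hh : ∀ s, ‖h s‖ ≤ Ct)
    (hTb : ∀ a i j, Bd η (T a i j - C (T₀ a i j)))
    (hT0 : ∀ a i j, T a i j - C (T₀ a i j) ∈ vanIdeal k (fun _ => 1) 1)
    (hAb : ∀ i j, Bd b (A i j - C (A₀ i j)))
    (hA0 : ∀ i j, A i j - C (A₀ i j) ∈ vanIdeal k (fun _ => 1) 1) :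
    ∃ (p : (Σ i, J i) → MvPowerSeries (Option (Σ i, J i)) k)
      (Φ Ψ : Matrix (Σ i, J i) (Σ i, J i) (MvPowerSeries (Option (Σ i, J i)) k))
      (Tb : ∀ j, (Σ i, J i) → Matrix (J j) (J j) (MvPowerSeries (Option (Σ i, J i)) k))
      (Ab : ∀ j, Matrix (J j) (J j) (MvPowerSeries (Option (Σ i, J i)) k))
      (N N' : ∀ j, Matrix (J j) (J j) (MvPowerSeries (Option (Σ i, J i)) k)),
      (∀ s, Bd 1 (p s)) ∧ (∀ s, pderiv k none (p s) = 0) ∧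
      (∀ s, p s - X (some s) ∈ vanIdeal k (fun _ => 1) 2) ∧
      (∀ i j, Bd 1 (Φ i j)) ∧ (∀ i j, Bd 1 (Ψ i j)) ∧ Φ * Ψ = 1 ∧ Ψ * Φ = 1 ∧
      Φ.map constantCoeff = 1 ∧
      (∀ j, IsFlat q (Tb j) (Ab j)) ∧
      (∃ D, ∀ j, (∀ a i i', Bd D (Tb j a i i')) ∧ ∀ i i', Bd D (Ab j i i')) ∧
      (∀ j i c, N j i c = (Tb j ⟨j, c⟩).mulVec (fun s => C (h ⟨j, s⟩)) i) ∧
      (∀ j i c, Bd 1 (N j i c)) ∧ (∀ j i c, Bd 1 (N' j i c)) ∧ (∀ j, N j * N' j = 1) ∧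
      (∀ a, matD (uD k a) Φ + T a * Φ = Φ * Matrix.blockDiagonal' fun j =>
        ∑ c, pderiv k (some a) (p ⟨j, c⟩) • (Tb j ⟨j, c⟩).map
          (subst (sliceMap (Sigma.mk j) fun c => p ⟨j, c⟩))) ∧
      matD (uuD _ q) Φ + A * Φ = Φ * Matrix.blockDiagonal' fun j =>
        (Ab j).map (subst (sliceMap (Sigma.mk j) fun c => p ⟨j, c⟩)) := by
  have hCt0 : 0 ≤ Ct := zero_le_one.trans hCt
  have hC2 : Ct ^ 2 ≤ Ct ^ 3 := pow_le_pow_right₀ hCt (by norm_num)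
  have hC1 : Ct ≤ Ct ^ 2 := by simpa using pow_le_pow_right₀ hCt (show 1 ≤ 2 by norm_num)
  have hε1 : η * Ct ^ 2 ≤ 1 := (mul_le_mul_of_nonneg_left hC2 hη).trans hηC
  have hηC1 : η * Ct ≤ 1 := (mul_le_mul_of_nonneg_left hC1 hη).trans hε1
  have hηηC : η ≤ η * Ct := le_mul_of_one_le_right hη hCt
  have hη1 : η ≤ 1 := hηηC.trans hηC1
  -- the dimension of the fibre may be zero, hence the maximum
  have hAb' : ∀ i j, Bd (max b 0)
      ((A - A₀.map (C (σ := Option (Σ i, J i)))) i j) := fun i j =>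
    (hAb i j).mono (le_max_left b 0)
  have hMb' : M * max b 0 ≤ η := by
    rw [mul_max_of_nonneg _ _ hM, mul_zero]
    exact max_le hMb hη
  obtain ⟨Xm, B', hXb, hX0, hB'bd, hB'b, hB'0, hXeq⟩ := exists_blockDiagonal_gauge hL hη hη1
    (le_max_right b 0) hM hMb' hMq hAb' hA0
  rw [show A₀.map C + (A - A₀.map C) = A by abel] at hXeq
  have hA₀' : IsBD Sigma.fst (A₀.map (C (σ := Option (Σ i, J i)))) :=
    fun p q h => by simp [hA₀ p q h]
  set Φ₁ := 1 + Xm with hΦ₁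
  have hΦ₁b : ∀ i j, Bd 1 (Φ₁ i j) := fun i j => (Bd.matrix_one i j).add ((hXb i j).mono hη1)
  have hΦ₁0 : Φ₁.map constantCoeff = 1 := by
    ext i j
    rw [Matrix.map_apply, hΦ₁, Matrix.add_apply, map_add, mem_vanIdeal_one_iff.mp (hX0 i j),
      add_zero, Matrix.one_apply, Matrix.one_apply]
    split_ifs <;> simp
  obtain ⟨Ψ₁, hΦΨ₁, hΨΦ₁, hΨ₁b, hΨ₁0⟩ := exists_inverse Φ₁ hΦ₁b hΦ₁0
  set T' : (Σ i, J i) → Matrix (Σ i, J i) (Σ i, J i) (MvPowerSeries (Option (Σ i, J i)) k) :=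
    fun a => Ψ₁ * (matD (uD k a) Φ₁ + T a * Φ₁) with hT'
  set A' := A₀.map C + B' with hA'
  have hT'eq : ∀ a, matD (uD k a) Φ₁ + T a * Φ₁ = Φ₁ * T' a := fun a => by
    rw [hT', ← Matrix.mul_assoc, hΦΨ₁, Matrix.one_mul]
  have hflat' : IsFlat q T' A' := hflat.gauge hΨΦ₁ hT'eq hXeq
  have hT'bd : ∀ a, IsBD Sigma.fst (T' a) := hflat'.isBD hL hA₀ hB'bd hB'0
  have hA'bd : IsBD Sigma.fst A' := hA₀'.add hB'bd
  set T₀C : (Σ i, J i) → Matrix (Σ i, J i) (Σ i, J i) (MvPowerSeries (Option (Σ i, J i)) k) :=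
    fun a => (T₀ a).map C with hT₀Cdef
  have hR' : ∀ a, T' a - T₀C a = Ψ₁ * (matD (uD k a) Xm + T₀C a * Xm -
      Xm * T₀C a + (T a - T₀C a) * Φ₁) := by
    intro a
    have h1 : matD (uD k a) Φ₁ = matD (uD k a) Xm := by rw [hΦ₁, map_add, matD_one, zero_add]
    have h2 : T₀C a = Ψ₁ * (Φ₁ * T₀C a) := by
      rw [← Matrix.mul_assoc, hΨΦ₁, Matrix.one_mul]
    conv_lhs => rw [h2]
    rw [hT', ← Matrix.mul_sub, h1, hΦ₁]
    congr 1
    noncomm_ring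
  have hT₀C : ∀ a i j, Bd Ct (T₀C a i j) :=
    fun a i j => Bd.C (hT₀ a i j)
  have hR'b : ∀ a i j, Bd (η * Ct) ((T' a - T₀C a) i j) := by
    intro a i j
    rw [hR', ← one_mul (η * Ct)]
    refine Bd.matrix_mul zero_le_one (mul_nonneg hη hCt0) hΨ₁b (fun i j => ?_) i j
    refine ((Bd.add ?_ ?_).sub ?_).add ?_
    · exact ((hXb i j).uD a).mono hηηC
    · have := Bd.matrix_mul hCt0 hη (hT₀C a) hXb i j
      rwa [mul_comm] at this
    · exact Bd.matrix_mul hη hCt0 hXb (hT₀C a) i j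
    · have := Bd.matrix_mul hη zero_le_one (hTb a) hΦ₁b i j
      rw [mul_one] at this
      exact this.mono hηηC
  have hR'0 : ∀ a i j, (T' a - T₀C a) i j ∈ vanIdeal k (fun _ => 1) 1 := by
    intro a i j
    rw [hR']
    refine mem_vanIdeal_matrix_mul (a := 0) (b := 1) (M := Ψ₁) (fun _ _ => vanIdeal_zero)
      (fun i j => ?_) i j
    refine Ideal.add_mem _ (Ideal.sub_mem _ (Ideal.add_mem _ ?_ ?_) ?_) ?_
    · exact uD_mem_vanIdeal (k := k) a
    · exact mem_vanIdeal_matrix_mul (a := 0) (fun _ _ => vanIdeal_zero) hX0 i j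
    · exact mem_vanIdeal_matrix_mul (b := 0) hX0 (fun _ _ => vanIdeal_zero) i j
    · exact mem_vanIdeal_matrix_mul (b := 0) (hT0 a) (fun _ _ => vanIdeal_zero) i j
  have hT'b : ∀ a i j, Bd Ct (T' a i j) := fun a i j => by
    have := ((hR'b a i j).mono (hηC1.trans hCt)).add (hT₀C a i j)
    rwa [Matrix.sub_apply, sub_add_cancel] at this
  have hT'1 : ∀ a i j m, m ≠ 0 → ‖coeff m (T' a i j)‖ ≤ 1 := by
    intro a i j m hm
    have := (hR'b a i j).mono hηC1 m
    have h1 : coeff m (T₀C a i j) = 0 := (coeff_C m _).trans (if_neg hm)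
    rwa [Matrix.sub_apply, map_sub, h1, sub_zero] at this
  -- the values of the connection on the cyclic vector
  have hT'h : ∀ a s, (T' a).mulVec (fun s => C (h s)) s =
      (if s = a then 1 else 0) + (T' a - T₀C a).mulVec (fun s => C (h s)) s := by
    intro a s
    have h1 : (T₀C a).mulVec (fun s => C (h s)) s =
        if s = a then 1 else 0 := by
      have h2 := congrArg (C (σ := Option (Σ i, J i))) (hcyc a s)
      simp only [Matrix.mulVec, dotProduct, map_sum, map_mul] at h2 ⊢
      rw [show (if s = a then (1 : MvPowerSeries (Option (Σ i, J i)) k) else 0) =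
        C (if s = a then 1 else 0) by split_ifs <;> simp]
      exact h2
    rw [← h1, Matrix.sub_mulVec, Pi.sub_apply]
    ring
  have hRh : ∀ a s, Bd (η * Ct ^ 2) ((T' a - T₀C a).mulVec (fun s => C (h s)) s) := by
    intro a s
    rw [Matrix.mulVec, dotProduct]
    refine Bd.sum (by positivity) _ fun l _ => ?_
    rw [pow_two, ← mul_assoc]
    exact (hR'b a s l).mul (Bd.C (hh l))
  have hRh0 : ∀ a s, constantCoeff ((T' a - T₀C a).mulVec (fun s => C (h s)) s) = 0 := by
    intro a s
    rw [Matrix.mulVec, dotProduct, map_sum]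
    exact Finset.sum_eq_zero fun l _ => by
      rw [map_mul, mem_vanIdeal_one_iff.mp (hR'0 a s l), zero_mul]
  have hblkh : ∀ j a i, (blk j (T' a)).mulVec (fun s => C (h ⟨j, s⟩)) i =
      (if (⟨j, i⟩ : Σ i, J i) = a then 1 else 0) +
        (T' a - T₀C a).mulVec (fun s => C (h s)) ⟨j, i⟩ := fun j a i => by
    rw [← hT'h]
    exact (hT'bd a).blk_mulVec (fun s => C (h s)) j i
  -- the `j`-th block of the cyclic vector is cyclic for the `j`-th block of the connection
  set N : ∀ j, Matrix (J j) (J j) (MvPowerSeries (Option (Σ i, J i)) k) := fun j =>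
    Matrix.of fun i c => (blk j (T' ⟨j, c⟩)).mulVec (fun s => C (h ⟨j, s⟩)) i
  have hNapp : ∀ j i c, N j i c = (if i = c then 1 else 0) +
      (T' ⟨j, c⟩ - T₀C ⟨j, c⟩).mulVec (fun s => C (h s)) ⟨j, i⟩ := fun j i c => by
    refine (hblkh j ⟨j, c⟩ i).trans ?_
    simp only [Sigma.mk.injEq, heq_eq_eq, true_and]
  have hNb : ∀ j i c, Bd 1 (N j i c) := by
    intro j i c
    rw [hNapp]
    refine Bd.add ?_ ((hRh _ _).mono hε1)
    split_ifs
    · exact Bd.one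
    · exact Bd.zero zero_le_one
  have hN0 : ∀ j, (N j).map constantCoeff = 1 := by
    intro j
    ext i c
    rw [Matrix.map_apply, hNapp, map_add, hRh0, add_zero, Matrix.one_apply]
    split_ifs <;> simp
  have hinj : ∀ j : I, Function.Injective (Sigma.mk j : J j → Σ i, J i) :=
    fun j => sigma_mk_injective
  have hblk : ∀ j, ∃ (p : J j → MvPowerSeries (Option (Σ i, J i)) k)
      (Φ Ψ : Matrix (J j) (J j) (MvPowerSeries (Option (Σ i, J i)) k)),
      (∀ c, Bd 1 (p c)) ∧ (∀ c, pderiv k none (p c) = 0) ∧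
      (∀ c, p c - X (some ⟨j, c⟩) ∈ vanIdeal k (fun _ => 1) 2) ∧
      (∀ i j, Bd 1 (Φ i j)) ∧ (∀ i j, Bd 1 (Ψ i j)) ∧ Φ * Ψ = 1 ∧ Ψ * Φ = 1 ∧
      Φ.map constantCoeff = 1 ∧
      (∀ a, matD (uD k a) Φ + blk j (T' a) * Φ = Φ * ∑ c, pderiv k (some a) (p c) •
        (blk j (T' ⟨j, c⟩)).map (subst (sliceMap (Sigma.mk j) p))) ∧
      matD (uuD _ q) Φ + blk j A' * Φ = Φ * (blk j A').map (subst (sliceMap (Sigma.mk j) p)) := by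
    intro j
    have hfl := hflat'.blk hT'bd hA'bd j
    obtain ⟨f, Sm, hf⟩ := exists_sliceStructure (e := (Sigma.mk j : J j → Σ i, J i)) hfl
      (fun s => h ⟨j, s⟩) (N := N j) (fun i c => rfl) (hNb j) (hN0 j) (ε := η * Ct ^ 2) (Ct := Ct)
      hε1 (by rw [mul_assoc, ← pow_succ]; exact hηC)
      (by
        intro b hb i
        have h1 : ¬ ((⟨j, i⟩ : Σ i, J i) = b) := fun h => hb ⟨i, h⟩
        rw [hblkh, if_neg h1, zero_add]
        exact ⟨hRh _ _, hRh0 _ _⟩)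
      (fun a i i' => hT'b a _ _) (fun a i i' m hm => hT'1 a _ _ m hm)
    exact exists_pullback_frame hk (hinj j) hfl hf
  choose p Φ₂ Ψ₂ hpb hpu hp2 hΦb hΨb hΦΨ hΨΦ hΦ0 hΦT hΦA using hblk
  choose N' hNN' _ hN'b _ using fun j => exists_inverse (N j) (hNb j) (hN0 j)
  have hbd1 : ∀ F : ∀ j, Matrix (J j) (J j) (MvPowerSeries (Option (Σ i, J i)) k),
      (∀ j i i', Bd 1 (F j i i')) → ∀ i i', Bd 1 (Matrix.blockDiagonal' F i i') := by
    intro F hF i i'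
    rw [Matrix.blockDiagonal'_apply]
    split_ifs
    · exact hF _ _ _
    · exact Bd.zero zero_le_one
  -- the composite of the two gauge transformations
  have hgauge : ∀ (D : Derivation k (MvPowerSeries (Option (Σ i, J i)) k)
      (MvPowerSeries (Option (Σ i, J i)) k))
      (M M' : Matrix (Σ i, J i) (Σ i, J i) (MvPowerSeries (Option (Σ i, J i)) k))
      (M'' : ∀ j, Matrix (J j) (J j) (MvPowerSeries (Option (Σ i, J i)) k)),
      IsBD Sigma.fst M' → matD D Φ₁ + M * Φ₁ = Φ₁ * M' →
      (∀ j, matD D (Φ₂ j) + blk j M' * Φ₂ j = Φ₂ j * M'' j) →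
      matD D (Φ₁ * Matrix.blockDiagonal' Φ₂) + M * (Φ₁ * Matrix.blockDiagonal' Φ₂) =
        Φ₁ * Matrix.blockDiagonal' Φ₂ * Matrix.blockDiagonal' M'' := by
    intro D M M' M'' hM' h1 h2
    rw [Matrix.mul_assoc, ← Matrix.blockDiagonal'_mul, ← funext h2]
    have h3 : Matrix.blockDiagonal' (fun j => matD D (Φ₂ j) + blk j M' * Φ₂ j) =
        matD D (Matrix.blockDiagonal' Φ₂) + M' * Matrix.blockDiagonal' Φ₂ := by
      conv_rhs => rw [hM'.eq_blockDiagonal']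
      rw [matD_blockDiagonal', ← Matrix.blockDiagonal'_mul, ← Matrix.blockDiagonal'_add]
      rfl
    rw [h3, matD_mul, Matrix.mul_add, ← Matrix.mul_assoc Φ₁ M', ← h1, Matrix.add_mul]
    noncomm_ring
  refine ⟨fun s => p s.1 s.2, Φ₁ * Matrix.blockDiagonal' Φ₂, Matrix.blockDiagonal' Ψ₂ * Ψ₁,
    fun j a => blk j (T' a), fun j => blk j A', N, N', fun s => hpb _ _, fun s => hpu _ _,
    fun s => hp2 _ _, ?_, ?_, ?_, ?_, ?_, fun j => hflat'.blk hT'bd hA'bd j, ?_, fun j i c => rfl,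
    hNb, hN'b, hNN', fun a => hgauge _ _ _ _ (hT'bd a) (hT'eq a) fun j => hΦT j a,
    hgauge _ _ _ _ hA'bd hXeq hΦA⟩
  · intro i j
    have := Bd.matrix_mul zero_le_one zero_le_one hΦ₁b (hbd1 Φ₂ hΦb) i j
    rwa [one_mul] at this
  · intro i j
    have := Bd.matrix_mul zero_le_one zero_le_one (hbd1 Ψ₂ hΨb) hΨ₁b i j
    rwa [one_mul] at this
  · rw [Matrix.mul_assoc, ← Matrix.mul_assoc (Matrix.blockDiagonal' Φ₂),
      ← Matrix.blockDiagonal'_mul, funext hΦΨ]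
    rw [show Matrix.blockDiagonal' (fun j => (1 : Matrix (J j) (J j)
      (MvPowerSeries (Option (Σ i, J i)) k))) = 1 from Matrix.blockDiagonal'_one, Matrix.one_mul,
      hΦΨ₁]
  · rw [Matrix.mul_assoc, ← Matrix.mul_assoc Ψ₁, hΨΦ₁, Matrix.one_mul,
      ← Matrix.blockDiagonal'_mul, funext hΨΦ]
    exact Matrix.blockDiagonal'_one
  · rw [Matrix.map_mul, hΦ₁0, Matrix.one_mul, Matrix.blockDiagonal'_map _ _ (map_zero _)]
    rw [show (fun j => (Φ₂ j).map constantCoeff) = fun j => (1 : Matrix (J j) (J j) k) from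
      funext hΦ0]
    exact Matrix.blockDiagonal'_one
  · obtain ⟨D, hD⟩ := (Set.finite_range fun x : (Σ i, J i) × (Σ i, J i) => ‖A₀ x.1 x.2‖).bddAbove
    refine ⟨max Ct (max D (max b 0)), fun j => ⟨fun a i i' => (hT'b a _ _).mono (le_max_left _ _),
      fun i i' => ?_⟩⟩
    change Bd _ (C (A₀ ⟨j, i⟩ ⟨j, i'⟩) + B' ⟨j, i⟩ ⟨j, i'⟩)
    refine Bd.add ?_ ((hB'b _ _).mono ?_)
    · exact Bd.C ((hD ⟨(⟨j, i⟩, ⟨j, i'⟩), rfl⟩).trans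
        ((le_max_left _ _).trans (le_max_right _ _)))
    · exact (le_max_right _ _).trans (le_max_right _ _)

end FormalDecomposition

/-! ### Values of bounded power series -/

section Evaluation

open Filter Topology

variable {k K : Type*} [NontriviallyNormedField k] [NontriviallyNormedField K] [NormedAlgebra k K]
  {σ : Type*}

theorem norm_aeval_le [IsUltrametricDist K] {P : MvPolynomial σ k} {C ρ : ℝ} {N : ℕ} {x : σ → K}
    (hP : Bd C (P : MvPowerSeries σ k))
    (hN : (P : MvPowerSeries σ k) ∈ vanIdeal k (fun _ => 1) N) (hρ : ρ ≤ 1) (hρ0 : 0 ≤ ρ)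
    (hx : ∀ i, ‖x i‖ ≤ ρ) : ‖MvPolynomial.aeval x P‖ ≤ C * ρ ^ N := by
  have hC := hP.nonneg
  rw [MvPolynomial.aeval_def, MvPolynomial.eval₂_eq]
  refine IsUltrametricDist.norm_sum_le_of_forall_le_of_nonneg (by positivity) fun d hd => ?_
  rw [norm_mul, norm_algebraMap', norm_prod]
  refine mul_le_mul ?_ ?_ (by positivity) hC
  · simpa using hP d
  · have h1 : ∏ i ∈ d.support, ‖x i ^ d i‖ ≤ ρ ^ d.degree := by
      rw [show d.degree = ∑ i ∈ d.support, d i from rfl, ← Finset.prod_pow_eq_pow_sum]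
      refine Finset.prod_le_prod (fun i _ => norm_nonneg _) fun i _ => ?_
      rw [norm_pow]
      exact pow_le_pow_left₀ (norm_nonneg _) (hx i) _
    refine h1.trans (pow_le_pow_of_le_one hρ0 hρ ?_)
    by_contra hlt
    rw [MvPolynomial.mem_support_iff, ← MvPolynomial.coeff_coe] at hd
    exact hd (hN d ((weight_eq_degree d).trans_lt (not_le.mp hlt)))

theorem coe_sub_mvPolynomial (P Q : MvPolynomial σ k) :
    ((P - Q : MvPolynomial σ k) : MvPowerSeries σ k) = P - Q :=
  map_sub (MvPolynomial.coeToMvPowerSeries.ringHom (R := k) (σ := σ)) P Q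

theorem exists_bd_coe (P : MvPolynomial σ k) : ∃ c, Bd c (P : MvPowerSeries σ k) := by
  obtain ⟨c, hc⟩ := (P.support.finite_toSet.image fun m => ‖P.coeff m‖).bddAbove
  refine ⟨max c 0, fun m => ?_⟩
  by_cases hm : m ∈ P.support
  · exact (hc ⟨m, hm, by simp⟩).trans (le_max_left _ _)
  · rw [MvPolynomial.notMem_support_iff] at hm
    simp [hm]

variable [Finite σ]

/-- The value at `x` of the power series `F`: the limit of the values of its truncations. It is
meaningful if the coefficients of `F` are bounded and all `‖x i‖ < 1`. -/
def ev (x : σ → K) (F : MvPowerSeries σ k) : K :=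
  limUnder atTop fun N => MvPolynomial.aeval x (truncTotal N F)

theorem Bd.truncTotal {C : ℝ} {F : MvPowerSeries σ k} (hF : Bd C F) (N : ℕ) :
    Bd C (truncTotal N F : MvPowerSeries σ k) := fun m => by
  rw [MvPolynomial.coeff_coe, coeff_truncTotal_eq_ite]
  split_ifs
  · exact hF m
  · simpa using hF.nonneg

theorem truncTotal_mem_vanIdeal {F : MvPowerSeries σ k} {n : ℕ}
    (hF : F ∈ vanIdeal k (fun _ => 1) n) (N : ℕ) :
    (truncTotal N F : MvPowerSeries σ k) ∈ vanIdeal k (fun _ => 1) n := fun m hm => by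
  rw [MvPolynomial.coeff_coe, coeff_truncTotal_eq_ite, hF m hm, ite_self]

theorem exists_norm_le_lt_one {x : σ → K} (hx : ∀ i, ‖x i‖ < 1) :
    ∃ ρ : ℝ, 0 ≤ ρ ∧ ρ < 1 ∧ ∀ i, ‖x i‖ ≤ ρ := by
  have := Fintype.ofFinite σ
  refine ⟨‖x‖, norm_nonneg _, ?_, norm_le_pi_norm x⟩
  exact (pi_norm_lt_iff one_pos).mpr hx

variable [IsUltrametricDist K] [IsUltrametricDist k] [CompleteSpace k] [Algebra.IsAlgebraic k K]
  {C D : ℝ} {F G : MvPowerSeries σ k} {x : σ → K}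

/-- The truncations of a bounded power series converge on the open unit polydisc, although `K` need
not be complete: their values lie in a finite extension of `k`. -/
theorem tendsto_truncTotal (hF : Bd C F) (hx : ∀ i, ‖x i‖ < 1) :
    Tendsto (fun N => MvPolynomial.aeval x (truncTotal N F)) atTop (𝓝 (ev x F)) := by
  obtain ⟨ρ, hρ0, hρ, hxρ⟩ := exists_norm_le_lt_one hx
  refine tendsto_nhds_limUnder ?_
  -- the algebra generated by the coordinates of `x` is finite over `k`, hence complete
  let V : Submodule k K := Subalgebra.toSubmodule (Algebra.adjoin k (Set.range x))
  have hV : FiniteDimensional k V := Module.Finite.iff_fg.mpr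
    (fg_adjoin_of_finite (Set.finite_range x) fun y _ => Algebra.IsIntegral.isIntegral y)
  have hc : IsComplete (V : Set K) := V.complete_of_finiteDimensional
  obtain ⟨y, -, hy⟩ := cauchySeq_tendsto_of_isComplete hc
    (u := fun N => MvPolynomial.aeval x (truncTotal N F))
    (fun N => by
      change _ ∈ Algebra.adjoin k (Set.range x)
      rw [Algebra.adjoin_range_eq_range_aeval]
      exact ⟨_, rfl⟩)
    (cauchySeq_of_le_geometric ρ C hρ fun N => by
      rw [dist_eq_norm, ← map_sub]
      refine norm_aeval_le ?_ ?_ hρ.le hρ0 hxρ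
      · rw [coe_sub_mvPolynomial]
        exact (hF.truncTotal _).sub (hF.truncTotal _)
      · rw [coe_sub_mvPolynomial, ← sub_sub_sub_cancel_left _ _ F]
        exact Ideal.sub_mem _ (vanIdeal_anti N.le_succ (sub_truncTotal_mem F (N + 1)))
          (sub_truncTotal_mem F N))
  exact ⟨y, hy⟩

/-- The values of bounded polynomials which converge formally to `F` converge to the value
of `F`. -/
theorem tendsto_ev (hF : Bd C F) (hx : ∀ i, ‖x i‖ < 1) {P : ℕ → MvPolynomial σ k}
    (hP : ∀ N, Bd C (P N : MvPowerSeries σ k))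
    (hv : ∀ N, F - (P N : MvPowerSeries σ k) ∈ vanIdeal k (fun _ => 1) N) :
    Tendsto (fun N => MvPolynomial.aeval x (P N)) atTop (𝓝 (ev x F)) := by
  obtain ⟨ρ, hρ0, hρ, hxρ⟩ := exists_norm_le_lt_one hx
  have h1 : Tendsto (fun N => MvPolynomial.aeval x (P N) -
      MvPolynomial.aeval x (truncTotal N F)) atTop (𝓝 0) := by
    refine squeeze_zero_norm (a := fun N => C * ρ ^ N) (fun N => ?_) ?_
    · rw [← map_sub]
      refine norm_aeval_le ?_ ?_ hρ.le hρ0 hxρ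
      · rw [coe_sub_mvPolynomial]
        exact (hP _).sub (hF.truncTotal _)
      · rw [coe_sub_mvPolynomial, ← sub_sub_sub_cancel_left _ _ F]
        exact Ideal.sub_mem _ (sub_truncTotal_mem F N) (hv N)
    · simpa using (tendsto_pow_atTop_nhds_zero_of_lt_one hρ0 hρ).const_mul C
  simpa using h1.add (tendsto_truncTotal hF hx)

theorem norm_ev_le {ρ : ℝ} {n : ℕ} (hF : Bd C F) (hn : F ∈ vanIdeal k (fun _ => 1) n)
    (hρ : ρ < 1) (hρ0 : 0 ≤ ρ) (hx : ∀ i, ‖x i‖ ≤ ρ) : ‖ev x F‖ ≤ C * ρ ^ n :=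
  le_of_tendsto' (tendsto_truncTotal hF fun i => (hx i).trans_lt hρ).norm fun N =>
    norm_aeval_le (hF.truncTotal N) (truncTotal_mem_vanIdeal hn N) hρ.le hρ0 hx

theorem norm_ev_le_bound (hF : Bd C F) (hx : ∀ i, ‖x i‖ < 1) : ‖ev x F‖ ≤ C := by
  obtain ⟨ρ, hρ0, hρ, hxρ⟩ := exists_norm_le_lt_one hx
  simpa using norm_ev_le hF vanIdeal_zero hρ hρ0 hxρ

theorem norm_ev_le_of_constantCoeff {ρ : ℝ} (hF : Bd 1 F) (h0 : constantCoeff F = 0) (hρ : ρ < 1)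
    (hρ0 : 0 ≤ ρ) (hx : ∀ i, ‖x i‖ ≤ ρ) : ‖ev x F‖ ≤ ρ := by
  have := Fintype.ofFinite σ
  simpa using norm_ev_le hF (mem_vanIdeal_one_iff.mpr h0) hρ hρ0 hx

theorem ev_coe (P : MvPolynomial σ k) (hx : ∀ i, ‖x i‖ < 1) :
    ev x (P : MvPowerSeries σ k) = MvPolynomial.aeval x P := by
  obtain ⟨c, hc⟩ := exists_bd_coe P
  exact tendsto_nhds_unique (tendsto_ev hc hx (fun _ => hc) fun N => by simp)
    tendsto_const_nhds

theorem ev_C (a : k) (hx : ∀ i, ‖x i‖ < 1) :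
    ev x (MvPowerSeries.C a : MvPowerSeries σ k) = algebraMap k K a := by
  simpa using ev_coe (MvPolynomial.C a) hx

theorem ev_zero (hx : ∀ i, ‖x i‖ < 1) : ev x (0 : MvPowerSeries σ k) = 0 := by
  simpa using ev_coe (0 : MvPolynomial σ k) hx

theorem ev_one (hx : ∀ i, ‖x i‖ < 1) : ev x (1 : MvPowerSeries σ k) = 1 := by
  simpa using ev_coe (1 : MvPolynomial σ k) hx

theorem ev_X (i : σ) (hx : ∀ i, ‖x i‖ < 1) : ev x (X i : MvPowerSeries σ k) = x i := by
  simpa using ev_coe (MvPolynomial.X i) hx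

theorem ev_add (hF : Bd C F) (hG : Bd D G) (hx : ∀ i, ‖x i‖ < 1) :
    ev x (F + G) = ev x F + ev x G := by
  have h := (tendsto_truncTotal hF hx).add (tendsto_truncTotal hG hx)
  simp only [← map_add] at h
  exact tendsto_nhds_unique (tendsto_truncTotal
    ((hF.mono (le_max_left C D)).add (hG.mono (le_max_right C D))) hx) h

theorem ev_smul (a : k) (hF : Bd C F) (hx : ∀ i, ‖x i‖ < 1) :
    ev x (a • F) = a • ev x F := by
  have h := (tendsto_truncTotal hF hx).const_smul a
  simp only [← map_smul] at h
  refine tendsto_nhds_unique (tendsto_truncTotal (C := ‖a‖ * C) (fun m => ?_) hx) h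
  rw [map_smul, norm_smul]
  exact mul_le_mul_of_nonneg_left (hF m) (norm_nonneg _)

theorem ev_neg (hF : Bd C F) (hx : ∀ i, ‖x i‖ < 1) : ev x (-F) = -ev x F := by
  simpa using ev_smul (-1) hF hx

theorem ev_sub (hF : Bd C F) (hG : Bd D G) (hx : ∀ i, ‖x i‖ < 1) :
    ev x (F - G) = ev x F - ev x G := by
  rw [sub_eq_add_neg, ev_add hF hG.neg hx, ev_neg hG hx, sub_eq_add_neg]

/-- Evaluation is multiplicative on bounded power series. -/
theorem ev_mul (hF : Bd C F) (hG : Bd D G) (hx : ∀ i, ‖x i‖ < 1) :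
    ev x (F * G) = ev x F * ev x G := by
  have h := (tendsto_truncTotal hF hx).mul (tendsto_truncTotal hG hx)
  simp only [← map_mul] at h
  refine tendsto_nhds_unique (tendsto_ev (hF.mul hG) hx (fun N => ?_) fun N => ?_) h
  · rw [MvPolynomial.coe_mul]
    exact (hF.truncTotal N).mul (hG.truncTotal N)
  · have h1 : F * G - ((truncTotal N F * truncTotal N G : MvPolynomial σ k) : MvPowerSeries σ k) =
        F * (G - truncTotal N G) + (F - truncTotal N F) * truncTotal N G := by
      rw [MvPolynomial.coe_mul]
      ring
    rw [h1]
    exact Ideal.add_mem _ (Ideal.mul_mem_left _ _ (sub_truncTotal_mem G N))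
      (Ideal.mul_mem_right _ _ (sub_truncTotal_mem F N))

theorem ev_sum {ι : Type*} (s : Finset ι) {f : ι → MvPowerSeries σ k} (hC : 0 ≤ C)
    (hf : ∀ i ∈ s, Bd C (f i)) (hx : ∀ i, ‖x i‖ < 1) :
    ev x (∑ i ∈ s, f i) = ∑ i ∈ s, ev x (f i) := by
  classical
  induction s using Finset.induction_on with
  | empty => simpa using ev_zero hx
  | insert a s ha ih =>
    have hs : ∀ i ∈ s, Bd C (f i) := fun i hi => hf i (Finset.mem_insert_of_mem hi)
    rw [Finset.sum_insert ha, Finset.sum_insert ha,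
      ev_add (hf a (Finset.mem_insert_self _ _)) (Bd.sum hC s hs) hx, ih hs]

theorem ev_matrix_mul {r s t : Type*} [Fintype s] {M : Matrix r s (MvPowerSeries σ k)}
    {N : Matrix s t (MvPowerSeries σ k)} (hM : ∀ i j, Bd C (M i j)) (hN : ∀ i j, Bd D (N i j))
    (hx : ∀ i, ‖x i‖ < 1) : (M * N).map (ev x) = M.map (ev x) * N.map (ev x) := by
  ext i j
  simp only [Matrix.map_apply, Matrix.mul_apply]
  rcases isEmpty_or_nonempty s with h | ⟨⟨l⟩⟩
  · simpa using ev_zero hx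
  rw [ev_sum _ (mul_nonneg (hM i l).nonneg (hN l j).nonneg)
    (fun l _ => (hM i l).mul (hN l j)) hx]
  exact Finset.sum_congr rfl fun l _ => ev_mul (hM i l) (hN l j) hx

theorem ev_matrix_one {r : Type*} [DecidableEq r] (hx : ∀ i, ‖x i‖ < 1) :
    (1 : Matrix r r (MvPowerSeries σ k)).map (ev x) = 1 :=
  Matrix.map_one _ (ev_zero hx) (ev_one hx)

/-- The value of a composite. -/
theorem ev_subst {τ : Type*} [Finite τ] {P : τ → MvPowerSeries σ k} {H : MvPowerSeries τ k}
    (hP : ∀ i, Bd 1 (P i)) (hP0 : ∀ i, constantCoeff (P i) = 0) (hH : Bd C H)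
    (hx : ∀ i, ‖x i‖ < 1) : ev x (subst P H) = ev (fun i => ev x (P i)) H := by
  obtain ⟨ρ, hρ0, hρ, hxρ⟩ := exists_norm_le_lt_one hx
  have hS := hasSubst_of_constantCoeff_zero hP0
  have hy : ∀ i, ‖ev x (P i)‖ < 1 := fun i =>
    (norm_ev_le_of_constantCoeff (hP i) (hP0 i) hρ hρ0 hxρ).trans_lt hρ
  have := Fintype.ofFinite σ
  have hpoly : ∀ Q : MvPolynomial τ k, (∃ c, Bd c (subst P (Q : MvPowerSeries τ k))) ∧
      ev x (subst P (Q : MvPowerSeries τ k)) = MvPolynomial.aeval (fun i => ev x (P i)) Q := by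
    intro Q
    induction Q using MvPolynomial.induction_on with
    | C a =>
      rw [MvPolynomial.coe_C, MvPolynomial.aeval_C, ← ev_C a hx, subst_C]
      exact ⟨⟨_, Bd.C le_rfl⟩, rfl⟩
    | add p q hp hq =>
      obtain ⟨⟨c, hc⟩, hp⟩ := hp
      obtain ⟨⟨d, hd⟩, hq⟩ := hq
      rw [MvPolynomial.coe_add, subst_add hS, map_add, ← hp, ← hq, ev_add hc hd hx]
      exact ⟨⟨max c d, (hc.mono (le_max_left _ _)).add (hd.mono (le_max_right _ _))⟩, rfl⟩
    | mul_X p i hp =>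
      obtain ⟨⟨c, hc⟩, hp⟩ := hp
      rw [MvPolynomial.coe_mul, MvPolynomial.coe_X, subst_mul hS, subst_X hS, map_mul,
        MvPolynomial.aeval_X, ← hp, ev_mul hc (hP i) hx]
      exact ⟨⟨_, hc.mul (hP i)⟩, rfl⟩
  have h1 : Tendsto (fun N => ev x (subst P H) -
      MvPolynomial.aeval (fun i => ev x (P i)) (truncTotal N H)) atTop (𝓝 0) := by
    refine squeeze_zero_norm (a := fun N => C * ρ ^ N) (fun N => ?_) ?_
    · have hb := (hH.truncTotal N).subst hP hP0
      rw [← (hpoly _).2, ← ev_sub (hH.subst hP hP0) hb hx, ← subst_sub hS]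
      exact norm_ev_le ((hH.sub (hH.truncTotal N)).subst hP hP0)
        (subst_mem_vanIdeal (fun i => mem_vanIdeal_one_iff.mpr (hP0 i)) hP0
          (sub_truncTotal_mem H N)) hρ hρ0 hxρ
    · simpa using (tendsto_pow_atTop_nhds_zero_of_lt_one hρ0 hρ).const_mul C
  have h2 := h1.add (tendsto_truncTotal hH hy)
  simp only [sub_add_cancel, zero_add] at h2
  exact tendsto_nhds_unique tendsto_const_nhds h2

theorem ev_rescale (a : σ → k) (ha : ∀ i, ‖a i‖ ≤ 1) (hF : Bd C F) (hx : ∀ i, ‖x i‖ < 1) :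
    ev x (rescale a F) = ev (fun i => algebraMap k K (a i) * x i) F := by
  have hP0 : ∀ i, constantCoeff ((a • X : σ → MvPowerSeries σ k) i) = 0 := fun i => by simp
  rw [rescale_eq_subst, ev_subst (fun i => ?_) hP0 hF hx]
  · congr 1
    ext1 i
    change ev x (a i • (X i : MvPowerSeries σ k)) = _
    rw [ev_smul _ (Bd.X i) hx, ev_X i hx, Algebra.smul_def]
  · change Bd 1 (a i • (X i : MvPowerSeries σ k))
    rw [← mul_one (1 : ℝ), smul_eq_C_mul]
    exact (Bd.C (ha i)).mul (Bd.X i)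

end Evaluation

/-! ### Derivatives of power series and the identity theorem -/

section Derivatives

open Filter Topology

variable {k K : Type*} [NontriviallyNormedField k] [NontriviallyNormedField K] [NormedAlgebra k K]
  {σ : Type*} [Fintype σ]

/-- The linear term at `z` of a polynomial. -/
def linTerm (z w : σ → K) (P : MvPolynomial σ k) : K :=
  ∑ l, w l * MvPolynomial.aeval z (MvPolynomial.pderiv l P)

theorem linTerm_mul (z w : σ → K) (P Q : MvPolynomial σ k) :
    linTerm z w (P * Q) = MvPolynomial.aeval z P * linTerm z w Q +
      linTerm z w P * MvPolynomial.aeval z Q := by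
  simp only [linTerm, Finset.mul_sum, Finset.sum_mul, ← Finset.sum_add_distrib]
  refine Finset.sum_congr rfl fun l _ => ?_
  rw [Derivation.leibniz, map_add, smul_eq_mul, smul_eq_mul, map_mul, map_mul]
  ring

variable [IsUltrametricDist K]

/-- The Taylor formula to second order for a polynomial with bounded coefficients. -/
theorem norm_taylor_aeval_le {P : MvPolynomial σ k} {C ω : ℝ} {z w : σ → K}
    (hP : Bd C (P : MvPowerSeries σ k)) (hω0 : 0 ≤ ω) (hω : ω ≤ 1) (hz : ∀ i, ‖z i‖ ≤ 1)
    (hw : ∀ i, ‖w i‖ ≤ ω) :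
    ‖MvPolynomial.aeval (z + w) P - MvPolynomial.aeval z P - linTerm z w P‖ ≤ C * ω ^ 2 := by
  classical
  have add_le : ∀ {a b : K} {r : ℝ}, ‖a‖ ≤ r → ‖b‖ ≤ r → ‖a + b‖ ≤ r := fun ha hb =>
    (IsUltrametricDist.norm_add_le_max _ _).trans (max_le ha hb)
  have mul_le : ∀ {a b : K} {r s : ℝ}, 0 ≤ r → ‖a‖ ≤ r → ‖b‖ ≤ s → ‖a * b‖ ≤ r * s :=
    fun hr ha hb => by
      rw [norm_mul]
      exact mul_le_mul ha hb (norm_nonneg _) hr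
  have hω2 : ω ^ 2 ≤ ω := by nlinarith
  -- the polynomials which satisfy the estimates with constant one are closed under products
  let Good : MvPolynomial σ k → Prop := fun Q => ‖MvPolynomial.aeval z Q‖ ≤ 1 ∧
    ‖linTerm z w Q‖ ≤ ω ∧
    ‖MvPolynomial.aeval (z + w) Q - MvPolynomial.aeval z Q - linTerm z w Q‖ ≤ ω ^ 2
  have hone : Good 1 := by simp [Good, linTerm, hω0]
  have hX : ∀ i, Good (MvPolynomial.X i) := fun i => by
    have h1 : linTerm z w (MvPolynomial.X i : MvPolynomial σ k) = w i := by
      rw [linTerm, Finset.sum_eq_single_of_mem i (Finset.mem_univ _)]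
      · simp
      · intro l _ hl
        rw [MvPolynomial.pderiv_X_of_ne hl.symm, map_zero, mul_zero]
    refine ⟨by simpa using hz i, by rw [h1]; exact hw i, ?_⟩
    rw [h1]
    simpa using sq_nonneg ω
  have hmul : ∀ P Q, Good P → Good Q → Good (P * Q) := by
    rintro P Q ⟨hp, hdp, hrp⟩ ⟨hq, hdq, hrq⟩
    refine ⟨?_, ?_, ?_⟩
    · rw [map_mul]
      simpa using mul_le zero_le_one hp hq
    · rw [linTerm_mul]
      refine add_le ?_ ?_
      · simpa using mul_le zero_le_one hp hdq
      · simpa using mul_le hω0 hdp hq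
    · rw [linTerm_mul, map_mul, map_mul]
      set p := MvPolynomial.aeval z P
      set q := MvPolynomial.aeval z Q
      set rp := MvPolynomial.aeval (z + w) P - p - linTerm z w P with hrpe
      set rq := MvPolynomial.aeval (z + w) Q - q - linTerm z w Q with hrqe
      have h1 : MvPolynomial.aeval (z + w) P * MvPolynomial.aeval (z + w) Q - p * q -
          (p * linTerm z w Q + linTerm z w P * q) = p * rq + (rp * q +
          (linTerm z w P + rp) * (linTerm z w Q + rq)) := by
        rw [hrpe, hrqe]
        ring
      rw [h1]
      refine add_le ?_ (add_le ?_ ?_)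
      · simpa using mul_le zero_le_one hp hrq
      · simpa using mul_le (sq_nonneg ω) hrp hq
      · rw [pow_two]
        exact mul_le hω0 (add_le hdp (hrp.trans hω2)) (add_le hdq (hrq.trans hω2))
  have hpow : ∀ i n, Good (MvPolynomial.X i ^ n) := fun i n => by
    induction n with
    | zero => simpa using hone
    | succ n ih => rw [pow_succ]; exact hmul _ _ ih (hX i)
  have hmon : ∀ d, Good (MvPolynomial.monomial d 1) := fun d => by
    rw [MvPolynomial.monomial_eq, map_one, one_mul]
    refine Finset.prod_induction _ Good hmul hone fun i _ => ?_
    exact hpow i (d i)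
  have hlin : ∀ Q : MvPolynomial σ k, MvPolynomial.aeval (z + w) Q - MvPolynomial.aeval z Q -
      linTerm z w Q = ∑ d ∈ Q.support, algebraMap k K (Q.coeff d) *
        (MvPolynomial.aeval (z + w) (MvPolynomial.monomial d (1 : k)) -
        MvPolynomial.aeval z (MvPolynomial.monomial d (1 : k)) -
        linTerm z w (MvPolynomial.monomial d (1 : k))) := by
    intro Q
    let L : MvPolynomial σ k →ₗ[k] K := (MvPolynomial.aeval (z + w)).toLinearMap -
      (MvPolynomial.aeval z).toLinearMap -
      ∑ l, (LinearMap.mulLeft k (w l)).comp ((MvPolynomial.aeval z).toLinearMap.comp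
        (MvPolynomial.pderiv l : Derivation k (MvPolynomial σ k) (MvPolynomial σ k)).toLinearMap)
    have hL : ∀ Q, L Q = MvPolynomial.aeval (z + w) Q - MvPolynomial.aeval z Q -
        linTerm z w Q := fun Q => by
      simp [L, linTerm, LinearMap.sum_apply]
    conv_lhs => rw [← hL, Q.as_sum, map_sum]
    refine Finset.sum_congr rfl fun d _ => ?_
    rw [← hL (MvPolynomial.monomial d 1), ← Algebra.smul_def, ← map_smul,
      MvPolynomial.smul_monomial, smul_eq_mul, mul_one]
  have hC := hP.nonneg
  rw [hlin]
  refine IsUltrametricDist.norm_sum_le_of_forall_le_of_nonneg (by positivity) fun d _ => ?_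
  refine mul_le hC ?_ (hmon d).2.2
  simpa using hP d

variable [IsUltrametricDist k] [CompleteSpace k] [Algebra.IsAlgebraic k K] {C : ℝ}
  {F : MvPowerSeries σ k}

theorem norm_taylor_ev_le {ω : ℝ} {z w : σ → K} (hF : Bd C F) (hω0 : 0 ≤ ω) (hω : ω < 1)
    (hz : ∀ i, ‖z i‖ < 1) (hw : ∀ i, ‖w i‖ ≤ ω) :
    ‖ev (z + w) F - ev z F - ∑ l, w l * ev z (pderiv k l F)‖ ≤ C * ω ^ 2 := by
  have hzw : ∀ i, ‖(z + w) i‖ < 1 := fun i =>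
    (IsUltrametricDist.norm_add_le_max _ _).trans_lt (max_lt (hz i) ((hw i).trans_lt hω))
  have h1 : ∀ l, Tendsto (fun N => MvPolynomial.aeval z
      (MvPolynomial.pderiv l (truncTotal (N + 1) F))) atTop (𝓝 (ev z (pderiv k l F))) := by
    intro l
    refine tendsto_ev (hF.pderiv l) hz (fun N => ?_) fun N => ?_
    · rw [← pderiv_coe]
      exact (hF.truncTotal _).pderiv l
    · rw [← pderiv_coe, ← map_sub]
      exact pderiv_mem_vanIdeal l (sub_truncTotal_mem F (N + 1)) le_rfl
  have h2 := (((tendsto_truncTotal hF hzw).comp (tendsto_add_atTop_nat 1)).sub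
    ((tendsto_truncTotal hF hz).comp (tendsto_add_atTop_nat 1))).sub
    (tendsto_finsetSum Finset.univ fun l _ => (h1 l).const_mul (w l))
  exact le_of_tendsto' h2.norm fun N =>
    norm_taylor_aeval_le (hF.truncTotal _) hω0 hω.le (fun i => (hz i).le) hw

/-- Bounded power series are differentiable term by term on the open unit polydisc. -/
theorem hasLineDerivAt_ev {z : σ → K} (v : σ → K) (hF : Bd C F) (hz : ∀ i, ‖z i‖ < 1) :
    HasLineDerivAt K (fun x => ev x F) (∑ l, v l * ev z (pderiv k l F)) z v := by
  have hC := hF.nonneg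
  rw [HasLineDerivAt, hasDerivAt_iff_tendsto]
  have h1 : Tendsto (fun t : K => C * ‖v‖ ^ 2 * ‖t‖) (𝓝 0) (𝓝 0) := by
    have := (tendsto_norm_zero (E := K)).const_mul (C * ‖v‖ ^ 2)
    simpa using this
  have h2 : ∀ᶠ t : K in 𝓝 0, ‖t‖ * ‖v‖ < 1 := by
    have := (tendsto_norm_zero (E := K)).mul_const ‖v‖
    rw [zero_mul] at this
    exact this.eventually_lt_const one_pos
  refine squeeze_zero' (Eventually.of_forall fun t => by positivity) ?_ h1
  filter_upwards [h2] with t ht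
  have hw : ∀ i, ‖(t • v) i‖ ≤ ‖t‖ * ‖v‖ := fun i => by
    rw [Pi.smul_apply, smul_eq_mul, norm_mul]
    exact mul_le_mul_of_nonneg_left (norm_le_pi_norm v i) (norm_nonneg _)
  have h3 := norm_taylor_ev_le hF (by positivity) ht hz hw
  simp only [sub_zero, zero_smul, add_zero, smul_eq_mul, Finset.mul_sum]
  simp only [Pi.smul_apply, smul_eq_mul, mul_assoc] at h3
  rcases eq_or_ne t 0 with rfl | ht0
  · simp
  · rw [inv_mul_le_iff₀ (norm_pos_iff.mpr ht0)]
    refine h3.trans (le_of_eq ?_)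
    ring

/-- A bounded power series which vanishes on a polydisc is zero. -/
theorem eq_zero_of_ev_eq_zero (hF : Bd C F) {r : ℝ} (hr : 0 < r) (hr1 : r < 1)
    (h : ∀ x : σ → K, (∀ i, ‖x i‖ ≤ r) → ev x F = 0) : F = 0 := by
  refine eq_zero_of_forall_mem_vanIdeal (w := fun _ => 1) fun n => ?_
  induction n with
  | zero => exact vanIdeal_zero
  | succ d ih =>
  set P := truncTotal (d + 1) F with hPdef
  -- the homogeneous part of lowest degree
  have hhom : P.IsHomogeneous d := by
    intro m hm
    rw [hPdef, coeff_truncTotal_eq_ite] at hm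
    split_ifs at hm with h1
    · by_contra h2
      refine hm (ih m ?_)
      have : m.degree ≠ d := fun h3 => h2 (by rw [← h3]; exact weight_eq_degree m)
      change Finsupp.weight (fun _ => 1) m < d
      rw [weight_eq_degree]
      omega
    · exact absurd rfl hm
  have hzero : P = 0 := by
    refine MvPolynomial.funext fun x => ?_
    rw [map_zero]
    set R := ‖x‖ with hR
    have hRn : 0 ≤ R := norm_nonneg _
    have hlim : Tendsto (fun t : k => C * R ^ (d + 1) * ‖t‖) (𝓝[≠] 0) (𝓝 0) := by
      have := ((tendsto_norm_zero (E := k)).mono_left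
        (nhdsWithin_le_nhds (s := {0}ᶜ))).const_mul (C * R ^ (d + 1))
      simpa using this
    have hsmall : ∀ᶠ t : k in 𝓝[≠] 0, ‖t‖ * R < r := by
      have := ((tendsto_norm_zero (E := k)).mono_left
        (nhdsWithin_le_nhds (s := {0}ᶜ))).mul_const R
      rw [zero_mul] at this
      exact this.eventually_lt_const hr
    have hle : ∀ᶠ t : k in 𝓝[≠] 0, ‖MvPolynomial.eval x P‖ ≤ C * R ^ (d + 1) * ‖t‖ := by
      filter_upwards [hsmall, self_mem_nhdsWithin] with t ht ht0
      have hx : ∀ i, ‖algebraMap k K (t * x i)‖ ≤ ‖t‖ * R := fun i => by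
        rw [norm_algebraMap', norm_mul]
        exact mul_le_mul_of_nonneg_left (norm_le_pi_norm x i) (norm_nonneg _)
      have hx1 : ∀ i, ‖algebraMap k K (t * x i)‖ < 1 := fun i => (hx i).trans_lt (ht.trans hr1)
      have h1 : ev (fun i => algebraMap k K (t * x i)) (F - (P : MvPowerSeries σ k)) =
          - MvPolynomial.aeval (fun i => algebraMap k K (t * x i)) P := by
        rw [ev_sub hF (hF.truncTotal _) hx1, h _ fun i => (hx i).trans ht.le, ev_coe _ hx1,
          zero_sub]
      have h2 := norm_ev_le (hF.sub (hF.truncTotal (d + 1))) (sub_truncTotal_mem F (d + 1))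
        (ht.trans hr1) (by positivity) hx
      rw [h1, norm_neg] at h2
      have h3 : MvPolynomial.aeval (fun i => algebraMap k K (t * x i)) P =
          algebraMap k K (t ^ d * MvPolynomial.eval x P) := by
        have h4 := MvPolynomial.aeval_algebraMap_apply K (fun i => t * x i) P
        refine h4.trans (congrArg _ ?_)
        change MvPolynomial.eval _ P = _
        rw [MvPolynomial.eval_eq, MvPolynomial.eval_eq, Finset.mul_sum]
        refine Finset.sum_congr rfl fun m hm => ?_
        have h5 : ∑ i ∈ m.support, m i = d := (hhom.degree_eq_sum_deg_support hm).symm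
        simp only [mul_pow]
        rw [Finset.prod_mul_distrib, Finset.prod_pow_eq_pow_sum, h5]
        ring
      rw [h3, norm_algebraMap', norm_mul, norm_pow] at h2
      have ht' : 0 < ‖t‖ ^ d := pow_pos (norm_pos_iff.mpr ht0) _
      refine le_of_mul_le_mul_left (h2.trans (le_of_eq ?_)) ht'
      ring
    exact norm_le_zero_iff.mp (ge_of_tendsto hlim hle)
  have := sub_truncTotal_mem F (d + 1)
  rwa [← hPdef, hzero, MvPolynomial.coe_zero, sub_zero] at this

end Derivatives

/-! ### The Gauss norm as a supremum norm -/

section CauchyEstimate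

variable {k : Type*} [NormedField k] [IsUltrametricDist k] {σ : Type*}

/-- The ring of integers of `k`. -/
def integers (k : Type*) [NormedField k] [IsUltrametricDist k] : Subring k where
  carrier := {x | ‖x‖ ≤ 1}
  mul_mem' {a b} ha hb := by
    simp only [Set.mem_ofPred_eq, norm_mul] at *
    exact mul_le_one₀ ha (norm_nonneg _) hb
  one_mem' := by simp
  add_mem' {a b} ha hb := (IsUltrametricDist.norm_add_le_max a b).trans (max_le ha hb)
  zero_mem' := by simp
  neg_mem' {a} ha := by simpa using ha

/-- The maximal ideal of the ring of integers. -/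
def topNilpotent (k : Type*) [NormedField k] [IsUltrametricDist k] : Ideal (integers k) where
  carrier := {x | ‖(x : k)‖ < 1}
  add_mem' {a b} ha hb := (IsUltrametricDist.norm_add_le_max (a : k) b).trans_lt (max_lt ha hb)
  zero_mem' := by simp
  smul_mem' c {x} hx := by
    simp only [Set.mem_ofPred_eq, smul_eq_mul, Subring.coe_mul, norm_mul] at *
    exact mul_lt_one_of_nonneg_of_lt_one_right c.2 (norm_nonneg _) hx

theorem mem_topNilpotent {x : integers k} : x ∈ topNilpotent k ↔ ‖(x : k)‖ < 1 := Iff.rfl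

instance : (topNilpotent k).IsPrime where
  ne_top' h := by
    have : (1 : integers k) ∈ topNilpotent k := h ▸ Submodule.mem_top
    simp [mem_topNilpotent] at this
  mem_or_mem' {x y} h := by
    by_contra! hxy
    simp only [mem_topNilpotent, not_lt, Subring.coe_mul, norm_mul] at h hxy
    exact absurd (one_le_mul_of_one_le_of_one_le hxy.1 hxy.2) (not_le.mpr h)

/-- A polynomial attains the maximum of the norms of its coefficients at an integral point: its
reduction is a nonzero polynomial over the residue field, which is infinite. -/
theorem exists_norm_coeff_le_norm_eval (hk : ∀ n : ℕ, n ≠ 0 → ‖(n : k)‖ = 1)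
    (P : MvPolynomial σ k) :
    ∃ x : σ → k, (∀ i, ‖x i‖ ≤ 1) ∧ ∀ m, ‖P.coeff m‖ ≤ ‖MvPolynomial.eval x P‖ := by
  rcases eq_or_ne P 0 with rfl | hP
  · exact ⟨0, by simp, by simp⟩
  have hinf : Infinite (integers k ⧸ topNilpotent k) := by
    refine Infinite.of_injective (fun n : ℕ => (n : integers k ⧸ topNilpotent k))
      (Function.Injective.of_lt_imp_ne fun a b hab h => ?_)
    have h1 : ((b - a : ℕ) : integers k ⧸ topNilpotent k) = 0 := by
      rw [Nat.cast_sub hab.le, sub_eq_zero]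
      exact h.symm
    rw [← map_natCast (Ideal.Quotient.mk (topNilpotent k)), Ideal.Quotient.eq_zero_iff_mem,
      mem_topNilpotent] at h1
    have h2 := hk (b - a) (by omega)
    simp only [Subring.coe_natCast] at h1
    exact h1.ne h2
  obtain ⟨m₀, hm₀, hmax⟩ := P.support.exists_max_image (fun m => ‖P.coeff m‖)
    (MvPolynomial.support_nonempty.mpr hP)
  have hmax' : ∀ m, ‖P.coeff m‖ ≤ ‖P.coeff m₀‖ := fun m => by
    by_cases hm : m ∈ P.support
    · exact hmax m hm
    · rw [MvPolynomial.notMem_support_iff] at hm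
      simp [hm]
  have hc : P.coeff m₀ ≠ 0 := MvPolynomial.mem_support_iff.mp hm₀
  have hint : ∀ m, (P.coeff m₀)⁻¹ * P.coeff m ∈ integers k := fun m => by
    change ‖_‖ ≤ 1
    rw [norm_mul, norm_inv, inv_mul_le_iff₀ (norm_pos_iff.mpr hc), mul_one]
    exact hmax' m
  -- `P`, divided by its largest coefficient, has a nonzero reduction
  set P' : MvPolynomial σ (integers k) :=
    ∑ m ∈ P.support, MvPolynomial.monomial m ⟨_, hint m⟩ with hP'
  have hP'P : MvPolynomial.map (integers k).subtype P' = MvPolynomial.C (P.coeff m₀)⁻¹ * P := by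
    have h1 : MvPolynomial.C (P.coeff m₀)⁻¹ * P =
        ∑ m ∈ P.support, MvPolynomial.monomial m ((P.coeff m₀)⁻¹ * P.coeff m) := by
      simp only [← MvPolynomial.C_mul_monomial]
      rw [← Finset.mul_sum, ← P.as_sum]
    rw [h1, hP', map_sum]
    refine Finset.sum_congr rfl fun m _ => ?_
    rw [MvPolynomial.map_monomial]
    rfl
  have hne : MvPolynomial.map (Ideal.Quotient.mk (topNilpotent k)) P' ≠ 0 := by
    intro h0
    have h1 := congrArg (MvPolynomial.coeff m₀) h0
    have h2 : ((P'.coeff m₀ : integers k) : k) = 1 := by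
      have := congrArg (MvPolynomial.coeff m₀) hP'P
      rw [MvPolynomial.coeff_map, MvPolynomial.coeff_C_mul, inv_mul_cancel₀ hc] at this
      exact this
    rw [MvPolynomial.coeff_map, MvPolynomial.coeff_zero, Ideal.Quotient.eq_zero_iff_mem,
      mem_topNilpotent, h2] at h1
    simp at h1
  obtain ⟨y, hy⟩ : ∃ y : σ → integers k ⧸ topNilpotent k,
      MvPolynomial.eval y (MvPolynomial.map (Ideal.Quotient.mk (topNilpotent k)) P') ≠ 0 := by
    by_contra! h
    exact hne (MvPolynomial.funext fun y => by rw [h, map_zero])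
  choose x hx using fun i => Ideal.Quotient.mk_surjective (y i)
  refine ⟨fun i => x i, fun i => (x i).2, fun m => (hmax' m).trans ?_⟩
  rw [show y = Ideal.Quotient.mk (topNilpotent k) ∘ x from funext fun i => (hx i).symm,
    MvPolynomial.eval_map, ← MvPolynomial.eval₂_comp, Ne, Ideal.Quotient.eq_zero_iff_mem,
    mem_topNilpotent, not_lt] at hy
  have h1 := (MvPolynomial.eval₂_comp (integers k).subtype x P').symm
  rw [← MvPolynomial.eval_map, hP'P, map_mul, MvPolynomial.eval_C] at h1
  have h2 : ‖(P.coeff m₀)⁻¹ * MvPolynomial.eval (fun i => (x i : k)) P‖ =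
      ‖((MvPolynomial.eval x P' : integers k) : k)‖ := congrArg norm h1
  rw [← h2, norm_mul, norm_inv, ← div_eq_inv_mul, one_le_div (norm_pos_iff.mpr hc)] at hy
  exact hy

end CauchyEstimate

section Scaling

variable {k : Type*} [Field k] {σ : Type*}

/-- The polynomial `P(c x)`. -/
def scalePoly (c : k) (P : MvPolynomial σ k) : MvPolynomial σ k :=
  MvPolynomial.aeval (fun i => MvPolynomial.C c * MvPolynomial.X i) P

theorem aeval_scalePoly {K : Type*} [Field K] [Algebra k K] (c : k) (P : MvPolynomial σ k)
    (x : σ → K) : MvPolynomial.aeval x (scalePoly c P) =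
      MvPolynomial.aeval (fun i => algebraMap k K c * x i) P := by
  rw [scalePoly, ← AlgHom.comp_apply, MvPolynomial.comp_aeval]
  simp

theorem coeff_scalePoly (c : k) (P : MvPolynomial σ k) (m : σ →₀ ℕ) :
    (scalePoly c P).coeff m = c ^ m.degree * P.coeff m := by
  classical
  induction P using MvPolynomial.induction_on' with
  | monomial d a =>
    have h1 : scalePoly c (MvPolynomial.monomial d a) =
        MvPolynomial.monomial d (c ^ d.degree * a) := by
      rw [scalePoly, MvPolynomial.aeval_monomial, Finsupp.prod]
      simp only [mul_pow]
      rw [Finset.prod_mul_distrib, Finset.prod_pow_eq_pow_sum,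
        MvPolynomial.monomial_eq, Finsupp.prod, map_mul, map_pow]
      change MvPolynomial.C a * (MvPolynomial.C c ^ d.degree * _) = _
      ring
    rw [h1, MvPolynomial.coeff_monomial, MvPolynomial.coeff_monomial]
    split_ifs with h
    · rw [h]
    · rw [mul_zero]
  | add p q hp hq =>
    rw [scalePoly, map_add, MvPolynomial.coeff_add, ← scalePoly, ← scalePoly, hp, hq,
      MvPolynomial.coeff_add, mul_add]

end Scaling

/-! ### Polydiscs in admissible open sets -/

section SmallPolydiscs

open Filter Topology

variable {k K : Type*} [NontriviallyNormedField k] [NontriviallyNormedField K] [NormedAlgebra k K]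
  [IsUltrametricDist K] {σ : Type*} [Finite σ]

/-- A rational domain which contains the origin contains the small polydiscs around it. -/
theorem IsRationalDomain.eventually_subset {V : Set (σ → K)} (hV : IsRationalDomain k V)
    (h0 : 0 ∈ V) : ∀ᶠ c in 𝓝 (0 : k), ∀ y : σ → K, (∀ i, ‖y i‖ ≤ ‖c‖) → y ∈ V := by
  have := Fintype.ofFinite σ
  obtain ⟨c₀, s, f, g, hc₀, hfg, rfl⟩ := hV
  have hg0 : MvPolynomial.aeval (0 : σ → K) g ≠ 0 := fun hg => by
    refine hfg 0 (by simp) ⟨hg, fun j => ?_⟩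
    have := h0.2 j
    rw [hg, norm_zero] at this
    exact norm_le_zero_iff.mp this
  have hcont : ∀ P : MvPolynomial σ k, Continuous fun y : σ → K => MvPolynomial.aeval y P := by
    intro P
    simp only [MvPolynomial.aeval_def, MvPolynomial.eval₂_eq_eval_map]
    exact MvPolynomial.continuous_eval _
  have hclose : ∀ P : MvPolynomial σ k, ∀ᶠ y in 𝓝 (0 : σ → K),
      ‖MvPolynomial.aeval y P - MvPolynomial.aeval (0 : σ → K) P‖ <
        ‖MvPolynomial.aeval (0 : σ → K) g‖ := by
    intro P
    have h1 : Tendsto (fun y : σ → K => ‖MvPolynomial.aeval y P -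
        MvPolynomial.aeval (0 : σ → K) P‖) (𝓝 0) (𝓝 0) := by
      have := (((hcont P).sub continuous_const).norm.tendsto (0 : σ → K) :
        Tendsto (fun y : σ → K => ‖MvPolynomial.aeval y P -
          MvPolynomial.aeval (0 : σ → K) P‖) (𝓝 0) _)
      simpa using this
    exact h1.eventually_lt_const (norm_pos_iff.mpr hg0)
  have hnhds : ∀ᶠ y in 𝓝 (0 : σ → K), (∀ i, ‖y i‖ ≤ ‖c₀‖) ∧
      ∀ j, ‖MvPolynomial.aeval y (f j)‖ ≤ ‖MvPolynomial.aeval y g‖ := by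
    have h1 : ∀ᶠ y in 𝓝 (0 : σ → K), ‖y‖ < ‖c₀‖ :=
      (tendsto_norm_zero (E := σ → K)).eventually_lt_const (norm_pos_iff.mpr hc₀)
    filter_upwards [h1, hclose g, Filter.eventually_all.mpr fun j => hclose (f j)] with y hy hg hf
    refine ⟨fun i => (norm_le_pi_norm y i).trans hy.le, fun j => ?_⟩
    have hgn : ‖MvPolynomial.aeval y g‖ = ‖MvPolynomial.aeval (0 : σ → K) g‖ := by
      have h2 := IsUltrametricDist.norm_eq_of_add_norm_lt_max
        (x := MvPolynomial.aeval y g) (y := -MvPolynomial.aeval (0 : σ → K) g)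
      rw [norm_neg, ← sub_eq_add_neg] at h2
      exact h2 (hg.trans_le (le_max_right _ _))
    rw [hgn, ← sub_add_cancel (MvPolynomial.aeval y (f j)) (MvPolynomial.aeval (0 : σ → K) (f j))]
    exact (IsUltrametricDist.norm_add_le_max _ _).trans (max_le (hf j).le (h0.2 j))
  obtain ⟨δ, hδ, hball⟩ := Metric.eventually_nhds_iff.mp hnhds
  have h2 : ∀ᶠ c in 𝓝 (0 : k), ‖c‖ < δ :=
    (tendsto_norm_zero (E := k)).eventually_lt_const hδ
  filter_upwards [h2] with c hc y hy
  refine hball ?_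
  rw [dist_zero_right]
  exact ((pi_norm_le_iff_of_nonneg (norm_nonneg _)).mpr hy).trans_lt hc

/-- An admissible open set which contains the origin contains the small polydiscs around it. -/
theorem IsAdmissibleOpen.eventually_subset {V : Set (σ → K)} (hV : IsAdmissibleOpen k V)
    (h0 : 0 ∈ V) : ∀ᶠ c in 𝓝 (0 : k), ∀ y : σ → K, (∀ i, ‖y i‖ ≤ ‖c‖) → y ∈ V := by
  obtain ⟨𝒱, h𝒱, hV, -⟩ := hV
  rw [hV] at h0
  obtain ⟨V', hV', h0'⟩ := h0
  filter_upwards [(h𝒱 V' hV').eventually_subset h0'] with c hc y hy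
  rw [hV]
  exact ⟨V', hV', hc y hy⟩

end SmallPolydiscs

/-! ### Power series expansions of analytic functions -/

section Expansion

open Filter Topology

variable {k K : Type*} [NontriviallyNormedField k] [NontriviallyNormedField K] [NormedAlgebra k K]
  [IsUltrametricDist K] [IsUltrametricDist k] {σ : Type*}

/-- A polynomial without zeros on the closed unit polydisc is dominated by its constant term: on the
line through the origin and a point where the Gauss norm is attained, all its roots have absolute
value greater than one, so that its absolute value is constant on the unit disc. -/
theorem norm_coeff_le_of_forall_aeval_ne_zero [IsAlgClosed K]
    (hk : ∀ n : ℕ, n ≠ 0 → ‖(n : k)‖ = 1) {Q : MvPolynomial σ k}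
    (hQ : ∀ x : σ → K, (∀ i, ‖x i‖ ≤ 1) → MvPolynomial.aeval x Q ≠ 0) (m : σ →₀ ℕ) :
    ‖Q.coeff m‖ ≤ ‖Q.coeff 0‖ := by
  obtain ⟨x, hx, hm⟩ := exists_norm_coeff_le_norm_eval hk Q
  refine (hm m).trans (le_of_eq ?_)
  -- the restriction of `Q` to the line through `x`
  set q : Polynomial K := MvPolynomial.aeval
    (fun i => Polynomial.C (algebraMap k K (x i)) * Polynomial.X) Q with hq
  have heval : ∀ t, q.eval t = MvPolynomial.aeval (fun i => algebraMap k K (x i) * t) Q := by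
    intro t
    have h1 := MvPolynomial.comp_aeval_apply
      (fun i => Polynomial.C (algebraMap k K (x i)) * Polynomial.X)
      ((Polynomial.aeval t).restrictScalars k : Polynomial K →ₐ[k] K) Q
    simpa using h1
  have hroot : ∀ r ∈ q.roots, 1 < ‖r‖ := by
    intro r hr
    by_contra! hr1
    have h2 := Polynomial.isRoot_of_mem_roots hr
    rw [Polynomial.IsRoot, heval] at h2
    refine hQ _ (fun i => ?_) h2
    rw [norm_mul, norm_algebraMap']
    exact mul_le_one₀ (hx i) (norm_nonneg _) hr1
  have hsplit := IsAlgClosed.splits q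
  have hnorm : ‖q.eval 1‖ = ‖q.eval 0‖ := by
    rw [hsplit.eval_eq_prod_roots, hsplit.eval_eq_prod_roots, norm_mul, norm_mul]
    congr 1
    have hmul : ∀ s : Multiset K, (∀ r ∈ s, 1 < ‖r‖) →
        ‖(s.map fun r => 1 - r).prod‖ = ‖(s.map fun r => 0 - r).prod‖ := by
      intro s
      induction s using Multiset.induction_on with
      | empty => simp
      | cons a s ih =>
        intro h
        rw [Multiset.map_cons, Multiset.prod_cons, Multiset.map_cons, Multiset.prod_cons,
          norm_mul, norm_mul, ih fun r hr => h r (Multiset.mem_cons_of_mem hr)]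
        congr 1
        have ha := h a (Multiset.mem_cons_self a s)
        have hne : ‖(1 : K)‖ ≠ ‖-a‖ := by rw [norm_one, norm_neg]; exact ha.ne
        rw [zero_sub, sub_eq_add_neg, IsUltrametricDist.norm_add_eq_max_of_norm_ne_norm hne,
          norm_one, norm_neg, max_eq_right ha.le]
    exact hmul _ hroot
  have h1 : q.eval 1 = algebraMap k K (MvPolynomial.eval x Q) := by
    rw [heval]
    simp only [mul_one]
    exact MvPolynomial.aeval_algebraMap_apply K x Q
  have h0 : q.eval 0 = algebraMap k K (Q.coeff 0) := by
    rw [heval]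
    simp only [mul_zero]
    have := MvPolynomial.aeval_zero (S₁ := K) Q
    rw [MvPolynomial.constantCoeff_eq] at this
    exact this
  rw [h1, h0, norm_algebraMap', norm_algebraMap'] at hnorm
  exact hnorm

variable [Finite σ] [CompleteSpace k] [Algebra.IsAlgebraic k K]

/-- The Cauchy estimate: a bound of a power series on the polydisc of radius `‖ϖ‖` bounds its
coefficients in coordinates scaled by `ϖ`. -/
theorem bd_rescale_of_norm_ev_le (hk : ∀ n : ℕ, n ≠ 0 → ‖(n : k)‖ = 1) {C ε : ℝ}
    {F : MvPowerSeries σ k} (hF : Bd C F) {ϖ : k} (hϖ : ‖ϖ‖ < 1)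
    (h : ∀ x : σ → K, (∀ i, ‖x i‖ ≤ ‖ϖ‖) → ‖ev x F‖ ≤ ε) : Bd ε (rescale (fun _ => ϖ) F) := by
  intro m
  have hlim : Tendsto (fun N => max ε (C * ‖ϖ‖ ^ N)) atTop (𝓝 (max ε 0)) := by
    have := (tendsto_pow_atTop_nhds_zero_of_lt_one (norm_nonneg _) hϖ).const_mul C
    rw [mul_zero] at this
    exact tendsto_const_nhds.max this
  have hε : 0 ≤ ε := (norm_nonneg _).trans (h 0 (by simp))
  rw [max_eq_left hε] at hlim
  refine ge_of_tendsto hlim ?_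
  filter_upwards [eventually_gt_atTop m.degree] with N hN
  obtain ⟨x, hx, hm⟩ := exists_norm_coeff_le_norm_eval hk (scalePoly ϖ (truncTotal N F))
  have h1 : coeff m (rescale (fun _ => ϖ) F) = (scalePoly ϖ (truncTotal N F)).coeff m := by
    rw [coeff_scalePoly, coeff_truncTotal _ hN, coeff_rescale, Finsupp.prod,
      Finset.prod_pow_eq_pow_sum]
    rfl
  rw [h1]
  refine (hm m).trans ?_
  have hx' : ∀ i, ‖algebraMap k K ϖ * algebraMap k K (x i)‖ ≤ ‖ϖ‖ := fun i => by
    rw [norm_mul, norm_algebraMap', norm_algebraMap']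
    exact mul_le_of_le_one_right (norm_nonneg _) (hx i)
  have hx1 : ∀ i, ‖algebraMap k K ϖ * algebraMap k K (x i)‖ < 1 := fun i => (hx' i).trans_lt hϖ
  have h2 : algebraMap k K (MvPolynomial.eval x (scalePoly ϖ (truncTotal N F))) =
      ev (fun i => algebraMap k K ϖ * algebraMap k K (x i)) F -
      ev (fun i => algebraMap k K ϖ * algebraMap k K (x i))
        (F - (truncTotal N F : MvPowerSeries σ k)) := by
    rw [ev_sub hF (hF.truncTotal N) hx1, sub_sub_cancel, ev_coe _ hx1, ← aeval_scalePoly]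
    exact (MvPolynomial.aeval_algebraMap_apply K x _).symm
  rw [← norm_algebraMap' K, h2]
  rw [sub_eq_add_neg]
  refine (IsUltrametricDist.norm_add_le_max _ _).trans (max_le_max (h _ hx') ?_)
  rw [norm_neg]
  exact norm_ev_le (hF.sub (hF.truncTotal N)) (sub_truncTotal_mem F N) hϖ (norm_nonneg _) hx'

variable [IsAlgClosed K]

/-- A rational function without poles on the closed unit polydisc has an expansion as a bounded
power series: up to a constant, the denominator is an integral power series with constant term
one. -/
theorem exists_ev_eq_div (hk : ∀ n : ℕ, n ≠ 0 → ‖(n : k)‖ = 1) {P Q : MvPolynomial σ k}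
    (hQ : ∀ x : σ → K, (∀ i, ‖x i‖ ≤ 1) → MvPolynomial.aeval x Q ≠ 0) :
    ∃ (C : ℝ) (G : MvPowerSeries σ k), Bd C G ∧ ∀ x : σ → K, (∀ i, ‖x i‖ < 1) →
      MvPolynomial.aeval x P / MvPolynomial.aeval x Q = ev x G := by
  have hQm := norm_coeff_le_of_forall_aeval_ne_zero hk hQ
  have hQ0 : Q.coeff 0 ≠ 0 := by
    have := hQ 0 (by simp)
    rw [MvPolynomial.aeval_zero, MvPolynomial.constantCoeff_eq] at this
    exact fun h => this (by rw [h, map_zero])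
  set Q' : MvPowerSeries σ k := (Q.coeff 0)⁻¹ • (Q : MvPowerSeries σ k) with hQ'
  have hQ'b : Bd 1 Q' := fun m => by
    rw [hQ', map_smul, smul_eq_mul, norm_mul, norm_inv, MvPolynomial.coeff_coe,
      inv_mul_le_iff₀ (norm_pos_iff.mpr hQ0), mul_one]
    exact hQm m
  have hQ'0 : constantCoeff Q' = 1 := by
    rw [← coeff_zero_eq_constantCoeff_apply, hQ', map_smul, smul_eq_mul, MvPolynomial.coeff_coe,
      inv_mul_cancel₀ hQ0]
  have := Fintype.ofFinite σ
  obtain ⟨N, hN, -, hNb, -⟩ := exists_inverse (r := Unit) (Matrix.of fun _ _ => Q')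
    (fun _ _ => hQ'b) (by ext; simp [hQ'0])
  have hN' : Q' * N () () = 1 := by
    have := congrFun (congrFun hN ()) ()
    simpa [Matrix.mul_apply] using this
  obtain ⟨c, hc⟩ := exists_bd_coe P
  have hN1 := hNb () ()
  refine ⟨_, (Q.coeff 0)⁻¹ • ((P : MvPowerSeries σ k) * N () ()),
    Bd.smul (le_refl ‖(Q.coeff 0)⁻¹‖) (hc.mul hN1), fun x hx => ?_⟩
  rw [div_eq_iff (hQ x fun i => (hx i).le), ev_smul _ (hc.mul hN1) hx, ev_mul hc hN1 hx,
    ev_coe _ hx]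
  have h1 := congrArg (ev x) hN'
  obtain ⟨c', hc'⟩ := exists_bd_coe Q
  rw [ev_mul hQ'b hN1 hx, hQ', ev_smul _ hc' hx, ev_coe _ hx, ev_one hx] at h1
  simp only [Algebra.smul_def] at h1 ⊢
  linear_combination (-MvPolynomial.aeval x P) * h1

/-- An analytic function has a power series expansion at the origin, bounded in sufficiently small
coordinates: by the Cauchy estimate, the expansions of the approximating rational functions converge
uniformly in their coefficients. -/
theorem IsAnalyticOn.eventually_eq_ev (hk : ∀ n : ℕ, n ≠ 0 → ‖(n : k)‖ = 1)
    {f : (σ → K) → K} {V : Set (σ → K)} (hf : IsAnalyticOn k f V) (h0 : 0 ∈ V) :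
    ∀ᶠ c in 𝓝[≠] (0 : k), ∃ (C : ℝ) (F : MvPowerSeries σ k), Bd C F ∧
      ∀ x : σ → K, (∀ i, ‖x i‖ < 1) → f (algebraMap k K c • x) = ev x F := by
  obtain ⟨𝒱, h𝒱, rfl, -⟩ := hf
  obtain ⟨V', hV', h0'⟩ := h0
  obtain ⟨hrat, hlim⟩ := h𝒱 V' hV'
  obtain ⟨c₀, hc₀V, hc₀⟩ := (((hrat.eventually_subset h0').filter_mono
    (nhdsWithin_le_nhds (s := {0}ᶜ))).and self_mem_nhdsWithin).exists
  obtain ⟨ϖ, hϖ0, hϖ⟩ := NormedField.exists_norm_lt_one k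
  have hϖn : ϖ ≠ 0 := norm_pos_iff.mp hϖ0
  -- approximations on the polydisc of radius `‖c₀‖`
  have happ : ∀ n : ℕ, ∃ (C : ℝ) (G : MvPowerSeries σ k), Bd C G ∧
      ∀ x : σ → K, (∀ i, ‖x i‖ < 1) →
        ‖f (algebraMap k K c₀ • x) - ev x G‖ ≤ 1 / ((n : ℝ) + 1) := by
    intro n
    obtain ⟨P, Q, hPQ⟩ := hlim (1 / ((n : ℝ) + 1)) (by positivity)
    have hmem : ∀ x : σ → K, (∀ i, ‖x i‖ ≤ 1) → algebraMap k K c₀ • x ∈ V' := fun x hx => by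
      refine hc₀V _ fun i => ?_
      rw [Pi.smul_apply, smul_eq_mul, norm_mul, norm_algebraMap']
      exact mul_le_of_le_one_right (norm_nonneg _) (hx i)
    obtain ⟨C, G, hG, hGe⟩ := exists_ev_eq_div (K := K) (P := scalePoly c₀ P)
      (Q := scalePoly c₀ Q) hk fun x hx => by
        rw [aeval_scalePoly]
        exact (hPQ _ (hmem x hx)).1
    refine ⟨C, G, hG, fun x hx => ?_⟩
    rw [← hGe x hx, aeval_scalePoly, aeval_scalePoly]
    exact (hPQ _ (hmem x fun i => (hx i).le)).2
  choose C G hG hGf using happ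
  have hGn : ∀ n m : ℕ, n ≤ m → Bd (1 / ((n : ℝ) + 1)) (rescale (fun _ => ϖ) (G n - G m)) := by
    intro n m hnm
    have hb : Bd (max (C n) (C m)) (G n - G m) :=
      ((hG n).mono (le_max_left _ _)).sub ((hG m).mono (le_max_right _ _))
    refine bd_rescale_of_norm_ev_le (K := K) hk hb hϖ fun x hx => ?_
    have hx1 : ∀ i, ‖x i‖ < 1 := fun i => (hx i).trans_lt hϖ
    rw [ev_sub (hG n) (hG m) hx1]
    have h1 : ev x (G n) - ev x (G m) = (f (algebraMap k K c₀ • x) - ev x (G m)) +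
        -(f (algebraMap k K c₀ • x) - ev x (G n)) := by ring
    rw [h1]
    refine (IsUltrametricDist.norm_add_le_max _ _).trans (max_le ?_ ?_)
    · refine (hGf m x hx1).trans ?_
      gcongr
    · rw [norm_neg]
      exact hGf n x hx1
  set H : ℕ → MvPowerSeries σ k := fun n => rescale (fun _ => ϖ) (G n) with hH
  have hHd : ∀ m n N, N ≤ n → ‖coeff m (H N) - coeff m (H n)‖ ≤ 1 / ((N : ℝ) + 1) := by
    intro m n N hn
    rw [← map_sub, hH, ← map_sub]
    exact hGn N n hn m
  have hcauchy : ∀ m, ∃ a, Tendsto (fun n => coeff m (H n)) atTop (𝓝 a) := fun m => by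
    refine cauchySeq_tendsto_of_complete (cauchySeq_of_le_tendsto_0'
      (fun n : ℕ => 1 / ((n : ℝ) + 1))
      (fun N n hn => ?_) tendsto_one_div_add_atTop_nhds_zero_nat)
    rw [dist_eq_norm]
    exact hHd m n N hn
  obtain ⟨F, hF⟩ : ∃ F : MvPowerSeries σ k,
      ∀ m, Tendsto (fun n => coeff m (H n)) atTop (𝓝 (coeff m F)) := by
    choose F hF using hcauchy
    exact ⟨F, hF⟩
  have hHF : ∀ N : ℕ, Bd (1 / ((N : ℝ) + 1)) (H N - F) := fun N m => by
    rw [map_sub]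
    refine le_of_tendsto ((tendsto_const_nhds.sub (hF m)).norm) ?_
    filter_upwards [eventually_ge_atTop N] with n hn
    exact hHd m n N hn
  have hHb : ∀ n, Bd (C n) (H n) := fun n => (hG n).rescale fun _ => hϖ.le
  have hFb : Bd (max (C 0) 1) F := by
    have h1 := ((hHb 0).mono (le_max_left _ 1)).sub ((hHF 0).mono ?_)
    · rwa [sub_sub_cancel] at h1
    · simp
  have hFe : ∀ x : σ → K, (∀ i, ‖x i‖ < 1) →
      f (algebraMap k K (c₀ * ϖ) • x) = ev x F := by
    intro x hx
    rw [← sub_eq_zero, ← norm_le_zero_iff]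
    refine ge_of_tendsto' tendsto_one_div_add_atTop_nhds_zero_nat fun n => ?_
    have hx' : ∀ i, ‖(algebraMap k K ϖ • x) i‖ < 1 := fun i => by
      rw [Pi.smul_apply, smul_eq_mul, norm_mul, norm_algebraMap']
      exact mul_lt_one_of_nonneg_of_lt_one_right hϖ.le (norm_nonneg _) (hx i)
    have h1 := hGf n _ hx'
    have h2 : ev (algebraMap k K ϖ • x) (G n) = ev x (H n) :=
      (ev_rescale (fun _ => ϖ) (fun _ => hϖ.le) (hG n) hx).symm
    rw [smul_smul, ← map_mul, h2] at h1
    have h3 := norm_ev_le_bound (hHF n) hx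
    rw [ev_sub (hHb n) hFb hx] at h3
    rw [← sub_add_sub_cancel _ (ev x (H n))]
    exact (IsUltrametricDist.norm_add_le_max _ _).trans (max_le h1 h3)
  have hc1 : c₀ * ϖ ≠ 0 := mul_ne_zero hc₀ hϖn
  have hsmall : ∀ᶠ c in 𝓝[≠] (0 : k), ‖c‖ < ‖c₀ * ϖ‖ :=
    ((tendsto_norm_zero (E := k)).mono_left
      (nhdsWithin_le_nhds (s := {0}ᶜ))).eventually_lt_const (norm_pos_iff.mpr hc1)
  filter_upwards [hsmall] with c hc
  have ha : ‖c / (c₀ * ϖ)‖ ≤ 1 := by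
    rw [norm_div]
    exact div_le_one_of_le₀ hc.le (norm_nonneg _)
  refine ⟨_, _, hFb.rescale fun _ => ha, fun x hx => ?_⟩
  rw [ev_rescale _ (fun _ => ha) hFb hx]
  have hx' : ∀ i, ‖(algebraMap k K (c / (c₀ * ϖ)) • x) i‖ < 1 := fun i => by
    rw [Pi.smul_apply, smul_eq_mul, norm_mul, norm_algebraMap']
    exact mul_lt_one_of_nonneg_of_lt_one_right ha (norm_nonneg _) (hx i)
  have h1 := hFe _ hx'
  rw [smul_smul, ← map_mul, mul_div_cancel₀ _ hc1] at h1
  exact h1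

end Expansion

/-! ### Linear coordinates and polydiscs -/

section LinearMaps

variable {k K : Type*} [NontriviallyNormedField k] [NontriviallyNormedField K] [NormedAlgebra k K]
  {σ τ : Type*} [Fintype σ]

/-- The `K`-linear map defined by a matrix over `k`. -/
def lin (Λ : Matrix τ σ k) (y : σ → K) : τ → K := (Λ.map (algebraMap k K)).mulVec y

theorem lin_apply (Λ : Matrix τ σ k) (y : σ → K) (l : τ) :
    lin Λ y l = ∑ m, algebraMap k K (Λ l m) * y m := rfl

theorem lin_add_smul (Λ : Matrix τ σ k) (y v : σ → K) (t : K) :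
    lin Λ (y + t • v) = lin Λ y + t • lin Λ v := by
  rw [lin, Matrix.mulVec_add, Matrix.mulVec_smul]
  rfl

theorem lin_zero (Λ : Matrix τ σ k) : lin Λ (0 : σ → K) = 0 := Matrix.mulVec_zero _

theorem lin_single [DecidableEq σ] (Λ : Matrix τ σ k) (i : σ) (l : τ) :
    lin Λ (Pi.single i 1 : σ → K) l = algebraMap k K (Λ l i) := by
  rw [lin, Matrix.mulVec_single_one]
  rfl

theorem lin_lin {υ : Type*} [Fintype τ] (Λ' : Matrix υ τ k) (Λ : Matrix τ σ k) (y : σ → K) :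
    lin Λ' (lin Λ y) = lin (Λ' * Λ) y := by
  rw [lin, lin, lin, Matrix.mulVec_mulVec, Matrix.map_mul]

theorem lin_one [DecidableEq σ] (y : σ → K) : lin (1 : Matrix σ σ k) y = y := by
  rw [lin, Matrix.map_one _ (map_zero _) (map_one _), Matrix.one_mulVec]

/-- The domain on which the linear forms defined by the rows of `Λ` are bounded by `‖ϖ‖`. -/
def disc (K : Type*) [NontriviallyNormedField K] [NormedAlgebra k K] (Λ : Matrix τ σ k) (ϖ : k) :
    Set (σ → K) :=
  {y | ∀ l, ‖lin Λ y l‖ ≤ ‖ϖ‖}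

theorem mem_disc {Λ : Matrix τ σ k} {ϖ : k} {y : σ → K} :
    y ∈ disc K Λ ϖ ↔ ∀ l, ‖lin Λ y l‖ ≤ ‖ϖ‖ := Iff.rfl

theorem zero_mem_disc {Λ : Matrix τ σ k} {ϖ : k} : (0 : σ → K) ∈ disc K Λ ϖ := by
  simp [mem_disc, lin_zero]

/-- A polydisc in linear coordinates is a rational domain: since the linear forms `Λ` have a left
inverse, it is contained in a polydisc of the standard coordinates. -/
theorem isRationalDomain_disc [Fintype τ] [DecidableEq σ] [IsUltrametricDist K]
    {Λ : Matrix τ σ k} {Λ' : Matrix σ τ k} (hΛ : Λ' * Λ = 1) {ϖ : k} (hϖ : ϖ ≠ 0) :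
    IsRationalDomain k (disc K Λ ϖ) := by
  obtain ⟨b, hb⟩ := (Set.finite_range fun x : σ × τ => ‖Λ' x.1 x.2‖).bddAbove
  obtain ⟨c, hc⟩ := NormedField.exists_lt_norm k (max (max b 0 * ‖ϖ‖) 0)
  have hbd : ∀ y ∈ disc K Λ ϖ, ∀ i, ‖y i‖ ≤ ‖c‖ := by
    intro y hy i
    rw [← lin_one (k := k) y, ← hΛ, ← lin_lin, lin_apply]
    refine IsUltrametricDist.norm_sum_le_of_forall_le_of_nonneg (norm_nonneg _) fun m _ => ?_
    rw [norm_mul, norm_algebraMap']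
    refine le_trans ?_ ((le_max_left _ _).trans hc.le)
    exact mul_le_mul ((hb ⟨(i, m), rfl⟩).trans (le_max_left _ _)) (hy m) (norm_nonneg _)
      (le_max_right _ _)
  have haev : ∀ (l : τ) (y : σ → K), MvPolynomial.aeval y
      (∑ m, MvPolynomial.C (Λ l m) * MvPolynomial.X m) = lin Λ y l := by
    intro l y
    simp [lin_apply]
  refine ⟨c, Fintype.card τ,
    fun j => ∑ m, MvPolynomial.C (Λ ((Fintype.equivFin τ).symm j) m) * MvPolynomial.X m,
    MvPolynomial.C ϖ, norm_pos_iff.mp ((le_max_right _ _).trans_lt hc), fun x _ h => ?_, ?_⟩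
  · rw [MvPolynomial.aeval_C, _root_.map_eq_zero] at h
    exact hϖ h.1
  · ext y
    simp only [haev, MvPolynomial.aeval_C, norm_algebraMap', Set.mem_ofPred_eq]
    refine ⟨fun h => ⟨hbd y h, fun j => h _⟩, fun h l => ?_⟩
    simpa using h.2 (Fintype.equivFin τ l)

end LinearMaps

/-! ### Analytic functions on rational domains -/

section Admissibility

variable {k K : Type*} [NontriviallyNormedField k] [NontriviallyNormedField K] [NormedAlgebra k K]
  {σ : Type*}

theorem isAdmissibleCover_self (U : Set (σ → K)) : IsAdmissibleCover k U {U} := by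
  refine ⟨(Set.sUnion_singleton U).symm, fun m Z φ _ _ hφ => ⟨1, fun _ => Z, fun _ => ?_, ?_, ?_⟩⟩
  · refine ⟨0, Fin.elim0, fun _ => 1, fun j => j.elim0, fun ε hε => ⟨1, fun x _ => ?_⟩, ?_, ?_⟩
    · simpa using hε.le
    · simp
    · simp
  · exact (Set.iUnion_const Z).symm
  · exact fun _ => ⟨U, rfl, hφ⟩

theorem IsRationalDomain.isAdmissibleOpen {V : Set (σ → K)} (hV : IsRationalDomain k V) :
    IsAdmissibleOpen k V :=
  ⟨{V}, fun _ h => h ▸ hV, isAdmissibleCover_self V⟩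

theorem IsRationalDomain.isAnalyticOn {V : Set (σ → K)} (hV : IsRationalDomain k V)
    {f : (σ → K) → K} (hf : IsUniformLimit k f V) : IsAnalyticOn k f V :=
  ⟨{V}, fun _ h => h ▸ ⟨hV, hf⟩, isAdmissibleCover_self V⟩

theorem IsRationalDomain.isAnalyticOn_const {V : Set (σ → K)} (hV : IsRationalDomain k V) (a : k) :
    IsAnalyticOn k (fun _ => algebraMap k K a) V :=
  hV.isAnalyticOn fun ε hε => ⟨MvPolynomial.C a, 1, fun x _ => by simpa using hε.le⟩

end Admissibility

section AnalyticSeries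

open Filter Topology

variable {k K : Type*} [NontriviallyNormedField k] [NontriviallyNormedField K] [NormedAlgebra k K]
  [IsUltrametricDist K] [IsUltrametricDist k] [CompleteSpace k] [Algebra.IsAlgebraic k K]
  {σ τ : Type*} [Fintype σ] [Fintype τ]

/-- A bounded power series in linear forms whose absolute values are bounded by `ρ < 1` defines an
analytic function. -/
theorem IsRationalDomain.isAnalyticOn_ev {V : Set (σ → K)} (hV : IsRationalDomain k V)
    {Λ : Matrix τ σ k} {ρ : ℝ} (hρ0 : 0 ≤ ρ) (hρ : ρ < 1) (hΛ : ∀ y ∈ V, ∀ l, ‖lin Λ y l‖ ≤ ρ)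
    {C : ℝ} {F : MvPowerSeries τ k} (hF : Bd C F) : IsAnalyticOn k (fun y => ev (lin Λ y) F) V := by
  refine hV.isAnalyticOn fun ε hε => ?_
  have hlim : Tendsto (fun N => C * ρ ^ N) atTop (𝓝 0) := by
    simpa using (tendsto_pow_atTop_nhds_zero_of_lt_one hρ0 hρ).const_mul C
  obtain ⟨N, hN⟩ := (hlim.eventually_lt_const hε).exists
  refine ⟨MvPolynomial.aeval (fun l => ∑ m, MvPolynomial.C (Λ l m) * MvPolynomial.X m)
    (truncTotal N F), 1, fun y hy => ?_⟩
  have hy1 : ∀ l, ‖lin Λ y l‖ < 1 := fun l => (hΛ y hy l).trans_lt hρ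
  have h1 : MvPolynomial.aeval y (MvPolynomial.aeval
      (fun l => ∑ m, MvPolynomial.C (Λ l m) * MvPolynomial.X m) (truncTotal N F)) =
      MvPolynomial.aeval (lin Λ y) (truncTotal N F) := by
    rw [← AlgHom.comp_apply, MvPolynomial.comp_aeval]
    congr 2
    ext l
    simp [lin_apply]
  rw [h1, map_one, div_one, ← ev_coe _ hy1, ← ev_sub hF (hF.truncTotal N) hy1]
  exact ⟨one_ne_zero, (norm_ev_le (hF.sub (hF.truncTotal N)) (sub_truncTotal_mem F N) hρ hρ0
    (hΛ y hy)).trans hN.le⟩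

theorem pd_ev_lin [DecidableEq σ] (i : σ) {Λ : Matrix τ σ k} {C : ℝ} {F : MvPowerSeries τ k}
    (hF : Bd C F) {y : σ → K} (hy : ∀ l, ‖lin Λ y l‖ < 1) :
    pd i (fun y => ev (lin Λ y) F) y =
      ∑ l, algebraMap k K (Λ l i) * ev (lin Λ y) (pderiv k l F) := by
  have h := hasLineDerivAt_ev (lin Λ (Pi.single i 1)) hF hy
  rw [HasLineDerivAt] at h
  simp only [← lin_add_smul, lin_single] at h
  exact HasLineDerivAt.lineDeriv h

end AnalyticSeries

/-! ### The Sylvester operator of a block diagonal matrix -/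

section Sylvester

/-- An intertwiner of two matrices intertwines their polynomials. -/
theorem aeval_mul_eq_mul_aeval {k r s : Type*} [Field k] [Fintype r] [Fintype s] [DecidableEq r]
    [DecidableEq s] {A : Matrix r r k} {B : Matrix s s k} {Z : Matrix r s k} (h : A * Z = Z * B)
    (p : Polynomial k) : Polynomial.aeval A p * Z = Z * Polynomial.aeval B p := by
  induction p using Polynomial.induction_on' with
  | add p q hp hq => rw [map_add, map_add, Matrix.add_mul, Matrix.mul_add, hp, hq]
  | monomial n a =>
    have hpow : ∀ n : ℕ, A ^ n * Z = Z * B ^ n := fun n => by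
      induction n with
      | zero => simp
      | succ n ih => rw [pow_succ, pow_succ, Matrix.mul_assoc, h, ← Matrix.mul_assoc, ih,
          Matrix.mul_assoc]
    simp only [Polynomial.aeval_monomial, ← Algebra.smul_def, Matrix.smul_mul, Matrix.mul_smul,
      hpow]

/-- Matrices with coprime characteristic polynomials admit no nonzero intertwiners. -/
theorem eq_zero_of_mul_eq_mul {k r s : Type*} [Field k] [Fintype r] [Fintype s] [DecidableEq r]
    [DecidableEq s] {A : Matrix r r k} {B : Matrix s s k}
    (hAB : IsCoprime A.charpoly B.charpoly) {Z : Matrix r s k} (h : A * Z = Z * B) : Z = 0 := by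
  obtain ⟨a, b, hab⟩ := hAB
  have h1 := congrArg (Polynomial.aeval A) hab
  rw [map_add, map_mul, map_mul, Matrix.aeval_self_charpoly, mul_zero, zero_add, map_one] at h1
  have h2 := congrArg (· * Z) h1
  simpa [Matrix.mul_assoc, aeval_mul_eq_mul_aeval h B.charpoly, Matrix.aeval_self_charpoly]
    using h2.symm

/-- The Sylvester operator `Z ↦ A₀ Z - Z A₀` of a block diagonal matrix whose blocks have coprime
characteristic polynomials is invertible on the matrices with zero diagonal blocks. -/
theorem exists_isSylvesterInverse {k : Type*} [NormedField k] [IsUltrametricDist k] {I : Type*}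
    [Fintype I] [DecidableEq I] {J : I → Type*} [∀ i, Fintype (J i)] [∀ i, DecidableEq (J i)]
    {A₀ : Matrix (Σ i, J i) (Σ i, J i) k} (hA₀ : IsBD Sigma.fst A₀)
    (hcop : ∀ i j, i ≠ j → IsCoprime (blk i A₀).charpoly (blk j A₀).charpoly) :
    ∃ L M, 0 ≤ M ∧ IsSylvesterInverse Sigma.fst A₀ L M := by
  let Off : Submodule k (Matrix (Σ i, J i) (Σ i, J i) k) :=
    { carrier := {Z | IsOff Sigma.fst Z}
      add_mem' := fun h h' => h.add h'
      zero_mem' := fun _ _ _ => rfl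
      smul_mem' := fun c Z h p q hpq => by rw [Matrix.smul_apply, h p q hpq, smul_zero] }
  let ad : Matrix (Σ i, J i) (Σ i, J i) k →ₗ[k] Matrix (Σ i, J i) (Σ i, J i) k :=
    LinearMap.mulLeft k A₀ - LinearMap.mulRight k A₀
  have had : ∀ Z, ad Z = A₀ * Z - Z * A₀ := fun Z => rfl
  have hmaps : ∀ Z ∈ Off, ad Z ∈ Off := fun Z hZ => (hA₀.mul_off hZ).sub (hZ.mul_bd hA₀)
  let f : Off →ₗ[k] Off := ad.restrict hmaps
  have hinj : Function.Injective f := by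
    rw [injective_iff_map_eq_zero]
    rintro ⟨Z, hZ⟩ h0
    have h1 : A₀ * Z = Z * A₀ := sub_eq_zero.mp (congrArg Subtype.val h0)
    have h2 : ∀ i j, i ≠ j → Z.submatrix (Sigma.mk i) (Sigma.mk j) = 0 := by
      intro i j hij
      refine eq_zero_of_mul_eq_mul (hcop i j hij) ?_
      ext p q
      have h3 := congrFun (congrFun h1 ⟨i, p⟩) ⟨j, q⟩
      rw [Matrix.mul_apply, Matrix.mul_apply, hA₀.sum_row (fun s => Z s ⟨j, q⟩),
        Fintype.sum_sigma, Finset.sum_eq_single_of_mem j (Finset.mem_univ _)] at h3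
      · rw [Matrix.mul_apply, Matrix.mul_apply]
        exact h3
      · intro l _ hl
        exact Finset.sum_eq_zero fun x _ => by rw [hA₀ ⟨l, x⟩ ⟨j, q⟩ hl, mul_zero]
    refine Subtype.ext (Matrix.ext fun s t => ?_)
    by_cases hst : s.1 = t.1
    · exact hZ s t hst
    · exact congrFun (congrFun (h2 s.1 t.1 hst) s.2) t.2
  let g : Off ≃ₗ[k] Off := LinearEquiv.ofInjectiveEndo f hinj
  have hgf : ∀ Z, g Z = f Z := fun Z => rfl
  let off : Matrix (Σ i, J i) (Σ i, J i) k →ₗ[k] Off :=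
    { toFun := fun Z => ⟨Z - diagPart Sigma.fst Z, isOff_sub_diagPart⟩
      map_add' := fun Z W => Subtype.ext (by
        ext p q
        simp only [diagPart, Matrix.sub_apply, Matrix.add_apply, Matrix.of_apply,
          Submodule.coe_add]
        split_ifs <;> ring)
      map_smul' := fun c Z => Subtype.ext (by
        ext p q
        simp only [diagPart, Matrix.sub_apply, Matrix.smul_apply, Matrix.of_apply,
          Submodule.coe_smul, RingHom.id_apply, smul_eq_mul]
        split_ifs <;> ring) }
  have hoff : ∀ (Z) (hZ : IsOff Sigma.fst Z), off Z = ⟨Z, hZ⟩ := fun Z hZ => Subtype.ext (by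
    ext p q
    change Z p q - diagPart Sigma.fst Z p q = Z p q
    simp only [diagPart, Matrix.of_apply]
    split_ifs with h
    · rw [hZ p q h, sub_zero]
    · rw [sub_zero])
  let L : Matrix (Σ i, J i) (Σ i, J i) k →ₗ[k] Matrix (Σ i, J i) (Σ i, J i) k :=
    Off.subtype ∘ₗ g.symm.toLinearMap ∘ₗ off
  -- the norms of the entries of the matrix of `L` bound its norm
  obtain ⟨M, hM⟩ := (Set.finite_range fun x : ((Σ i, J i) × (Σ i, J i)) × (Σ i, J i) × (Σ i, J i) =>
    ‖L (Matrix.single x.1.1 x.1.2 1) x.2.1 x.2.2‖).bddAbove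
  refine ⟨L, max M 0, le_max_right _ _, fun Z => (g.symm (off Z)).2, fun Z hZ => ?_, fun Z hZ => ?_,
    fun Z c hc hZ p q => ?_⟩
  · have h1 : f (g.symm (off Z)) = off Z := by rw [← hgf, LinearEquiv.apply_symm_apply]
    rw [hoff Z hZ] at h1
    have h2 := congrArg Subtype.val h1
    change A₀ * ((g.symm (⟨Z, hZ⟩ : Off) : Off) : Matrix _ _ k) - _ = Z at h2
    rw [← hoff Z hZ] at h2
    exact h2
  · have h1 : off (A₀ * Z - Z * A₀) = g ⟨Z, hZ⟩ := hoff _ (hmaps Z hZ)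
    change ((g.symm (off (A₀ * Z - Z * A₀)) : Off) : Matrix _ _ k) = Z
    rw [h1, LinearEquiv.symm_apply_apply]
  · have h1 : L Z p q = ∑ a, ∑ b, Z a b * L (Matrix.single a b 1) p q := by
      conv_lhs => rw [Matrix.matrix_eq_sum_single Z]
      simp only [map_sum, Matrix.sum_apply]
      refine Finset.sum_congr rfl fun a _ => Finset.sum_congr rfl fun b _ => ?_
      rw [← smul_eq_mul, ← Matrix.smul_apply, ← map_smul, Matrix.smul_single, smul_eq_mul, mul_one]
    rw [h1]
    have hMc : 0 ≤ max M 0 * c := mul_nonneg (le_max_right _ _) hc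
    refine IsUltrametricDist.norm_sum_le_of_forall_le_of_nonneg hMc fun a _ =>
      IsUltrametricDist.norm_sum_le_of_forall_le_of_nonneg hMc fun b _ => ?_
    rw [norm_mul, mul_comm]
    exact mul_le_mul ((hM ⟨((a, b), (p, q)), rfl⟩).trans (le_max_left _ _)) (hZ a b)
      (norm_nonneg _) (le_max_right _ _)

end Sylvester

/-! ### Bases adapted to the spectral decomposition of the fibre -/

section AdaptedBasis

theorem isBD_blockDiagonal' {k I : Type*} [CommRing k] [DecidableEq I] {J : I → Type*}
    (M : ∀ i, Matrix (J i) (J i) k) : IsBD Sigma.fst (Matrix.blockDiagonal' M) := fun p q h => by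
  rw [Matrix.blockDiagonal'_apply, dif_neg h]

theorem blk_blockDiagonal' {k I : Type*} [CommRing k] [DecidableEq I] {J : I → Type*}
    (M : ∀ i, Matrix (J i) (J i) k) (i : I) : blk i (Matrix.blockDiagonal' M) = M i := by
  ext p q
  exact Matrix.blockDiagonal'_apply_eq M i p q

/-- Endomorphisms with disjoint spectra over an algebraically closed extension have coprime
characteristic polynomials. -/
theorem isCoprime_charpoly_of_disjoint_spectrum {k : Type*} (K : Type*) [Field k] [Field K]
    [Algebra k K] [IsAlgClosed K] {V W : Type*} [AddCommGroup V] [Module k V]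
    [FiniteDimensional k V] [AddCommGroup W] [Module k W] [FiniteDimensional k W]
    {f : Module.End k V} {g : Module.End k W}
    (h : Disjoint (spectrum K (f.baseChange K)) (spectrum K (g.baseChange K))) :
    IsCoprime f.charpoly g.charpoly := by
  rw [← Polynomial.isCoprime_map (algebraMap k K),
    Polynomial.isCoprime_iff_aeval_ne_zero_of_isAlgClosed (k := K) K]
  intro a
  by_contra! ha
  refine Set.disjoint_left.mp h (show a ∈ _ from ?_) ?_
  · rw [Module.End.mem_spectrum_iff_isRoot_charpoly, LinearMap.charpoly_baseChange]
    exact ha.1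
  · rw [Module.End.mem_spectrum_iff_isRoot_charpoly, LinearMap.charpoly_baseChange]
    exact ha.2

/-- A basis adapted to a decomposition into invariant subspaces with disjoint spectra. -/
theorem exists_adapted_basis {k : Type*} (K : Type*) [Field k] [Field K] [Algebra k K]
    [IsAlgClosed K] {r : Type*} [Fintype r] [DecidableEq r] (f : Module.End k (r → k))
    {I : Type*} [Fintype I] [DecidableEq I] {H : I → Submodule k (r → k)}
    (hH : DirectSum.IsInternal H) (hstab : ∀ i, ∀ h ∈ H i, f h ∈ H i)
    (hspec : ∀ i j, i ≠ j → Disjoint (spectrum K ((f.restrict (hstab i)).baseChange K))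
      (spectrum K ((f.restrict (hstab j)).baseChange K))) :
    ∃ (P : Matrix r (Σ i, Fin (Module.finrank k (H i))) k)
      (P' : Matrix (Σ i, Fin (Module.finrank k (H i))) r k), P * P' = 1 ∧ P' * P = 1 ∧
      IsBD Sigma.fst (P' * LinearMap.toMatrix' f * P) ∧
      (∀ i j, i ≠ j → IsCoprime (blk i (P' * LinearMap.toMatrix' f * P)).charpoly
        (blk j (P' * LinearMap.toMatrix' f * P)).charpoly) ∧
      ∀ i h, h ∈ H i ↔ ∃ v : Fin (Module.finrank k (H i)) → k,
        h = P.mulVec fun s => (Pi.single i v : ∀ j, Fin (Module.finrank k (H j)) → k) s.1 s.2 := by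
  let b : ∀ i, Module.Basis (Fin (Module.finrank k (H i))) k (H i) := fun i =>
    Module.finBasis k (H i)
  let cb := hH.collectedBasis b
  let e := Pi.basisFun k r
  have hA : cb.toMatrix e * LinearMap.toMatrix' f * e.toMatrix cb =
      Matrix.blockDiagonal' fun i => LinearMap.toMatrix (b i) (b i) (f.restrict (hstab i)) := by
    rw [← LinearMap.toMatrix_directSum_collectedBasis_eq_blockDiagonal' hH hH b b hstab,
      ← LinearMap.toMatrix_eq_toMatrix',
      basis_toMatrix_mul_linearMap_toMatrix_mul_basis_toMatrix]
  refine ⟨e.toMatrix cb, cb.toMatrix e, e.toMatrix_mul_toMatrix_flip cb,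
    cb.toMatrix_mul_toMatrix_flip e, ?_, fun i j hij => ?_, fun i h => ?_⟩
  · rw [hA]
    exact isBD_blockDiagonal' _
  · rw [hA, blk_blockDiagonal', blk_blockDiagonal', LinearMap.charpoly_toMatrix,
      LinearMap.charpoly_toMatrix]
    exact isCoprime_charpoly_of_disjoint_spectrum K (hspec i j hij)
  · have hmul : ∀ v : Fin (Module.finrank k (H i)) → k, ((e.toMatrix cb).mulVec fun s =>
        (Pi.single i v : ∀ j, Fin (Module.finrank k (H j)) → k) s.1 s.2) =
        ((∑ q, v q • b i q : H i) : r → k) := by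
      intro v
      ext x
      rw [Matrix.mulVec, dotProduct, Fintype.sum_sigma,
        Finset.sum_eq_single_of_mem i (Finset.mem_univ _)]
      · simp [Module.Basis.toMatrix_apply, cb, e, mul_comm]
      · intro j _ hj
        exact Finset.sum_eq_zero fun q _ => by simp [Pi.single_eq_of_ne hj]
    simp only [hmul]
    constructor
    · intro hh
      refine ⟨(b i).repr ⟨h, hh⟩, ?_⟩
      rw [(b i).sum_repr]
    · rintro ⟨v, rfl⟩
      exact Subtype.mem _

/-- A bijective linear map over `K` which is defined over `k` has an inverse over `k`. -/
theorem exists_inverse_of_bijective {k K : Type*} [Field k] [Field K] [Algebra k K] {r s : Type*}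
    [Fintype r] [Fintype s] [DecidableEq r] [DecidableEq s] {M : Matrix r s k}
    (hM : Function.Bijective (M.map (algebraMap k K)).mulVec) :
    ∃ N : Matrix s r k, M * N = 1 ∧ N * M = 1 := by
  have hcard : Fintype.card s = Fintype.card r := by
    have := (LinearEquiv.ofBijective (M.map (algebraMap k K)).mulVecLin hM).finrank_eq
    simpa using this
  have hinj : Function.Injective M.mulVecLin := by
    rw [injective_iff_map_eq_zero]
    intro v hv
    have h1 : (M.map (algebraMap k K)).mulVec (algebraMap k K ∘ v) = 0 := by
      ext i
      rw [← RingHom.map_mulVec, ← Matrix.mulVecLin_apply, hv, Pi.zero_apply, Pi.zero_apply,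
        map_zero]
    have h2 := hM.1 (h1.trans (Matrix.mulVec_zero _).symm)
    ext q
    exact (algebraMap k K).injective ((congrFun h2 q).trans (map_zero _).symm)
  have hsurj : Function.Surjective M.mulVec :=
    (M.mulVecLin.linearEquivOfInjective hinj (by simpa using hcard)).surjective
  obtain ⟨N, hN⟩ := Matrix.mulVec_surjective_iff_exists_right_inverse.mp hsurj
  exact ⟨N, hN, (Matrix.mul_eq_one_comm_of_card_eq _ _ _ hcard.symm).mp hN⟩

end AdaptedBasis

/-! ### Matrices of bounded power series and their values -/

section BoundedMatrices

variable {k : Type*} [NormedField k] {σ r s t : Type*}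

/-- The entries of the matrix `M` have uniformly bounded coefficients. -/
def MBdd (M : Matrix r s (MvPowerSeries σ k)) : Prop := ∃ C, 0 ≤ C ∧ ∀ i j, Bd C (M i j)

theorem MBdd.zero : MBdd (0 : Matrix r s (MvPowerSeries σ k)) :=
  ⟨0, le_rfl, fun _ _ => Bd.zero le_rfl⟩

theorem MBdd.map_C [Finite r] [Finite s] (M : Matrix r s k) :
    MBdd (M.map (MvPowerSeries.C : k → MvPowerSeries σ k)) := by
  obtain ⟨D, hD⟩ := (Set.finite_range fun x : r × s => ‖M x.1 x.2‖).bddAbove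
  exact ⟨max D 0, le_max_right _ _, fun i j =>
    Bd.C ((hD ⟨(i, j), rfl⟩).trans (le_max_left _ _))⟩

theorem MBdd.of_forall [Finite r] [Finite s] {M : Matrix r s (MvPowerSeries σ k)}
    (h : ∀ i j, ∃ C, Bd C (M i j)) : MBdd M := by
  choose D hD using h
  obtain ⟨C, hC⟩ := (Set.finite_range fun x : r × s => D x.1 x.2).bddAbove
  exact ⟨max C 0, le_max_right _ _, fun i j =>
    (hD i j).mono ((hC ⟨(i, j), rfl⟩).trans (le_max_left _ _))⟩

variable [IsUltrametricDist k]

theorem MBdd.add {M N : Matrix r s (MvPowerSeries σ k)} (hM : MBdd M) (hN : MBdd N) :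
    MBdd (M + N) := by
  obtain ⟨C, hC, hM⟩ := hM
  obtain ⟨D, -, hN⟩ := hN
  exact ⟨max C D, hC.trans (le_max_left _ _), fun i j =>
    ((hM i j).mono (le_max_left _ _)).add ((hN i j).mono (le_max_right _ _))⟩

theorem MBdd.sub {M N : Matrix r s (MvPowerSeries σ k)} (hM : MBdd M) (hN : MBdd N) :
    MBdd (M - N) := by
  obtain ⟨C, hC, hM⟩ := hM
  obtain ⟨D, -, hN⟩ := hN
  exact ⟨max C D, hC.trans (le_max_left _ _), fun i j =>
    ((hM i j).mono (le_max_left _ _)).sub ((hN i j).mono (le_max_right _ _))⟩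

theorem MBdd.mul [Fintype s] {M : Matrix r s (MvPowerSeries σ k)}
    {N : Matrix s t (MvPowerSeries σ k)} (hM : MBdd M) (hN : MBdd N) : MBdd (M * N) := by
  obtain ⟨C, hC, hM⟩ := hM
  obtain ⟨D, hD, hN⟩ := hN
  exact ⟨C * D, mul_nonneg hC hD, fun i j => Bd.matrix_mul hC hD hM hN i j⟩

theorem MBdd.smul {C : ℝ} {f : MvPowerSeries σ k} (hf : Bd C f)
    {M : Matrix r s (MvPowerSeries σ k)} (hM : MBdd M) : MBdd (f • M) := by
  obtain ⟨D, hD, hM⟩ := hM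
  exact ⟨C * D, mul_nonneg hf.nonneg hD, fun i j => hf.mul (hM i j)⟩

theorem MBdd.sum {ι : Type*} (S : Finset ι) {M : ι → Matrix r s (MvPowerSeries σ k)}
    (hM : ∀ i ∈ S, MBdd (M i)) : MBdd (∑ i ∈ S, M i) :=
  Finset.sum_induction _ _ (fun _ _ => MBdd.add) MBdd.zero hM

theorem MBdd.matD_pderiv {M : Matrix r s (MvPowerSeries σ k)} (hM : MBdd M) (l : σ) :
    MBdd (matD (pderiv k l) M) := by
  obtain ⟨C, hC, hM⟩ := hM
  exact ⟨C, hC, fun i j => (hM i j).pderiv l⟩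

theorem MBdd.matD_uD {S : Type*} {M : Matrix r s (MvPowerSeries (Option S) k)} (hM : MBdd M)
    (a : S) : MBdd (matD (uD k a) M) :=
  (hM.matD_pderiv (some a)).smul (Bd.X none)

theorem Bd.C_mul_X_none_pow {S : Type*} (q : k) (n : ℕ) :
    Bd (‖q‖ * 1) (MvPowerSeries.C q * MvPowerSeries.X none ^ n : MvPowerSeries (Option S) k) :=
  (Bd.C le_rfl).mul (by simpa using (Bd.X none).pow n)

theorem MBdd.matD_uuD {S : Type*} {M : Matrix r s (MvPowerSeries (Option S) k)} (hM : MBdd M)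
    (q : k) : MBdd (matD (uuD S q) M) :=
  (hM.matD_pderiv none).smul (Bd.C_mul_X_none_pow q 2)

end BoundedMatrices

section MatrixValues

variable {k K : Type*} [NontriviallyNormedField k] [NontriviallyNormedField K] [NormedAlgebra k K]
  [IsUltrametricDist K] [IsUltrametricDist k] [CompleteSpace k] [Algebra.IsAlgebraic k K]
  {σ r s t : Type*} [Finite σ] {M N : Matrix r s (MvPowerSeries σ k)} {x : σ → K}

theorem map_ev_add (hM : MBdd M) (hN : MBdd N) (hx : ∀ i, ‖x i‖ < 1) :
    (M + N).map (ev x) = M.map (ev x) + N.map (ev x) := by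
  obtain ⟨C, -, hM⟩ := hM
  obtain ⟨D, -, hN⟩ := hN
  ext i j
  exact ev_add (hM i j) (hN i j) hx

theorem map_ev_sub (hM : MBdd M) (hN : MBdd N) (hx : ∀ i, ‖x i‖ < 1) :
    (M - N).map (ev x) = M.map (ev x) - N.map (ev x) := by
  obtain ⟨C, -, hM⟩ := hM
  obtain ⟨D, -, hN⟩ := hN
  ext i j
  exact ev_sub (hM i j) (hN i j) hx

theorem map_ev_mul [Fintype s] {N : Matrix s t (MvPowerSeries σ k)} (hM : MBdd M) (hN : MBdd N)
    (hx : ∀ i, ‖x i‖ < 1) : (M * N).map (ev x) = M.map (ev x) * N.map (ev x) := by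
  obtain ⟨C, -, hM⟩ := hM
  obtain ⟨D, -, hN⟩ := hN
  exact ev_matrix_mul hM hN hx

theorem map_ev_smul {C : ℝ} {f : MvPowerSeries σ k} (hf : Bd C f) (hM : MBdd M)
    (hx : ∀ i, ‖x i‖ < 1) : (f • M).map (ev x) = ev x f • M.map (ev x) := by
  obtain ⟨D, -, hM⟩ := hM
  ext i j
  exact ev_mul hf (hM i j) hx

theorem map_ev_zero (hx : ∀ i, ‖x i‖ < 1) :
    (0 : Matrix r s (MvPowerSeries σ k)).map (ev x) = 0 := by
  ext i j
  exact ev_zero hx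

theorem map_ev_sum {ι : Type*} (S : Finset ι) {M : ι → Matrix r s (MvPowerSeries σ k)}
    (hM : ∀ i, MBdd (M i)) (hx : ∀ i, ‖x i‖ < 1) :
    (∑ i ∈ S, M i).map (ev x) = ∑ i ∈ S, (M i).map (ev x) := by
  classical
  induction S using Finset.induction_on with
  | empty => simpa using map_ev_zero hx
  | insert a S ha ih => rw [Finset.sum_insert ha, Finset.sum_insert ha,
      map_ev_add (hM a) (MBdd.sum S fun i _ => hM i) hx, ih]

theorem map_ev_map_C (M : Matrix r s k) (hx : ∀ i, ‖x i‖ < 1) :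
    (M.map (MvPowerSeries.C : k → MvPowerSeries σ k)).map (ev x) = M.map (algebraMap k K) := by
  ext i j
  exact ev_C _ hx

theorem map_ev_matD_uD {S : Type*} [Finite S] {x : Option S → K}
    {M : Matrix r s (MvPowerSeries (Option S) k)}
    (hM : MBdd M) (a : S) (hx : ∀ i, ‖x i‖ < 1) :
    (matD (uD k a) M).map (ev x) = x none • (matD (pderiv k (some a)) M).map (ev x) := by
  rw [matD_uD, map_ev_smul (Bd.X none) (hM.matD_pderiv _) hx, ev_X none hx]

theorem ev_C_mul_X_none_pow {S : Type*} [Finite S] {x : Option S → K} (q : k) (n : ℕ)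
    (hx : ∀ i, ‖x i‖ < 1) :
    ev x (C q * X none ^ n : MvPowerSeries (Option S) k) = algebraMap k K q * x none ^ n := by
  have h := ev_coe (MvPolynomial.C q * MvPolynomial.X none ^ n : MvPolynomial (Option S) k) hx
  rw [MvPolynomial.coe_mul, MvPolynomial.coe_pow, MvPolynomial.coe_C, MvPolynomial.coe_X] at h
  rw [h]
  simp

theorem map_ev_matD_uuD {S : Type*} [Finite S] {x : Option S → K}
    {M : Matrix r s (MvPowerSeries (Option S) k)}
    (hM : MBdd M) (q : k) (hx : ∀ i, ‖x i‖ < 1) : (matD (uuD S q) M).map (ev x) =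
      (algebraMap k K q * x none ^ 2) • (matD (pderiv k none) M).map (ev x) := by
  have h := map_ev_smul (Bd.C_mul_X_none_pow q 2) (hM.matD_pderiv none) hx
  rw [ev_C_mul_X_none_pow q 2 hx] at h
  exact h

/-- Bounded matrices with equal values on a polydisc are equal. -/
theorem eq_of_map_ev_eq {σ : Type*} [Finite σ] {M N : Matrix r s (MvPowerSeries σ k)} (hM : MBdd M)
    (hN : MBdd N) (h : ∀ x : σ → K, (∀ i, ‖x i‖ < 1) → M.map (ev x) = N.map (ev x)) : M = N := by
  have := Fintype.ofFinite σ
  obtain ⟨C, -, hC⟩ := hM.sub hN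
  rw [← sub_eq_zero]
  ext1 i j
  refine eq_zero_of_ev_eq_zero (K := K) (hC i j) one_half_pos one_half_lt_one fun x hx => ?_
  have hx1 : ∀ i, ‖x i‖ < 1 := fun i => (hx i).trans_lt one_half_lt_one
  have h1 := map_ev_sub hM hN hx1
  rw [h x hx1, sub_self] at h1
  exact congrFun (congrFun h1 i) j

end MatrixValues

/-! ### Linear coordinates on the base times the `u`-line -/

section ProductCoordinates

variable {k K : Type*} [NontriviallyNormedField k] [NontriviallyNormedField K] [NormedAlgebra k K]
  {ι κ S : Type*}

/-- The matrix `L ⊕ a` of a linear map of `𝔸^ι × 𝔸¹`. -/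
def optMat (a : k) (L : Matrix S ι k) : Matrix (Option S) (Option ι) k :=
  fun o o' => o.elim (o'.elim a fun _ => 0) fun s => o'.elim 0 fun i => L s i

variable [Fintype ι]

theorem lin_optMat (a : k) (L : Matrix S ι k) (y : Option ι → K) :
    lin (optMat a L) y = pt (lin L (base y)) (algebraMap k K a * y none) := by
  funext o
  cases o <;> simp [lin_apply, optMat, pt, base, Fintype.sum_option]

theorem lin_optMat_pt (a : k) (L : Matrix S ι k) (x : ι → K) (t : K) :
    lin (optMat a L) (pt x t) = pt (lin L x) (algebraMap k K a * t) :=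
  lin_optMat a L (pt x t)

theorem optMat_mul (a b : k) (L : Matrix S ι k) (M : Matrix ι κ k) :
    optMat a L * optMat b M = optMat (a * b) (L * M) := by
  ext o o'
  cases o <;> cases o' <;> simp [Matrix.mul_apply, optMat, Fintype.sum_option]

theorem optMat_one [DecidableEq S] : optMat (1 : k) (1 : Matrix S S k) = 1 := by
  ext o o'
  cases o <;> cases o' <;> simp [optMat, Matrix.one_apply]

end ProductCoordinates

section LinearContinuity

variable {k K : Type*} [NontriviallyNormedField k] [NontriviallyNormedField K] [NormedAlgebra k K]

theorem continuous_lin {σ τ : Type*} [Fintype σ] (Λ : Matrix τ σ k) :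
    Continuous (lin Λ : (σ → K) → τ → K) := by
  refine continuous_pi fun l => ?_
  simp only [lin_apply]
  fun_prop

end LinearContinuity

section MatrixDerivatives

open Filter Topology

variable {k K : Type*} [NontriviallyNormedField k] [NontriviallyNormedField K] [NormedAlgebra k K]
  [IsUltrametricDist K] [IsUltrametricDist k] [CompleteSpace k] [Algebra.IsAlgebraic k K]
  {ι S r s : Type*} [Fintype ι] [Fintype S]

/-- The derivatives of a matrix which is given by power series near `y`. -/
theorem pdM_of_eq_ev {σ τ : Type*} [Fintype σ] [DecidableEq σ] [Fintype τ] (o : σ)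
    {f : (σ → K) → Matrix r s K} {M : Matrix r s (MvPowerSeries τ k)} (hM : MBdd M)
    {Λ : Matrix τ σ k} (hf : ∀ y, (∀ l, ‖lin Λ y l‖ < 1) → f y = M.map (ev (lin Λ y)))
    {y : σ → K} (hy : ∀ l, ‖lin Λ y l‖ < 1) :
    pdM o f y = ∑ l, algebraMap k K (Λ l o) • (matD (pderiv k l) M).map (ev (lin Λ y)) := by
  obtain ⟨C, -, hM⟩ := hM
  have hnear : ∀ᶠ y' in 𝓝 y, ∀ l, ‖lin Λ y' l‖ < 1 := by
    refine Filter.eventually_all.mpr fun l => ?_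
    have h1 : Continuous fun y' : σ → K => ‖lin Λ y' l‖ :=
      ((continuous_apply l).comp (continuous_lin Λ)).norm
    exact h1.continuousAt.eventually_lt_const (hy l)
  ext i j
  have h2 : (fun y => f y i j) =ᶠ[𝓝 y] fun y => ev (lin Λ y) (M i j) := by
    filter_upwards [hnear] with y' hy'
    rw [hf y' hy', Matrix.map_apply]
  change lineDeriv K (fun y => f y i j) y (Pi.single o 1) = _
  rw [h2.lineDeriv_eq, Matrix.sum_apply]
  exact pd_ev_lin o (hM i j) hy

variable [DecidableEq ι] {f : (Option ι → K) → Matrix r s K}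
  {M : Matrix r s (MvPowerSeries (Option S) k)} {a : k} {L : Matrix S ι k} {y : Option ι → K}

theorem pdM_some_of_eq_ev (hM : MBdd M)
    (hf : ∀ y, (∀ l, ‖lin (optMat a L) y l‖ < 1) → f y = M.map (ev (lin (optMat a L) y)))
    (hy : ∀ l, ‖lin (optMat a L) y l‖ < 1) (i : ι) : pdM (some i) f y =
      ∑ s, algebraMap k K (L s i) •
        (matD (pderiv k (some s)) M).map (ev (lin (optMat a L) y)) := by
  rw [pdM_of_eq_ev (some i) hM hf hy, Fintype.sum_option]
  simp [optMat]

theorem pdM_none_of_eq_ev (hM : MBdd M)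
    (hf : ∀ y, (∀ l, ‖lin (optMat a L) y l‖ < 1) → f y = M.map (ev (lin (optMat a L) y)))
    (hy : ∀ l, ‖lin (optMat a L) y l‖ < 1) : pdM none f y =
      algebraMap k K a • (matD (pderiv k none) M).map (ev (lin (optMat a L) y)) := by
  rw [pdM_of_eq_ev none hM hf hy, Fintype.sum_option]
  simp [optMat]

end MatrixDerivatives

/-! ### Expansions in small linear coordinates -/

section LinearSubstitution

open Filter Topology

variable {k K : Type*} [NontriviallyNormedField k] [NontriviallyNormedField K] [NormedAlgebra k K]

theorem lin_smul {σ τ : Type*} [Fintype σ] (a : k) (Λ : Matrix τ σ k) (y : σ → K) :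
    lin (a • Λ) y = algebraMap k K a • lin Λ y := by
  ext l
  simp [lin_apply, Finset.mul_sum, mul_assoc]

theorem lin_const_smul {σ τ : Type*} [Fintype σ] (Λ : Matrix τ σ k) (t : K) (y : σ → K) :
    lin Λ (t • y) = t • lin Λ y := by
  rw [lin, Matrix.mulVec_smul]
  rfl

theorem MBdd.const_smul {σ r s : Type*} (a : k) {M : Matrix r s (MvPowerSeries σ k)}
    (hM : MBdd M) : MBdd (a • M) := by
  obtain ⟨D, hD, hM⟩ := hM
  refine ⟨‖a‖ * D, mul_nonneg (norm_nonneg _) hD, fun i j m => ?_⟩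
  rw [Matrix.smul_apply, coeff_smul, norm_mul]
  exact mul_le_mul_of_nonneg_left (hM i j m) (norm_nonneg _)

variable [IsUltrametricDist K] [IsUltrametricDist k] [CompleteSpace k] [Algebra.IsAlgebraic k K]

theorem map_ev_const_smul {σ r s : Type*} [Finite σ] (a : k) {M : Matrix r s (MvPowerSeries σ k)}
    (hM : MBdd M) {x : σ → K} (hx : ∀ i, ‖x i‖ < 1) :
    (a • M).map (ev x) = algebraMap k K a • M.map (ev x) := by
  obtain ⟨D, -, hM⟩ := hM
  ext i j
  exact (ev_smul a (hM i j) hx).trans (Algebra.smul_def _ _)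

/-- Near the origin, an analytic function is given by a bounded power series in the coordinates of
a linear map; in sufficiently small coordinates, its nonconstant coefficients are small. -/
theorem IsAnalyticOn.eventually_eq_ev_lin [IsAlgClosed K] {σ τ : Type*} [Finite σ] [Fintype τ]
    (hk : ∀ n : ℕ, n ≠ 0 → ‖(n : k)‖ = 1) {f : (σ → K) → K} {V : Set (σ → K)}
    (hf : IsAnalyticOn k f V) (h0 : 0 ∈ V) (M : Matrix σ τ k) {ε : ℝ} (hε : 0 < ε) :
    ∀ᶠ q in 𝓝[≠] (0 : k), ∃ F : MvPowerSeries τ k, (∃ D, Bd D F) ∧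
      Bd ε (F - C (constantCoeff F)) ∧
      ∀ x : τ → K, (∀ l, ‖x l‖ < 1) → f (lin (q • M) x) = ev x F := by
  obtain ⟨c₀, ⟨D, F₀, hF₀, hfF⟩, hc₀⟩ :=
    ((hf.eventually_eq_ev hk h0).and self_mem_nhdsWithin).exists
  obtain ⟨b, hb⟩ := (Set.finite_range fun x : σ × τ => ‖M x.1 x.2‖).bddAbove
  have hb' : ∀ m l, ‖M m l‖ ≤ max b 1 := fun m l => (hb ⟨(m, l), rfl⟩).trans (le_max_left _ _)
  have hb0 : 0 < max b 1 := one_pos.trans_le (le_max_right _ _)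
  obtain ⟨d, hd0, hd⟩ := NormedField.exists_norm_lt k (inv_pos.mpr hb0)
  have hdM : ∀ m l, ‖d * M m l‖ ≤ 1 := fun m l => by
    rw [norm_mul, ← inv_mul_cancel₀ hb0.ne']
    exact mul_le_mul hd.le (hb' m l) (norm_nonneg _) (inv_pos.mpr hb0).le
  -- the linear map `M`, made integral by the factor `d`
  let P : σ → MvPowerSeries τ k := fun m => ∑ l, (d * M m l) • X l
  have hterm : ∀ m l, Bd 1 ((d * M m l) • X l : MvPowerSeries τ k) := fun m l n => by
    rw [coeff_smul, norm_mul]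
    exact mul_le_one₀ (hdM m l) (norm_nonneg _) (Bd.X l n)
  have hP : ∀ m, Bd 1 (P m) := fun m => Bd.sum zero_le_one _ fun l _ => hterm m l
  have hP0 : ∀ m, constantCoeff (P m) = 0 := fun m => by
    simp [P]
  have hPev : ∀ x : τ → K, (∀ l, ‖x l‖ < 1) → (fun m => ev x (P m)) =
      algebraMap k K d • lin M x := fun x hx => by
    ext m
    rw [ev_sum _ zero_le_one (fun l _ => hterm m l) hx]
    rw [Pi.smul_apply, lin_apply, Finset.smul_sum]
    refine Finset.sum_congr rfl fun l _ => ?_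
    rw [ev_smul _ (Bd.X _) hx, ev_X _ hx, Algebra.smul_def, map_mul, smul_eq_mul, mul_assoc]
  have hF₁ : Bd D (subst P F₀) := hF₀.subst hP hP0
  have hc₁ : c₀ * d ≠ 0 := mul_ne_zero hc₀ (norm_pos_iff.mp hd0)
  have hcont : Tendsto (fun q : k => ‖q / (c₀ * d)‖) (𝓝 0) (𝓝 0) := by
    have h := (continuous_id.div_const (c₀ * d)).norm.tendsto (0 : k)
    simpa using h
  have h1 : ∀ᶠ q in 𝓝[≠] (0 : k), ‖q / (c₀ * d)‖ ≤ 1 :=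
    nhdsWithin_le_nhds (hcont.eventually_le_const one_pos)
  have h2 : ∀ᶠ q in 𝓝[≠] (0 : k), D * ‖q / (c₀ * d)‖ ≤ ε := by
    have := hcont.const_mul D
    rw [mul_zero] at this
    exact nhdsWithin_le_nhds (this.eventually_le_const hε)
  filter_upwards [h1, h2] with q hq1 hq2
  have hcoeff : ∀ m, coeff m (rescale (fun _ => q / (c₀ * d)) (subst P F₀)) =
      (q / (c₀ * d)) ^ m.degree * coeff m (subst P F₀) := fun m => by
    rw [coeff_rescale, Finsupp.prod, Finset.prod_pow_eq_pow_sum]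
    rfl
  refine ⟨rescale (fun _ => q / (c₀ * d)) (subst P F₀), ⟨D, fun m => ?_⟩, fun m => ?_,
    fun x hx => ?_⟩
  · rw [hcoeff, norm_mul, norm_pow]
    exact (mul_le_of_le_one_left (norm_nonneg _) (pow_le_one₀ (norm_nonneg _) hq1)).trans (hF₁ m)
  · classical
    rw [map_sub, coeff_C]
    split_ifs with hm
    · rw [hm, coeff_zero_eq_constantCoeff_apply, sub_self, norm_zero]
      exact hε.le
    · rw [sub_zero, hcoeff, norm_mul, norm_pow]
      refine le_trans ?_ hq2
      rw [mul_comm D]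
      refine mul_le_mul ?_ (hF₁ m) (norm_nonneg _) (norm_nonneg _)
      exact pow_le_of_le_one (norm_nonneg _) hq1 (by rwa [Ne, Finsupp.degree_eq_zero_iff])
  · rw [ev_rescale _ (fun _ => hq1) hF₁ hx]
    have hx' : ∀ l, ‖algebraMap k K (q / (c₀ * d)) * x l‖ < 1 := fun l => by
      rw [norm_mul, norm_algebraMap']
      exact (mul_le_of_le_one_left (norm_nonneg _) hq1).trans_lt (hx l)
    have hy : ∀ m, ‖ev (fun l => algebraMap k K (q / (c₀ * d)) * x l) (P m)‖ < 1 := fun m => by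
      obtain ⟨ρ, hρ0, hρ, hxρ⟩ := exists_norm_le_lt_one hx'
      exact (norm_ev_le_of_constantCoeff (hP m) (hP0 m) hρ hρ0 hxρ).trans_lt hρ
    rw [ev_subst hP hP0 hF₀ hx', ← hfF _ hy, hPev _ hx']
    congr 1
    have h3 : (fun l => algebraMap k K (q / (c₀ * d)) * x l) =
      algebraMap k K (q / (c₀ * d)) • x := rfl
    rw [h3, lin_smul, lin_const_smul, smul_smul, smul_smul, ← map_mul, ← map_mul]
    rw [mul_div_assoc', mul_div_cancel_left₀ _ hc₁]

end LinearSubstitution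

section LinearAlgebra

variable {k K : Type*} [NontriviallyNormedField k] [NontriviallyNormedField K] [NormedAlgebra k K]
  {ι S : Type*} [Fintype ι]

theorem algebraMap_mul_lin_none {q : k} (hq : q ≠ 0) (L : Matrix S ι k) (y : Option ι → K) :
    algebraMap k K q * lin (optMat q⁻¹ L) y none = y none := by
  rw [lin_optMat]
  change _ * (algebraMap k K q⁻¹ * y none) = y none
  rw [← mul_assoc, ← map_mul, mul_inv_cancel₀ hq, map_one, one_mul]

/-- An invertible linear change of coordinates, applied to a family of vectors, is injective. -/
theorem eq_zero_of_sum_smul_eq_zero {N : Type*} [AddCommGroup N] [Module K N] [Fintype S]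
    [DecidableEq S] {L : Matrix S ι k} {L' : Matrix ι S k} (hL : L * L' = 1) {R : S → N}
    (h : ∀ i, ∑ s, algebraMap k K (L s i) • R s = 0) (s : S) : R s = 0 := by
  have h1 : ∀ t, ∑ i, algebraMap k K (L' i s) • algebraMap k K (L t i) • R t =
      algebraMap k K ((1 : Matrix S S k) t s) • R t := fun t => by
    rw [← hL, Matrix.mul_apply, map_sum, Finset.sum_smul]
    exact Finset.sum_congr rfl fun i _ => by rw [smul_smul, map_mul, mul_comm]
  have h2 : ∑ i, algebraMap k K (L' i s) • ∑ t, algebraMap k K (L t i) • R t = 0 := by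
    simp [h]
  simp only [Finset.smul_sum] at h2
  rw [Finset.sum_comm] at h2
  simpa [h1, Matrix.one_apply] using h2

end LinearAlgebra

/-! ### Flatness of analytic and formal connections -/

section Curvature

variable {k K : Type*} [NontriviallyNormedField k] [NontriviallyNormedField K] [NormedAlgebra k K]
  [IsUltrametricDist K] [IsUltrametricDist k] [CompleteSpace k] [Algebra.IsAlgebraic k K]
  {ι S r s : Type*} [Fintype ι] [DecidableEq ι] [Fintype S]
  {f : (Option ι → K) → Matrix r s K}
  {M : Matrix r s (MvPowerSeries (Option S) k)} {q : k} {L : Matrix S ι k} {y : Option ι → K}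

/-- In coordinates scaled by `q`, the operators `u ∂ᵢ` are the linear combinations of the formal
operators `u ∂ₛ`. -/
theorem smul_pdM_some_of_eq_ev (hq : q ≠ 0) (hM : MBdd M)
    (hf : ∀ y, (∀ l, ‖lin (optMat q⁻¹ L) y l‖ < 1) → f y = M.map (ev (lin (optMat q⁻¹ L) y)))
    (hy : ∀ l, ‖lin (optMat q⁻¹ L) y l‖ < 1) (i : ι) : y none • pdM (some i) f y =
      ∑ s, algebraMap k K (q * L s i) •
        (matD (uD k s) M).map (ev (lin (optMat q⁻¹ L) y)) := by
  rw [pdM_some_of_eq_ev hM hf hy, Finset.smul_sum]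
  refine Finset.sum_congr rfl fun s _ => ?_
  rw [map_ev_matD_uD hM s hy, smul_smul, smul_smul, map_mul, mul_right_comm,
    algebraMap_mul_lin_none hq]

/-- In coordinates scaled by `q`, the operator `u² ∂ᵤ` is the formal operator `q u² ∂ᵤ`. -/
theorem smul_pdM_none_of_eq_ev (hq : q ≠ 0) (hM : MBdd M)
    (hf : ∀ y, (∀ l, ‖lin (optMat q⁻¹ L) y l‖ < 1) → f y = M.map (ev (lin (optMat q⁻¹ L) y)))
    (hy : ∀ l, ‖lin (optMat q⁻¹ L) y l‖ < 1) : y none ^ 2 • pdM none f y =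
      (matD (uuD S q) M).map (ev (lin (optMat q⁻¹ L) y)) := by
  have hq' : algebraMap k K q ≠ 0 := by simpa using hq
  rw [pdM_none_of_eq_ev hM hf hy, map_ev_matD_uuD hM q hy, smul_smul,
    ← algebraMap_mul_lin_none hq L y, map_inv₀]
  congr 1
  field_simp

variable [Fintype r] {c : ConnForm K ι r} {T : S → Matrix r r (MvPowerSeries (Option S) k)}
  {A : Matrix r r (MvPowerSeries (Option S) k)}

/-- The curvature of a connection given by power series in linear coordinates, in the directions of
the base. -/
theorem base_curvature_eq (hq : q ≠ 0) (hTb : ∀ s, MBdd (T s))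
    (hT : ∀ y, (∀ l, ‖lin (optMat q⁻¹ L) y l‖ < 1) → ∀ i,
      c.T i y = ∑ s, algebraMap k K (q * L s i) • (T s).map (ev (lin (optMat q⁻¹ L) y)))
    (hy : ∀ l, ‖lin (optMat q⁻¹ L) y l‖ < 1) (i j : ι) :
    y none • (pdM (some i) (c.T j) y - pdM (some j) (c.T i) y) +
      (c.T i y * c.T j y - c.T j y * c.T i y) =
    ∑ s, algebraMap k K (q * L s i) • ∑ t, algebraMap k K (q * L t j) •
      (matD (uD k s) (T t) - matD (uD k t) (T s) + (T s * T t - T t * T s)).map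
        (ev (lin (optMat q⁻¹ L) y)) := by
  have hF : ∀ i, MBdd (∑ s, (q * L s i) • T s) := fun i =>
    MBdd.sum _ fun s _ => (hTb s).const_smul _
  have hTF : ∀ y, (∀ l, ‖lin (optMat q⁻¹ L) y l‖ < 1) → ∀ i,
      c.T i y = (∑ s, (q * L s i) • T s).map (ev (lin (optMat q⁻¹ L) y)) := fun y hy i => by
    rw [hT y hy, map_ev_sum _ (fun s => (hTb s).const_smul _) hy]
    exact Finset.sum_congr rfl fun s _ => (map_ev_const_smul _ (hTb s) hy).symm
  have hd : ∀ i j, y none • pdM (some i) (c.T j) y =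
      ∑ s, ∑ t, algebraMap k K (q * L s i) • algebraMap k K (q * L t j) •
        (matD (uD k s) (T t)).map (ev (lin (optMat q⁻¹ L) y)) := fun i j => by
    rw [smul_pdM_some_of_eq_ev hq (hF j) (fun y hy => hTF y hy j) hy]
    refine Finset.sum_congr rfl fun s _ => ?_
    rw [map_sum, map_ev_sum _ (fun t => ?_) hy, Finset.smul_sum]
    · refine Finset.sum_congr rfl fun t _ => ?_
      rw [map_smul, map_ev_const_smul _ ((hTb t).matD_uD s) hy]
    · rw [map_smul]
      exact ((hTb t).matD_uD s).const_smul _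
  have hm : ∀ i j, c.T i y * c.T j y = ∑ s, ∑ t,
      algebraMap k K (q * L s i) • algebraMap k K (q * L t j) •
        ((T s).map (ev (lin (optMat q⁻¹ L) y)) * (T t).map (ev (lin (optMat q⁻¹ L) y))) :=
    fun i j => by
      rw [hT y hy, hT y hy, Finset.sum_mul_sum]
      refine Finset.sum_congr rfl fun s _ => Finset.sum_congr rfl fun t _ => ?_
      rw [Matrix.smul_mul, Matrix.mul_smul]
  have hd' := hd j i
  have hm' := hm j i
  rw [Finset.sum_comm] at hd' hm'
  rw [smul_sub, hd i j, hm i j, hd', hm']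
  simp only [Finset.smul_sum, ← Finset.sum_sub_distrib, ← Finset.sum_add_distrib]
  refine Finset.sum_congr rfl fun s _ => Finset.sum_congr rfl fun t _ => ?_
  have h1 := (hTb t).matD_uD s
  have h2 := (hTb s).matD_uD t
  have h3 := (hTb s).mul (hTb t)
  have h4 := (hTb t).mul (hTb s)
  rw [map_ev_add (h1.sub h2) (h3.sub h4) hy, map_ev_sub h1 h2 hy, map_ev_sub h3 h4 hy,
    map_ev_mul (hTb s) (hTb t) hy, map_ev_mul (hTb t) (hTb s) hy]
  simp only [smul_add, smul_sub]
  simp only [smul_comm (algebraMap k K (q * L t j)) (algebraMap k K (q * L s i))]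

/-- The curvature of a connection given by power series in linear coordinates, in the direction
of `u`. -/
theorem u_curvature_eq (hq : q ≠ 0) (hTb : ∀ s, MBdd (T s)) (hAb : MBdd A)
    (hT : ∀ y, (∀ l, ‖lin (optMat q⁻¹ L) y l‖ < 1) → ∀ i,
      c.T i y = ∑ s, algebraMap k K (q * L s i) • (T s).map (ev (lin (optMat q⁻¹ L) y)))
    (hA : ∀ y, (∀ l, ‖lin (optMat q⁻¹ L) y l‖ < 1) → c.A y = A.map (ev (lin (optMat q⁻¹ L) y)))
    (hy : ∀ l, ‖lin (optMat q⁻¹ L) y l‖ < 1) (i : ι) :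
    y none ^ 2 • pdM none (c.T i) y - y none • pdM (some i) c.A y +
      (c.A y * c.T i y - c.T i y * c.A y) - y none • c.T i y =
    ∑ s, algebraMap k K (q * L s i) •
      (matD (uuD S q) (T s) - matD (uD k s) A + (A * T s - T s * A) -
        (MvPowerSeries.C q * X none : MvPowerSeries (Option S) k) • T s).map
        (ev (lin (optMat q⁻¹ L) y)) := by
  have hF : MBdd (∑ s, (q * L s i) • T s) := MBdd.sum _ fun s _ => (hTb s).const_smul _
  have hTF : ∀ y, (∀ l, ‖lin (optMat q⁻¹ L) y l‖ < 1) →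
      c.T i y = (∑ s, (q * L s i) • T s).map (ev (lin (optMat q⁻¹ L) y)) := fun y hy => by
    rw [hT y hy, map_ev_sum _ (fun s => (hTb s).const_smul _) hy]
    exact Finset.sum_congr rfl fun s _ => (map_ev_const_smul _ (hTb s) hy).symm
  rw [smul_pdM_none_of_eq_ev hq hF hTF hy, smul_pdM_some_of_eq_ev hq hAb hA hy, hT y hy, hA y hy,
    map_sum, map_ev_sum _ (fun s => by rw [map_smul]; exact ((hTb s).matD_uuD q).const_smul _) hy]
  simp only [Finset.sum_mul, Finset.mul_sum, Finset.smul_sum, Matrix.smul_mul, Matrix.mul_smul]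
  simp only [← Finset.sum_sub_distrib, ← Finset.sum_add_distrib]
  refine Finset.sum_congr rfl fun s _ => ?_
  have h1 := (hTb s).matD_uuD q
  have h2 := hAb.matD_uD s
  have h3 := hAb.mul (hTb s)
  have h4 := (hTb s).mul hAb
  have hX : Bd (‖q‖ * 1) (MvPowerSeries.C q * X none : MvPowerSeries (Option S) k) := by
    simpa using Bd.C_mul_X_none_pow (S := S) q 1
  have hXev : ev (lin (optMat q⁻¹ L) y)
      (MvPowerSeries.C q * X none : MvPowerSeries (Option S) k) = y none := by
    rw [← algebraMap_mul_lin_none hq L y]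
    simpa using ev_C_mul_X_none_pow q 1 hy
  rw [map_smul, map_ev_const_smul _ h1 hy,
    map_ev_sub ((h1.sub h2).add (h3.sub h4)) ((hTb s).smul hX) hy,
    map_ev_add (h1.sub h2) (h3.sub h4) hy, map_ev_sub h1 h2 hy, map_ev_sub h3 h4 hy,
    map_ev_mul (hTb s) hAb hy, map_ev_mul hAb (hTb s) hy, map_ev_smul hX (hTb s) hy, hXev]
  simp only [smul_add, smul_sub]
  rw [smul_comm (y none)]

/-- A connection given by a flat formal connection in linear coordinates is flat. -/
theorem ConnForm.IsFlatOn.of_isFlat (hq : q ≠ 0) (hTb : ∀ s, MBdd (T s)) (hAb : MBdd A)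
    (hT : ∀ y, (∀ l, ‖lin (optMat q⁻¹ L) y l‖ < 1) → ∀ i,
      c.T i y = ∑ s, algebraMap k K (q * L s i) • (T s).map (ev (lin (optMat q⁻¹ L) y)))
    (hA : ∀ y, (∀ l, ‖lin (optMat q⁻¹ L) y l‖ < 1) → c.A y = A.map (ev (lin (optMat q⁻¹ L) y)))
    (h : IsFlat q T A) {V : Set (Option ι → K)}
    (hV : ∀ y ∈ V, ∀ l, ‖lin (optMat q⁻¹ L) y l‖ < 1) : c.IsFlatOn V where
  base y hy i j := by
    rw [base_curvature_eq hq hTb hT (hV y hy)]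
    refine Finset.sum_eq_zero fun s _ => ?_
    rw [Finset.sum_eq_zero fun t _ => ?_, smul_zero]
    rw [h.base, map_ev_zero (hV y hy), smul_zero]
  u y hy i := by
    rw [← sub_eq_zero, u_curvature_eq hq hTb hAb hT hA (hV y hy)]
    refine Finset.sum_eq_zero fun s _ => ?_
    rw [h.u, sub_self, map_ev_zero (hV y hy), smul_zero]

/-- The formal connection which defines a flat connection in linear coordinates is flat. -/
theorem ConnForm.IsFlatOn.isFlat [DecidableEq S] (hq : q ≠ 0) {L' : Matrix ι S k} (hL : L * L' = 1)
    (hTb : ∀ s, MBdd (T s)) (hAb : MBdd A)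
    (hT : ∀ y, (∀ l, ‖lin (optMat q⁻¹ L) y l‖ < 1) → ∀ i,
      c.T i y = ∑ s, algebraMap k K (q * L s i) • (T s).map (ev (lin (optMat q⁻¹ L) y)))
    (hA : ∀ y, (∀ l, ‖lin (optMat q⁻¹ L) y l‖ < 1) → c.A y = A.map (ev (lin (optMat q⁻¹ L) y)))
    {V : Set (Option ι → K)} (h : c.IsFlatOn V)
    (hV : ∀ y, (∀ l, ‖lin (optMat q⁻¹ L) y l‖ < 1) → y ∈ V) : IsFlat q T A := by
  have hLq : (q • L) * (q⁻¹ • L') = 1 := by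
    rw [Matrix.smul_mul, Matrix.mul_smul, smul_smul, mul_inv_cancel₀ hq, one_smul, hL]
  have hinv : ∀ x : Option S → K, lin (optMat q⁻¹ L) (lin (optMat q L') x) = x := fun x => by
    rw [lin_lin, optMat_mul, hL, inv_mul_cancel₀ hq, optMat_one, lin_one]
  have hX : Bd (‖q‖ * 1) (MvPowerSeries.C q * X none : MvPowerSeries (Option S) k) := by
    simpa using Bd.C_mul_X_none_pow (S := S) q 1
  constructor
  · intro a b
    refine eq_of_map_ev_eq (K := K) ((((hTb b).matD_uD a).sub ((hTb a).matD_uD b)).add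
      (((hTb a).mul (hTb b)).sub ((hTb b).mul (hTb a)))) MBdd.zero fun x hx => ?_
    have hy : ∀ l, ‖lin (optMat q⁻¹ L) (lin (optMat q L') x) l‖ < 1 := by rwa [hinv]
    rw [map_ev_zero hx]
    refine eq_zero_of_sum_smul_eq_zero (K := K) hLq (R := fun b => (matD (uD k a) (T b) -
      matD (uD k b) (T a) + (T a * T b - T b * T a)).map (ev x)) (fun j => ?_) b
    refine eq_zero_of_sum_smul_eq_zero (K := K) hLq (R := fun a => ∑ b, algebraMap k K
      ((q • L) b j) • (matD (uD k a) (T b) -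
      matD (uD k b) (T a) + (T a * T b - T b * T a)).map (ev x)) (fun i => ?_) a
    have h1 := base_curvature_eq hq hTb hT hy i j
    rw [h.base _ (hV _ hy), hinv] at h1
    exact h1.symm
  · intro a
    rw [← sub_eq_zero]
    refine eq_of_map_ev_eq (K := K) (((((hTb a).matD_uuD q).sub (hAb.matD_uD a)).add
      ((hAb.mul (hTb a)).sub ((hTb a).mul hAb))).sub ((hTb a).smul hX)) MBdd.zero fun x hx => ?_
    have hy : ∀ l, ‖lin (optMat q⁻¹ L) (lin (optMat q L') x) l‖ < 1 := by rwa [hinv]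
    rw [map_ev_zero hx]
    refine eq_zero_of_sum_smul_eq_zero (K := K) hLq (R := fun a => (matD (uuD S q) (T a) -
      matD (uD k a) A + (A * T a - T a * A) -
        (MvPowerSeries.C q * X none : MvPowerSeries (Option S) k) • T a).map (ev x))
      (fun i => ?_) a
    have h1 := u_curvature_eq hq hTb hAb hT hA hy i
    rw [h.u _ (hV _ hy), hinv, sub_self] at h1
    exact h1.symm

end Curvature

section MatrixSeries

theorem exists_norm_entries_le {k r s : Type*} [NormedField k] [Finite r] [Finite s]
    (M : Matrix r s k) : ∃ R : ℝ, ∀ i j, ‖M i j‖ ≤ R := by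
  obtain ⟨R, hR⟩ := (Set.finite_range fun x : r × s => ‖M x.1 x.2‖).bddAbove
  exact ⟨R, fun i j => hR ⟨(i, j), rfl⟩⟩

/-- A matrix over `k`, viewed as a matrix of constant power series. -/
abbrev constM {k r s : Type*} [Field k] (σ : Type*) (M : Matrix r s k) :
    Matrix r s (MvPowerSeries σ k) := M.map C

theorem constM_mul {k σ r s t : Type*} [Field k] [Fintype s] (M : Matrix r s k)
    (N : Matrix s t k) : constM σ (M * N) = constM σ M * constM σ N :=
  Matrix.map_mul

theorem constM_one {k σ r : Type*} [Field k] [DecidableEq r] :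
    constM σ (1 : Matrix r r k) = 1 :=
  Matrix.map_one _ (map_zero _) (map_one _)

theorem matD_constM {k σ r s : Type*} [Field k]
    (D : Derivation k (MvPowerSeries σ k) (MvPowerSeries σ k)) (M : Matrix r s k) :
    matD D (constM σ M) = 0 := by
  ext1 i j
  exact D.map_algebraMap (M i j)

theorem constantCoeff_conj {k σ r S : Type*} [Field k] [Fintype r] (P : Matrix r S k)
    (P' : Matrix S r k) {E : Matrix r r (MvPowerSeries σ k)} {E₀ : Matrix r r k}
    (hE : ∀ a b, constantCoeff (E a b) = E₀ a b) (i j : S) :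
    constantCoeff ((constM σ P' * E * constM σ P) i j) = (P' * E₀ * P) i j := by
  simp [Matrix.mul_apply, hE]

theorem bd_conj_sub {k σ r S : Type*} [NormedField k] [IsUltrametricDist k] [Fintype r]
    {P : Matrix r S k} {P' : Matrix S r k} {R ε : ℝ} (hR : 0 ≤ R) (hε : 0 ≤ ε)
    (hP : ∀ i j, ‖P i j‖ ≤ R) (hP' : ∀ i j, ‖P' i j‖ ≤ R) {E : Matrix r r (MvPowerSeries σ k)}
    {E₀ : Matrix r r k} (hE : ∀ a b, Bd ε (E a b - C (E₀ a b))) (i j : S) :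
    Bd (R * ε * R) ((constM σ P' * E * constM σ P - constM σ (P' * E₀ * P)) i j) := by
  have h1 : constM σ P' * E * constM σ P - constM σ (P' * E₀ * P) =
      constM σ P' * (E - constM σ E₀) * constM σ P := by
    rw [Matrix.mul_sub, Matrix.sub_mul, ← constM_mul, ← constM_mul]
  rw [h1]
  exact Bd.matrix_mul (mul_nonneg hR hε) hR (Bd.matrix_mul hR hε (fun i j => Bd.C (hP' i j)) hE)
    (fun i j => Bd.C (hP i j)) i j

open Filter Topology

variable {k K : Type*} [NontriviallyNormedField k] [NontriviallyNormedField K] [NormedAlgebra k K]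
  [IsUltrametricDist K] [IsUltrametricDist k] [CompleteSpace k] [Algebra.IsAlgebraic k K]

theorem ev_zero_point {σ : Type*} [Finite σ] {D : ℝ} {F : MvPowerSeries σ k} (hF : Bd D F) :
    ev (0 : σ → K) F = algebraMap k K (constantCoeff F) := by
  have := Fintype.ofFinite σ
  have hx : ∀ i, ‖(0 : σ → K) i‖ < 1 := fun i => by simp
  have hC : Bd D (C (constantCoeff F) : MvPowerSeries σ k) := Bd.C (by simpa using hF 0)
  have h1 : F - C (constantCoeff F) ∈ vanIdeal k (fun _ => 1) 1 := by
    rw [mem_vanIdeal_one_iff]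
    simp
  have h2 := norm_ev_le (hF.sub hC) h1 one_pos le_rfl (x := (0 : σ → K)) fun i => by simp
  rw [ev_sub hF hC hx, ev_C _ hx, pow_one, mul_zero, norm_le_zero_iff, sub_eq_zero] at h2
  exact h2

end MatrixSeries

/-! ### Expansion of a flat analytic connection -/

section ConnectionSeries

open Filter Topology

variable {k K : Type*} [NontriviallyNormedField k] [NontriviallyNormedField K] [NormedAlgebra k K]

theorem smul_optMat {ι S : Type*} (a b : k) (L : Matrix S ι k) :
    a • optMat b L = optMat (a * b) (a • L) := by
  ext o o'
  cases o <;> cases o' <;> simp [optMat]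

/-- The sum of the translates of the matrices `X i` by two mutually inverse changes of
coordinates. -/
theorem sum_smul_sum_smul {N : Type*} [AddCommGroup N] [Module K N] {ι S : Type*} [Fintype ι]
    [Fintype S] [DecidableEq ι] {Λ : Matrix S ι k} {L : Matrix ι S k} (h : L * Λ = 1) (X : ι → N)
    (i : ι) : ∑ s, algebraMap k K (Λ s i) • ∑ j, algebraMap k K (L j s) • X j = X i := by
  simp only [Finset.smul_sum]
  rw [Finset.sum_comm]
  have h1 : ∀ j, ∑ s, algebraMap k K (Λ s i) • algebraMap k K (L j s) • X j =
      algebraMap k K ((1 : Matrix ι ι k) j i) • X j := fun j => by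
    rw [← h, Matrix.mul_apply, map_sum, Finset.sum_smul]
    exact Finset.sum_congr rfl fun s _ => by rw [smul_smul, map_mul, mul_comm]
  simp [h1, Matrix.one_apply]

variable [IsUltrametricDist K] [IsUltrametricDist k] [CompleteSpace k] [Algebra.IsAlgebraic k K]

/-- In sufficiently small linear coordinates and in a constant frame, a flat analytic connection
is given by a flat formal connection whose nonconstant coefficients are small. -/
theorem ConnForm.IsFlatOn.eventually_exists_series [IsAlgClosed K]
    (hk : ∀ n : ℕ, n ≠ 0 → ‖(n : k)‖ = 1) {ι S r : Type*} [Fintype ι] [DecidableEq ι] [Fintype S]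
    [DecidableEq S] [Fintype r] [DecidableEq r] {V : Set (Option ι → K)}
    (hV : IsAdmissibleOpen k V) (h0 : 0 ∈ V) {c : ConnForm K ι r}
    (hT : ∀ i, IsAnalyticMatrixOn k (c.T i) V) (hA : IsAnalyticMatrixOn k c.A V)
    (hc : c.IsFlatOn V) {P : Matrix r S k} {P' : Matrix S r k} (hP : P * P' = 1)
    (hP' : P' * P = 1)
    {Λ : Matrix S ι k} {L : Matrix ι S k} (hΛ : Λ * L = 1) (hL : L * Λ = 1)
    {T₀ : ι → Matrix r r k} (hT₀ : ∀ i, c.T i 0 = (T₀ i).map (algebraMap k K))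
    {A₀ : Matrix r r k} (hA₀ : c.A 0 = A₀.map (algebraMap k K)) {η : ℝ} (hη : 0 < η) :
    ∀ᶠ q in 𝓝[≠] (0 : k), ∃ (T : S → Matrix S S (MvPowerSeries (Option S) k))
      (A : Matrix S S (MvPowerSeries (Option S) k)), IsFlat q T A ∧
      (∀ s i j, Bd η (T s i j - C ((∑ l, L l s • (P' * T₀ l * P)) i j))) ∧
      (∀ s i j, T s i j - C ((∑ l, L l s • (P' * T₀ l * P)) i j) ∈ vanIdeal k (fun _ => 1) 1) ∧
      (∀ i j, Bd η (A i j - C ((P' * A₀ * P) i j))) ∧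
      (∀ i j, A i j - C ((P' * A₀ * P) i j) ∈ vanIdeal k (fun _ => 1) 1) ∧
      (∀ s, MBdd (T s)) ∧ MBdd A ∧
      ∀ y, (∀ l, ‖lin (optMat q⁻¹ (q⁻¹ • Λ)) y l‖ < 1) → y ∈ V ∧
        (∀ i, c.T i y = ∑ s, algebraMap k K (Λ s i) • (P.map (algebraMap k K) *
          (T s).map (ev (lin (optMat q⁻¹ (q⁻¹ • Λ)) y)) * P'.map (algebraMap k K))) ∧
        c.A y = P.map (algebraMap k K) * A.map (ev (lin (optMat q⁻¹ (q⁻¹ • Λ)) y)) *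
          P'.map (algebraMap k K) := by
  obtain ⟨R₁, hR₁⟩ := exists_norm_entries_le P
  obtain ⟨R₂, hR₂⟩ := exists_norm_entries_le P'
  obtain ⟨R₃, hR₃⟩ := exists_norm_entries_le (optMat 1 L)
  -- a common bound for the entries of all the constant matrices involved
  obtain ⟨R, hR1, hRP, hRP', hRL⟩ : ∃ R : ℝ, 1 ≤ R ∧ (∀ i j, ‖P i j‖ ≤ R) ∧
      (∀ i j, ‖P' i j‖ ≤ R) ∧ ∀ i j, ‖optMat 1 L i j‖ ≤ R :=
    ⟨max 1 (max R₁ (max R₂ R₃)), le_max_left _ _,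
      fun i j => (hR₁ i j).trans ((le_max_left _ _).trans (le_max_right _ _)),
      fun i j => (hR₂ i j).trans ((le_max_left _ _).trans ((le_max_right _ _).trans
        (le_max_right _ _))),
      fun i j => (hR₃ i j).trans ((le_max_right _ _).trans ((le_max_right _ _).trans
        (le_max_right _ _)))⟩
  have hR0 : 0 < R := one_pos.trans_le hR1
  have hε : 0 < η / R ^ 3 := div_pos hη (pow_pos hR0 3)
  have hεη : R * (R * (η / R ^ 3) * R) = η := by field_simp
  obtain ⟨c₀, hc₀V, hc₀⟩ := (((hV.eventually_subset h0).filter_mono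
    (nhdsWithin_le_nhds (s := {0}ᶜ))).and self_mem_nhdsWithin).exists
  have hsmall : ∀ᶠ q in 𝓝[≠] (0 : k), ‖q‖ * R ≤ ‖c₀‖ := by
    have h1 : Tendsto (fun q : k => ‖q‖ * R) (𝓝 0) (𝓝 0) := by
      have h := (continuous_norm.mul_const R).tendsto (0 : k)
      simpa using h
    exact nhdsWithin_le_nhds (h1.eventually_le_const (norm_pos_iff.mpr hc₀))
  have hTq : ∀ᶠ q in 𝓝[≠] (0 : k), ∀ i a b, _ := Filter.eventually_all.mpr fun i =>
    Filter.eventually_all.mpr fun a => Filter.eventually_all.mpr fun b =>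
      (hT i a b).eventually_eq_ev_lin hk h0 (optMat 1 L) hε
  have hAq : ∀ᶠ q in 𝓝[≠] (0 : k), ∀ a b, _ := Filter.eventually_all.mpr fun a =>
    Filter.eventually_all.mpr fun b => (hA a b).eventually_eq_ev_lin hk h0 (optMat 1 L) hε
  filter_upwards [hTq, hAq, hsmall, self_mem_nhdsWithin] with q hTq hAq hq hq0
  choose F hFb hFε hFev using hTq
  choose G hGb hGε hGev using hAq
  have hF : ∀ i, MBdd (Matrix.of (F i)) := fun i => MBdd.of_forall (hFb i)
  have hG : MBdd (Matrix.of G) := MBdd.of_forall hGb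
  have hF0 : ∀ i a b, constantCoeff (F i a b) = T₀ i a b := fun i a b => by
    obtain ⟨D, hD⟩ := hFb i a b
    apply (algebraMap k K).injective
    rw [← ev_zero_point hD, ← hFev i a b 0 fun l => by simp, lin_zero, hT₀]
    rfl
  have hG0 : ∀ a b, constantCoeff (G a b) = A₀ a b := fun a b => by
    obtain ⟨D, hD⟩ := hGb a b
    apply (algebraMap k K).injective
    rw [← ev_zero_point hD, ← hGev a b 0 fun l => by simp, lin_zero, hA₀]
    rfl
  have hFconj := fun i => bd_conj_sub hR0.le hε.le hRP hRP' (E := Matrix.of (F i)) (E₀ := T₀ i)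
    fun a b => by simpa [hF0] using hFε i a b
  have hGconj := bd_conj_sub hR0.le hε.le hRP hRP' (E := Matrix.of G) (E₀ := A₀)
    fun a b => by simpa [hG0] using hGε a b
  have hFconst := fun i => constantCoeff_conj P P' (E := Matrix.of (F i)) (E₀ := T₀ i) (hF0 i)
  have hGconst := constantCoeff_conj P P' (E := Matrix.of G) (E₀ := A₀) hG0
  have hFC : ∀ i, MBdd (constM (Option S) P' * Matrix.of (F i) * constM (Option S) P) := fun i =>
    ((MBdd.map_C P').mul (hF i)).mul (MBdd.map_C P)
  have hGC : MBdd (constM (Option S) P' * Matrix.of G * constM (Option S) P) :=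
    ((MBdd.map_C P').mul hG).mul (MBdd.map_C P)
  have hL1 : ∀ i s, ‖L i s‖ ≤ R := fun i s => hRL (some i) (some s)
  have hq' : q ≠ 0 := hq0
  have hqy : ∀ y : Option ι → K, lin (q • optMat 1 L) (lin (optMat q⁻¹ (q⁻¹ • Λ)) y) = y :=
    fun y => by
      have h1 : optMat q⁻¹ (q⁻¹ • Λ) = q⁻¹ • optMat 1 Λ := by rw [smul_optMat, mul_one]
      rw [lin_lin, h1, Matrix.smul_mul, Matrix.mul_smul, smul_smul, mul_inv_cancel₀ hq', one_smul,
        optMat_mul, hL, mul_one, optMat_one, lin_one]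
  have hTy : ∀ y, (∀ l, ‖lin (optMat q⁻¹ (q⁻¹ • Λ)) y l‖ < 1) → ∀ i,
      c.T i y = (Matrix.of (F i)).map (ev (lin (optMat q⁻¹ (q⁻¹ • Λ)) y)) := fun y hy i => by
    ext a b
    rw [Matrix.map_apply, Matrix.of_apply, ← hFev i a b _ hy, hqy]
  have hAy : ∀ y, (∀ l, ‖lin (optMat q⁻¹ (q⁻¹ • Λ)) y l‖ < 1) →
      c.A y = (Matrix.of G).map (ev (lin (optMat q⁻¹ (q⁻¹ • Λ)) y)) := fun y hy => by
    ext a b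
    rw [Matrix.map_apply, Matrix.of_apply, ← hGev a b _ hy, hqy]
  have hVy : ∀ y, (∀ l, ‖lin (optMat q⁻¹ (q⁻¹ • Λ)) y l‖ < 1) → y ∈ V := fun y hy => by
    refine hc₀V y fun i => ?_
    rw [← hqy y, lin_smul, Pi.smul_apply, smul_eq_mul, norm_mul, norm_algebraMap', lin_apply]
    refine le_trans (mul_le_mul_of_nonneg_left ?_ (norm_nonneg q)) hq
    refine IsUltrametricDist.norm_sum_le_of_forall_le_of_nonneg hR0.le fun m _ => ?_
    rw [norm_mul, norm_algebraMap', ← mul_one R]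
    exact mul_le_mul (hRL i m) (hy m).le (norm_nonneg _) hR0.le
  have hflat : IsFlat q (fun s => ∑ i, L i s • Matrix.of (F i)) (Matrix.of G) := by
    refine ConnForm.IsFlatOn.isFlat (L := q⁻¹ • Λ) (L' := q • L) hq' ?_
      (fun s => MBdd.sum _ fun i _ => (hF i).const_smul _) hG (fun y hy i => ?_) hAy hc hVy
    · rw [Matrix.smul_mul, Matrix.mul_smul, smul_smul, inv_mul_cancel₀ hq', one_smul, hΛ]
    · rw [hTy y hy, ← sum_smul_sum_smul (K := K) hL
      (fun i => (Matrix.of (F i)).map (ev (lin (optMat q⁻¹ (q⁻¹ • Λ)) y))) i]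
      refine Finset.sum_congr rfl fun s _ => ?_
      rw [Matrix.smul_apply, smul_eq_mul, mul_inv_cancel_left₀ hq',
        map_ev_sum _ (fun i => (hF i).const_smul _) hy]
      simp only [map_ev_const_smul _ (hF _) hy]
  have hPC : constM (Option S) P' * constM (Option S) P =
      (1 : Matrix S S (MvPowerSeries (Option S) k)) := by
    rw [← constM_mul, hP', constM_one]
  have hPC' : constM (Option S) P * constM (Option S) P' =
      (1 : Matrix r r (MvPowerSeries (Option S) k)) := by
    rw [← constM_mul, hP, constM_one]
  have hPK : P.map (algebraMap k K) * P'.map (algebraMap k K) = 1 := by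
    rw [← Matrix.map_mul, hP, Matrix.map_one _ (map_zero _) (map_one _)]
  have hundo : ∀ (E : Matrix r r (MvPowerSeries (Option S) k)) (_ : MBdd E) (x : Option S → K)
      (_ : ∀ l, ‖x l‖ < 1), P.map (algebraMap k K) *
        (constM (Option S) P' * E * constM (Option S) P).map (ev x) * P'.map (algebraMap k K) =
          E.map (ev x) := fun E hE x hx => by
    rw [map_ev_mul ((MBdd.map_C P').mul hE) (MBdd.map_C P) hx, map_ev_mul (MBdd.map_C P') hE hx,
      (map_ev_map_C P' hx : (constM _ P').map (ev x) = _),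
      (map_ev_map_C P hx : (constM _ P).map (ev x) = _), Matrix.mul_assoc (P'.map _),
      ← Matrix.mul_assoc, hPK, Matrix.one_mul, Matrix.mul_assoc, hPK, Matrix.mul_one]
  refine ⟨fun s => ∑ i, L i s • (constM (Option S) P' * Matrix.of (F i) * constM (Option S) P),
    constM (Option S) P' * Matrix.of G * constM (Option S) P,
    hflat.gauge hPC (fun a => ?_) ?_, fun s i j => ?_, fun s i j => ?_, fun i j => ?_,
    fun i j => ?_, fun s => MBdd.sum _ fun i _ => (hFC i).const_smul _, hGC,
    fun y hy => ⟨hVy y hy, fun i => ?_, ?_⟩⟩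
  · rw [matD_constM, zero_add, Matrix.sum_mul, Matrix.mul_sum]
    refine Finset.sum_congr rfl fun i _ => ?_
    rw [Matrix.mul_smul, ← Matrix.mul_assoc, ← Matrix.mul_assoc, hPC', Matrix.one_mul,
      Matrix.smul_mul]
  · rw [matD_constM, zero_add, ← Matrix.mul_assoc, ← Matrix.mul_assoc, hPC', Matrix.one_mul]
  · have h1 : (∑ l, L l s • (constM (Option S) P' * Matrix.of (F l) * constM (Option S) P)) i j -
        C ((∑ l, L l s • (P' * T₀ l * P)) i j) =
        ∑ l, L l s • (constM (Option S) P' * Matrix.of (F l) * constM (Option S) P -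
          constM (Option S) (P' * T₀ l * P)) i j := by
      simp only [Matrix.sum_apply, Matrix.smul_apply, Matrix.sub_apply, smul_sub,
        Finset.sum_sub_distrib, map_sum, smul_eq_mul, map_mul, MvPowerSeries.smul_eq_C_mul]
      rfl
    have h2 : (0 : ℝ) ≤ R * (R * (η / R ^ 3) * R) := hη.le.trans_eq hεη.symm
    rw [h1]
    refine (Bd.sum h2 _ fun l _ m => ?_).mono hεη.le
    rw [coeff_smul, norm_mul]
    exact mul_le_mul (hL1 l s) (hFconj l i j m) (norm_nonneg _) hR0.le
  · rw [mem_vanIdeal_one_iff, map_sub, constantCoeff_C, sub_eq_zero]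
    simp only [Matrix.sum_apply, map_sum]
    refine Finset.sum_congr rfl fun l _ => ?_
    rw [Matrix.smul_apply, constantCoeff_smul, hFconst, Matrix.smul_apply]
  · exact (hGconj i j).mono ((le_mul_of_one_le_left (mul_nonneg (mul_nonneg hR0.le hε.le) hR0.le)
      hR1).trans_eq hεη)
  · rw [mem_vanIdeal_one_iff, map_sub, constantCoeff_C, sub_eq_zero, hGconst]
  · rw [hTy y hy, ← sum_smul_sum_smul (K := K) hL
      (fun i => (Matrix.of (F i)).map (ev (lin (optMat q⁻¹ (q⁻¹ • Λ)) y))) i]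
    refine Finset.sum_congr rfl fun s _ => ?_
    rw [map_ev_sum _ (fun i => (hFC i).const_smul _) hy, Matrix.mul_sum, Matrix.sum_mul]
    congr 1
    refine Finset.sum_congr rfl fun j _ => ?_
    rw [map_ev_const_smul _ (hFC j) hy, Matrix.mul_smul, Matrix.smul_mul, hundo _ (hF j) _ hy]
  · rw [hundo _ hG _ hy, hAy y hy]

end ConnectionSeries

/-! ### Power series on the base -/

section Section

variable {k K : Type*} [NontriviallyNormedField k] [NontriviallyNormedField K] [NormedAlgebra k K]
  {ι S : Type*} [Fintype ι]

/-- The matrix of the linear map `x ↦ (L x, 0)`. -/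
def sec (L : Matrix S ι k) : Matrix (Option S) ι k := fun o i => o.elim 0 fun s => L s i

theorem lin_sec (L : Matrix S ι k) (x : ι → K) : lin (sec L) x = pt (lin L x) 0 := by
  ext o
  cases o <;> simp [lin_apply, sec, pt]

theorem norm_pt_le {x : S → K} {t : K} {ρ : ℝ} (hx : ∀ s, ‖x s‖ ≤ ρ) (ht : ‖t‖ ≤ ρ) (o : Option S) :
    ‖pt x t o‖ ≤ ρ := by
  cases o with
  | none => exact ht
  | some s => exact hx s

theorem IsAnalyticOn.congr {σ : Type*} {f g : (σ → K) → K} {U : Set (σ → K)}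
    (hf : IsAnalyticOn k f U) (h : ∀ x ∈ U, f x = g x) : IsAnalyticOn k g U := by
  obtain ⟨𝒱, h𝒱, hU⟩ := hf
  refine ⟨𝒱, fun V hV => ⟨(h𝒱 V hV).1, fun ε hε => ?_⟩, hU⟩
  obtain ⟨P, Q, hPQ⟩ := (h𝒱 V hV).2 ε hε
  refine ⟨P, Q, fun x hx => ?_⟩
  rw [← h x (hU.1 ▸ Set.mem_sUnion_of_mem hx hV)]
  exact hPQ x hx

end Section

section IndependenceOfU

/-- A power series whose derivative with respect to `u` vanishes does not involve `u`. -/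
theorem coeff_eq_zero_of_pderiv_none {k S : Type*} [Field k] [CharZero k]
    {F : MvPowerSeries (Option S) k} (h : pderiv k none F = 0) {m : Option S →₀ ℕ}
    (hm : m none ≠ 0) : coeff m F = 0 := by
  classical
  have h1 := congrArg (coeff (m - Finsupp.single none 1)) h
  have h2 : m - Finsupp.single none 1 + Finsupp.single none 1 = m :=
    tsub_add_cancel_of_le (Finsupp.single_le_iff.mpr (Nat.one_le_iff_ne_zero.mpr hm))
  rw [coeff_pderiv, h2, map_zero] at h1
  exact (mul_eq_zero.mp h1).resolve_right (Nat.cast_add_one_ne_zero _)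

variable {k K : Type*} [NontriviallyNormedField k] [NontriviallyNormedField K] [NormedAlgebra k K]
  [IsUltrametricDist K] [IsUltrametricDist k] [CompleteSpace k] [Algebra.IsAlgebraic k K]
  [CharZero k] {S : Type*} [Finite S]

/-- The values of a power series that does not involve `u` do not depend on the coordinate `u`. -/
theorem ev_pt_zero_base {D : ℝ} {F : MvPowerSeries (Option S) k} (hF : Bd D F)
    (h : pderiv k none F = 0) {y : Option S → K} (hy : ∀ o, ‖y o‖ < 1) :
    ev (pt (base y) 0) F = ev y F := by
  let a : Option S → k := fun o => o.elim 0 fun _ => 1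
  have ha : ∀ o, ‖a o‖ ≤ 1 := fun o => by cases o <;> simp [a]
  have h1 : rescale a F = F := by
    ext m
    rw [coeff_rescale]
    by_cases hm : m none = 0
    · rw [Finsupp.prod, Finset.prod_eq_one, one_mul]
      intro o ho
      cases o with
      | none => exact absurd hm (Finsupp.mem_support_iff.mp ho)
      | some s => exact one_pow _
    · rw [coeff_eq_zero_of_pderiv_none h hm, mul_zero]
  have h2 := ev_rescale a ha hF hy
  rw [h1] at h2
  rw [h2]
  congr 1
  ext o
  cases o <;> simp [a, pt, base]

end IndependenceOfU

/-! ### Product decompositions of polydiscs -/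

section ProductDecomposition

variable {k K : Type*} [NontriviallyNormedField k] [NontriviallyNormedField K] [NormedAlgebra k K]
  [IsUltrametricDist K] [IsUltrametricDist k] [CompleteSpace k] [Algebra.IsAlgebraic k K]
  {ι I : Type*} {J : I → Type*} [Fintype ι] [DecidableEq ι] [Fintype I] [DecidableEq I]
  [∀ i, Fintype (J i)] [∀ i, DecidableEq (J i)]

/-- A system of power series tangent to the identity, in the coordinates of a linear isomorphism,
decomposes a polydisc into a product of polydiscs. -/
theorem isProductIso_ev {p : (Σ i, J i) → MvPowerSeries (Option (Σ i, J i)) k}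
    (hp : ∀ s, Bd 1 (p s)) (hp2 : ∀ s, p s - X (some s) ∈ vanIdeal k (fun _ => 1) 2)
    {Λ : Matrix (Σ i, J i) ι k} {L : Matrix ι (Σ i, J i) k} (hΛ : Λ * L = 1) (hL : L * Λ = 1)
    {ϖ : k} (hϖ0 : ϖ ≠ 0) (hϖ1 : ‖ϖ‖ < 1) :
    IsProductIso k (disc K Λ ϖ) (fun i => disc K (1 : Matrix (J i) (J i) k) ϖ)
      fun i x c => ev (pt (lin Λ x) 0) (p ⟨i, c⟩) := by
  let P : Option (Σ i, J i) → MvPowerSeries (Option (Σ i, J i)) k := fun o => o.elim (X none) p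
  have hP : ∀ o, Bd 1 (P o) := fun o => by
    cases o with
    | none => exact Bd.X none
    | some s => exact hp s
  have hP2 : ∀ o, P o - X o ∈ vanIdeal k (fun _ => 1) 2 := fun o => by
    cases o with
    | none =>
      change X none - X none ∈ _
      rw [sub_self]
      exact Ideal.zero_mem _
    | some s => exact hp2 s
  have hP0 : ∀ o, constantCoeff (P o) = 0 := fun o => by
    have := hP2 o 0 (by simp)
    rwa [map_sub, coeff_zero_eq_constantCoeff_apply, coeff_zero_eq_constantCoeff_apply,
      constantCoeff_X, sub_zero] at this
  obtain ⟨Q, hQ, hQ0, hPQ, hQP⟩ := exists_formal_inverse hP hP2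
  have hQn : Q none = X none := by
    have := hQP none
    rwa [show P none = X none from rfl, subst_X (hasSubst_of_constantCoeff_zero hQ0)] at this
  have hlt : ∀ {z : (Σ i, J i) → K}, (∀ s, ‖z s‖ ≤ ‖ϖ‖) → ∀ o, ‖pt z 0 o‖ < 1 := fun hz o =>
    (norm_pt_le hz (by simp) o).trans_lt hϖ1
  have hle : ∀ {z : (Σ i, J i) → K}, (∀ s, ‖z s‖ ≤ ‖ϖ‖) →
      ∀ {F : MvPowerSeries (Option (Σ i, J i)) k}, Bd 1 F → constantCoeff F = 0 →
        ‖ev (pt z 0) F‖ ≤ ‖ϖ‖ := fun hz _ hF hF0 =>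
    norm_ev_le_of_constantCoeff hF hF0 hϖ1 (norm_nonneg _) (norm_pt_le hz (by simp))
  have hPpt : ∀ {z : (Σ i, J i) → K}, (∀ s, ‖z s‖ ≤ ‖ϖ‖) →
      pt (fun s => ev (pt z 0) (p s)) 0 = fun o => ev (pt z 0) (P o) := fun hz => by
    ext o
    cases o with
    | none => exact (ev_X none (hlt hz)).symm
    | some s => rfl
  have hQpt : ∀ {z : (Σ i, J i) → K}, (∀ s, ‖z s‖ ≤ ‖ϖ‖) →
      pt (fun s => ev (pt z 0) (Q (some s))) 0 = fun o => ev (pt z 0) (Q o) := fun hz => by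
    ext o
    cases o with
    | none =>
      rw [hQn]
      exact (ev_X none (hlt hz)).symm
    | some s => rfl
  have hdom : {z : (Σ i, J i) → K |
      ∀ i, (fun l => z ⟨i, l⟩) ∈ disc K (1 : Matrix (J i) (J i) k) ϖ} =
      disc K (1 : Matrix (Σ i, J i) (Σ i, J i) k) ϖ := by
    ext z
    simp only [Set.mem_ofPred_eq, mem_disc, lin_one, Sigma.forall]
  refine ⟨fun i c => ?_, fun i x hx => ?_, fun z => lin L fun s => ev (pt z 0) (Q (some s)),
    fun j => ?_, fun z hz => ?_, fun x hx => ?_⟩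
  · simp only [← lin_sec]
    refine (isRationalDomain_disc hL hϖ0).isAnalyticOn_ev (norm_nonneg ϖ) hϖ1 (fun y hy o => ?_)
      (hp _)
    rw [lin_sec]
    exact norm_pt_le hy (by simp) o
  · rw [mem_disc, lin_one]
    exact fun c => hle hx (hp _) (hP0 (some ⟨i, c⟩))
  · rw [hdom]
    obtain ⟨R, hR⟩ := exists_norm_entries_le L
    have hterm : ∀ s, Bd (max R 0) (L j s • Q (some s)) := fun s m => by
      rw [coeff_smul, norm_mul, ← mul_one (max R 0)]
      exact mul_le_mul ((hR j s).trans (le_max_left _ _)) (hQ _ m) (norm_nonneg _)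
        (le_max_right _ _)
    have han := (isRationalDomain_disc (K := K) (Matrix.one_mul (1 : Matrix (Σ i, J i) _ k))
      hϖ0).isAnalyticOn_ev (norm_nonneg ϖ) hϖ1 (Λ := sec 1) (fun y hy o => ?_)
      (Bd.sum (le_max_right R 0) Finset.univ fun s _ => hterm s)
    · refine han.congr fun z hz => ?_
      rw [mem_disc, lin_one] at hz
      rw [lin_sec, lin_one, ev_sum _ (le_max_right R 0) (fun s _ => hterm s) (hlt hz)]
      refine Finset.sum_congr rfl fun s _ => ?_
      rw [ev_smul _ (hQ _) (hlt hz), Algebra.smul_def]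
      rfl
    · rw [lin_sec]
      exact norm_pt_le hy (by simp) o
  · have hz' : ∀ s, ‖z s‖ ≤ ‖ϖ‖ := by
      have : z ∈ disc K (1 : Matrix (Σ i, J i) (Σ i, J i) k) ϖ := hdom ▸ hz
      rwa [mem_disc, lin_one] at this
    have hΛL : lin Λ (lin L fun s => ev (pt z 0) (Q (some s))) =
        fun s => ev (pt z 0) (Q (some s)) := by
      rw [lin_lin, hΛ, lin_one]
    refine ⟨fun s => ?_, fun i => ?_⟩
    · rw [hΛL]
      exact hle hz' (hQ _) (hQ0 _)
    · ext c
      rw [hΛL, hQpt hz', ← ev_subst hQ hQ0 (hp _) (hlt hz')]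
      exact (congrArg _ (hQP (some ⟨i, c⟩))).trans (ev_X _ (hlt hz'))
  · have h1 : (fun s => ev (pt (fun s => ev (pt (lin Λ x) 0) (p s)) 0) (Q (some s))) = lin Λ x := by
      ext s
      rw [hPpt hx, ← ev_subst hP hP0 (hQ _) (hlt hx), hPQ, ev_X _ (hlt hx)]
      rfl
    exact (congrArg (lin L) h1).trans (by rw [lin_lin, hL, lin_one])

end ProductDecomposition

/-! ### F-bundles on a slice -/

section Incl

/-- The matrix of the inclusion of the coordinate subspace with the coordinates `e c`. -/
def incl (k : Type*) [Zero k] [One k] {S κ : Type*} [DecidableEq S] (e : κ → S) : Matrix S κ k :=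
  fun s c => if s = e c then 1 else 0

theorem pdM_const {K : Type*} [NontriviallyNormedField K] {σ r s : Type*} [DecidableEq σ] (i : σ)
    (M : Matrix r s K) (y : σ → K) : pdM i (fun _ => M) y = 0 := by
  ext a b
  exact deriv_const _ _

variable {k K : Type*} [NontriviallyNormedField k] [NontriviallyNormedField K] [NormedAlgebra k K]
  {S κ : Type*} [DecidableEq S] [Fintype κ] {e : κ → S}

theorem lin_incl_apply [DecidableEq κ] (he : Function.Injective e) (x : κ → K) (c : κ) :
    lin (incl k e) x (e c) = x c := by
  simp [lin_apply, incl, he.eq_iff]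

theorem lin_incl_of_not_mem {s : S} (hs : s ∉ Set.range e) (x : κ → K) :
    lin (incl k e) x s = 0 := by
  rw [lin_apply]
  refine Finset.sum_eq_zero fun c _ => ?_
  rw [incl, if_neg fun h => hs ⟨c, h.symm⟩, map_zero, zero_mul]

theorem norm_lin_incl_le [DecidableEq κ] {q : k} (he : Function.Injective e) {ρ : ℝ}
    {y : Option κ → K} (hy : ∀ o, ‖lin (optMat q⁻¹ (1 : Matrix κ κ k)) y o‖ ≤ ρ) (o : Option S) :
    ‖lin (optMat q⁻¹ (incl k e)) y o‖ ≤ ρ := by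
  rw [lin_optMat, lin_one] at hy
  rw [lin_optMat]
  cases o with
  | none => exact hy none
  | some s =>
    change ‖lin (incl k e) (base y) s‖ ≤ ρ
    by_cases hs : s ∈ Set.range e
    · obtain ⟨c, rfl⟩ := hs
      rw [lin_incl_apply he]
      exact hy (some c)
    · rw [lin_incl_of_not_mem hs, norm_zero]
      exact (norm_nonneg _).trans (hy none)

/-- The connection on the slice with the coordinates `e c` defined by a formal connection; `q` is
the scale of the coordinate `u`. -/
def sliceConn [Finite S] {r : Type*} (q : k) (e : κ → S)
    (T : S → Matrix r r (MvPowerSeries (Option S) k))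
    (A : Matrix r r (MvPowerSeries (Option S) k)) :
    ConnForm K κ r where
  T l y := (q • T (e l)).map (ev (lin (optMat q⁻¹ (incl k e)) y))
  A y := A.map (ev (lin (optMat q⁻¹ (incl k e)) y))

end Incl

section SliceBundle

universe u v w

variable {k : Type u} {K : Type v} [NontriviallyNormedField k] [NontriviallyNormedField K]
  [NormedAlgebra k K] [IsUltrametricDist K]
  {S κ : Type*} [DecidableEq S] [Fintype κ] [DecidableEq κ]
  {q ϖ : k} {e : κ → S}

theorem isRationalDomain_disc_optMat (hq : q ≠ 0) (hϖ : ϖ ≠ 0) :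
    IsRationalDomain k (disc K (optMat q⁻¹ (1 : Matrix κ κ k)) ϖ) :=
  isRationalDomain_disc (Λ' := optMat q 1)
    (by rw [optMat_mul, mul_inv_cancel₀ hq, Matrix.one_mul, optMat_one]) hϖ

variable [IsUltrametricDist k] [CompleteSpace k] [Algebra.IsAlgebraic k K] [Fintype S]

section

variable {r : Type*} [Fintype r] {T : S → Matrix r r (MvPowerSeries (Option S) k)}
  {A : Matrix r r (MvPowerSeries (Option S) k)}

theorem sliceConn_isFlatOn (hq : q ≠ 0) (hϖ : ‖ϖ‖ < 1) (he : Function.Injective e)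
    (hT : ∀ s, MBdd (T s)) (hA : MBdd A) (h : IsFlat q T A) :
    (sliceConn (K := K) q e T A).IsFlatOn (disc K (optMat q⁻¹ (1 : Matrix κ κ k)) ϖ) := by
  refine ConnForm.IsFlatOn.of_isFlat hq hT hA (L := incl k e) (fun y hy l => ?_) (fun y _ => rfl) h
    fun y hy o => (norm_lin_incl_le he hy o).trans_lt hϖ
  rw [Finset.sum_eq_single (e l), incl, if_pos rfl, mul_one]
  · exact map_ev_const_smul q (hT _) hy
  · intro s _ hs
    rw [incl, if_neg hs, mul_zero, map_zero, zero_smul]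
  · exact fun h => absurd (Finset.mem_univ _) h

end

variable {d : ℕ} {T : S → Matrix (Fin d) (Fin d) (MvPowerSeries (Option S) k)}
  {A : Matrix (Fin d) (Fin d) (MvPowerSeries (Option S) k)}

theorem isAnalyticMatrixOn_sliceConn (hq : q ≠ 0) (hϖ0 : ϖ ≠ 0) (hϖ : ‖ϖ‖ < 1)
    (he : Function.Injective e) {r s : Type*} {M : Matrix r s (MvPowerSeries (Option S) k)}
    (hM : MBdd M) : IsAnalyticMatrixOn k (fun y => M.map (ev (lin (optMat q⁻¹ (incl k e)) y)))
      (disc K (optMat q⁻¹ (1 : Matrix κ κ k)) ϖ) := fun i j => by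
  obtain ⟨D, -, hD⟩ := hM
  exact (isRationalDomain_disc_optMat hq hϖ0).isAnalyticOn_ev (norm_nonneg ϖ) hϖ
    (fun y hy o => norm_lin_incl_le he hy o) (hD i j)

/-- The F-bundle, trivial as a vector bundle, over a polydisc, defined by a formal connection. -/
def sliceBundle (hq : q ≠ 0) (hϖ0 : ϖ ≠ 0) (hϖ : ‖ϖ‖ < 1) (he : Function.Injective e)
    (hT : ∀ s, MBdd (T s)) (hA : MBdd A) (h : IsFlat q T A) :
    FBundle.{u, v, w} k (disc K (1 : Matrix κ κ k) ϖ) where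
  W := disc K (optMat q⁻¹ 1) ϖ
  isAdmissibleOpen_W := (isRationalDomain_disc_optMat hq hϖ0).isAdmissibleOpen
  zero_section x hx o := by
    rw [lin_optMat_pt, mul_zero]
    exact norm_pt_le hx (by simp) o
  base_mem y hy s := by
    have h := hy (some s)
    rwa [lin_optMat] at h
  J := PUnit
  chart _ := disc K (optMat q⁻¹ 1) ϖ
  isAdmissibleOpen_chart _ := (isRationalDomain_disc_optMat hq hϖ0).isAdmissibleOpen
  cover := by
    rw [Set.range_const]
    exact isAdmissibleCover_self _
  rank _ := d
  g _ _ _ := 1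
  analytic_g _ _ i j := by
    rw [Set.inter_self]
    have h := (isRationalDomain_disc_optMat (K := K) (κ := κ) hq hϖ0).isAnalyticOn_const
      ((1 : Matrix (Fin d) (Fin d) k) i j)
    simpa [Matrix.one_apply, apply_ite (algebraMap k K)] using h
  g_self _ _ _ := rfl
  g_mul _ _ _ _ _ := Matrix.mul_one _
  conn _ := sliceConn q e T A
  analytic_T _ l := isAnalyticMatrixOn_sliceConn hq hϖ0 hϖ he ((hT _).const_smul q)
  analytic_A _ := isAnalyticMatrixOn_sliceConn hq hϖ0 hϖ he hA
  flat _ := sliceConn_isFlatOn hq hϖ he hT hA h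
  compat _ _ := ⟨
    fun y _ i => by rw [pdM_const, smul_zero, zero_add, Matrix.mul_one, Matrix.one_mul],
    fun y _ => by rw [pdM_const, smul_zero, zero_add, Matrix.mul_one, Matrix.one_mul]⟩

end SliceBundle

section MatrixVectorValues

variable {k K : Type*} [NontriviallyNormedField k] [NontriviallyNormedField K]
  [NormedAlgebra k K] [IsUltrametricDist K] [IsUltrametricDist k] [CompleteSpace k]
  [Algebra.IsAlgebraic k K] {σ r s : Type*} [Finite σ] [Fintype s]

theorem map_ev_mulVec {M : Matrix r s (MvPowerSeries σ k)} (hM : MBdd M) (v : s → k) {x : σ → K}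
    (hx : ∀ i, ‖x i‖ < 1) (i : r) : (M.map (ev x)).mulVec (fun j => algebraMap k K (v j)) i =
      ev x (M.mulVec (fun j => C (v j)) i) := by
  have h := map_ev_mul hM (MBdd.map_C (Matrix.of fun (j : s) (_ : Unit) => v j)) hx
  rw [map_ev_map_C _ hx] at h
  exact (congrFun (congrFun h i) ()).symm

end MatrixVectorValues

/-! ### Maximality of the F-bundles on a slice -/

section Maximality

universe u v w

variable {k : Type u} {K : Type v} [NontriviallyNormedField k] [NontriviallyNormedField K]
  [NormedAlgebra k K] [IsUltrametricDist K] [IsUltrametricDist k] [CompleteSpace k]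
  [Algebra.IsAlgebraic k K] {S : Type*} [DecidableEq S] [Fintype S] {d : ℕ} {q ϖ : k}
  {e : Fin d → S} {T : S → Matrix (Fin d) (Fin d) (MvPowerSeries (Option S) k)}
  {A : Matrix (Fin d) (Fin d) (MvPowerSeries (Option S) k)}

/-- The F-bundle on the slice is maximal at every point: the matrix `N`, whose columns are the
values of the `T (e c)` on the vector `v`, is invertible as a matrix of power series, and so are its
values. -/
theorem sliceBundle_maximalAt (hq : q ≠ 0) (hϖ0 : ϖ ≠ 0) (hϖ : ‖ϖ‖ < 1)
    (he : Function.Injective e) (hT : ∀ s, MBdd (T s)) (hA : MBdd A) (h : IsFlat q T A)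
    {N N' : Matrix (Fin d) (Fin d) (MvPowerSeries (Option S) k)} (hN : MBdd N) (hN' : MBdd N')
    (hNN : N * N' = 1) {v : Fin d → k}
    (hNT : ∀ i c, N i c = (T (e c)).mulVec (fun s => C (v s)) i)
    (x : Fin d → K) :
    (sliceBundle.{u, v, w} hq hϖ0 hϖ he hT hA h).MaximalAt x := by
  intro a hxa
  have hy : ∀ o, ‖lin (optMat q⁻¹ (incl k e)) (pt x 0) o‖ < 1 := fun o =>
    (norm_lin_incl_le he (mem_disc.mp hxa) o).trans_lt hϖ
  set y := lin (optMat q⁻¹ (incl k e)) (pt x 0) with hydef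
  have hinv : N.map (ev y) * N'.map (ev y) = 1 := by
    rw [← map_ev_mul hN hN' hy, hNN]
    exact ev_matrix_one hy
  have hinv' : N'.map (ev y) * N.map (ev y) = 1 := mul_eq_one_comm.mp hinv
  have hcol : ∀ c, ((sliceConn (K := K) q e T A).T c (pt x 0)).mulVec
      (fun s => algebraMap k K (v s)) = algebraMap k K q • fun i => N.map (ev y) i c := fun c => by
    change (((q • T (e c)).map (ev y)).mulVec fun s => algebraMap k K (v s)) = _
    rw [map_ev_const_smul q (hT _) hy, Matrix.smul_mulVec]
    congr 1
    ext i
    rw [map_ev_mulVec (hT _) v hy, Matrix.map_apply, hNT]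
  have hmap : (fun t : Fin d → K => ∑ c, t c • ((sliceConn (K := K) q e T A).T c (pt x 0)).mulVec
      fun s => algebraMap k K (v s)) =
      fun t => algebraMap k K q • (N.map (ev y)).mulVec t := by
    ext t i
    simp only [hcol, Finset.sum_apply, Pi.smul_apply, smul_eq_mul, Matrix.mulVec, dotProduct,
      Finset.mul_sum]
    exact Finset.sum_congr rfl fun c _ => by ring
  have hq' : algebraMap k K q ≠ 0 := by simpa using hq
  have hbij : Function.Bijective fun t : Fin d → K =>
      algebraMap k K q • (N.map (ev y)).mulVec t := by
    refine Function.bijective_iff_has_inverse.mpr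
      ⟨fun w => (N'.map (ev y)).mulVec ((algebraMap k K q)⁻¹ • w), fun t => ?_, fun w => ?_⟩
    · simp only [smul_smul, inv_mul_cancel₀ hq', one_smul, Matrix.mulVec_mulVec, hinv',
        Matrix.one_mulVec]
    · simp only [Matrix.mulVec_mulVec, hinv, Matrix.one_mulVec, smul_smul, mul_inv_cancel₀ hq',
        one_smul]
  rw [← hmap] at hbij
  exact ⟨fun s : Fin d => algebraMap k K (v s), fun s => IntermediateField.algebraMap_mem _ _, hbij⟩

end Maximality

/-! ### Pullbacks of the connection on a slice -/

section SlicePullbackValues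

theorem MBdd.map_subst {k σ τ r s : Type*} [NormedField k] [IsUltrametricDist k] [Finite τ]
    {P : τ → MvPowerSeries σ k} (hP : ∀ i, Bd 1 (P i)) (hP0 : ∀ i, constantCoeff (P i) = 0)
    {M : Matrix r s (MvPowerSeries τ k)} (hM : MBdd M) : MBdd (M.map (subst P)) := by
  obtain ⟨D, hD0, hD⟩ := hM
  exact ⟨D, hD0, fun i j => (hD i j).subst hP hP0⟩

theorem blockDiagonal'_sum_smul {R I N : Type*} [CommRing R] [DecidableEq I] {J : I → Type*}
    (s : Finset N) (a : N → R) (X : N → ∀ i, Matrix (J i) (J i) R) :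
    Matrix.blockDiagonal' (fun i => ∑ n ∈ s, a n • X n i) =
      ∑ n ∈ s, a n • Matrix.blockDiagonal' (X n) := by
  have h := map_sum (Matrix.blockDiagonal'AddMonoidHom J J R) (fun n i => a n • X n i) s
  rw [show (fun i => ∑ n ∈ s, a n • X n i) = ∑ n ∈ s, fun i => a n • X n i by
    ext1 i; exact (Finset.sum_apply i s fun n i => a n • X n i).symm]
  refine h.trans (Finset.sum_congr rfl fun n _ => ?_)
  exact Matrix.blockDiagonal'_smul (a n) (X n)

variable {k K : Type*} [NontriviallyNormedField k] [NontriviallyNormedField K] [NormedAlgebra k K]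
  [IsUltrametricDist K] [IsUltrametricDist k] [CompleteSpace k] [Algebra.IsAlgebraic k K]

theorem map_ev_subst {σ τ r s : Type*} [Finite σ] [Finite τ] {P : τ → MvPowerSeries σ k}
    (hP : ∀ i, Bd 1 (P i)) (hP0 : ∀ i, constantCoeff (P i) = 0)
    {M : Matrix r s (MvPowerSeries τ k)} (hM : MBdd M) {x : σ → K} (hx : ∀ i, ‖x i‖ < 1) :
    (M.map (subst P)).map (ev x) = M.map (ev fun i => ev x (P i)) := by
  obtain ⟨D, -, hD⟩ := hM
  ext i j
  exact ev_subst hP hP0 (hD i j) hx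

variable [CharZero k]

theorem pd_ev_pt_lin {ι S : Type*} [Fintype ι] [DecidableEq ι] [Fintype S] {Λ : Matrix S ι k}
    {y : Option ι → K} {D : ℝ} {F : MvPowerSeries (Option S) k} (hF : Bd D F)
    (hFu : pderiv k none F = 0) {a : k} (hy : ∀ o, ‖lin (optMat a Λ) y o‖ < 1) (i : ι) :
    pd i (fun x => ev (pt (lin Λ x) 0) F) (base y) =
      ∑ s, algebraMap k K (Λ s i) * ev (lin (optMat a Λ) y) (pderiv k (some s) F) := by
  have hbase : base (lin (optMat a Λ) y) = lin Λ (base y) := by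
    rw [lin_optMat]
    rfl
  have hy0 : ∀ o, ‖lin (sec Λ) (base y) o‖ < 1 := fun o => by
    rw [lin_sec]
    cases o with
    | none => simp [pt]
    | some s => exact hbase ▸ hy (some s)
  simp only [← lin_sec]
  rw [pd_ev_lin i hF hy0, Fintype.sum_option]
  simp only [sec, Option.elim_none, Option.elim_some, map_zero, zero_mul, zero_add]
  refine Finset.sum_congr rfl fun s _ => ?_
  congr 1
  have hu : pderiv k none (pderiv k (some s) F) = 0 := by rw [pderiv_comm, hFu, map_zero]
  rw [← ev_pt_zero_base (hF.pderiv (some s)) hu hy, hbase, ← lin_sec]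

variable {ι I : Type*} {J : I → Type*} [Fintype ι] [Fintype I]
  [DecidableEq I] [∀ i, Fintype (J i)] [∀ i, DecidableEq (J i)]
  {q : k} {p : (Σ i, J i) → MvPowerSeries (Option (Σ i, J i)) k} {Λ : Matrix (Σ i, J i) ι k}
  {y : Option ι → K}

/-- Restriction to the slice after the projection with the components `p ⟨j, c⟩` is the substitution
`sliceMap`. -/
theorem lin_incl_timesId (hp : ∀ s, Bd 1 (p s)) (hpu : ∀ s, pderiv k none (p s) = 0)
    {a : k} (hy : ∀ o, ‖lin (optMat a Λ) y o‖ < 1) (j : I) :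
    lin (optMat a (incl k (Sigma.mk j)))
        (timesId (fun (x : ι → K) c => ev (pt (lin Λ x) 0) (p ⟨j, c⟩)) y) =
      fun o => ev (lin (optMat a Λ) y) (sliceMap (Sigma.mk j) (fun c => p ⟨j, c⟩) o) := by
  have he : Function.Injective (Sigma.mk j : J j → Σ i, J i) := sigma_mk_injective
  rw [lin_optMat]
  ext o
  cases o with
  | none =>
    rw [sliceMap_none, ev_X _ hy, lin_optMat]
    rfl
  | some s =>
    change lin (incl k (Sigma.mk j)) (fun c => ev (pt (lin Λ (base y)) 0) (p ⟨j, c⟩)) s = _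
    by_cases hs : s ∈ Set.range (Sigma.mk j : J j → Σ i, J i)
    · obtain ⟨c, rfl⟩ := hs
      rw [lin_incl_apply he, sliceMap_some he, ← ev_pt_zero_base (hp _) (hpu _) hy, lin_optMat]
      rfl
    · rw [lin_incl_of_not_mem hs, sliceMap_of_not_mem hs, ev_zero hy]

/-- The pullback of the connection on the slice along the projection with the components `p ⟨j, c⟩`,
in the directions of the base. -/
theorem pullback_sliceConn_T [DecidableEq ι] (hq : q ≠ 0) (hp : ∀ s, Bd 1 (p s))
    (hp0 : ∀ s, constantCoeff (p s) = 0) (hpu : ∀ s, pderiv k none (p s) = 0)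
    (hy : ∀ o, ‖lin (optMat q⁻¹ (q⁻¹ • Λ)) y o‖ < 1) (j : I) {r : Type*}
    {T : (Σ i, J i) → Matrix r r (MvPowerSeries (Option (Σ i, J i)) k)} (hT : ∀ s, MBdd (T s))
    (A : Matrix r r (MvPowerSeries (Option (Σ i, J i)) k)) (i : ι) :
    ((sliceConn (K := K) q (Sigma.mk j) T A).pullback
      fun x c => ev (pt (lin (q⁻¹ • Λ) x) 0) (p ⟨j, c⟩)).T i y =
    ∑ s, algebraMap k K (Λ s i) • (∑ c, pderiv k (some s) (p ⟨j, c⟩) •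
      (T ⟨j, c⟩).map (subst (sliceMap (Sigma.mk j) fun c => p ⟨j, c⟩))).map
        (ev (lin (optMat q⁻¹ (q⁻¹ • Λ)) y)) := by
  have he : Function.Injective (Sigma.mk j : J j → Σ i, J i) := sigma_mk_injective
  have hsl : ∀ o, Bd 1 (sliceMap (Sigma.mk j) (fun c => p ⟨j, c⟩) o) :=
    sliceMap_cases he (Q := fun _ F => Bd 1 F) (Bd.X none) (fun c => hp _)
      fun _ _ => Bd.zero zero_le_one
  have hsl0 : ∀ o, constantCoeff (sliceMap (Sigma.mk j) (fun c => p ⟨j, c⟩) o) = 0 :=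
    sliceMap_cases he (Q := fun _ F => constantCoeff F = 0) (constantCoeff_X _) (fun c => hp0 _)
      fun _ _ => map_zero _
  have hW : ∀ c, MBdd ((T ⟨j, c⟩).map (subst (sliceMap (Sigma.mk j) fun c => p ⟨j, c⟩))) := fun c =>
    (hT _).map_subst hsl hsl0
  have hy' : ∀ o, ‖ev (lin (optMat q⁻¹ (q⁻¹ • Λ)) y)
      (sliceMap (Sigma.mk j) (fun c => p ⟨j, c⟩) o)‖ < 1 := fun o => by
    obtain ⟨ρ, hρ0, hρ, hyρ⟩ := exists_norm_le_lt_one hy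
    exact (norm_ev_le_of_constantCoeff (hsl o) (hsl0 o) hρ hρ0 hyρ).trans_lt hρ
  have h1 : ∀ c, (q • T ⟨j, c⟩).map (ev (lin (optMat q⁻¹ (incl k (Sigma.mk j)))
      (timesId (fun (x : ι → K) c => ev (pt (lin (q⁻¹ • Λ) x) 0) (p ⟨j, c⟩)) y))) =
      algebraMap k K q • ((T ⟨j, c⟩).map (subst (sliceMap (Sigma.mk j) fun c => p ⟨j, c⟩))).map
        (ev (lin (optMat q⁻¹ (q⁻¹ • Λ)) y)) := fun c => by
    rw [lin_incl_timesId hp hpu hy, map_ev_const_smul q (hT _) hy', map_ev_subst hsl hsl0 (hT _) hy]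
  have h2 : ∀ s, (∑ c, pderiv k (some s) (p ⟨j, c⟩) •
      (T ⟨j, c⟩).map (subst (sliceMap (Sigma.mk j) fun c => p ⟨j, c⟩))).map
        (ev (lin (optMat q⁻¹ (q⁻¹ • Λ)) y)) =
      ∑ c, ev (lin (optMat q⁻¹ (q⁻¹ • Λ)) y) (pderiv k (some s) (p ⟨j, c⟩)) •
        ((T ⟨j, c⟩).map (subst (sliceMap (Sigma.mk j) fun c => p ⟨j, c⟩))).map
        (ev (lin (optMat q⁻¹ (q⁻¹ • Λ)) y)) := fun s => by
    rw [map_ev_sum _ (fun c => (hW c).smul ((hp _).pderiv _)) hy]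
    exact Finset.sum_congr rfl fun c _ => map_ev_smul ((hp _).pderiv _) (hW c) hy
  change ∑ c, pd i (fun x => ev (pt (lin (q⁻¹ • Λ) x) 0) (p ⟨j, c⟩)) (base y) •
    (q • T ⟨j, c⟩).map (ev (lin (optMat q⁻¹ (incl k (Sigma.mk j)))
      (timesId (fun (x : ι → K) c => ev (pt (lin (q⁻¹ • Λ) x) 0) (p ⟨j, c⟩)) y))) = _
  simp only [h1, h2, pd_ev_pt_lin (hp _) (hpu _) hy, Finset.smul_sum, Finset.sum_smul]
  rw [Finset.sum_comm]
  refine Finset.sum_congr rfl fun s _ => Finset.sum_congr rfl fun c _ => ?_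
  rw [smul_smul, smul_smul, Matrix.smul_apply, smul_eq_mul, map_mul, map_inv₀]
  congr 1
  have hq' : algebraMap k K q ≠ 0 := by simpa using hq
  field_simp

/-- The pullback of the connection on the slice along the projection with the components `p ⟨j, c⟩`,
in the direction of `u`. -/
theorem pullback_sliceConn_A (hp : ∀ s, Bd 1 (p s)) (hp0 : ∀ s, constantCoeff (p s) = 0)
    (hpu : ∀ s, pderiv k none (p s) = 0)
    (hy : ∀ o, ‖lin (optMat q⁻¹ (q⁻¹ • Λ)) y o‖ < 1) (j : I) {r : Type*}
    (T : (Σ i, J i) → Matrix r r (MvPowerSeries (Option (Σ i, J i)) k))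
    {A : Matrix r r (MvPowerSeries (Option (Σ i, J i)) k)} (hA : MBdd A) [DecidableEq ι] :
    ((sliceConn (K := K) q (Sigma.mk j) T A).pullback
      fun x c => ev (pt (lin (q⁻¹ • Λ) x) 0) (p ⟨j, c⟩)).A y =
    (A.map (subst (sliceMap (Sigma.mk j) fun c => p ⟨j, c⟩))).map
      (ev (lin (optMat q⁻¹ (q⁻¹ • Λ)) y)) := by
  have he : Function.Injective (Sigma.mk j : J j → Σ i, J i) := sigma_mk_injective
  change A.map (ev (lin (optMat q⁻¹ (incl k (Sigma.mk j)))
    (timesId (fun (x : ι → K) c => ev (pt (lin (q⁻¹ • Λ) x) 0) (p ⟨j, c⟩)) y))) = _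
  rw [lin_incl_timesId hp hpu hy, map_ev_subst (sliceMap_cases he (Q := fun _ F => Bd 1 F)
    (Bd.X none) (fun c => hp _) fun _ _ => Bd.zero zero_le_one) (sliceMap_cases he
    (Q := fun _ F => constantCoeff F = 0) (constantCoeff_X _) (fun c => hp0 _)
    fun _ _ => map_zero _) hA hy]

end SlicePullbackValues

/-! ### From formal to analytic isomorphisms -/

section Intertwining

theorem MBdd.blockDiagonal' {k σ I : Type*} [NormedField k] [Fintype I] [DecidableEq I]
    {J : I → Type*} {M : ∀ i, Matrix (J i) (J i) (MvPowerSeries σ k)} (hM : ∀ i, MBdd (M i)) :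
    MBdd (Matrix.blockDiagonal' M) := by
  choose D hD0 hD using hM
  obtain ⟨C, hC⟩ := (Set.finite_range D).bddAbove
  refine ⟨max C 0, le_max_right _ _, fun ⟨i, a⟩ ⟨j, b⟩ => ?_⟩
  rw [Matrix.blockDiagonal'_apply]
  split_ifs
  · exact (hD _ _ _).mono ((hC ⟨_, rfl⟩).trans (le_max_left _ _))
  · exact Bd.zero (le_max_right _ _)

theorem matD_constM_mul {k σ r s t : Type*} [Field k] [Fintype s]
    (D : Derivation k (MvPowerSeries σ k) (MvPowerSeries σ k)) (P : Matrix r s k)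
    (M : Matrix s t (MvPowerSeries σ k)) : matD D (constM σ P * M) = constM σ P * matD D M := by
  rw [matD_mul, matD_constM, Matrix.zero_mul, zero_add]

variable {k K : Type*} [NontriviallyNormedField k] [NontriviallyNormedField K] [NormedAlgebra k K]
  [IsUltrametricDist K] [IsUltrametricDist k] [CompleteSpace k] [Algebra.IsAlgebraic k K]

theorem map_ev_blockDiagonal' {σ I : Type*} [Finite σ] [DecidableEq I] {J : I → Type*}
    (M : ∀ i, Matrix (J i) (J i) (MvPowerSeries σ k)) {x : σ → K} (hx : ∀ i, ‖x i‖ < 1) :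
    (Matrix.blockDiagonal' M).map (ev x) = Matrix.blockDiagonal' fun i => (M i).map (ev x) :=
  Matrix.blockDiagonal'_map M (ev x) (ev_zero hx)

variable [CharZero k] {ι I r : Type*} {J : I → Type*} [Fintype ι] [DecidableEq ι] [Fintype I]
  [DecidableEq I] [∀ i, Fintype (J i)] [∀ i, DecidableEq (J i)] [Fintype r]

/-- A formal isomorphism between connections, evaluated in linear coordinates. -/
theorem intertwines_of_formal {q : k} (hq : q ≠ 0)
    {p : (Σ i, J i) → MvPowerSeries (Option (Σ i, J i)) k} (hp : ∀ s, Bd 1 (p s))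
    (hp0 : ∀ s, constantCoeff (p s) = 0) (hpu : ∀ s, pderiv k none (p s) = 0)
    {Λ : Matrix (Σ i, J i) ι k} {P : Matrix r (Σ i, J i) k} {P' : Matrix (Σ i, J i) r k}
    (hP : P' * P = 1)
    {T : (Σ i, J i) → Matrix (Σ i, J i) (Σ i, J i) (MvPowerSeries (Option (Σ i, J i)) k)}
    {A Φ : Matrix (Σ i, J i) (Σ i, J i) (MvPowerSeries (Option (Σ i, J i)) k)}
    {Tb : ∀ j, (Σ i, J i) → Matrix (J j) (J j) (MvPowerSeries (Option (Σ i, J i)) k)}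
    {Ab : ∀ j, Matrix (J j) (J j) (MvPowerSeries (Option (Σ i, J i)) k)}
    (hT : ∀ s, MBdd (T s)) (hA : MBdd A) (hΦ : MBdd Φ) (hTb : ∀ j s, MBdd (Tb j s))
    (hAb : ∀ j, MBdd (Ab j))
    (hΦT : ∀ a, matD (uD k a) Φ + T a * Φ = Φ * Matrix.blockDiagonal' fun j =>
      ∑ c, pderiv k (some a) (p ⟨j, c⟩) •
        (Tb j ⟨j, c⟩).map (subst (sliceMap (Sigma.mk j) fun c => p ⟨j, c⟩)))
    (hΦA : matD (uuD _ q) Φ + A * Φ = Φ * Matrix.blockDiagonal' fun j =>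
      (Ab j).map (subst (sliceMap (Sigma.mk j) fun c => p ⟨j, c⟩)))
    {c : ConnForm K ι r} {V : Set (Option ι → K)}
    (hV : ∀ y ∈ V, ∀ o, ‖lin (optMat q⁻¹ (q⁻¹ • Λ)) y o‖ < 1)
    (hcT : ∀ y ∈ V, ∀ i, c.T i y = ∑ s, algebraMap k K (Λ s i) • (P.map (algebraMap k K) *
      (T s).map (ev (lin (optMat q⁻¹ (q⁻¹ • Λ)) y)) * P'.map (algebraMap k K)))
    (hcA : ∀ y ∈ V, c.A y = P.map (algebraMap k K) *
      A.map (ev (lin (optMat q⁻¹ (q⁻¹ • Λ)) y)) * P'.map (algebraMap k K)) :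
    c.Intertwines (ConnForm.directSum fun j => (sliceConn q (Sigma.mk j) (Tb j) (Ab j)).pullback
        fun x c => ev (pt (lin (q⁻¹ • Λ) x) 0) (p ⟨j, c⟩))
      (fun y => (constM (Option (Σ i, J i)) P * Φ).map (ev (lin (optMat q⁻¹ (q⁻¹ • Λ)) y))) V := by
  have hsl : ∀ j o, Bd 1 (sliceMap (Sigma.mk j) (fun c : J j => p ⟨j, c⟩) o) := fun j =>
    sliceMap_cases sigma_mk_injective (Q := fun _ F => Bd 1 F) (Bd.X none) (fun c => hp _)
      fun _ _ => Bd.zero zero_le_one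
  have hsl0 : ∀ j o,
      constantCoeff (sliceMap (Sigma.mk j) (fun c : J j => p ⟨j, c⟩) o) = 0 := fun j =>
    sliceMap_cases sigma_mk_injective (Q := fun _ F => constantCoeff F = 0) (constantCoeff_X _)
      (fun c => hp0 _) fun _ _ => map_zero _
  have hPΦ : MBdd (constM (Option (Σ i, J i)) P * Φ) := (MBdd.map_C P).mul hΦ
  have hPK : P'.map (algebraMap k K) * P.map (algebraMap k K) = 1 := by
    rw [← Matrix.map_mul, hP, Matrix.map_one _ (map_zero _) (map_one _)]
  have hval : ∀ (M : Matrix (Σ i, J i) (Σ i, J i) (MvPowerSeries (Option (Σ i, J i)) k))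
      (_ : MBdd M) (x : Option (Σ i, J i) → K) (_ : ∀ o, ‖x o‖ < 1),
      (constM (Option (Σ i, J i)) P * M).map (ev x) = P.map (algebraMap k K) * M.map (ev x) :=
    fun M hM x hx => by
      rw [map_ev_mul (MBdd.map_C P) hM hx, (map_ev_map_C P hx : (constM _ P).map (ev x) = _)]
  have hconj : ∀ (M : Matrix (Σ i, J i) (Σ i, J i) (MvPowerSeries (Option (Σ i, J i)) k))
      (_ : MBdd M) (x : Option (Σ i, J i) → K) (_ : ∀ o, ‖x o‖ < 1),
      P.map (algebraMap k K) * M.map (ev x) * P'.map (algebraMap k K) *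
        (constM (Option (Σ i, J i)) P * Φ).map (ev x) =
      P.map (algebraMap k K) * (M * Φ).map (ev x) := fun M hM x hx => by
    rw [hval Φ hΦ x hx, map_ev_mul hM hΦ hx, Matrix.mul_assoc _ (P'.map _), ← Matrix.mul_assoc
      (P'.map _), hPK, Matrix.one_mul, Matrix.mul_assoc]
  constructor
  · intro y hy i
    have hx := hV y hy
    rw [smul_pdM_some_of_eq_ev hq hPΦ (fun _ _ => rfl) hx]
    have hX : ∀ s, MBdd (Matrix.blockDiagonal' fun j => ∑ c, pderiv k (some s) (p ⟨j, c⟩) •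
        (Tb j ⟨j, c⟩).map (subst (sliceMap (Sigma.mk j) fun c => p ⟨j, c⟩))) := fun s =>
      MBdd.blockDiagonal' fun j => MBdd.sum _ fun c _ =>
        ((hTb j _).map_subst (hsl j) (hsl0 j)).smul ((hp _).pderiv _)
    have hdir : (ConnForm.directSum fun j => (sliceConn (K := K) q (Sigma.mk j) (Tb j)
        (Ab j)).pullback fun x c => ev (pt (lin (q⁻¹ • Λ) x) 0) (p ⟨j, c⟩)).T i y =
        ∑ s, algebraMap k K (Λ s i) • (Matrix.blockDiagonal' fun j =>
          ∑ c, pderiv k (some s) (p ⟨j, c⟩) •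
          (Tb j ⟨j, c⟩).map (subst (sliceMap (Sigma.mk j) fun c => p ⟨j, c⟩))).map
            (ev (lin (optMat q⁻¹ (q⁻¹ • Λ)) y)) := by
      simp only [map_ev_blockDiagonal' _ hx]
      rw [← blockDiagonal'_sum_smul]
      exact congrArg Matrix.blockDiagonal'
        (funext fun j => pullback_sliceConn_T hq hp hp0 hpu hx j (hTb j) (Ab j) i)
    rw [hdir, hcT y hy, Matrix.sum_mul, Matrix.mul_sum, ← Finset.sum_add_distrib]
    refine Finset.sum_congr rfl fun s _ => ?_
    rw [Matrix.smul_apply, smul_eq_mul, mul_inv_cancel_left₀ hq, Matrix.smul_mul, Matrix.mul_smul,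
      ← smul_add, matD_constM_mul, hconj _ (hT s) _ hx, hval _ (hΦ.matD_uD s) _ hx,
      ← Matrix.mul_add, ← map_ev_add (hΦ.matD_uD s) ((hT s).mul hΦ) hx, hΦT s,
      map_ev_mul hΦ (hX s) hx, hval _ hΦ _ hx, Matrix.mul_assoc]
  · intro y hy
    have hx := hV y hy
    rw [smul_pdM_none_of_eq_ev hq hPΦ (fun _ _ => rfl) hx]
    have hdir : (ConnForm.directSum fun j => (sliceConn (K := K) q (Sigma.mk j) (Tb j)
        (Ab j)).pullback fun x c => ev (pt (lin (q⁻¹ • Λ) x) 0) (p ⟨j, c⟩)).A y =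
        (Matrix.blockDiagonal' fun j =>
          (Ab j).map (subst (sliceMap (Sigma.mk j) fun c => p ⟨j, c⟩))).map
            (ev (lin (optMat q⁻¹ (q⁻¹ • Λ)) y)) := by
      rw [map_ev_blockDiagonal' _ hx]
      exact congrArg Matrix.blockDiagonal'
        (funext fun j => pullback_sliceConn_A hp hp0 hpu hx j (Tb j) (hAb j))
    rw [hdir, hcA y hy, matD_constM_mul, hconj _ hA _ hx, hval _ (hΦ.matD_uuD q) _ hx,
      ← Matrix.mul_add, ← map_ev_add (hΦ.matD_uuD q) (hA.mul hΦ) hx, hΦA, map_ev_mul hΦ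
        (MBdd.blockDiagonal' fun j => (hAb j).map_subst (hsl j) (hsl0 j)) hx, hval _ hΦ _ hx,
      Matrix.mul_assoc]

end Intertwining

/-! ### Splitting of a flat analytic connection -/

section Splitting

open Filter Topology

variable {k K : Type*} [NontriviallyNormedField k] [NontriviallyNormedField K] [NormedAlgebra k K]
  [IsUltrametricDist K] [IsUltrametricDist k] [CompleteSpace k] [Algebra.IsAlgebraic k K]
  {ι I r : Type*} {J : I → Type*} [Fintype ι] [DecidableEq ι] [Fintype I]
  [DecidableEq I] [∀ i, Fintype (J i)] [∀ i, DecidableEq (J i)] [Fintype r]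

/-- A splitting of the connection `c` near the origin, by power series in linear coordinates: `P` is
the constant frame in which the splitting at the origin is block diagonal, `q⁻¹ • Λ` and `q⁻¹` are
the coordinates on the base and in the direction of `u`, the `p ⟨j, c⟩` are the coordinates of the
`j`-th factor of the base, `Φ` is the frame in which the connection splits, and `Tb j`, `Ab j` is
the connection on the `j`-th factor, with cyclic vector `v ⟨j, ·⟩`. -/
structure Splitting (c : ConnForm K ι r) (V : Set (Option ι → K)) (P : Matrix r (Σ i, J i) k)
    (P' : Matrix (Σ i, J i) r k) where
  Λ : Matrix (Σ i, J i) ι k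
  L : Matrix ι (Σ i, J i) k
  Λ_mul : Λ * L = 1
  mul_Λ : L * Λ = 1
  q : k
  q_ne : q ≠ 0
  T : (Σ i, J i) → Matrix (Σ i, J i) (Σ i, J i) (MvPowerSeries (Option (Σ i, J i)) k)
  A : Matrix (Σ i, J i) (Σ i, J i) (MvPowerSeries (Option (Σ i, J i)) k)
  mbdd_T : ∀ s, MBdd (T s)
  mbdd_A : MBdd A
  mem : ∀ y : Option ι → K, (∀ l, ‖lin (optMat q⁻¹ (q⁻¹ • Λ)) y l‖ < 1) → y ∈ V
  c_T : ∀ y, (∀ l, ‖lin (optMat q⁻¹ (q⁻¹ • Λ)) y l‖ < 1) → ∀ i,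
    c.T i y = ∑ s, algebraMap k K (Λ s i) • (P.map (algebraMap k K) *
      (T s).map (ev (lin (optMat q⁻¹ (q⁻¹ • Λ)) y)) * P'.map (algebraMap k K))
  c_A : ∀ y, (∀ l, ‖lin (optMat q⁻¹ (q⁻¹ • Λ)) y l‖ < 1) →
    c.A y = P.map (algebraMap k K) * A.map (ev (lin (optMat q⁻¹ (q⁻¹ • Λ)) y)) *
      P'.map (algebraMap k K)
  p : (Σ i, J i) → MvPowerSeries (Option (Σ i, J i)) k
  Φ : Matrix (Σ i, J i) (Σ i, J i) (MvPowerSeries (Option (Σ i, J i)) k)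
  Ψ : Matrix (Σ i, J i) (Σ i, J i) (MvPowerSeries (Option (Σ i, J i)) k)
  Tb : ∀ j, (Σ i, J i) → Matrix (J j) (J j) (MvPowerSeries (Option (Σ i, J i)) k)
  Ab : ∀ j, Matrix (J j) (J j) (MvPowerSeries (Option (Σ i, J i)) k)
  N : ∀ j, Matrix (J j) (J j) (MvPowerSeries (Option (Σ i, J i)) k)
  N' : ∀ j, Matrix (J j) (J j) (MvPowerSeries (Option (Σ i, J i)) k)
  v : (Σ i, J i) → k
  bd_p : ∀ s, Bd 1 (p s)
  pderiv_p : ∀ s, pderiv k none (p s) = 0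
  p_sub_mem : ∀ s, p s - X (some s) ∈ vanIdeal k (fun _ => 1) 2
  mbdd_Φ : MBdd Φ
  mbdd_Ψ : MBdd Ψ
  Φ_mul_Ψ : Φ * Ψ = 1
  Ψ_mul_Φ : Ψ * Φ = 1
  constantCoeff_Φ : Φ.map constantCoeff = 1
  isFlat : ∀ j, IsFlat q (Tb j) (Ab j)
  mbdd_Tb : ∀ j s, MBdd (Tb j s)
  mbdd_Ab : ∀ j, MBdd (Ab j)
  N_eq : ∀ j i c, N j i c = (Tb j ⟨j, c⟩).mulVec (fun s => C (v ⟨j, s⟩)) i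
  mbdd_N : ∀ j, MBdd (N j)
  mbdd_N' : ∀ j, MBdd (N' j)
  N_mul : ∀ j, N j * N' j = 1
  gauge_T : ∀ a, matD (uD k a) Φ + T a * Φ = Φ * Matrix.blockDiagonal' fun j =>
    ∑ c, pderiv k (some a) (p ⟨j, c⟩) •
      (Tb j ⟨j, c⟩).map (subst (sliceMap (Sigma.mk j) fun c => p ⟨j, c⟩))
  gauge_A : matD (uuD _ q) Φ + A * Φ = Φ * Matrix.blockDiagonal' fun j =>
    (Ab j).map (subst (sliceMap (Sigma.mk j) fun c => p ⟨j, c⟩))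

variable [DecidableEq r] {c : ConnForm K ι r} {V : Set (Option ι → K)}
  {P : Matrix r (Σ i, J i) k} {P' : Matrix (Σ i, J i) r k}

/-- A flat connection with a cyclic vector at the origin splits near the origin according to any
splitting of the endomorphism `∇_{u²∂ᵤ}` at the origin into parts with coprime characteristic
polynomials. -/
theorem ConnForm.IsFlatOn.nonempty_splitting [IsAlgClosed K]
    (hk : ∀ n : ℕ, n ≠ 0 → ‖(n : k)‖ = 1)
    (hV : IsAdmissibleOpen k V) (h0 : 0 ∈ V)
    (hT : ∀ i, IsAnalyticMatrixOn k (c.T i) V) (hA : IsAnalyticMatrixOn k c.A V)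
    (hc : c.IsFlatOn V) (hP : P * P' = 1) (hP' : P' * P = 1) {A₀ : Matrix r r k}
    (hA₀ : c.A 0 = A₀.map (algebraMap k K)) {T₀ : ι → Matrix r r k}
    (hT₀ : ∀ i, c.T i 0 = (T₀ i).map (algebraMap k K))
    (hBD : IsBD Sigma.fst (P' * A₀ * P)) (hcop : ∀ i j, i ≠ j →
      IsCoprime (blk i (P' * A₀ * P)).charpoly (blk j (P' * A₀ * P)).charpoly) {h : r → k}
    (hcyc : Function.Bijective fun v : ι → K =>
      ∑ i, v i • (c.T i 0).mulVec fun a => algebraMap k K (h a)) :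
    Nonempty (Splitting c V P P') := by
  -- the isomorphism `v ↦ μ(v)(h)` of the tangent space with the fibre provides the coordinates on
  -- the base in which the values of the connection on the cyclic vector are the basis vectors
  let N₀ : Matrix r ι k := Matrix.of fun a i => (T₀ i).mulVec h a
  have hN₀ : Function.Bijective (N₀.map (algebraMap k K)).mulVec := by
    convert hcyc using 1
    ext v a
    simp only [Finset.sum_apply, Pi.smul_apply, smul_eq_mul, Matrix.mulVec, dotProduct, hT₀]
    refine Finset.sum_congr rfl fun i _ => ?_
    simp [N₀, Matrix.mulVec, dotProduct, mul_comm]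
  obtain ⟨N₁, hN₀₁, hN₁₀⟩ := exists_inverse_of_bijective hN₀
  have hΛ : P' * N₀ * (N₁ * P) = 1 := by
    rw [Matrix.mul_assoc, ← Matrix.mul_assoc N₀, hN₀₁, Matrix.one_mul, hP']
  have hL : N₁ * P * (P' * N₀) = 1 := by
    rw [Matrix.mul_assoc, ← Matrix.mul_assoc P, hP, Matrix.one_mul, hN₁₀]
  obtain ⟨L, M, hM, hLM⟩ := exists_isSylvesterInverse hBD hcop
  let T₁ : (Σ i, J i) → Matrix (Σ i, J i) (Σ i, J i) k :=
    fun s => ∑ l, (N₁ * P) l s • (P' * T₀ l * P)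
  have hcyc₁ : ∀ a s, (T₁ a).mulVec (P'.mulVec h) s = if s = a then 1 else 0 := fun a s => by
    have h1 : P.mulVec (P'.mulVec h) = h := by rw [Matrix.mulVec_mulVec, hP, Matrix.one_mulVec]
    rw [← Matrix.one_apply, ← hΛ, Matrix.sum_mulVec, Finset.sum_apply, ← Matrix.mul_assoc,
      Matrix.mul_assoc, Matrix.mul_apply]
    refine Finset.sum_congr rfl fun l _ => ?_
    rw [Matrix.smul_mulVec, ← Matrix.mulVec_mulVec, h1, ← Matrix.mulVec_mulVec]
    exact mul_comm _ _
  obtain ⟨C₁, hC₁⟩ := exists_norm_entries_le (Matrix.of fun a (x : (Σ i, J i) × (Σ i, J i)) =>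
    T₁ a x.1 x.2)
  obtain ⟨C₂, hC₂⟩ := exists_norm_entries_le (Matrix.of fun a (_ : Unit) => P'.mulVec h a)
  -- the nonconstant coefficients are made smaller than `η / (M + 1)`, where `η = Ct⁻³` and `M` is
  -- the norm of the inverse of `ad A₀`
  let Ct := max 1 (max C₁ C₂)
  have hCt1 : 1 ≤ Ct := le_max_left _ _
  have hCt : 0 < Ct := one_pos.trans_le hCt1
  have hη : 0 < (Ct ^ 3)⁻¹ := inv_pos.mpr (pow_pos hCt 3)
  have hM1 : 0 < M + 1 := add_pos_of_nonneg_of_pos hM one_pos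
  have hb : 0 < (Ct ^ 3)⁻¹ / (M + 1) := div_pos hη hM1
  have hbη : (Ct ^ 3)⁻¹ / (M + 1) ≤ (Ct ^ 3)⁻¹ := div_le_self hη.le (le_add_of_nonneg_left hM)
  have hMb : M * ((Ct ^ 3)⁻¹ / (M + 1)) ≤ (Ct ^ 3)⁻¹ := by
    rw [mul_div_assoc', div_le_iff₀ hM1, mul_comm M]
    exact mul_le_mul_of_nonneg_left (le_add_of_nonneg_right zero_le_one) hη.le
  have hqM : ∀ᶠ q in 𝓝[≠] (0 : k), M * ‖q‖ ≤ 1 := by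
    have h1 : Tendsto (fun q : k => M * ‖q‖) (𝓝 0) (𝓝 0) := by
      have h := (continuous_norm.const_mul M).tendsto (0 : k)
      simpa using h
    exact nhdsWithin_le_nhds (h1.eventually_le_const one_pos)
  obtain ⟨q, ⟨T, A, hflat, hTb, hT0, hAb, hA0, hTm, hAm, hy⟩, hqM, hq0⟩ :=
    ((hc.eventually_exists_series hk hV h0 hT hA hP hP' hΛ hL hT₀ hA₀ hb).and
      (hqM.and self_mem_nhdsWithin)).exists
  obtain ⟨p, Φ, Ψ, Tb, Ab, N, N', hp, hpu, hp2, hΦ, hΨ, hΦΨ, hΨΦ, hΦ0, hflatb, ⟨D, hD⟩, hN, hNb,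
    hNb', hNN, hgT, hgA⟩ := exists_formal_decomposition hk hflat hLM hBD hη.le hM
      hMb hqM hCt1 (inv_mul_cancel₀ (pow_pos hCt 3).ne').le hcyc₁
      (fun a i j => (hC₁ a (i, j)).trans ((le_max_left _ _).trans (le_max_right _ _)))
      (fun s => (hC₂ s ()).trans ((le_max_right _ _).trans (le_max_right _ _)))
      (fun a i j => (hTb a i j).mono hbη) hT0 hAb hA0
  exact ⟨{
      Λ := P' * N₀, L := N₁ * P, Λ_mul := hΛ, mul_Λ := hL, q := q, q_ne := hq0, T := T, A := A
      mbdd_T := hTm, mbdd_A := hAm, mem := fun y h => (hy y h).1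
      c_T := fun y h => (hy y h).2.1, c_A := fun y h => (hy y h).2.2
      p := p, Φ := Φ, Ψ := Ψ, Tb := Tb, Ab := Ab, N := N, N' := N', v := P'.mulVec h
      bd_p := hp, pderiv_p := hpu, p_sub_mem := hp2
      mbdd_Φ := ⟨1, zero_le_one, hΦ⟩, mbdd_Ψ := ⟨1, zero_le_one, hΨ⟩, Φ_mul_Ψ := hΦΨ
      Ψ_mul_Φ := hΨΦ, constantCoeff_Φ := hΦ0, isFlat := hflatb
      mbdd_Tb := fun j s => MBdd.of_forall fun i i' => ⟨D, (hD j).1 s i i'⟩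
      mbdd_Ab := fun j => MBdd.of_forall fun i i' => ⟨D, (hD j).2 i i'⟩
      N_eq := hN, mbdd_N := fun j => ⟨1, zero_le_one, hNb j⟩
      mbdd_N' := fun j => ⟨1, zero_le_one, hNb' j⟩, N_mul := hNN, gauge_T := hgT, gauge_A := hgA }⟩

end Splitting

/-! ### The decomposition of the F-bundle -/

section Decomposition

universe u v w

theorem pt_zero {K : Type*} [NontriviallyNormedField K] {ι : Type*} :
    pt (0 : ι → K) 0 = 0 := by
  ext o
  cases o <;> rfl

variable {k : Type u} {K : Type v} [NontriviallyNormedField k] [NontriviallyNormedField K]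
  [NormedAlgebra k K] {ι I : Type*} [Fintype ι] [DecidableEq ι] [Fintype I] [DecidableEq I]
  {d : I → ℕ} {B : Set (ι → K)} {E : FBundle.{u, v, w} k B} {a₀ : E.J}
  {P : Matrix (Fin (E.rank a₀)) (Σ i, Fin (d i)) k}
  {P' : Matrix (Σ i, Fin (d i)) (Fin (E.rank a₀)) k}

namespace Splitting

variable (D : Splitting (E.conn a₀) (E.chart a₀) P P') {ϖ : k}

/-- The neighbourhood of the origin on which the splitting is considered. -/
def total (ϖ : k) : Set (Option ι → K) := disc K (optMat D.q⁻¹ (D.q⁻¹ • D.Λ)) ϖ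

theorem smul_mul_smul_Λ : (D.q⁻¹ • D.Λ) * (D.q • D.L) = 1 := by
  rw [Matrix.smul_mul, Matrix.mul_smul, smul_smul, inv_mul_cancel₀ D.q_ne, one_smul, D.Λ_mul]

theorem smul_mul_smul_L : (D.q • D.L) * (D.q⁻¹ • D.Λ) = 1 := by
  rw [Matrix.smul_mul, Matrix.mul_smul, smul_smul, mul_inv_cancel₀ D.q_ne, one_smul, D.mul_Λ]

theorem constantCoeff_p (s : Σ i, Fin (d i)) : constantCoeff (D.p s) = 0 := by
  have := D.p_sub_mem s 0 (by simp)
  rwa [map_sub, coeff_zero_eq_constantCoeff_apply, coeff_zero_eq_constantCoeff_apply,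
    constantCoeff_X, sub_zero] at this

theorem base_mem_of_mem_total {y : Option ι → K} (hy : y ∈ D.total ϖ) :
    base y ∈ disc K (D.q⁻¹ • D.Λ) ϖ := fun s => by
  have h := hy (some s)
  rwa [lin_optMat] at h

theorem pt_mem_total {x : ι → K} (hx : x ∈ disc K (D.q⁻¹ • D.Λ) ϖ) : pt x 0 ∈ D.total ϖ :=
  fun o => by
    rw [lin_optMat_pt, mul_zero]
    exact norm_pt_le hx (by simp) o

section Bounded

variable [IsUltrametricDist k]

theorem mbdd_frame : MBdd (constM (Option (Σ i, Fin (d i))) P * D.Φ) := by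
  have h : MBdd (constM (Option (Σ i, Fin (d i))) P) := MBdd.map_C P
  exact h.mul D.mbdd_Φ

theorem mbdd_coframe : MBdd (D.Ψ * constM (Option (Σ i, Fin (d i))) P') := by
  have h : MBdd (constM (Option (Σ i, Fin (d i))) P') := MBdd.map_C P'
  exact D.mbdd_Ψ.mul h

end Bounded

variable [IsUltrametricDist K]

theorem isRationalDomain_total (hϖ0 : ϖ ≠ 0) : IsRationalDomain k (D.total ϖ) :=
  isRationalDomain_disc (Λ' := optMat D.q (D.q • D.L))
    (by rw [optMat_mul, mul_inv_cancel₀ D.q_ne, D.smul_mul_smul_L, optMat_one]) hϖ0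

variable [IsUltrametricDist k] [CompleteSpace k] [Algebra.IsAlgebraic k K]

/-- The projections onto the factors of the base. -/
def proj (i : I) (x : ι → K) (c : Fin (d i)) : K := ev (pt (lin (D.q⁻¹ • D.Λ) x) 0) (D.p ⟨i, c⟩)

/-- The F-bundles on the factors of the base. -/
def bundle (hϖ0 : ϖ ≠ 0) (hϖ : ‖ϖ‖ < 1) (i : I) :
    FBundle.{u, v, w} k (disc K (1 : Matrix (Fin (d i)) (Fin (d i)) k) ϖ) :=
  have he : Function.Injective (Sigma.mk (β := fun i => Fin (d i)) i) := sigma_mk_injective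
  sliceBundle D.q_ne hϖ0 hϖ he (D.mbdd_Tb i) (D.mbdd_Ab i) (D.isFlat i)

theorem maximalAt_bundle (hϖ0 : ϖ ≠ 0) (hϖ : ‖ϖ‖ < 1) (i : I) (x : Fin (d i) → K) :
    (D.bundle hϖ0 hϖ i).MaximalAt x :=
  have he : Function.Injective (Sigma.mk (β := fun i => Fin (d i)) i) := sigma_mk_injective
  sliceBundle_maximalAt D.q_ne hϖ0 hϖ he (D.mbdd_Tb i) (D.mbdd_Ab i) (D.isFlat i)
    (D.mbdd_N i) (D.mbdd_N' i) (D.N_mul i) (v := fun s => D.v ⟨i, s⟩) (D.N_eq i) x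

theorem isProductIso (hϖ0 : ϖ ≠ 0) (hϖ : ‖ϖ‖ < 1) :
    IsProductIso k (disc K (D.q⁻¹ • D.Λ) ϖ)
      (fun i => disc K (1 : Matrix (Fin (d i)) (Fin (d i)) k) ϖ) D.proj :=
  isProductIso_ev D.bd_p D.p_sub_mem D.smul_mul_smul_Λ D.smul_mul_smul_L hϖ0 hϖ

theorem proj_zero (i : I) : D.proj i 0 = 0 := by
  ext c
  rw [proj, lin_zero, pt_zero, ev_zero_point (D.bd_p _), D.constantCoeff_p, map_zero]
  rfl

theorem analytic_ev (hϖ0 : ϖ ≠ 0) (hϖ : ‖ϖ‖ < 1) {r s : Type*}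
    {M : Matrix r s (MvPowerSeries (Option (Σ i, Fin (d i))) k)} (hM : MBdd M) :
    IsAnalyticMatrixOn k (fun y => M.map (ev (lin (optMat D.q⁻¹ (D.q⁻¹ • D.Λ)) y)))
      (D.total ϖ) := fun i j => by
  obtain ⟨C, -, hC⟩ := hM
  exact (D.isRationalDomain_total hϖ0).isAnalyticOn_ev (norm_nonneg ϖ) hϖ (fun y hy => hy) (hC i j)

theorem timesId_mem (hϖ0 : ϖ ≠ 0) (hϖ : ‖ϖ‖ < 1) {y : Option ι → K} (hy : y ∈ D.total ϖ) (i : I) :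
    timesId (D.proj i) y ∈ disc K (optMat D.q⁻¹ (1 : Matrix (Fin (d i)) (Fin (d i)) k)) ϖ :=
  fun o => by
    rw [lin_optMat]
    refine norm_pt_le ((D.isProductIso hϖ0 hϖ).mapsTo i (D.base_mem_of_mem_total hy)) ?_ o
    have h := hy none
    rwa [lin_optMat] at h

/-- The frame of the bundle defined by a splitting. -/
def frame (y : Option ι → K) : Matrix (Fin (E.rank a₀)) (Σ i, Fin (d i)) K :=
  (constM (Option (Σ i, Fin (d i))) P * D.Φ).map (ev (lin (optMat D.q⁻¹ (D.q⁻¹ • D.Λ)) y))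

/-- The inverse of the frame defined by a splitting. -/
def coframe (y : Option ι → K) : Matrix (Σ i, Fin (d i)) (Fin (E.rank a₀)) K :=
  (D.Ψ * constM (Option (Σ i, Fin (d i))) P').map (ev (lin (optMat D.q⁻¹ (D.q⁻¹ • D.Λ)) y))

theorem frame_mul_coframe (hP : P * P' = 1) (hϖ : ‖ϖ‖ < 1) {y : Option ι → K}
    (hy : y ∈ D.total ϖ) : D.frame y * D.coframe y = 1 := by
  have hx := fun o => (hy o).trans_lt hϖ
  rw [frame, coframe, ← map_ev_mul D.mbdd_frame D.mbdd_coframe hx,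
    Matrix.mul_assoc, ← Matrix.mul_assoc D.Φ, D.Φ_mul_Ψ, Matrix.one_mul, ← constM_mul, hP,
    constM_one]
  exact ev_matrix_one hx

theorem coframe_mul_frame (hP' : P' * P = 1) (hϖ : ‖ϖ‖ < 1) {y : Option ι → K}
    (hy : y ∈ D.total ϖ) : D.coframe y * D.frame y = 1 := by
  have hx := fun o => (hy o).trans_lt hϖ
  rw [frame, coframe, ← map_ev_mul D.mbdd_coframe D.mbdd_frame hx,
    Matrix.mul_assoc, ← Matrix.mul_assoc (constM _ P'), ← constM_mul, hP', constM_one,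
    Matrix.one_mul, D.Ψ_mul_Φ]
  exact ev_matrix_one hx

/-- At the origin, the frame is the given splitting of the fibre. -/
theorem frame_zero : D.frame 0 = P.map (algebraMap k K) := by
  let cc : MvPowerSeries (Option (Σ i, Fin (d i))) k →+* k := constantCoeff
  have h1 : (constM (Option (Σ i, Fin (d i))) P).map cc = P := by
    ext i j
    simp [cc]
  have hΦ : (constM (Option (Σ i, Fin (d i))) P * D.Φ).map cc = P := by
    have h2 : (constM (Option (Σ i, Fin (d i))) P * D.Φ).map cc =
        (constM (Option (Σ i, Fin (d i))) P).map cc * D.Φ.map cc := Matrix.map_mul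
    rw [h2, h1, D.constantCoeff_Φ, Matrix.mul_one]
  obtain ⟨C, -, hC⟩ := D.mbdd_frame
  ext i j
  rw [frame, lin_zero, Matrix.map_apply, ev_zero_point (hC i j)]
  exact congrArg _ (congrFun (congrFun hΦ i) j)

variable [CharZero k]

theorem intertwines (hP' : P' * P = 1) (hϖ : ‖ϖ‖ < 1) : (E.conn a₀).Intertwines
    (ConnForm.directSum fun i =>
      (sliceConn D.q (Sigma.mk i) (D.Tb i) (D.Ab i)).pullback (D.proj i))
    D.frame (D.total ϖ) :=
  intertwines_of_formal D.q_ne D.bd_p D.constantCoeff_p D.pderiv_p hP' D.mbdd_T D.mbdd_A D.mbdd_Φ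
    D.mbdd_Tb D.mbdd_Ab D.gauge_T D.gauge_A (fun _ hy o => (hy o).trans_lt hϖ)
    (fun y hy => D.c_T y fun o => (hy o).trans_lt hϖ)
    (fun y hy => D.c_A y fun o => (hy o).trans_lt hϖ)

/-- The isomorphism of F-bundles defined by a splitting. -/
def directSumIso (hP : P * P' = 1) (hP' : P' * P = 1) (hϖ0 : ϖ ≠ 0) (hϖ : ‖ϖ‖ < 1) :
    DirectSumIso E (disc K (D.q⁻¹ • D.Λ) ϖ) (D.bundle hϖ0 hϖ) D.proj where
  W' := D.total ϖ
  isAdmissibleOpen_W' := (D.isRationalDomain_total hϖ0).isAdmissibleOpen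
  subset_W y hy := by
    rw [E.cover.1]
    exact ⟨_, ⟨a₀, rfl⟩, D.mem y fun o => (hy o).trans_lt hϖ⟩
  zero_section _ := D.pt_mem_total
  base_mem _ := D.base_mem_of_mem_total
  L := Unit
  V _ := D.total ϖ
  isAdmissibleOpen_V _ := (D.isRationalDomain_total hϖ0).isAdmissibleOpen
  cover := by
    rw [Set.range_const]
    exact isAdmissibleCover_self _
  a _ := a₀
  c _ _ := PUnit.unit
  mem_chart _ y hy := D.mem y fun o => (hy o).trans_lt hϖ
  mem_chart' _ i _ hy := D.timesId_mem hϖ0 hϖ hy i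
  Φ _ := D.frame
  Ψ _ := D.coframe
  analytic_Φ _ := D.analytic_ev hϖ0 hϖ D.mbdd_frame
  analytic_Ψ _ := D.analytic_ev hϖ0 hϖ D.mbdd_coframe
  Φ_mul_Ψ _ _ := D.frame_mul_coframe hP hϖ
  Ψ_mul_Φ _ _ := D.coframe_mul_frame hP' hϖ
  glue _ _ y hy := by
    have h1 : (Matrix.blockDiagonal' fun i => (1 : Matrix (Fin (d i)) (Fin (d i)) K)) = 1 :=
      Matrix.blockDiagonal'_one
    have h2 := congrArg (· * D.frame y) (E.g_self a₀ y (D.mem y fun o => (hy.1 o).trans_lt hϖ))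
    exact (h2.trans (Matrix.one_mul _)).trans ((congrArg _ h1).trans (Matrix.mul_one _)).symm
  intertwines _ := D.intertwines hP' hϖ

end Splitting

end Decomposition

end

end RigidF

theorem mainTheorem2 {k : Type*} {K : Type*}
    [NontriviallyNormedField k] [CompleteSpace k] [IsUltrametricDist k] [CharZero k]
    (hk : ∀ q : ℚ, q ≠ 0 → ‖(q : k)‖ = 1)
    [NontriviallyNormedField K] [NormedAlgebra k K] [IsAlgClosure k K]
    (n : ℕ) (B : Set (Fin n → K)) (hB : RigidF.IsAdmissibleOpen k B) (hB0 : (0 : Fin n → K) ∈ B)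
    (E : RigidF.FBundle k B) (hE : E.MaximalAt 0)
    {I : Type*} [Fintype I] [DecidableEq I]
    (a₀ : E.J) (ha₀ : RigidF.pt 0 0 ∈ E.chart a₀)
    (H : I → Submodule k (Fin (E.rank a₀) → k)) (hH : DirectSum.IsInternal H)
    (hstab : ∀ i, ∀ h ∈ H i, E.fibreK a₀ h ∈ H i)
    (hspec : ∀ i j, i ≠ j → Disjoint
      (spectrum K (((E.fibreK a₀).restrict (hstab i)).baseChange K))
      (spectrum K (((E.fibreK a₀).restrict (hstab j)).baseChange K))) :
    ∃ U ⊆ B, RigidF.IsAdmissibleOpen k U ∧ (0 : Fin n → K) ∈ U ∧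
      ∃ (d : I → ℕ) (U' : ∀ i, Set (Fin (d i) → K)) (F : ∀ i, RigidF.FBundle k (U' i))
        (p : ∀ i, (Fin n → K) → Fin (d i) → K),
        (∀ i, RigidF.IsAdmissibleOpen k (U' i)) ∧
        RigidF.IsProductIso k U U' p ∧ (∀ i, p i 0 = 0) ∧
        (∀ i, ∀ x ∈ U' i, (F i).MaximalAt x) ∧
        ∃ D : RigidF.DirectSumIso E U F p, D.Extends a₀ H := by
  have : IsAlgClosed K := IsAlgClosure.isAlgClosed k
  have : Algebra.IsAlgebraic k K := IsAlgClosure.isAlgebraic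
  have hk' : ∀ m : ℕ, m ≠ 0 → ‖(m : k)‖ = 1 := fun m hm => by
    simpa using hk m (Nat.cast_ne_zero.mpr hm)
  -- the norm of `K` extends that of `k`, and integers have norm at most one
  have : IsUltrametricDist K :=
    IsUltrametricDist.isUltrametricDist_of_forall_norm_natCast_le_one fun m => by
      rw [← map_natCast (algebraMap k K), norm_algebraMap']
      exact IsUltrametricDist.norm_natCast_le_one k m
  obtain ⟨P, P', hP, hP', hBD, hcop, hmem⟩ :=
    RigidF.exists_adapted_basis K (E.fibreK a₀) hH hstab hspec
  have h0 : (0 : Option (Fin n) → K) ∈ E.chart a₀ := by rwa [RigidF.pt_zero] at ha₀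
  have hA₀ : (E.conn a₀).A 0 = (LinearMap.toMatrix' (E.fibreK a₀)).map (algebraMap k K) := by
    rw [E.algebraMap_fibreK a₀ ha₀, RigidF.pt_zero]
  have hT₀ : ∀ i, (E.conn a₀).T i 0 =
      (((E.conn a₀).T i 0).map (RigidF.ratVal k)).map (algebraMap k K) := fun i => by
    have hz : (fun o : Option (Fin n) => algebraMap k K ((0 : Option (Fin n) → k) o)) = 0 :=
      funext fun _ => map_zero _
    ext s t
    have h := (E.analytic_T a₀ i s t).algebraMap_ratVal 0 (by rwa [hz])
    rw [hz] at h
    exact h.symm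
  obtain ⟨h, hh, hcyc⟩ := hE a₀ ha₀
  -- the residue field of the origin is `k`, so the cyclic vector has entries in `k`
  have hbot : ∀ s, ∃ z : k, algebraMap k K z = h s := fun s => by
    have h1 := hh s
    have h2 : IntermediateField.adjoin k (Set.range (0 : Fin n → K)) = ⊥ :=
      IntermediateField.adjoin_eq_bot_iff.mpr (by rintro _ ⟨_, rfl⟩; exact zero_mem _)
    rwa [h2, IntermediateField.mem_bot] at h1
  choose h' hh' using hbot
  obtain rfl : (fun s => algebraMap k K (h' s)) = h := funext hh'
  rw [RigidF.pt_zero] at hcyc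
  obtain ⟨D⟩ := RigidF.ConnForm.IsFlatOn.nonempty_splitting hk' (E.isAdmissibleOpen_chart a₀) h0
    (E.analytic_T a₀) (E.analytic_A a₀) (E.flat a₀) hP hP' hA₀ hT₀ hBD hcop hcyc
  obtain ⟨ϖ, hϖ0, hϖ⟩ := NormedField.exists_norm_lt_one k
  have hϖ0 : ϖ ≠ 0 := norm_pos_iff.mp hϖ0
  have htot : ∀ y ∈ D.total ϖ, y ∈ E.chart a₀ := fun y hy => D.mem y fun o => (hy o).trans_lt hϖ
  refine ⟨RigidF.disc K (D.q⁻¹ • D.Λ) ϖ, fun x hx => ?_,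
    (RigidF.isRationalDomain_disc D.smul_mul_smul_L hϖ0).isAdmissibleOpen, RigidF.zero_mem_disc,
    fun i => Module.finrank k (H i), fun i => RigidF.disc K 1 ϖ, D.bundle hϖ0 hϖ, D.proj,
    fun i => (RigidF.isRationalDomain_disc (Matrix.one_mul 1) hϖ0).isAdmissibleOpen,
    D.isProductIso hϖ0 hϖ, D.proj_zero,
    fun i x _ => D.maximalAt_bundle hϖ0 hϖ i x, D.directSumIso hP hP' hϖ0 hϖ, ?_⟩
  · refine E.base_mem (RigidF.pt x 0) ?_
    rw [E.cover.1]
    exact ⟨_, ⟨a₀, rfl⟩, htot _ (D.pt_mem_total hx)⟩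
  · intro β _ i h
    have hframe : E.g a₀ a₀ (RigidF.pt 0 0) * D.frame (RigidF.pt 0 0) =
        P.map (algebraMap k K) := by
      rw [E.g_self a₀ _ ha₀, Matrix.one_mul, RigidF.pt_zero, D.frame_zero]
    rw [hmem]
    refine exists_congr fun v => ?_
    change _ ↔ _ = (E.g a₀ a₀ (RigidF.pt 0 0) * D.frame (RigidF.pt 0 0)).mulVec _
    rw [hframe]
    constructor
    · rintro rfl
      ext s
      exact RingHom.map_mulVec (algebraMap k K) P _ s
    · intro hv
      ext s
      refine (algebraMap k K).injective ?_
      exact (congrFun hv s).trans (RingHom.map_mulVec (algebraMap k K) P _ s).symm
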